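/- **Bulk-edge correspondence for topological insulators.** *Setting.* Let $N\ge 0$ and $k\in S^1=\mathbb{R}/2\pi\mathbb{Z}$. The bulk Hamiltonian acts on $\ell^2(\mathbb{Z};\mathbb{C}^N)$ by $$(H(k)\psi)_n=A(k)\psi_{n-1}+A(k)^*\psi_{n+1}+V_n(k)\psi_n ,$$ where $A(k)\in \mathrm{GL}(N)$, $V_n(k)=V_n(k)^*$, and $A$, $V_n$ are bounded and $C^1$ in $k\in S^1$, uniformly in $n$ (that is, $k\mapsto (V_n(k))_n$ is $C^1$ for the supremum norm over $n$). The edge Hamiltonian $H^\sharp(k)$ acts on $\ell^2(\{1,2,\dots\};\mathbb{C}^N)$ by the same formula with $V_n$ replaced by $V_n^\sharp$ and with $\psi_0=0$, where $V^\sharp$ has the same properties as $V$ and, for some $n_0\ge 0$, $V^\sharp_n(k)=V_n(k)$ for all $n>n_0$ and all $k$. Let $\Theta:\mathbb{C}^N\to\mathbb{C}^N$ be antilinear with $\Theta^2=-1$, $\Theta^*\Theta=1$, $H(-k)=\Theta H(k)\Theta^{-1}$ and $H^\sharp(-k)=\Theta H^\sharp(k)\Theta^{-1}$ for all $k$. Let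 $\mu\in\mathbb{R}$ satisfy $\mu\notin\sigma(H(k))$ for all $k$. *Index of a family.* Let $Z(x)$, $x\in[a,b]$, be a family of unordered $N$-tuples of points of the unit circle with continuous arguments $\theta_i(x)$, such that each point occurs with even multiplicity in $Z(a)$ and in $Z(b)$. Continue $Z$ over an interval $[b,c]$ by a continuous family $\tilde Z$ in which all multiplicities are even, with $\tilde Z(b)=Z(b)$ and $\tilde Z(c)=Z(a)$. Then $\mathcal{I}(Z)=(-1)^w$, where $w\in\mathbb{Z}$ is the winding number of the concatenated family: $2\pi w$ is the total change of the sum of the arguments. Let $\varepsilon$ be the block diagonal matrix with blocks $\begin{pmatrix}0&-1\\1&0\end{pmatrix}$ and $\Theta_0=\varepsilon C$, with $C$ complex conjugation. For a continuous family $T(\varphi)\in \mathrm{GL}(N)$, $0\le\varphi\le\pi$, with $\Theta_0T=T^{-1}\Theta_0$ at $\varphi=0,\pi$, let $\mathcal{I}(T)$ be the index of the family of phases $\lambda/|\lambda|$ of the eigenvalues $\lambda$ of $T(\varphi)$, repeated by algebraic multiplicity. *Bulk index.* Let $\gamma:\mathbb{R}/2\pi\mathbb{Z}\to\mathbb{C}$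 be a simple closed curve with $\gamma(-t)=\overline{\gamma(t)}$ and $\gamma(\pi)=\mu$ that does not meet $\sigma(H(k))$ for any $k$, and that encircles the part of the spectra below $\mu$ but not the part above $\mu$. For $z=\gamma(\varphi_1)$ and $k=\varphi_2$ let $E_{z,k}$ be the space of sequences $\psi:\mathbb{Z}\to\mathbb{C}^N$ that satisfy $H(k)\psi=z\psi$ and are square-summable at $n\to+\infty$; the topology on sequences is that of pointwise convergence. Take a continuous $v=(v_1,\dots,v_N)$ on the cut torus $[-\pi,\pi]\times S^1$ such that $v(\varphi)$ is a basis of $E_{\gamma(\varphi_1),\varphi_2}$ and $v(-\varphi)=(\Theta v(\varphi))\varepsilon$, and define $T(\varphi_2)\in \mathrm{GL}(N)$ by $v(\pi,\varphi_2)=v(-\pi,\varphi_2)T(\varphi_2)$. The bulk index is $\mathcal{I}=\mathcal{I}(T)$, with $T$ restricted to $[0,\pi]$. *Edge index.* Adjust $\mu$ to some $\nu$ in a closed interval that contains $\mu$ in its interior and is disjoint from $\sigma(H(k))$ for all $k$, in such a way that every local $C^1$ eigenvalue branch $\epsilon_i(k)$ of $H^\sharp(k)$ with $\epsilon_i(k_*)=\nu$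 satisfies $\epsilon_i'(k_*)\ne0$. Let $n$ be the number of crossings of $\nu$ at points $k_*\in[0,\pi]$, counted with multiplicity, those at $k_*=0$ and $k_*=\pi$ being counted half. The edge index is $\mathcal{I}^\sharp=(-1)^n$. *Theorem.* Both indices exist. The bulk index does not depend on the choices of $\gamma$, $v$, the arguments and $\tilde Z$; the edge index does not depend on the choice of $\nu$; and $$\mathcal{I}=\mathcal{I}^\sharp .$$ -/

import Mathlib

open scoped ENNReal ComplexConjugate

noncomputable section

namespace BulkEdge

/-! ### Hilbert spaces and elementary operators -/

/-- The internal space `ℂ^N` with its Hermitian inner product. -/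
abbrev Internal (N : ℕ) : Type := EuclideanSpace ℂ (Fin N)

/-- Complex `N × N` matrices, regarded as operators on `ℂ^N`, with the operator norm. -/
abbrev Mat (N : ℕ) : Type := Internal N →L[ℂ] Internal N

/-- `ℓ²(ι; ℂ^N)`. -/
abbrev L2 (ι : Type) (N : ℕ) : Type := lp (fun _ : ι => Internal N) 2

/-- Bounded sequences of matrices, with the supremum norm. -/
abbrev BddSeq (ι : Type) (N : ℕ) : Type := lp (fun _ : ι => Mat N) ∞

theorem sum_norm_elim_le {ι κ : Type} {N : ℕ} (f : ι → Option κ)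
    (hf : ∀ a b m, f a = some m → f b = some m → a = b) (ψ : L2 κ N) (s : Finset ι) :
    ∑ n ∈ s, ‖(f n).elim (0 : Internal N) (fun m => ψ m)‖ ^ (2 : ℝ≥0∞).toReal
      ≤ ‖ψ‖ ^ (2 : ℝ≥0∞).toReal := by
  classical
  have h2 : 0 < (2 : ℝ≥0∞).toReal := by norm_num
  refine le_trans ?_ (lp.sum_rpow_le_norm_rpow h2 ψ
    (s.filterMap f (fun a b m ha hb => hf a b m ha hb)))
  induction s using Finset.induction_on with
  | empty => simp
  | insert a s ha ih =>
    rw [Finset.sum_insert ha]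
    cases hfa : f a with
    | none =>
      have e : (insert a s).filterMap f (fun a b m ha hb => hf a b m ha hb)
          = s.filterMap f (fun a b m ha hb => hf a b m ha hb) := by
        ext m
        simp [Finset.mem_filterMap, hfa]
      rw [e]
      simpa using ih
    | some m =>
      have hm : m ∉ s.filterMap f (fun a b m ha hb => hf a b m ha hb) := by
        intro hm
        obtain ⟨b, hb, hbm⟩ := (by simpa [Finset.mem_filterMap] using hm : ∃ b ∈ s, f b = some m)
        exact ha (hf b a m hbm hfa ▸ hb)
      have e : (insert a s).filterMap f (fun a b m ha hb => hf a b m ha hb)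
          = insert m (s.filterMap f (fun a b m ha hb => hf a b m ha hb)) := by
        ext m'
        simp [Finset.mem_filterMap, hfa, eq_comm]
      rw [e, Finset.sum_insert hm]
      simpa using ih

/-- The contraction `(hop f ψ)_n = ψ_{f n}`, read as `0` where `f n` is undefined, for a partially
defined injective map `f` of lattices. -/
def hop {ι κ : Type} (N : ℕ) (f : ι → Option κ)
    (hf : ∀ a b m, f a = some m → f b = some m → a = b) : L2 κ N →L[ℂ] L2 ι N :=
  LinearMap.mkContinuous
    { toFun := fun ψ => ⟨fun n => (f n).elim 0 (fun m => ψ m),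
        memℓp_gen' (fun s => sum_norm_elim_le f hf ψ s)⟩
      map_add' := fun ψ φ => by
        ext1; funext n
        change (f n).elim (0 : Internal N) (fun m => (ψ + φ) m)
          = (f n).elim (0 : Internal N) (fun m => ψ m) + (f n).elim (0 : Internal N) (fun m => φ m)
        cases h : f n <;> simp
      map_smul' := fun c ψ => by
        ext1; funext n
        cases h : f n <;> simp [h] } 1
    (fun ψ => by
      rw [one_mul]
      exact lp.norm_le_of_forall_sum_le (by norm_num) (norm_nonneg _)
        (fun s => sum_norm_elim_le f hf ψ s))

theorem sum_norm_mul_le {ι : Type} {N : ℕ} (W : ι → Mat N) (C : ℝ) (hC : 0 ≤ C)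
    (hW : ∀ n, ‖W n‖ ≤ C) (ψ : L2 ι N) (s : Finset ι) :
    ∑ n ∈ s, ‖W n (ψ n)‖ ^ (2 : ℝ≥0∞).toReal ≤ (C * ‖ψ‖) ^ (2 : ℝ≥0∞).toReal := by
  have h2 : 0 < (2 : ℝ≥0∞).toReal := by norm_num
  rw [Real.mul_rpow hC (norm_nonneg _)]
  refine le_trans ?_ (mul_le_mul_of_nonneg_left (lp.sum_rpow_le_norm_rpow h2 ψ s)
    (Real.rpow_nonneg hC _))
  rw [Finset.mul_sum]
  refine Finset.sum_le_sum fun n _ => ?_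
  rw [← Real.mul_rpow hC (norm_nonneg _)]
  exact Real.rpow_le_rpow (norm_nonneg _)
    ((W n).le_of_opNorm_le (hW n) (ψ n)) h2.le

/-- The multiplication operator `(W ψ)_n = W_n ψ_n` for a bounded sequence `W` of matrices. -/
def mulOp {ι : Type} {N : ℕ} (W : ι → Mat N) (C : ℝ) (hC : 0 ≤ C) (hW : ∀ n, ‖W n‖ ≤ C) :
    L2 ι N →L[ℂ] L2 ι N :=
  LinearMap.mkContinuous
    { toFun := fun ψ => ⟨fun n => W n (ψ n),
        memℓp_gen' (fun s => sum_norm_mul_le W C hC hW ψ s)⟩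
      map_add' := fun ψ φ => by
        ext1; funext n
        exact map_add (W n) (ψ n) (φ n)
      map_smul' := fun c ψ => by ext1; funext n; simp } C
    (fun ψ => lp.norm_le_of_forall_sum_le (by norm_num) (by positivity)
      (fun s => sum_norm_mul_le W C hC hW ψ s))

/-! ### Bulk and edge Hamiltonians -/

/-- The coefficients of a bulk Hamiltonian on `ℤ`.  The quasi-momentum `k` in the circle is written
as a real number modulo `2π`.  That `V_n(k)` is `C¹` in `k` uniformly in `n` means that
`k ↦ (V_n(k))_n` is `C¹` for the supremum norm over `n`. -/
structure BulkHamiltonian (N : ℕ) where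
  /-- the hopping matrices -/
  A : ℝ → Mat N
  /-- the potential -/
  V : ℝ → BddSeq ℤ N
  A_contDiff : ContDiff ℝ 1 A
  V_contDiff : ContDiff ℝ 1 V
  A_periodic : ∀ k, A (k + 2 * Real.pi) = A k
  V_periodic : ∀ k, V (k + 2 * Real.pi) = V k
  A_isUnit : ∀ k, IsUnit (A k)
  V_selfAdjoint : ∀ k n, IsSelfAdjoint (V k n)

/-- The coefficients of an edge Hamiltonian on the half-line `{1, 2, …}` which agrees with the bulk
Hamiltonian `B` at all sites `n > n₀`.  The index `j : ℕ` stands for the site `n = j + 1`. -/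
structure EdgeHamiltonian {N : ℕ} (B : BulkHamiltonian N) where
  /-- the potential; `V k j` belongs to the site `j + 1` -/
  V : ℝ → BddSeq ℕ N
  V_contDiff : ContDiff ℝ 1 V
  V_periodic : ∀ k, V (k + 2 * Real.pi) = V k
  V_selfAdjoint : ∀ k j, IsSelfAdjoint (V k j)
  eq_bulk : ∃ n₀ : ℕ, ∀ k (j : ℕ), n₀ < j + 1 → V k j = B.V k ((j : ℤ) + 1)

/-- The bulk Hamiltonian `H(k)` as a bounded operator on `ℓ²(ℤ; ℂ^N)`. -/
def BulkHamiltonian.op {N : ℕ} (B : BulkHamiltonian N) (k : ℝ) : L2 ℤ N →L[ℂ] L2 ℤ N :=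
  mulOp (fun _ => B.A k) ‖B.A k‖ (norm_nonneg _) (fun _ => le_rfl) ∘L
      hop N (fun n : ℤ => some (n - 1)) (fun a b m ha hb => by
        simp only [Option.some.injEq] at ha hb; omega)
    + mulOp (fun _ => ContinuousLinearMap.adjoint (B.A k)) ‖ContinuousLinearMap.adjoint (B.A k)‖
        (norm_nonneg _) (fun _ => le_rfl) ∘L
      hop N (fun n : ℤ => some (n + 1)) (fun a b m ha hb => by
        simp only [Option.some.injEq] at ha hb; omega)
    + mulOp (fun n => B.V k n) ‖B.V k‖ (norm_nonneg _)
        (fun n => lp.norm_apply_le_norm ENNReal.top_ne_zero (B.V k) n)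

theorem BulkHamiltonian.op_apply {N : ℕ} (B : BulkHamiltonian N) (k : ℝ) (ψ : L2 ℤ N) (n : ℤ) :
    B.op k ψ n = B.A k (ψ (n - 1)) + ContinuousLinearMap.adjoint (B.A k) (ψ (n + 1))
      + B.V k n (ψ n) := rfl

/-- The left neighbour on the half-line; the first site has none (Dirichlet condition). -/
def leftSite : ℕ → Option ℕ
  | 0 => none
  | j + 1 => some j

/-- The edge Hamiltonian `H♯(k)` as a bounded operator on `ℓ²({1, 2, …}; ℂ^N)`, with the Dirichlet
boundary condition. -/
def EdgeHamiltonian.op {N : ℕ} {B : BulkHamiltonian N} (S : EdgeHamiltonian B) (k : ℝ) :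
    L2 ℕ N →L[ℂ] L2 ℕ N :=
  mulOp (fun _ => B.A k) ‖B.A k‖ (norm_nonneg _) (fun _ => le_rfl) ∘L
      hop N leftSite (fun a b m ha hb => by
        cases a <;> cases b <;> simp_all [leftSite])
    + mulOp (fun _ => ContinuousLinearMap.adjoint (B.A k)) ‖ContinuousLinearMap.adjoint (B.A k)‖
        (norm_nonneg _) (fun _ => le_rfl) ∘L
      hop N (fun j : ℕ => some (j + 1)) (fun a b m ha hb => by
        simp only [Option.some.injEq] at ha hb; omega)
    + mulOp (fun j => S.V k j) ‖S.V k‖ (norm_nonneg _)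
        (fun j => lp.norm_apply_le_norm ENNReal.top_ne_zero (S.V k) j)

theorem EdgeHamiltonian.op_apply_zero {N : ℕ} {B : BulkHamiltonian N} (S : EdgeHamiltonian B)
    (k : ℝ) (ψ : L2 ℕ N) :
    S.op k ψ 0 = B.A k 0 + ContinuousLinearMap.adjoint (B.A k) (ψ 1) + S.V k 0 (ψ 0) := rfl

theorem EdgeHamiltonian.op_apply_succ {N : ℕ} {B : BulkHamiltonian N} (S : EdgeHamiltonian B)
    (k : ℝ) (ψ : L2 ℕ N) (j : ℕ) :
    S.op k ψ (j + 1) = B.A k (ψ j) + ContinuousLinearMap.adjoint (B.A k) (ψ (j + 2))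
      + S.V k (j + 1) (ψ (j + 1)) := rfl

/-- Fermionic time-reversal symmetry: `Θ` is antilinear, `Θ² = -1`, `Θ*Θ = 1`, and
`H(-k) = Θ H(k) Θ⁻¹`, `H♯(-k) = Θ H♯(k) Θ⁻¹` for the map induced by `Θ` on sequences. -/
structure IsTimeReversal {N : ℕ} (B : BulkHamiltonian N) (S : EdgeHamiltonian B)
    (Θ : Internal N →ₛₗ[starRingEnd ℂ] Internal N) : Prop where
  sq : ∀ x, Θ (Θ x) = -x
  antiunitary : ∀ x y, inner ℂ (Θ x) (Θ y) = inner ℂ y x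
  bulk : ∀ (k : ℝ) (ψ φ : L2 ℤ N), (∀ n, φ n = Θ (ψ n)) →
    ∀ n, B.op (-k) φ n = Θ (B.op k ψ n)
  edge : ∀ (k : ℝ) (ψ φ : L2 ℕ N), (∀ j, φ j = Θ (ψ j)) →
    ∀ j, S.op (-k) φ j = Θ (S.op k ψ j)

/-! ### The index of endpoint degenerate families and of Kramers families -/

/-- The unordered tuple of the points `exp (i θ₁), …, exp (i θ_N)` of the unit circle. -/
def circleTuple {N : ℕ} (θ : Fin N → ℝ) : Multiset ℂ :=
  Finset.univ.val.map fun i => Complex.exp (Complex.I * (θ i : ℂ))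

/-- Every point of the unordered tuple occurs with even multiplicity. -/
def EvenDegenerate (Z : Multiset ℂ) : Prop := ∀ z, Even (Z.count z)

/-- `s` is the index of the family `Z(x)`, `a ≤ x ≤ b`, of unordered `N`-tuples of points of the
unit circle which is even degenerate at `x = a, b`: with continuous arguments `θ` of `Z`, and
continuous arguments `θ'` of an even degenerate family over `[b, c]` that leads from `Z(b)` back to
`Z(a)`, the index is `(-1)^w`, where `w` is the winding number of the concatenated family. -/
def IsFamilyIndex (N : ℕ) (a b : ℝ) (Z : ℝ → Multiset ℂ) (s : ℤˣ) : Prop :=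
  EvenDegenerate (Z a) ∧ EvenDegenerate (Z b) ∧
  ∃ (c : ℝ) (θ θ' : ℝ → Fin N → ℝ) (w : ℤ),
    b ≤ c ∧
    ContinuousOn θ (Set.Icc a b) ∧ (∀ x ∈ Set.Icc a b, circleTuple (θ x) = Z x) ∧
    ContinuousOn θ' (Set.Icc b c) ∧ (∀ x ∈ Set.Icc b c, EvenDegenerate (circleTuple (θ' x))) ∧
    circleTuple (θ' b) = Z b ∧ circleTuple (θ' c) = Z a ∧
    ∑ i, (θ b i - θ a i) + ∑ i, (θ' c i - θ' b i) = 2 * Real.pi * w ∧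
    s = (-1) ^ w

/-- The phases `λ / |λ|` of the eigenvalues of `T`, repeated by algebraic multiplicity. -/
def eigenPhases {N : ℕ} (T : Matrix (Fin N) (Fin N) ℂ) : Multiset ℂ :=
  T.charpoly.roots.map fun l => l / (‖l‖ : ℂ)

/-- The block diagonal matrix with blocks `(0, -1; 1, 0)`. -/
def epsMatrix (N : ℕ) : Matrix (Fin N) (Fin N) ℂ := fun i j =>
  if Even (i : ℕ) ∧ (j : ℕ) = i + 1 then -1 else if Even (j : ℕ) ∧ (i : ℕ) = j + 1 then 1 else 0

/-- The Kramers property `Θ₀ T = T⁻¹ Θ₀` with `Θ₀ = ε C`, `C` being complex conjugation: on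
vectors, `Θ₀ T x = ε conj(T) conj(x)` and `T⁻¹ Θ₀ x = T⁻¹ ε conj(x)`. -/
def IsKramers {N : ℕ} (T : Matrix (Fin N) (Fin N) ℂ) : Prop :=
  IsUnit T ∧ epsMatrix N * T.map (starRingEnd ℂ) = T⁻¹ * epsMatrix N

/-- `s` is the index of the Kramers family `T(φ)`, `0 ≤ φ ≤ π`. -/
def IsKramersIndex {N : ℕ} (T : ℝ → Matrix (Fin N) (Fin N) ℂ) (s : ℤˣ) : Prop :=
  ContinuousOn T (Set.Icc 0 Real.pi) ∧ (∀ φ ∈ Set.Icc 0 Real.pi, IsUnit (T φ)) ∧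
  IsKramers (T 0) ∧ IsKramers (T Real.pi) ∧
  IsFamilyIndex N 0 Real.pi (fun φ => eigenPhases (T φ)) s

/-! ### The index of time-reversal invariant bundles over the torus

A bundle over the torus with coordinates `(φ₁, φ₂)` modulo `2π` is given by its fibres, which are
subspaces of a topological vector space `W` on which `Θ` acts. -/

/-- A time-reversal invariant continuous section `v` of the frame bundle over the cut torus
`[-π, π] × (ℝ / 2πℤ)`: the vectors `v φ₁ φ₂ 1, …, v φ₁ φ₂ N` are a basis of the fibre, and
`v(-φ) = (Θ v(φ)) ε`. -/
structure IsCutTorusSection {N : ℕ} {W : Type} [AddCommGroup W] [Module ℂ W] [TopologicalSpace W]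
    (fib : ℝ → ℝ → Submodule ℂ W) (Θ : W → W) (v : ℝ → ℝ → Fin N → W) : Prop where
  continuousOn : ContinuousOn (fun p : ℝ × ℝ => v p.1 p.2)
    (Set.Icc (-Real.pi) Real.pi ×ˢ Set.univ)
  periodic : ∀ φ₁ ∈ Set.Icc (-Real.pi) Real.pi, ∀ φ₂, v φ₁ (φ₂ + 2 * Real.pi) = v φ₁ φ₂
  linearIndependent : ∀ φ₁ ∈ Set.Icc (-Real.pi) Real.pi, ∀ φ₂, LinearIndependent ℂ (v φ₁ φ₂)
  span_eq : ∀ φ₁ ∈ Set.Icc (-Real.pi) Real.pi, ∀ φ₂,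
    Submodule.span ℂ (Set.range (v φ₁ φ₂)) = fib φ₁ φ₂
  timeReversal : ∀ φ₁ ∈ Set.Icc (-Real.pi) Real.pi, ∀ φ₂ j,
    v (-φ₁) (-φ₂) j = ∑ i, epsMatrix N i j • Θ (v φ₁ φ₂ i)

/-- `s` is the index of the time-reversal invariant bundle with fibres `fib`: it is the index of the
family of transition matrices, `v(π, φ₂) = v(-π, φ₂) T(φ₂)`, of a time-reversal invariant section on
the cut torus. -/
def IsBundleIndex (N : ℕ) {W : Type} [AddCommGroup W] [Module ℂ W] [TopologicalSpace W]
    (fib : ℝ → ℝ → Submodule ℂ W) (Θ : W → W) (s : ℤˣ) : Prop :=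
  ∃ (v : ℝ → ℝ → Fin N → W) (T : ℝ → Matrix (Fin N) (Fin N) ℂ),
    IsCutTorusSection fib Θ v ∧
    (∀ φ₂ j, v Real.pi φ₂ j = ∑ i, T φ₂ i j • v (-Real.pi) φ₂ i) ∧
    IsKramersIndex T s

/-! ### The bulk index -/

/-- The space `E_{z,k}` of all sequences on `ℤ` that solve `H(k) ψ = z ψ` and are square-summable
at `n → +∞`. -/
def decayingSolutions {N : ℕ} (B : BulkHamiltonian N) (z : ℂ) (k : ℝ) :
    Submodule ℂ (ℤ → Internal N) where
  carrier := {ψ | (∀ n, B.A k (ψ (n - 1)) + ContinuousLinearMap.adjoint (B.A k) (ψ (n + 1))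
      + B.V k n (ψ n) = z • ψ n) ∧ Memℓp (fun n : ℕ => ψ (n : ℤ)) 2}
  zero_mem' := ⟨fun n => by simp, zero_memℓp⟩
  add_mem' := by
    rintro ψ φ ⟨h1, h2⟩ ⟨h3, h4⟩
    refine ⟨fun n => ?_, h2.add h4⟩
    simp only [Pi.add_apply, map_add, smul_add, ← h1 n, ← h3 n]
    abel
  smul_mem' := by
    rintro c ψ ⟨h1, h2⟩
    refine ⟨fun n => ?_, h2.const_smul c⟩
    simp only [Pi.smul_apply, map_smul, smul_comm z c, ← h1 n, smul_add]

/-- The closed curve `γ : [-π, π] → ℂ` winds `m` times around the point `w` off the curve. -/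
def HasWindingNumber (γ : ℝ → ℂ) (w : ℂ) (m : ℤ) : Prop :=
  ∃ θ : ℝ → ℝ, ContinuousOn θ (Set.Icc (-Real.pi) Real.pi) ∧
    (∀ t ∈ Set.Icc (-Real.pi) Real.pi, γ t ≠ w ∧
      γ t - w = ‖γ t - w‖ * Complex.exp (Complex.I * (θ t : ℂ))) ∧
    θ Real.pi - θ (-Real.pi) = 2 * Real.pi * m

/-- A reflection symmetric simple closed contour in the resolvent sets of all `H(k)`, which passes
through `μ` (at the parameter `±π`, where the torus is cut) and encircles exactly the part of the
spectra below `μ`. -/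
structure IsContour {N : ℕ} (B : BulkHamiltonian N) (μ : ℝ) (γ : ℝ → ℂ) : Prop where
  continuous : Continuous γ
  periodic : ∀ t, γ (t + 2 * Real.pi) = γ t
  injOn : Set.InjOn γ (Set.Ico (-Real.pi) Real.pi)
  symm : ∀ t, γ (-t) = conj (γ t)
  at_pi : γ Real.pi = μ
  resolvent : ∀ t k, γ t ∉ spectrum ℂ (B.op k)
  below : ∀ k, ∀ w ∈ spectrum ℂ (B.op k), w.re < μ →
    HasWindingNumber γ w 1 ∨ HasWindingNumber γ w (-1)
  above : ∀ k, ∀ w ∈ spectrum ℂ (B.op k), μ < w.re → HasWindingNumber γ w 0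

/-- `s` is the bulk index: the index of the bundle with fibres `E_{z,k}`, `z = γ(φ₁)`, `k = φ₂`. -/
def IsBulkIndex {N : ℕ} (B : BulkHamiltonian N) (Θ : Internal N →ₛₗ[starRingEnd ℂ] Internal N)
    (γ : ℝ → ℂ) (s : ℤˣ) : Prop :=
  IsBundleIndex N (fun φ₁ φ₂ => decayingSolutions B (γ φ₁) φ₂) (fun ψ n => Θ (ψ n)) s

/-! ### The edge index -/

/-- The multiplicity of `l` as an eigenvalue of `H♯(k)` (zero if it is none). -/
def EdgeHamiltonian.mult {N : ℕ} {B : BulkHamiltonian N} (S : EdgeHamiltonian B) (k l : ℝ) : ℕ :=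
  Module.finrank ℂ
    (Module.End.eigenspace (S.op k : L2 ℕ N →ₗ[ℂ] L2 ℕ N) (l : ℂ))

/-- Near `(k₀, ν)` the eigenvalues of `H♯(k)`, repeated by multiplicity, are given by `C¹` branches
`ε₁(k), …, ε_m(k)` through `ν`, and `ε_i'(k₀) ≠ 0` for all of them. -/
def HasTransversalBranches {N : ℕ} {B : BulkHamiltonian N} (S : EdgeHamiltonian B)
    (ν k₀ : ℝ) : Prop :=
  ∃ (m : ℕ) (ε : Fin m → ℝ → ℝ),
    (∀ i, ContDiffAt ℝ 1 (ε i) k₀ ∧ ε i k₀ = ν ∧ deriv (ε i) k₀ ≠ 0) ∧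
    ∃ δ > 0, ∀ k l : ℝ, |k - k₀| < δ → |l - ν| < δ →
      S.mult k l = Nat.card {i : Fin m // ε i k = l}

/-- `s` is the edge index: the energy `μ` may be adjusted to an energy `ν` in an interval `[a, b]`
around `μ` free of bulk spectrum, such that all eigenvalue branches crossing `ν` do so with non-zero
slope; then `s = (-1)^n`, where `n` is the number of crossings (with multiplicity) at points of
`[0, π]`, those at the endpoints being counted half. -/
def IsEdgeIndex {N : ℕ} {B : BulkHamiltonian N} (S : EdgeHamiltonian B) (μ : ℝ) (s : ℤˣ) : Prop :=
  ∃ (a b ν : ℝ) (K : Finset ℝ) (n : ℕ),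
    a < μ ∧ μ < b ∧ (∀ l ∈ Set.Icc a b, ∀ k, (l : ℂ) ∉ spectrum ℂ (B.op k)) ∧
    ν ∈ Set.Icc a b ∧ (∀ k₀, HasTransversalBranches S ν k₀) ∧
    (∀ k, k ∈ K ↔ k ∈ Set.Icc 0 Real.pi ∧ S.mult k ν ≠ 0) ∧
    2 * n = ∑ k ∈ K, (if k = 0 ∨ k = Real.pi then S.mult k ν else 2 * S.mult k ν) ∧
    s = (-1) ^ n

end BulkEdge

end

/-!
# Bulk-edge correspondence via the scattering matrix of the half-line

Both indices are identified with a sign attached to the scattering matrix of the half-line at the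
energy `μ`.

**Signs of Kramers families.**  An invertible matrix `T` is Kramers if `T τ(T) = 1`, where
`τ(M) = ε conj(M) ε⁻¹`.  Its eigenvalue phases then come in equal pairs, so that the phase of `det T`
has a distinguished square root, the product of the phases with each pair taken once
(`kramersRoot`).  For a continuous family `T(k)`, `0 ≤ k ≤ π`, which is Kramers at the ends, a
continuous square root of the phase of `det T(k)` can be compared with `kramersRoot` at both ends.
The resulting sign (`IsKramersSign`) is unique and a homotopy invariant, and it equals `(-1)^w`
for the index defined by continuation of the eigenvalue phases
(`IsKramersIndex.isKramersSign`).

**The scattering matrix.**  A solution `ψ` of energy `z` on the half-line, decaying at `+∞`, is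
determined by its amplitude `ψ₀ + i A* ψ₁` whenever `0 ≤ Im z` and `z` is outside the bulk spectrum:
this is the value of an absorbing boundary condition (`isUnit_dissOp_of_real`,
`isUnit_dissOp_of_im_pos`).  For real `x` in the gap, the map `S_x(k)` from `ψ₀ + i A* ψ₁` to
`ψ₀ - i A* ψ₁` is unitary, of class `C¹`, and rotates monotonically with `x`, because
`S_y = S_x (1 + 2i (y - x) Γ)` with the Gram matrix `Γ` of the solutions (`scat_eq_mul`).  Its
eigenvalue `-1` signals `ψ₀ = 0`, that is, an edge state (`finrank_eigenspace_halfOp`), and time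
reversal makes it Kramers at `k = 0, π` in an adapted basis (`IsEdgeReversal.scatMatrix_mul_tau`).

**Edge index.**  The phase of `det (1 + S_x(k))` is a square root of `det S_x(k)` away from edge
states, and by monotonicity it jumps by the parity of the multiplicity at an edge state
(`exists_sign_jump`).  Following it along `0 ≤ k ≤ π` counts the crossings, those at the ends being
counted half thanks to the reflection symmetry there (`exists_isKramersSign_of_crossings`).  By
homotopy invariance the sign depends neither on the energy within the gap nor on the potential near
the boundary (`IsEdgeReversal.exists_common_sign`), and below the bulk spectrum it is trivial, since
there are no edge states at very low energies (`IsEdgeReversal.isKramersSign_one`).  A Baire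
category argument provides energies with transversal crossings
(`IsScatteringFamily.isMeagre_not_transversal`).

**Bulk index.**  Up to its direction, the contour runs in the closed upper half-plane from a point
`γ(0)` below the bulk spectrum to `μ` (`IsContour.isUpperContour`).  There the matrix of amplitudes
`ψ₀ + i A* ψ₁` of a frame of decaying solutions is invertible, hence its determinant has the same
winding number in `k` at both ends.  The sign of the transition matrix is therefore the product of
the signs of the scattering matrices at `μ` and at `γ(0)`, the latter being trivial
(`transition_sign`, `IsUpperContour.isKramersSign_scatMatrix`).  Conversely, prescribing the
amplitudes of a frame on the upper half of the contour, and reflecting, gives a section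
(`IsUpperContour.exists_section`).
-/

open scoped ENNReal ComplexConjugate

noncomputable section

namespace BulkEdge

/-! ### Phases -/

/-- The phase `w / |w|` of a complex number (`0` for `w = 0`). -/
def phase (w : ℂ) : ℂ := w / (‖w‖ : ℂ)

theorem phase_mul (w z : ℂ) : phase (w * z) = phase w * phase z := by
  simp [phase, mul_div_mul_comm]

theorem phase_one : phase 1 = 1 := by simp [phase]

theorem phase_pow (w : ℂ) (n : ℕ) : phase (w ^ n) = phase w ^ n := by
  simp [phase, div_pow]

theorem phase_inv (w : ℂ) : phase w⁻¹ = (phase w)⁻¹ := by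
  simp [phase, div_eq_mul_inv, mul_comm]

theorem phase_conj (w : ℂ) : phase (conj w) = conj (phase w) := by simp [phase]

theorem phase_ne_zero {w : ℂ} (h : w ≠ 0) : phase w ≠ 0 := by simp [phase, h]

theorem norm_phase {w : ℂ} (h : w ≠ 0) : ‖phase w‖ = 1 := by simp [phase, h]

theorem phase_of_norm_one {w : ℂ} (h : ‖w‖ = 1) : phase w = w := by simp [phase, h]

theorem phase_ofReal_pos {x : ℝ} (h : 0 < x) : phase (x : ℂ) = 1 := by
  simp [phase, abs_of_pos h, h.ne']

theorem phase_ofReal_neg {x : ℝ} (h : x < 0) : phase (x : ℂ) = -1 := by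
  have : (x : ℂ) ≠ 0 := by exact_mod_cast h.ne
  simp [phase, abs_of_neg h, this]

theorem conj_phase {w : ℂ} (h : w ≠ 0) : conj (phase w) = (phase w)⁻¹ := by
  rw [Complex.inv_def, Complex.normSq_eq_norm_sq, norm_phase h]; simp

theorem phase_multiset_prod (s : Multiset ℂ) : phase s.prod = (s.map phase).prod := by
  induction s using Multiset.induction_on with
  | empty => simp [phase_one]
  | cons a s ih => simp [phase_mul, ih]

theorem ContinuousOn.phase {X : Type*} [TopologicalSpace X] {f : X → ℂ} {s : Set X}
    (hf : ContinuousOn f s) (h0 : ∀ x ∈ s, f x ≠ 0) : ContinuousOn (fun x => phase (f x)) s :=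
  hf.div (Complex.continuous_ofReal.comp_continuousOn hf.norm)
    (fun x hx => by simpa using h0 x hx)

theorem continuousAt_phase {w : ℂ} (h : w ≠ 0) : ContinuousAt phase w :=
  continuousAt_id.div (Complex.continuous_ofReal.continuousAt.comp continuous_norm.continuousAt)
    (by simpa using h)

/-! ### Spectrum of Kramers maps -/

/-- A linear map `T` on a finite-dimensional space with a quaternionic structure `J` which satisfies
`T J T = J` has its eigenvalues in pairs `l, 1 / conj l` of equal phase.  The proof splits off the
invariant plane spanned by an eigenvector `u` and by `J u`. -/
theorem exists_eigenvalue_pairs (n : ℕ) : ∀ (V : Type) [AddCommGroup V] [Module ℂ V]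
    [FiniteDimensional ℂ V], Module.finrank ℂ V = n →
    ∀ (J : V →ₛₗ[starRingEnd ℂ] V) (T : V →ₗ[ℂ] V), (∀ x, J (J x) = -x) →
    (∀ x, T (J (T x)) = J x) →
    ∃ l : Multiset ℂ, n = 2 * l.card ∧ (∀ a ∈ l, a ≠ 0) ∧
      ∀ c : ℂ, LinearMap.det (c • LinearMap.id - T)
        = (l.map fun a => (c - a) * (c - (conj a)⁻¹)).prod := by
  induction n using Nat.strong_induction_on with
  | _ n ih =>
  intro V _ _ _ hn J T hJ hT
  rcases Nat.eq_zero_or_pos n with h0 | hpos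
  · refine ⟨0, by simp [h0], by simp, fun c => ?_⟩
    have := Module.finrank_zero_iff.1 (hn.trans h0)
    simp [LinearMap.det_eq_one_of_finrank_eq_zero (hn.trans h0)]
  have : Nontrivial V := Module.nontrivial_of_finrank_pos (R := ℂ) (by omega)
  obtain ⟨a, ha⟩ := Module.End.exists_eigenvalue (K := ℂ) T
  obtain ⟨u, hu⟩ := ha.exists_hasEigenvector
  have hu0 : u ≠ 0 := hu.2
  have hTu : T u = a • u := hu.apply_eq_smul
  have hinj : ∀ x, T x = 0 → x = 0 := fun x hx => by
    have h1 := hT x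
    rw [hx, map_zero, map_zero] at h1
    have h2 := hJ x
    rw [← h1, map_zero] at h2
    exact neg_eq_zero.1 h2.symm
  have ha0 : a ≠ 0 := by
    rintro rfl
    exact hu0 (hinj u (by simp [hTu]))
  have hca0 : conj a ≠ 0 := by simpa using ha0
  have hTJu : T (J u) = (conj a)⁻¹ • J u := by
    have h1 := hT u
    rw [hTu, LinearMap.map_smulₛₗ, map_smul] at h1
    rw [eq_inv_smul_iff₀ hca0, h1]
  have hli : LinearIndependent ℂ ![u, J u] := by
    rw [LinearIndependent.pair_iff' hu0]
    intro c hc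
    have h1 := hJ u
    rw [← hc, LinearMap.map_smulₛₗ, ← hc, smul_smul] at h1
    have h2 : (conj c * c + 1) • u = 0 := by rw [add_smul, h1]; simp
    rcases smul_eq_zero.1 h2 with h3 | h3
    · rw [mul_comm, Complex.mul_conj] at h3
      have h4 : (Complex.normSq c + 1 : ℝ) = 0 := by exact_mod_cast h3
      have := Complex.normSq_nonneg c
      linarith
    · exact hu0 h3
  set E : Submodule ℂ V := Submodule.span ℂ (Set.range ![u, J u]) with hE
  have huE : u ∈ E := Submodule.subset_span ⟨0, rfl⟩
  have hJuE : J u ∈ E := Submodule.subset_span ⟨1, rfl⟩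
  have hTE : E ≤ E.comap T := by
    rw [hE, Submodule.span_le]
    rintro _ ⟨i, rfl⟩
    fin_cases i
    · exact (congrArg (· ∈ E) hTu).mpr (E.smul_mem a huE)
    · exact (congrArg (· ∈ E) hTJu).mpr (E.smul_mem _ hJuE)
  have hJE : E ≤ E.comap J := by
    rw [hE, Submodule.span_le]
    rintro _ ⟨i, rfl⟩
    fin_cases i
    · exact hJuE
    · exact (congrArg (· ∈ E) (hJ u)).mpr (E.neg_mem huE)
  have hfE : Module.finrank ℂ E = 2 := by rw [hE, finrank_span_eq_card hli]; simp
  have hfQ : Module.finrank ℂ (V ⧸ E) + 2 = n := by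
    rw [← hfE, Submodule.finrank_quotient_add_finrank, hn]
  obtain ⟨l, hl, hl0, hdet⟩ := ih (n - 2) (by omega) (V ⧸ E) (by omega)
    (E.mapQ E J hJE) (E.mapQ E T hTE)
    (fun x => by
      obtain ⟨y, rfl⟩ := E.mkQ_surjective x
      simp [hJ])
    (fun x => by
      obtain ⟨y, rfl⟩ := E.mkQ_surjective x
      simp [hT])
  refine ⟨a ::ₘ l, by simp; omega, ?_, fun c => ?_⟩
  · intro b hb
    rcases Multiset.mem_cons.1 hb with rfl | hb
    exacts [ha0, hl0 b hb]
  have hcE : E ≤ E.comap (c • LinearMap.id - T) := fun x hx => by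
    simpa using E.sub_mem (E.smul_mem c hx) (hTE hx)
  rw [LinearMap.det_eq_det_mul_det E _ hcE]
  have hq : E.mapQ E (c • LinearMap.id - T) hcE = c • LinearMap.id - E.mapQ E T hTE := by
    ext x; simp
  rw [hq, hdet, Multiset.map_cons, Multiset.prod_cons]
  congr 1
  let b := Module.Basis.span hli
  have hb : ∀ i, ((b i : E) : V) = ![u, J u] i := fun i => by
    rw [Module.Basis.span_apply hli i]
  have hd : LinearMap.toMatrix b b ((c • LinearMap.id - T).restrict hcE)
      = Matrix.diagonal ![c - a, c - (conj a)⁻¹] := by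
    ext i j
    have h1 : ((c • LinearMap.id - T).restrict hcE) (b j) = ![c - a, c - (conj a)⁻¹] j • b j := by
      apply Subtype.ext
      rw [LinearMap.coe_restrict_apply, Submodule.coe_smul, hb]
      fin_cases j
      · simp [hTu, sub_smul]
      · simp [hTJu, sub_smul]
    rw [LinearMap.toMatrix_apply, h1, map_smul, b.repr_self]
    simp only [Matrix.diagonal_apply, Finsupp.smul_apply, Finsupp.single_apply, smul_eq_mul]
    by_cases h : i = j
    · subst h; simp
    · simp [h, Ne.symm h]
  rw [← LinearMap.det_toMatrix b, hd, Matrix.det_diagonal]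
  simp [Fin.prod_univ_two]

/-! ### The quaternionic conjugation of matrices -/

/-- The standard quaternionic structure `ε C` conjugates matrices to `ε conj(M) ε⁻¹`. -/
def tau {N : ℕ} (M : Matrix (Fin N) (Fin N) ℂ) : Matrix (Fin N) (Fin N) ℂ :=
  -(epsMatrix N * M.map (starRingEnd ℂ) * epsMatrix N)

theorem epsMatrix_map_conj (N : ℕ) : (epsMatrix N).map (starRingEnd ℂ) = epsMatrix N := by
  ext i j
  simp only [Matrix.map_apply, epsMatrix]
  split_ifs <;> simp

theorem epsMatrix_mul_self {N : ℕ} (hN : Even N) : epsMatrix N * epsMatrix N = -1 := by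
  ext i j
  rw [Matrix.mul_apply, Matrix.neg_apply, Matrix.one_apply]
  rcases Nat.even_or_odd (i : ℕ) with hi | hi
  · have hlt : (i : ℕ) + 1 < N := by
      rcases Nat.lt_or_ge (i + 1) N with h | h
      · exact h
      · exfalso
        have : (i : ℕ) + 1 = N := by omega
        rw [← this] at hN
        exact (Nat.even_add_one.1 hN) hi
    rw [Finset.sum_eq_single (⟨i + 1, hlt⟩ : Fin N)]
    · have h1 : epsMatrix N i ⟨i + 1, hlt⟩ = -1 := by simp [epsMatrix, hi]
      have h2 : epsMatrix N ⟨i + 1, hlt⟩ j = if i = j then 1 else 0 := by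
        have ho : ¬ Even ((i : ℕ) + 1) := by simpa [Nat.even_add_one] using hi
        simp only [epsMatrix, ho, false_and, if_false]
        by_cases hij : i = j
        · subst hij; simp [hi]
        · have : ¬ (Even (j : ℕ) ∧ (i : ℕ) + 1 = j + 1) := fun h => hij (Fin.ext (by omega))
          simp only [this, if_false, hij]
      rw [h1, h2]; split_ifs <;> simp
    · intro k _ hk
      have h1 : epsMatrix N i k = 0 := by
        have : (k : ℕ) ≠ i + 1 := fun h => hk (Fin.ext h)
        have h' : ¬ (Even (k : ℕ) ∧ (i : ℕ) = k + 1) := by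
          rintro ⟨hk, h⟩
          rw [h] at hi
          exact (Nat.even_add_one.1 hi) hk
        simp [epsMatrix, this]
        intro hk h; exact h' ⟨hk, h⟩
      rw [h1, zero_mul]
    · simp
  · have hpos : 0 < (i : ℕ) := by
      rcases Nat.eq_zero_or_pos (i : ℕ) with h | h
      · rw [h] at hi; simp at hi
      · exact h
    have hlt : (i : ℕ) - 1 < N := by omega
    have he : Even ((i : ℕ) - 1) := Nat.Odd.sub_odd hi odd_one
    have hi' : ¬ Even (i : ℕ) := by simpa using hi
    rw [Finset.sum_eq_single (⟨i - 1, hlt⟩ : Fin N)]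
    · have h1 : epsMatrix N i ⟨i - 1, hlt⟩ = 1 := by
        simp only [epsMatrix, hi', false_and, if_false, he, true_and]
        rw [if_pos (by omega)]
      have h2 : epsMatrix N ⟨i - 1, hlt⟩ j = if i = j then -1 else 0 := by
        simp only [epsMatrix, he, true_and]
        by_cases hij : i = j
        · subst hij; rw [if_pos (by omega)]; simp
        · have h3 : ¬ ((j : ℕ) = i - 1 + 1) := fun h => hij (Fin.ext (by omega))
          have h4 : ¬ (Even (j : ℕ) ∧ (i : ℕ) - 1 = j + 1) := by
            rintro ⟨hj, h⟩
            rw [h] at he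
            exact (Nat.even_add_one.1 he) hj
          simp only [h3, h4, if_false, hij]
      rw [h1, h2]; split_ifs <;> simp
    · intro k _ hk
      have h1 : epsMatrix N i k = 0 := by
        have : ¬ (Even (k : ℕ) ∧ (i : ℕ) = k + 1) := by
          rintro ⟨_, h⟩
          exact hk (Fin.ext (by simp only; omega))
        simp only [epsMatrix, hi', false_and, if_false, this]
      rw [h1, zero_mul]
    · simp

theorem epsMatrix_mul_mul {N : ℕ} (hN : Even N) (M : Matrix (Fin N) (Fin N) ℂ) :
    epsMatrix N * (epsMatrix N * M) = -M := by
  rw [← mul_assoc, epsMatrix_mul_self hN]; simp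

theorem tau_mul {N : ℕ} (hN : Even N) (M M' : Matrix (Fin N) (Fin N) ℂ) :
    tau (M * M') = tau M * tau M' := by
  simp only [tau, Matrix.map_mul, neg_mul_neg, mul_assoc, epsMatrix_mul_mul hN]
  simp

theorem tau_one {N : ℕ} (hN : Even N) : tau (1 : Matrix (Fin N) (Fin N) ℂ) = 1 := by
  simp [tau, epsMatrix_mul_self hN]

theorem tau_tau {N : ℕ} (hN : Even N) (M : Matrix (Fin N) (Fin N) ℂ) : tau (tau M) = M := by
  have h : (-(epsMatrix N * M.map (starRingEnd ℂ) * epsMatrix N)).map (starRingEnd ℂ)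
      = -(epsMatrix N * M * epsMatrix N) := by
    have h1 : (M.map (starRingEnd ℂ)).map (starRingEnd ℂ) = M := by ext i j; simp
    have h2 : ∀ X : Matrix (Fin N) (Fin N) ℂ,
        (-X).map (starRingEnd ℂ) = -(X.map (starRingEnd ℂ)) := by intro X; ext i j; simp
    rw [h2, Matrix.map_mul, Matrix.map_mul, epsMatrix_map_conj, h1]
  rw [tau, tau, h]
  simp only [mul_neg, neg_neg, mul_assoc, epsMatrix_mul_self hN, epsMatrix_mul_mul hN]
  simp

theorem tau_add {N : ℕ} (M M' : Matrix (Fin N) (Fin N) ℂ) : tau (M + M') = tau M + tau M' := by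
  have h2 : (M + M').map (starRingEnd ℂ) = M.map (starRingEnd ℂ) + M'.map (starRingEnd ℂ) := by
    ext i j; simp
  simp only [tau, h2, mul_add, add_mul, neg_add]

theorem tau_smul {N : ℕ} (c : ℂ) (M : Matrix (Fin N) (Fin N) ℂ) :
    tau (c • M) = conj c • tau M := by
  have h2 : (c • M).map (starRingEnd ℂ) = conj c • M.map (starRingEnd ℂ) := by
    ext i j; simp
  simp [tau, h2]

theorem det_tau {N : ℕ} (hN : Even N) (M : Matrix (Fin N) (Fin N) ℂ) :
    (tau M).det = conj M.det := by
  have h1 : (epsMatrix N).det * (epsMatrix N).det = 1 := by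
    rw [← Matrix.det_mul, epsMatrix_mul_self hN, Matrix.det_neg]
    simp [hN.neg_one_pow]
  have h2 : (M.map (starRingEnd ℂ)).det = conj M.det := by
    rw [RingHom.map_det]; rfl
  rw [tau, Matrix.det_neg, Matrix.det_mul, Matrix.det_mul, h2]
  simp only [Fintype.card_fin, hN.neg_one_pow]
  linear_combination (conj M.det) * h1

theorem continuous_tau {N : ℕ} : Continuous (tau : Matrix (Fin N) (Fin N) ℂ → _) := by
  unfold tau
  exact ((continuous_const.matrix_mul (continuous_id.matrix_map Complex.continuous_conj)).matrix_mul
    continuous_const).neg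

theorem isKramers_iff {N : ℕ} (hN : Even N) (T : Matrix (Fin N) (Fin N) ℂ) :
    IsKramers T ↔ T * tau T = 1 := by
  have hnt : T * tau T = -(T * (epsMatrix N * T.map (starRingEnd ℂ) * epsMatrix N)) := by
    simp [tau]
  constructor
  · rintro ⟨hu, h⟩
    rw [hnt, h, ← mul_assoc, ← mul_assoc, Matrix.mul_nonsing_inv _
      ((Matrix.isUnit_iff_isUnit_det _).1 hu), one_mul, epsMatrix_mul_self hN, neg_neg]
  · intro h
    have hu : IsUnit T := IsUnit.of_mul_eq_one _ h
    refine ⟨hu, ?_⟩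
    have hT : T⁻¹ = tau T := Matrix.inv_eq_right_inv h
    rw [hT, tau, neg_mul, mul_assoc, epsMatrix_mul_self hN]
    simp

theorem kramers_det_ne_zero {N : ℕ} {T : Matrix (Fin N) (Fin N) ℂ} (h : T * tau T = 1) :
    T.det ≠ 0 := fun h0 => by
  have := congrArg Matrix.det h
  rw [Matrix.det_mul, h0, zero_mul, Matrix.det_one] at this
  exact zero_ne_one this

/-- The antilinear map `ε C`. -/
def thetaZero (N : ℕ) : (Fin N → ℂ) →ₛₗ[starRingEnd ℂ] (Fin N → ℂ) where
  toFun x := (epsMatrix N).mulVec (fun i => conj (x i))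
  map_add' x y := by
    rw [← Matrix.mulVec_add]; congr 1; ext i; simp
  map_smul' c x := by
    rw [← Matrix.mulVec_smul]; congr 1; ext i; simp

theorem thetaZero_apply {N : ℕ} (x : Fin N → ℂ) :
    thetaZero N x = (epsMatrix N).mulVec (fun i => conj (x i)) := rfl

theorem conj_mulVec {N : ℕ} (M : Matrix (Fin N) (Fin N) ℂ) (x : Fin N → ℂ) :
    (fun i => conj (M.mulVec x i)) = (M.map (starRingEnd ℂ)).mulVec (fun i => conj (x i)) := by
  ext i
  simp [Matrix.mulVec, dotProduct]

theorem thetaZero_thetaZero {N : ℕ} (hN : Even N) (x : Fin N → ℂ) :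
    thetaZero N (thetaZero N x) = -x := by
  rw [thetaZero_apply, thetaZero_apply, conj_mulVec, epsMatrix_map_conj, Matrix.mulVec_mulVec,
    epsMatrix_mul_self hN]
  simp [Matrix.neg_mulVec]

theorem thetaZero_mulVec {N : ℕ} (hN : Even N) (M : Matrix (Fin N) (Fin N) ℂ) (x : Fin N → ℂ) :
    thetaZero N (M.mulVec x) = (tau M).mulVec (thetaZero N x) := by
  rw [thetaZero_apply, thetaZero_apply, conj_mulVec, Matrix.mulVec_mulVec, Matrix.mulVec_mulVec]
  congr 1
  rw [tau, neg_mul, mul_assoc, epsMatrix_mul_self hN]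
  simp

/-- The eigenvalues of a Kramers matrix come in pairs `a, 1 / conj a`. -/
theorem exists_pairs {N : ℕ} (hN : Even N) {T : Matrix (Fin N) (Fin N) ℂ} (h : T * tau T = 1) :
    ∃ l : Multiset ℂ, N = 2 * l.card ∧ (∀ a ∈ l, a ≠ 0) ∧
      ∀ c : ℂ, (c • (1 : Matrix (Fin N) (Fin N) ℂ) - T).det
        = (l.map fun a => (c - a) * (c - (conj a)⁻¹)).prod := by
  obtain ⟨l, h1, h2, h3⟩ := exists_eigenvalue_pairs N (Fin N → ℂ) (by simp) (thetaZero N)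
    (Matrix.toLin' T) (thetaZero_thetaZero hN) (fun x => by
      rw [Matrix.toLin'_apply, Matrix.toLin'_apply, thetaZero_mulVec hN, Matrix.mulVec_mulVec, h,
        Matrix.one_mulVec])
  refine ⟨l, h1, h2, fun c => ?_⟩
  rw [← h3 c, ← LinearMap.det_toLin']
  congr 1
  simp

/-- The phases of the eigenvalues of a Kramers matrix form a doubled multiset `Y + Y`, and the
product of the phases in `Y` is the phase of `det (z + conj z T)` for any `z` of modulus one. -/
theorem kramers_phases {N : ℕ} (hN : Even N) {T : Matrix (Fin N) (Fin N) ℂ} (h : T * tau T = 1) :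
    ∃ Y : Multiset ℂ, (∀ a ∈ Y, ‖a‖ = 1) ∧ eigenPhases T = Y + Y ∧
      ∀ z : ℂ, ‖z‖ = 1 → (z • (1 : Matrix (Fin N) (Fin N) ℂ) + conj z • T).det ≠ 0 →
        phase (z • (1 : Matrix (Fin N) (Fin N) ℂ) + conj z • T).det = Y.prod := by
  obtain ⟨l, h1, h2, h3⟩ := exists_pairs hN h
  have hconj : ∀ a ∈ l, phase (conj a)⁻¹ = phase a := fun a ha => by
    rw [phase_inv, phase_conj, conj_phase (h2 a ha), inv_inv]
  refine ⟨l.map phase, ?_, ?_, ?_⟩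
  · intro a ha
    obtain ⟨b, hb, rfl⟩ := Multiset.mem_map.1 ha
    exact norm_phase (h2 b hb)
  · have hcp : T.charpoly
        = ((l + l.map fun a => (conj a)⁻¹).map fun a => Polynomial.X - Polynomial.C a).prod := by
      refine Polynomial.funext fun c => ?_
      rw [Matrix.eval_charpoly, show Matrix.scalar (Fin N) c = c • 1 by
        rw [Matrix.scalar_apply, Matrix.smul_one_eq_diagonal], h3, Multiset.map_add,
        Multiset.prod_add, Multiset.prod_map_mul, Polynomial.eval_mul,
        Polynomial.eval_multiset_prod, Polynomial.eval_multiset_prod]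
      simp [Multiset.map_map]
    rw [eigenPhases, hcp, Polynomial.roots_multiset_prod_X_sub_C, Multiset.map_add,
      Multiset.map_map]
    congr 1
    exact Multiset.map_congr rfl fun a ha => hconj a ha
  · intro z hz hne
    have hz0 : z ≠ 0 := by rintro rfl; simp at hz
    have hzc : conj z * z = 1 := by
      rw [mul_comm, Complex.mul_conj, Complex.normSq_eq_norm_sq, hz]; simp
    have e1 : z • (1 : Matrix (Fin N) (Fin N) ℂ) + conj z • T
        = (-conj z) • ((-(z * z)) • (1 : Matrix (Fin N) (Fin N) ℂ) - T) := by
      rw [smul_sub, smul_smul, sub_eq_add_neg, ← neg_smul, neg_neg]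
      congr 2
      linear_combination (-z) * hzc
    have e2 : (z • (1 : Matrix (Fin N) (Fin N) ℂ) + conj z • T).det
        = (l.map fun a => conj z * conj z * ((z * z + a) * (z * z + (conj a)⁻¹))).prod := by
      rw [e1, Matrix.det_smul, h3, Fintype.card_fin]
      have : (-conj z) ^ N = (l.map fun _ => conj z * conj z).prod := by
        rw [Multiset.map_const', Multiset.prod_replicate]
        conv_lhs => rw [h1]
        rw [pow_mul]; congr 1; ring
      rw [this, ← Multiset.prod_map_mul]
      congr 1
      exact Multiset.map_congr rfl fun a _ => by ring
    have hne' := hne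
    rw [e2] at hne' ⊢
    rw [phase_multiset_prod, Multiset.map_map]
    congr 1
    refine Multiset.map_congr rfl fun a ha => ?_
    have hfac : conj z * conj z * ((z * z + a) * (z * z + (conj a)⁻¹)) ≠ 0 := fun h0 =>
      hne' (Multiset.prod_eq_zero (Multiset.mem_map.2 ⟨a, ha, h0⟩))
    have ha0 := h2 a ha
    have hn : (‖a‖ : ℂ) ≠ 0 := by simpa using ha0
    have hca0 : conj a ≠ 0 := by simpa using ha0
    have hna : a * conj a = (‖a‖ : ℂ) ^ 2 := by
      rw [Complex.mul_conj, Complex.normSq_eq_norm_sq]; push_cast; ring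
    -- the factor is `phase a` times a nonnegative real number
    set x : ℝ := (z * z * conj (phase a) + conj (z * z * conj (phase a))).re + ‖a‖ + ‖a‖⁻¹ with hx
    have hfx : conj z * conj z * ((z * z + a) * (z * z + (conj a)⁻¹)) = phase a * (x : ℂ) := by
      have hre : (((z * z * conj (phase a) + conj (z * z * conj (phase a))).re : ℝ) : ℂ)
          = z * z * conj (phase a) + conj (z * z * conj (phase a)) := by
        rw [Complex.add_conj]; simp
      rw [hx]
      push_cast [hre]
      have hinv : (conj a)⁻¹ = a / (‖a‖ : ℂ) ^ 2 := by
        rw [← hna]; field_simp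
      rw [hinv]
      simp only [phase, map_mul, map_div₀, Complex.conj_ofReal, Complex.conj_conj]
      field_simp
      linear_combination (conj z * z + 1) *
        (z * z * (‖a‖ : ℂ) ^ 2 + a * (‖a‖ : ℂ) ^ 2 + a) * hzc - z * z * hna
    have hx0 : 0 ≤ x := by
      have h4 : ‖z * z * conj (phase a)‖ = 1 := by simp [hz, norm_phase ha0]
      have h5 := Complex.abs_re_le_norm (z * z * conj (phase a))
      rw [h4] at h5
      have h6 := (abs_le.1 h5).1
      have h7 : 0 < ‖a‖ := norm_pos_iff.2 ha0
      have h8 : 2 ≤ ‖a‖ + ‖a‖⁻¹ := by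
        have : ‖a‖ * ‖a‖⁻¹ = 1 := mul_inv_cancel₀ h7.ne'
        nlinarith [sq_nonneg (‖a‖ - ‖a‖⁻¹), inv_pos.2 h7, sq_nonneg (‖a‖ - 1)]
      rw [hx, Complex.add_re, Complex.conj_re]
      linarith
    have hxp : 0 < x := lt_of_le_of_ne hx0 (fun h0 => by
      rw [hfx, ← h0] at hfac; simp at hfac)
    simp only [Function.comp]
    rw [hfx, phase_mul, phase_ofReal_pos hxp, mul_one]
    exact phase_of_norm_one (norm_phase ha0)

/-! ### The square root of the determinant phase of a Kramers matrix -/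

theorem exists_unit_det_ne_zero {N : ℕ} (T : Matrix (Fin N) (Fin N) ℂ) :
    ∃ z : ℂ, ‖z‖ = 1 ∧ (z • (1 : Matrix (Fin N) (Fin N) ℂ) + conj z • T).det ≠ 0 := by
  have hinf : (Set.Ioo (0 : ℝ) 1).Infinite := Set.Ioo_infinite one_pos
  set f : ℝ → ℂ := fun t => Complex.exp (Complex.I * t) with hf
  have hnorm : ∀ t, ‖f t‖ = 1 := fun t => Complex.norm_exp_I_mul_ofReal t
  have hinj : Set.InjOn (fun t => f t * f t) (Set.Ioo (0 : ℝ) 1) := by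
    intro a ha b hb hab
    have h2 : ∀ t, (f t * f t).re = Real.cos (2 * t) := fun t => by
      rw [hf, ← Complex.exp_add, show Complex.I * (t : ℂ) + Complex.I * t = ((2 * t : ℝ) : ℂ)
        * Complex.I by push_cast; ring, Complex.exp_ofReal_mul_I_re]
    have h3 : Real.cos (2 * a) = Real.cos (2 * b) := by
      rw [← h2, ← h2]; exact congrArg Complex.re hab
    have hpi := Real.pi_gt_three
    have := Real.injOn_cos ⟨by linarith [ha.1], by linarith [ha.2]⟩
      ⟨by linarith [hb.1], by linarith [hb.2]⟩ h3
    linarith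
  obtain ⟨w, ⟨t, ht, rfl⟩, hw⟩ := ((hinf.image hinj).sdiff
    ((-T).charpoly.roots.toFinset.finite_toSet)).nonempty
  refine ⟨f t, hnorm t, ?_⟩
  have h0 : f t ≠ 0 := by intro h; have := hnorm t; rw [h] at this; simp at this
  have hzc : conj (f t) * f t = 1 := by
    rw [mul_comm, Complex.mul_conj, Complex.normSq_eq_norm_sq, hnorm]; simp
  have e1 : f t • (1 : Matrix (Fin N) (Fin N) ℂ) + conj (f t) • T
      = (conj (f t)) • ((f t * f t) • (1 : Matrix (Fin N) (Fin N) ℂ) - (-T)) := by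
    rw [sub_neg_eq_add, smul_add, smul_smul, ← mul_assoc, hzc, one_mul]
  rw [e1, Matrix.det_smul, Matrix.smul_one_eq_diagonal, ← Matrix.scalar_apply,
    ← Matrix.eval_charpoly]
  refine mul_ne_zero (pow_ne_zero _ (by simpa using h0)) fun h => hw ?_
  simp only [Finset.mem_coe, Multiset.mem_toFinset]
  exact (Polynomial.mem_roots (Matrix.charpoly_monic _).ne_zero).2 h

/-- The square root of the phase of `det T` for a Kramers matrix `T`: the product of the eigenvalue
phases, each degenerate pair taken once.  It is encoded as the phase of `det (z + conj z T)` for a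
`z` of modulus one, the choice of which does not matter. -/
def kramersRoot {N : ℕ} (T : Matrix (Fin N) (Fin N) ℂ) : ℂ :=
  phase ((exists_unit_det_ne_zero T).choose • (1 : Matrix (Fin N) (Fin N) ℂ)
    + conj (exists_unit_det_ne_zero T).choose • T).det

theorem kramersRoot_spec {N : ℕ} (hN : Even N) {T : Matrix (Fin N) (Fin N) ℂ}
    (h : T * tau T = 1) :
    ∃ Y : Multiset ℂ, (∀ a ∈ Y, ‖a‖ = 1) ∧ eigenPhases T = Y + Y ∧ kramersRoot T = Y.prod := by
  obtain ⟨Y, h1, h2, h3⟩ := kramers_phases hN h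
  exact ⟨Y, h1, h2, h3 _ (exists_unit_det_ne_zero T).choose_spec.1
    (exists_unit_det_ne_zero T).choose_spec.2⟩

theorem kramersRoot_eq {N : ℕ} (hN : Even N) {T : Matrix (Fin N) (Fin N) ℂ}
    (h : T * tau T = 1) {z : ℂ} (hz : ‖z‖ = 1)
    (hne : (z • (1 : Matrix (Fin N) (Fin N) ℂ) + conj z • T).det ≠ 0) :
    kramersRoot T = phase (z • (1 : Matrix (Fin N) (Fin N) ℂ) + conj z • T).det := by
  obtain ⟨Y, h1, h2, h3⟩ := kramers_phases hN h
  rw [h3 z hz hne]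
  exact h3 _ (exists_unit_det_ne_zero T).choose_spec.1 (exists_unit_det_ne_zero T).choose_spec.2

theorem kramersRoot_ne_zero {N : ℕ} (T : Matrix (Fin N) (Fin N) ℂ) : kramersRoot T ≠ 0 :=
  phase_ne_zero (exists_unit_det_ne_zero T).choose_spec.2

theorem eigenPhases_prod {N : ℕ} (T : Matrix (Fin N) (Fin N) ℂ) :
    (eigenPhases T).prod = phase T.det := by
  rw [Matrix.det_eq_prod_roots_charpoly, phase_multiset_prod]; rfl

theorem kramersRoot_sq {N : ℕ} (hN : Even N) {T : Matrix (Fin N) (Fin N) ℂ}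
    (h : T * tau T = 1) : kramersRoot T ^ 2 = phase T.det := by
  obtain ⟨Y, h1, h2, h3⟩ := kramersRoot_spec hN h
  rw [← eigenPhases_prod, h2, h3, Multiset.prod_add, sq]

theorem kramersRoot_one (N : ℕ) (hN : Even N) :
    kramersRoot (1 : Matrix (Fin N) (Fin N) ℂ) = 1 := by
  have e : ((1 : ℂ) • (1 : Matrix (Fin N) (Fin N) ℂ) + conj (1 : ℂ) • 1).det = (2 : ℂ) ^ N := by
    rw [map_one, ← add_smul, Matrix.det_smul]; norm_num
  rw [kramersRoot_eq hN (by rw [tau_one hN, one_mul]) (z := 1) (by simp)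
    (by rw [e]; exact pow_ne_zero _ two_ne_zero), e, phase_pow]
  have : phase 2 = 1 := by exact_mod_cast phase_ofReal_pos (x := 2) (by norm_num)
  rw [this, one_pow]

theorem kramersRoot_tau {N : ℕ} (hN : Even N) {T : Matrix (Fin N) (Fin N) ℂ}
    (h : T * tau T = 1) : kramersRoot (tau T) = (kramersRoot T)⁻¹ := by
  obtain ⟨z, hz, hne⟩ := exists_unit_det_ne_zero T
  have e : (conj z • (1 : Matrix (Fin N) (Fin N) ℂ) + conj (conj z) • tau T).det
      = conj (z • (1 : Matrix (Fin N) (Fin N) ℂ) + conj z • T).det := by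
    rw [← det_tau hN, tau_add, tau_smul, tau_smul, tau_one hN]
  have h' : tau T * tau (tau T) = 1 := by rw [← tau_mul hN, h, tau_one hN]
  rw [kramersRoot_eq hN h' (z := conj z) (by simpa using hz) (by rw [e]; simpa using hne), e,
    phase_conj, conj_phase hne, kramersRoot_eq hN h hz hne]

theorem continuousOn_kramersRoot {N : ℕ} (hN : Even N) :
    ContinuousOn (kramersRoot (N := N)) {T | T * tau T = 1} := by
  intro T hT
  obtain ⟨z, hz, hne⟩ := exists_unit_det_ne_zero T
  have hc : Continuous fun T : Matrix (Fin N) (Fin N) ℂ =>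
      (z • (1 : Matrix (Fin N) (Fin N) ℂ) + conj z • T).det :=
    (continuous_const.add (continuous_id.const_smul (conj z))).matrix_det
  have hev : ∀ᶠ T' in nhdsWithin T {T | T * tau T = 1},
      phase (z • (1 : Matrix (Fin N) (Fin N) ℂ) + conj z • T').det = kramersRoot T' := by
    have := (hc.continuousAt (x := T)).eventually_ne hne
    filter_upwards [nhdsWithin_le_nhds this, self_mem_nhdsWithin] with T' h1 h2
    exact (kramersRoot_eq hN h2 hz h1).symm
  refine ContinuousWithinAt.congr_of_eventuallyEq
    ((ContinuousAt.comp (f := fun T : Matrix (Fin N) (Fin N) ℂ =>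
      (z • (1 : Matrix (Fin N) (Fin N) ℂ) + conj z • T).det) (continuousAt_phase hne)
      hc.continuousAt).continuousWithinAt)
    (hev.mono fun _ h => h.symm) (kramersRoot_eq hN hT hz hne)

/-- A continuous function with values `±1` is constant on a preconnected set. -/
theorem eq_of_sq_eq_one {X : Type*} [TopologicalSpace X] {s : Set X} (hs : IsPreconnected s)
    {f : X → ℂ} (hf : ContinuousOn f s) (h2 : ∀ x ∈ s, f x ^ 2 = 1) {x y : X} (hx : x ∈ s)
    (hy : y ∈ s) : f x = f y := by
  rcases hs.eq_one_or_eq_neg_one_of_sq_eq hf (fun x hx => h2 x hx) with h | h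
  · rw [h hx, h hy]; rfl
  · rw [h hx, h hy]; rfl

/-- The line through `1` and an invertible matrix `M` meets the singular matrices in finitely many
points only. -/
theorem isPathConnected_det_line {N : ℕ} (M : Matrix (Fin N) (Fin N) ℂ) :
    IsPathConnected {s : ℂ | (1 + s • (M - 1)).det ≠ 0} := by
  have hcount : {s : ℂ | (1 + s • (M - 1)).det = 0}.Countable := by
    refine (((-(M - 1)).charpoly.roots.toFinset.finite_toSet.image (fun x => x⁻¹)).subset
      fun s hs => ?_).countable
    have hs0 : s ≠ 0 := by
      rintro rfl
      simp at hs
    refine ⟨s⁻¹, ?_, inv_inv s⟩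
    simp only [Finset.mem_coe, Multiset.mem_toFinset]
    refine (Polynomial.mem_roots (Matrix.charpoly_monic _).ne_zero).2 ?_
    rw [Polynomial.IsRoot, Matrix.eval_charpoly, Matrix.scalar_apply,
      ← Matrix.smul_one_eq_diagonal, sub_neg_eq_add]
    have e : 1 + s • (M - 1) = s • (s⁻¹ • (1 : Matrix (Fin N) (Fin N) ℂ) + (M - 1)) := by
      rw [smul_add, smul_smul, mul_inv_cancel₀ hs0, one_smul]
    have hs' : (1 + s • (M - 1)).det = 0 := hs
    rw [e, Matrix.det_smul] at hs'
    exact (mul_eq_zero.1 hs').resolve_left (pow_ne_zero _ hs0)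
  have := hcount.isPathConnected_compl_of_one_lt_rank (by simp [Complex.rank_real_complex])
  exact this

theorem kramers_gauge {N : ℕ} (hN : Even N) {T M : Matrix (Fin N) (Fin N) ℂ}
    (h : T * tau T = 1) (hM : M.det ≠ 0) :
    ((tau M)⁻¹ * T * M) * tau ((tau M)⁻¹ * T * M) = 1 := by
  have h1 : IsUnit M.det := isUnit_iff_ne_zero.2 hM
  have h2 : IsUnit (tau M).det := isUnit_iff_ne_zero.2 (by rw [det_tau hN]; simpa using hM)
  have h3 : tau (tau M)⁻¹ = M⁻¹ := by
    refine (Matrix.inv_eq_right_inv ?_).symm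
    have := congrArg tau (Matrix.mul_nonsing_inv _ h2)
    rwa [tau_mul hN, tau_tau hN, tau_one hN] at this
  rw [tau_mul hN, tau_mul hN, h3]
  calc (tau M)⁻¹ * T * M * (M⁻¹ * tau T * tau M)
      = (tau M)⁻¹ * (T * (M * M⁻¹) * tau T) * tau M := by simp only [mul_assoc]
    _ = 1 := by rw [Matrix.mul_nonsing_inv _ h1, mul_one, h, mul_one, Matrix.nonsing_inv_mul _ h2]

/-- A time-reversal compatible change of frames multiplies `kramersRoot` by the phase of the
determinant, because the invertible matrices are connected. -/
theorem kramersRoot_gauge {N : ℕ} (hN : Even N) {T M : Matrix (Fin N) (Fin N) ℂ}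
    (h : T * tau T = 1) (hM : M.det ≠ 0) :
    kramersRoot ((tau M)⁻¹ * T * M) = kramersRoot T * phase M.det := by
  set D := {s : ℂ | (1 + s • (M - 1)).det ≠ 0} with hD
  set g : ℂ → Matrix (Fin N) (Fin N) ℂ := fun s => 1 + s • (M - 1) with hg
  have hgc : Continuous g := by fun_prop
  have hpre : IsPreconnected D := (isPathConnected_det_line M).isConnected.isPreconnected
  have hK : ∀ s ∈ D, ((tau (g s))⁻¹ * T * g s) * tau ((tau (g s))⁻¹ * T * g s) = 1 :=
    fun s hs => kramers_gauge hN h hs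
  have htu : ∀ s ∈ D, (tau (g s)).det ≠ 0 := fun s hs => by
    rw [det_tau hN]; exact (map_ne_zero _).2 hs
  have hcont : ContinuousOn (fun s => kramersRoot ((tau (g s))⁻¹ * T * g s)
      * (kramersRoot T * phase (g s).det)⁻¹) D := by
    refine ContinuousOn.mul ?_ (ContinuousOn.inv₀ ?_ ?_)
    · refine (continuousOn_kramersRoot hN).comp ?_ hK
      have hinv : ContinuousOn (fun s => (tau (g s))⁻¹) D := by
        have e : (fun s => (tau (g s))⁻¹)
            = fun s => ((tau (g s)).det)⁻¹ • (tau (g s)).adjugate := by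
          funext s; rw [Matrix.inv_def, Ring.inverse_eq_inv']
        rw [e]
        exact ((continuous_tau.comp hgc).matrix_det.continuousOn.inv₀ htu).smul
          (continuous_tau.comp hgc).matrix_adjugate.continuousOn
      exact (hinv.mul continuousOn_const).mul hgc.continuousOn
    · exact continuousOn_const.mul (ContinuousOn.phase hgc.matrix_det.continuousOn (fun s hs => hs))
    · exact fun s hs => mul_ne_zero (kramersRoot_ne_zero _) (phase_ne_zero hs)
  have hsq : ∀ s ∈ D, (kramersRoot ((tau (g s))⁻¹ * T * g s)
      * (kramersRoot T * phase (g s).det)⁻¹) ^ 2 = 1 := fun s hs => by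
    have hp : (phase (g s).det) ≠ 0 := phase_ne_zero hs
    have hT0 := phase_ne_zero (kramers_det_ne_zero h)
    rw [mul_pow, inv_pow, mul_pow, kramersRoot_sq hN (hK s hs), kramersRoot_sq hN h,
      Matrix.det_mul, Matrix.det_mul, phase_mul, phase_mul, Matrix.det_nonsing_inv,
      Ring.inverse_eq_inv', det_tau hN, phase_inv, phase_conj, conj_phase (w := (g s).det) hs]
    field_simp
  have h0 : (0 : ℂ) ∈ D := by simp [hD]
  have h1 : (1 : ℂ) ∈ D := by simpa [hD] using hM
  have := eq_of_sq_eq_one hpre hcont hsq h1 h0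
  simp only [hg, one_smul, zero_smul, add_sub_cancel, add_zero, tau_one hN, inv_one, one_mul,
    mul_one, Matrix.det_one, phase_one] at this
  rw [mul_inv_cancel₀ (kramersRoot_ne_zero T)] at this
  rwa [mul_inv_eq_one₀ (mul_ne_zero (kramersRoot_ne_zero T) (phase_ne_zero hM))] at this

/-! ### Continuous logarithms -/

theorem exists_continuous_log {X : Type*} [TopologicalSpace X] [LocallyPathConnectedSpace X]
    [SimplyConnectedSpace X] {g : X → ℂ} (hg : Continuous g) (h0 : ∀ x, g x ≠ 0) :
    ∃ f : X → ℂ, Continuous f ∧ ∀ x, Complex.exp (f x) = g x := by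
  obtain ⟨f, hf, -⟩ := Complex.isCoveringMapOn_exp.existsUnique_continuousMap_lifts
    ⟨g, hg⟩ (e₀ := Complex.log (g (Classical.arbitrary X))) (Complex.exp_log (h0 _))
    (fun x => h0 x)
  exact ⟨f, f.continuous, fun x => congrFun hf.2 x⟩

/-- A continuous function from a simply connected space to the unit circle has a continuous
argument. -/
theorem exists_continuous_arg {X : Type*} [TopologicalSpace X] [LocallyPathConnectedSpace X]
    [SimplyConnectedSpace X] {g : X → ℂ} (hg : Continuous g) (h1 : ∀ x, ‖g x‖ = 1) :
    ∃ f : X → ℝ, Continuous f ∧ ∀ x, Complex.exp (Complex.I * f x) = g x := by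
  obtain ⟨f, hf, hfg⟩ := exists_continuous_log hg (fun x h => by simpa [h] using h1 x)
  refine ⟨fun x => (f x).im, Complex.continuous_im.comp hf, fun x => ?_⟩
  have h2 : (f x).re = 0 := by
    have := h1 x
    rw [← hfg, Complex.norm_exp] at this
    simpa using this
  rw [← hfg]
  congr 1
  apply Complex.ext <;> simp [h2]

theorem exists_continuousOn_arg {a b : ℝ} (hab : a ≤ b) {g : ℝ → ℂ}
    (hg : ContinuousOn g (Set.Icc a b)) (h1 : ∀ x ∈ Set.Icc a b, ‖g x‖ = 1) :
    ∃ f : ℝ → ℝ, Continuous f ∧ ∀ x ∈ Set.Icc a b, Complex.exp (Complex.I * f x) = g x := by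
  obtain ⟨f, hf, hfg⟩ := exists_continuous_arg
    (g := Set.IccExtend hab ((Set.Icc a b).domRestrict g))
    (Continuous.Icc_extend' hg.domRestrict) (fun x => h1 _ (Set.projIcc a b hab x).2)
  exact ⟨f, hf, fun x hx => by rw [hfg, Set.IccExtend_of_mem _ _ hx]; rfl⟩

/-! ### The index as a sign -/

/-- The sign of a Kramers family `T(φ)`, `0 ≤ φ ≤ π`: a continuous square root of the phase of
`det T` is compared at `φ = 0, π` with `kramersRoot`. -/
def IsKramersSign {N : ℕ} (T : ℝ → Matrix (Fin N) (Fin N) ℂ) (s : ℂ) : Prop :=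
  ∃ r : ℝ → ℂ, ContinuousOn r (Set.Icc 0 Real.pi) ∧
    (∀ k ∈ Set.Icc 0 Real.pi, r k ^ 2 = phase (T k).det) ∧
    r Real.pi * kramersRoot (T 0) = s * (r 0 * kramersRoot (T Real.pi))

theorem exists_half {Z : Multiset ℂ} (h : EvenDegenerate Z) : ∃ Y, Z = Y + Y := by
  induction hn : Z.card using Nat.strong_induction_on generalizing Z with
  | _ n ih =>
  rcases Z.empty_or_exists_mem with rfl | ⟨z, hz⟩
  · exact ⟨0, rfl⟩
  · have h1 : 2 ≤ Z.count z := by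
      have := Multiset.count_pos.2 hz
      obtain ⟨m, hm⟩ := h z
      omega
    obtain ⟨W, rfl⟩ := Multiset.le_iff_exists_add.1 (Multiset.le_count_iff_replicate_le.1 h1)
    have hW : EvenDegenerate W := fun y => by
      have h2 := h y
      rw [Multiset.count_add, Multiset.count_replicate] at h2
      split_ifs at h2
      · exact (Nat.even_add.1 h2).1 even_two
      · simpa using h2
    obtain ⟨Y, rfl⟩ := ih W.card (by rw [← hn]; simp) hW rfl
    refine ⟨z ::ₘ Y, ?_⟩
    simp [Multiset.replicate_succ, Multiset.cons_add, Multiset.add_cons]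

theorem half_unique {Y Y' : Multiset ℂ} (h : Y + Y = Y' + Y') : Y = Y' := by
  ext a
  have := congrArg (Multiset.count a) h
  simp only [Multiset.count_add] at this
  omega

theorem half_evenDegenerate {Y : Multiset ℂ} : EvenDegenerate (Y + Y) := fun z => by
  rw [Multiset.count_add]; exact Even.add_self _

theorem circleTuple_prod {N : ℕ} (θ : Fin N → ℝ) :
    (circleTuple θ).prod = Complex.exp (Complex.I * ((∑ i, θ i : ℝ) : ℂ)) := by
  rw [circleTuple]
  push_cast
  rw [Finset.mul_sum, Complex.exp_sum]
  rfl

theorem circleTuple_half_prod {N : ℕ} {θ : Fin N → ℝ} {Y : Multiset ℂ}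
    (h : circleTuple θ = Y + Y) {z : ℂ} (hz : ‖z‖ = 1)
    (hne : ∏ i, (z + conj z * Complex.exp (Complex.I * (θ i : ℂ))) ≠ 0) :
    phase (∏ i, (z + conj z * Complex.exp (Complex.I * (θ i : ℂ)))) = Y.prod := by
  have e : ∏ i, (z + conj z * Complex.exp (Complex.I * (θ i : ℂ)))
      = ((circleTuple θ).map fun a => z + conj z * a).prod := by
    rw [circleTuple, Multiset.map_map]; rfl
  rw [e] at hne ⊢
  have hmem : ∀ a ∈ Y, a ∈ circleTuple θ := fun a ha => by
    rw [h]; exact Multiset.mem_add.2 (Or.inl ha)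
  have hn1 : ∀ a ∈ Y, ‖a‖ = 1 := fun a ha => by
    obtain ⟨i, -, rfl⟩ := Multiset.mem_map.1 (hmem a ha)
    exact Complex.norm_exp_I_mul_ofReal _
  have hne' : ∀ a ∈ Y, z + conj z * a ≠ 0 := fun a ha h0 =>
    hne (Multiset.prod_eq_zero (Multiset.mem_map.2 ⟨a, hmem a ha, h0⟩))
  rw [h, Multiset.map_add, Multiset.prod_add, ← Multiset.prod_map_mul, phase_multiset_prod,
    Multiset.map_map]
  conv_rhs => rw [← Multiset.map_id Y]
  congr 1
  refine Multiset.map_congr rfl fun a ha => ?_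
  -- `(z + conj z a)² = a |z + conj z a|²`
  have ha1 : a * conj a = 1 := by
    rw [Complex.mul_conj, Complex.normSq_eq_norm_sq, hn1 a ha]; simp
  have hz1 : z * conj z = 1 := by
    rw [Complex.mul_conj, Complex.normSq_eq_norm_sq, hz]; simp
  have e2 : (z + conj z * a) * (z + conj z * a) = a * ((‖z + conj z * a‖ ^ 2 : ℝ) : ℂ) := by
    rw [← Complex.normSq_eq_norm_sq, ← Complex.mul_conj]
    simp only [map_add, map_mul, Complex.conj_conj]
    linear_combination (-(z * (z + conj z * a))) * ha1
  simp only [Function.comp, id]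
  rw [e2, phase_mul, phase_ofReal_pos (by have := norm_pos_iff.2 (hne' a ha); positivity),
    mul_one, phase_of_norm_one (hn1 a ha)]

/-- Along a continuous family of even degenerate tuples, half the sum of the arguments follows the
product of the points, each degenerate pair taken once. -/
theorem half_sum_transport {N : ℕ} {b c : ℝ} (hbc : b ≤ c) {θ : ℝ → Fin N → ℝ}
    (hθ : ContinuousOn θ (Set.Icc b c))
    (he : ∀ x ∈ Set.Icc b c, EvenDegenerate (circleTuple (θ x))) {Yb Yc : Multiset ℂ}
    (hb : circleTuple (θ b) = Yb + Yb) (hc : circleTuple (θ c) = Yc + Yc) :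
    Complex.exp (Complex.I * ((∑ i, θ b i : ℝ) : ℂ) / 2) * Yc.prod
      = Complex.exp (Complex.I * ((∑ i, θ c i : ℝ) : ℂ) / 2) * Yb.prod := by
  have hY : ∀ x, ∃ Y, x ∈ Set.Icc b c → circleTuple (θ x) = Y + Y := fun x => by
    by_cases hx : x ∈ Set.Icc b c
    · obtain ⟨Y, hY⟩ := exists_half (he x hx)
      exact ⟨Y, fun _ => hY⟩
    · exact ⟨0, fun h => absurd h hx⟩
  choose Y hY using hY
  have hbm : b ∈ Set.Icc b c := ⟨le_rfl, hbc⟩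
  have hcm : c ∈ Set.Icc b c := ⟨hbc, le_rfl⟩
  obtain rfl : Yb = Y b := half_unique (by rw [← hb, hY b hbm])
  obtain rfl : Yc = Y c := half_unique (by rw [← hc, hY c hcm])
  have hsqY : ∀ x ∈ Set.Icc b c, (Y x).prod ^ 2
      = Complex.exp (Complex.I * ((∑ i, θ x i : ℝ) : ℂ)) := fun x hx => by
    rw [← circleTuple_prod, hY x hx, Multiset.prod_add, sq]
  have hY0 : ∀ x ∈ Set.Icc b c, (Y x).prod ≠ 0 := fun x hx h0 => by
    have := hsqY x hx
    rw [h0] at this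
    exact Complex.exp_ne_zero _ (by rw [← this]; simp)
  have hcomp : ∀ i, ContinuousOn (fun x => θ x i) (Set.Icc b c) := fun i =>
    (continuous_apply i).comp_continuousOn hθ
  -- near `x`, the product of the pairs is the phase of a non-vanishing expression with fixed `z`
  have hcY : ContinuousOn (fun x => (Y x).prod) (Set.Icc b c) := by
    intro x hx
    obtain ⟨z, hz, hne⟩ := exists_unit_det_ne_zero
      (Matrix.diagonal fun i => Complex.exp (Complex.I * (θ x i : ℂ)))
    have hne' : ∏ i, (z + conj z * Complex.exp (Complex.I * (θ x i : ℂ))) ≠ 0 := by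
      rw [Matrix.smul_one_eq_diagonal, ← Matrix.diagonal_smul, Matrix.diagonal_add,
        Matrix.det_diagonal] at hne
      simpa using hne
    have hcw : ContinuousWithinAt
        (fun x => ∏ i, (z + conj z * Complex.exp (Complex.I * (θ x i : ℂ)))) (Set.Icc b c) x := by
      refine tendsto_finsetProd _ fun i _ => ?_
      have := (Complex.continuous_ofReal.comp_continuousOn (hcomp i)) x hx
      exact (this.const_mul Complex.I).cexp.const_mul (conj z) |>.const_add z
    have hev : ∀ᶠ y in nhdsWithin x (Set.Icc b c),
        phase (∏ i, (z + conj z * Complex.exp (Complex.I * (θ y i : ℂ)))) = (Y y).prod := by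
      filter_upwards [hcw.eventually_ne hne', self_mem_nhdsWithin] with y h1 h2
      exact circleTuple_half_prod (hY y h2) hz h1
    refine ContinuousWithinAt.congr_of_eventuallyEq
      (ContinuousAt.comp_continuousWithinAt
        (f := fun x => ∏ i, (z + conj z * Complex.exp (Complex.I * (θ x i : ℂ))))
        (continuousAt_phase hne') hcw)
      (hev.mono fun _ h => h.symm) (circleTuple_half_prod (hY x hx) hz hne').symm
  have hcs : ContinuousOn (fun x => Complex.exp (Complex.I * ((∑ i, θ x i : ℝ) : ℂ) / 2))
      (Set.Icc b c) := by
    have : ContinuousOn (fun x => ((∑ i, θ x i : ℝ) : ℂ)) (Set.Icc b c) :=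
      Complex.continuous_ofReal.comp_continuousOn (continuousOn_finsetSum _ fun i _ => hcomp i)
    exact ((this.const_mul Complex.I).div_const 2).cexp
  have key := eq_of_sq_eq_one (f := fun x => Complex.exp (Complex.I * ((∑ i, θ x i : ℝ) : ℂ) / 2)
      * ((Y x).prod)⁻¹) isPreconnected_Icc (hcs.mul (hcY.inv₀ hY0)) (fun x hx => by
    rw [mul_pow, inv_pow, hsqY x hx, ← Complex.exp_nat_mul]
    rw [show ((2 : ℕ) : ℂ) * (Complex.I * ((∑ i, θ x i : ℝ) : ℂ) / 2)
      = Complex.I * ((∑ i, θ x i : ℝ) : ℂ) by push_cast; ring]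
    exact mul_inv_cancel₀ (Complex.exp_ne_zero _)) hbm hcm
  have h1 := hY0 b hbm
  have h2 := hY0 c hcm
  field_simp at key
  linear_combination key

/-- The exponential of `i` times half the sum of the arguments is a square root of the phase of the
determinant; over the even degenerate continuation it changes in the same way as `kramersRoot`. -/
theorem IsKramersIndex.isKramersSign {N : ℕ} (hN : Even N) {T : ℝ → Matrix (Fin N) (Fin N) ℂ}
    {s : ℤˣ} (h : IsKramersIndex T s) : IsKramersSign T ((s : ℤ) : ℂ) := by
  obtain ⟨hTc, hTu, hK0, hKpi, -, -, c, θ, θ', w, hbc, hθ, hθZ, hθ', hev, hb, hc, hw, hs⟩ := h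
  have hpi : (0 : ℝ) ≤ Real.pi := Real.pi_pos.le
  obtain ⟨Y0, -, hY0, hq0⟩ := kramersRoot_spec hN ((isKramers_iff hN _).1 hK0)
  obtain ⟨Y1, -, hY1, hq1⟩ := kramersRoot_spec hN ((isKramers_iff hN _).1 hKpi)
  refine ⟨fun x => Complex.exp (Complex.I * ((∑ i, θ x i : ℝ) : ℂ) / 2), ?_, ?_, ?_⟩
  · have : ContinuousOn (fun x => ((∑ i, θ x i : ℝ) : ℂ)) (Set.Icc 0 Real.pi) :=
      Complex.continuous_ofReal.comp_continuousOn (continuousOn_finsetSum _ fun i _ =>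
        (continuous_apply i).comp_continuousOn hθ)
    exact ((this.const_mul Complex.I).div_const 2).cexp
  · intro k hk
    have h1 := hθZ k hk
    simp only at h1 ⊢
    rw [← eigenPhases_prod, ← h1, circleTuple_prod, ← Complex.exp_nat_mul]
    congr 1; push_cast; ring
  · have key := half_sum_transport hbc hθ' hev (hb.trans hY1) (hc.trans hY0)
    rw [hq0, hq1]
    have hsw : ((s : ℤ) : ℂ) = Complex.exp (Complex.I * (Real.pi * w : ℝ)) := by
      rw [hs, show Complex.I * ((Real.pi * w : ℝ) : ℂ) = (w : ℂ) * (Real.pi * Complex.I) by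
        push_cast; ring, Complex.exp_int_mul, Complex.exp_pi_mul_I]
      rcases Int.even_or_odd w with h | h
      · simp [h.neg_one_zpow]
      · simp [h.neg_one_zpow]
    have hw' : ∑ i, θ Real.pi i - ∑ i, θ 0 i + (∑ i, θ' c i - ∑ i, θ' Real.pi i)
        = 2 * (Real.pi * w) := by
      rw [← mul_assoc, ← hw, Finset.sum_sub_distrib, Finset.sum_sub_distrib]
    have hw2 : Complex.exp (Complex.I * (Real.pi * w : ℝ))
        * Complex.exp (Complex.I * ((∑ i, θ 0 i : ℝ) : ℂ) / 2)
        * Complex.exp (Complex.I * ((∑ i, θ' Real.pi i : ℝ) : ℂ) / 2)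
        = Complex.exp (Complex.I * ((∑ i, θ Real.pi i : ℝ) : ℂ) / 2)
        * Complex.exp (Complex.I * ((∑ i, θ' c i : ℝ) : ℂ) / 2) := by
      rw [← Complex.exp_add, ← Complex.exp_add, ← Complex.exp_add]
      congr 1
      have hw3 := congrArg (fun t : ℝ => (t : ℂ)) hw'
      simp only [Complex.ofReal_add, Complex.ofReal_sub, Complex.ofReal_mul] at hw3 ⊢
      push_cast at hw3 ⊢
      linear_combination (-Complex.I / 2) * hw3
    have hne : Complex.exp (Complex.I * ((∑ i, θ' Real.pi i : ℝ) : ℂ) / 2) ≠ 0 :=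
      Complex.exp_ne_zero _
    rw [hsw]
    apply mul_left_cancel₀ hne
    linear_combination (Complex.exp (Complex.I * ((∑ i, θ Real.pi i : ℝ) : ℂ) / 2)) * key
      - Y1.prod * hw2

/-! ### Continuous arguments of the eigenvalue phases -/

/-- The arguments `θ` form a window of length at most `2π`, in increasing order. -/
def IsArgWindow {N : ℕ} (θ : Fin N → ℝ) : Prop :=
  Monotone θ ∧ ∀ i j, θ i ≤ θ j + 2 * Real.pi

theorem exp_arg_add_two_pi (x : ℝ) :
    Complex.exp (Complex.I * ((x + 2 * Real.pi : ℝ) : ℂ)) = Complex.exp (Complex.I * (x : ℂ)) := by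
  rw [← Complex.exp_periodic (Complex.I * (x : ℂ))]
  congr 1; push_cast; ring

theorem circleTuple_succ {n : ℕ} (θ : Fin (n + 1) → ℝ) :
    circleTuple θ = Complex.exp (Complex.I * (θ 0 : ℂ)) ::ₘ circleTuple (fun i => θ i.succ) := by
  rw [circleTuple, Fin.univ_succ, Finset.cons_val, Multiset.map_cons, Finset.map_val,
    Multiset.map_map]
  rfl

theorem circleTuple_castSucc {n : ℕ} (θ : Fin (n + 1) → ℝ) :
    circleTuple θ = Complex.exp (Complex.I * (θ (Fin.last n) : ℂ))
      ::ₘ circleTuple (fun i => θ i.castSucc) := by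
  rw [circleTuple, Fin.univ_castSuccEmb, Finset.cons_val, Multiset.map_cons, Finset.map_val,
    Multiset.map_map]
  rfl

theorem exists_window_up {n : ℕ} {θ : Fin (n + 1) → ℝ} (h : IsArgWindow θ) :
    ∃ θ' : Fin (n + 1) → ℝ, IsArgWindow θ' ∧ circleTuple θ' = circleTuple θ ∧
      ∑ i, θ' i = ∑ i, θ i + 2 * Real.pi := by
  have hpi := Real.pi_pos
  refine ⟨Fin.snoc (fun i => θ i.succ) (θ 0 + 2 * Real.pi), ⟨?_, ?_⟩, ?_, ?_⟩
  · intro i j hij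
    induction j using Fin.lastCases with
    | last =>
      induction i using Fin.lastCases with
      | last => simp
      | cast i => simpa using h.2 _ _
    | cast j =>
      induction i using Fin.lastCases with
      | last => exact absurd hij (by simp)
      | cast i => simpa using h.1 (Fin.succ_le_succ_iff.2 (by simpa using hij))
  · intro i j
    induction j using Fin.lastCases with
    | last =>
      induction i using Fin.lastCases with
      | last => simp; positivity
      | cast i => simp; linarith [h.2 i.succ 0]
    | cast j =>
      induction i using Fin.lastCases with
      | last => simpa using h.1 (Fin.zero_le _)
      | cast i => simpa using h.2 _ _
  · rw [circleTuple_castSucc, circleTuple_succ]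
    simp [exp_arg_add_two_pi, -Complex.ofReal_add, -Complex.ofReal_mul]
  · rw [Fin.sum_univ_castSucc, Fin.sum_univ_succ]
    simp; ring

theorem exists_window_down {n : ℕ} {θ : Fin (n + 1) → ℝ} (h : IsArgWindow θ) :
    ∃ θ' : Fin (n + 1) → ℝ, IsArgWindow θ' ∧ circleTuple θ' = circleTuple θ ∧
      ∑ i, θ' i = ∑ i, θ i - 2 * Real.pi := by
  have hpi := Real.pi_pos
  have hexp := exp_arg_add_two_pi (θ (Fin.last n) - 2 * Real.pi)
  rw [sub_add_cancel] at hexp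
  refine ⟨Fin.cons (θ (Fin.last n) - 2 * Real.pi) (fun i => θ i.castSucc), ⟨?_, ?_⟩, ?_, ?_⟩
  · intro i j hij
    induction j using Fin.cases with
    | zero =>
      induction i using Fin.cases with
      | zero => simp
      | succ i => exact absurd hij (by simp)
    | succ j =>
      induction i using Fin.cases with
      | zero => simp; linarith [h.2 (Fin.last n) j.castSucc]
      | succ i => simpa using h.1 (by simpa using hij)
  · intro i j
    induction j using Fin.cases with
    | zero =>
      induction i using Fin.cases with
      | zero => simp; positivity
      | succ i => simpa using h.1 (Fin.le_last _)
    | succ j =>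
      induction i using Fin.cases with
      | zero => simp; linarith [h.2 (Fin.last n) j.castSucc]
      | succ i => simpa using h.2 _ _
  · rw [circleTuple_castSucc θ, circleTuple_succ]
    simp [hexp, -Complex.ofReal_sub, -Complex.ofReal_mul]
  · rw [Fin.sum_univ_castSucc θ, Fin.sum_univ_succ]
    simp; ring

theorem exists_perm_of_map_eq {N : ℕ} {f g : Fin N → ℂ}
    (h : Finset.univ.val.map f = Finset.univ.val.map g) :
    ∃ σ : Equiv.Perm (Fin N), ∀ i, f i = g (σ i) := by
  classical
  have hc : ∀ (f : Fin N → ℂ) (c : ℂ),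
      Fintype.card {a // f a = c} = (Finset.univ.val.map f).count c := fun f c => by
    rw [Multiset.count_map, Fintype.card_subtype]
    simp only [eq_comm (a := c)]
    rfl
  have e : ∀ c, {a // f a = c} ≃ {b // g b = c} := fun c =>
    Fintype.equivOfCardEq (by rw [hc, hc, h])
  exact ⟨Equiv.ofFiberEquiv e, fun i => (Equiv.ofFiberEquiv_map e i).symm⟩

theorem circleTuple_perm {N : ℕ} (θ : Fin N → ℝ) (σ : Equiv.Perm (Fin N)) :
    circleTuple (fun i => θ (σ i)) = circleTuple θ := by
  unfold circleTuple
  rw [Fin.univ_val_map, Fin.univ_val_map, Multiset.coe_eq_coe]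
  exact σ.ofFn_comp_perm fun i => Complex.exp (Complex.I * (θ i : ℂ))

/-- A nonempty tuple of points of the circle has a window of arguments with any given admissible
sum. -/
theorem exists_window {N : ℕ} (hN : 0 < N) (θ₀ : Fin N → ℝ) (m : ℤ) :
    ∃ θ : Fin N → ℝ, IsArgWindow θ ∧ circleTuple θ = circleTuple θ₀ ∧
      ∑ i, θ i = ∑ i, θ₀ i + 2 * Real.pi * m := by
  obtain ⟨n, rfl⟩ : ∃ n, N = n + 1 := ⟨N - 1, by omega⟩
  have hpi := Real.two_pi_pos
  set θ₁ : Fin (n + 1) → ℝ := fun i => toIcoMod hpi 0 (θ₀ i) with hθ₁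
  have h1 : ∀ i, θ₁ i = θ₀ i - 2 * Real.pi * (toIcoDiv hpi 0 (θ₀ i)) := fun i => by
    simp only [hθ₁, toIcoMod, zsmul_eq_mul]; ring
  have hc1 : circleTuple θ₁ = circleTuple θ₀ := by
    unfold circleTuple
    congr 1; funext i
    rw [h1, Complex.exp_eq_exp_iff_exists_int]
    exact ⟨-toIcoDiv hpi 0 (θ₀ i), by push_cast; ring⟩
  set σ := Tuple.sort θ₁ with hσ
  have hw : IsArgWindow (fun i => θ₁ (σ i)) := by
    refine ⟨Tuple.monotone_sort θ₁, fun i j => ?_⟩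
    have h2 := toIcoMod_mem_Ico hpi 0 (θ₀ (σ i))
    have h3 := toIcoMod_mem_Ico hpi 0 (θ₀ (σ j))
    have h4 := h2.2
    have h5 := h3.1
    simp only [hθ₁]
    linarith
  have key : ∀ k : ℤ, ∃ θ : Fin (n + 1) → ℝ, IsArgWindow θ ∧ circleTuple θ = circleTuple θ₀ ∧
      ∑ i, θ i = ∑ i, θ₁ i + 2 * Real.pi * k := by
    intro k
    induction k using Int.induction_on with
    | zero => exact ⟨_, hw, by rw [circleTuple_perm, hc1], by rw [Equiv.sum_comp σ θ₁]; simp⟩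
    | succ k ih =>
      obtain ⟨θ, a, b, c⟩ := ih
      obtain ⟨θ', a', b', c'⟩ := exists_window_up a
      exact ⟨θ', a', b'.trans b, by rw [c', c]; push_cast; ring⟩
    | pred k ih =>
      obtain ⟨θ, a, b, c⟩ := ih
      obtain ⟨θ', a', b', c'⟩ := exists_window_down a
      exact ⟨θ', a', b'.trans b, by rw [c', c]; push_cast; ring⟩
  obtain ⟨θ, a, b, c⟩ := key (m + ∑ i, toIcoDiv hpi 0 (θ₀ i))
  refine ⟨θ, a, b, ?_⟩
  rw [c]
  simp only [h1, Finset.sum_sub_distrib, ← Finset.mul_sum]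
  push_cast; ring

theorem circleTuple_eq_iff {N : ℕ} {θ θ' : Fin N → ℝ} (h : circleTuple θ = circleTuple θ') :
    ∃ (σ : Equiv.Perm (Fin N)) (m : Fin N → ℤ), ∀ i, θ i = θ' (σ i) + 2 * Real.pi * m i := by
  obtain ⟨σ, hσ⟩ := exists_perm_of_map_eq h
  have : ∀ i, ∃ m : ℤ, θ i = θ' (σ i) + 2 * Real.pi * m := fun i => by
    have h1 := hσ i
    obtain ⟨m, hm⟩ := Complex.exp_eq_exp_iff_exists_int.1 h1
    refine ⟨m, ?_⟩
    have h2 : (θ i : ℂ) = θ' (σ i) + m * (2 * Real.pi) := by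
      apply mul_left_cancel₀ Complex.I_ne_zero
      rw [hm]; ring
    have h3 : θ i = θ' (σ i) + m * (2 * Real.pi) := by exact_mod_cast h2
    linarith
  choose m hm using this
  exact ⟨σ, m, hm⟩

/-- The number of arguments up to `t`, counted over all periods, locates the arguments. -/
theorem window_le_iff {N : ℕ} {θ : Fin N → ℝ} (h : IsArgWindow θ) (j : Fin N) (t : ℝ) :
    θ j ≤ t ↔ (j : ℤ) + 1 - N ≤ ∑ i, ⌊(t - θ i) / (2 * Real.pi)⌋ := by
  have hpi := Real.two_pi_pos
  have hcard1 : ∑ i : Fin N, (if i ≤ j then (0 : ℤ) else -1) = (j : ℤ) + 1 - N := by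
    have e : ∀ i : Fin N, (if i ≤ j then (0 : ℤ) else -1) = (if i ≤ j then 1 else 0) - 1 := by
      intro i; split_ifs <;> simp
    simp only [e, Finset.sum_sub_distrib, Finset.sum_boole]
    have : (Finset.univ.filter fun i : Fin N => i ≤ j) = Finset.Iic j := by ext; simp
    rw [this, Fin.card_Iic]
    simp
  have hcard2 : ∑ i : Fin N, (if i < j then (0 : ℤ) else -1) = (j : ℤ) - N := by
    have e : ∀ i : Fin N, (if i < j then (0 : ℤ) else -1) = (if i < j then 1 else 0) - 1 := by
      intro i; split_ifs <;> simp
    simp only [e, Finset.sum_sub_distrib, Finset.sum_boole]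
    have : (Finset.univ.filter fun i : Fin N => i < j) = Finset.Iio j := by ext; simp
    rw [this, Fin.card_Iio]
    simp
  constructor
  · intro hj
    rw [← hcard1]
    refine Finset.sum_le_sum fun i _ => ?_
    rw [Int.le_floor]
    split_ifs with hi
    · have := h.1 hi
      push_cast
      exact div_nonneg (by linarith) hpi.le
    · rw [le_div_iff₀ hpi]
      have := h.2 i j
      push_cast
      linarith
  · intro hF
    by_contra hj
    rw [not_le] at hj
    have : ∑ i, ⌊(t - θ i) / (2 * Real.pi)⌋ ≤ (j : ℤ) - N := by
      rw [← hcard2]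
      refine Finset.sum_le_sum fun i _ => ?_
      rw [← Int.lt_add_one_iff, Int.floor_lt]
      split_ifs with hi
      · rw [div_lt_iff₀ hpi]
        have := h.2 j i
        push_cast
        linarith
      · rw [div_lt_iff₀ hpi]
        have := h.1 (not_lt.1 hi)
        push_cast
        linarith
    omega

/-- A window of arguments is determined by the points on the circle and by the sum. -/
theorem window_unique {N : ℕ} {θ θ' : Fin N → ℝ} (h : IsArgWindow θ) (h' : IsArgWindow θ')
    (hc : circleTuple θ = circleTuple θ') (hs : ∑ i, θ i = ∑ i, θ' i) : θ = θ' := by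
  have hpi := Real.two_pi_pos
  obtain ⟨σ, m, hm⟩ := circleTuple_eq_iff hc
  have hm0 : ∑ i, m i = 0 := by
    have h1 : ∑ i, θ i = ∑ i, θ' i + 2 * Real.pi * ((∑ i, m i : ℤ) : ℝ) := by
      simp only [hm, Finset.sum_add_distrib, ← Finset.mul_sum]
      rw [Equiv.sum_comp σ θ']; push_cast; ring
    have h2 : 2 * Real.pi * ((∑ i, m i : ℤ) : ℝ) = 0 := by linarith
    have := (mul_eq_zero.1 h2).resolve_left hpi.ne'
    exact_mod_cast this
  have hF : ∀ t, ∑ i, ⌊(t - θ i) / (2 * Real.pi)⌋ = ∑ i, ⌊(t - θ' i) / (2 * Real.pi)⌋ := by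
    intro t
    have h1 : ∀ i, ⌊(t - θ i) / (2 * Real.pi)⌋ = ⌊(t - θ' (σ i)) / (2 * Real.pi)⌋ - m i := by
      intro i
      rw [← Int.floor_sub_intCast, hm]
      congr 1
      field_simp
      ring
    simp only [h1, Finset.sum_sub_distrib, hm0, sub_zero]
    exact Equiv.sum_comp σ fun i => ⌊(t - θ' i) / (2 * Real.pi)⌋
  funext j
  refine le_antisymm ?_ ?_
  · rw [window_le_iff h, hF, ← window_le_iff h']
  · rw [window_le_iff h', ← hF, ← window_le_iff h]

/-- `θ` and `ρ` are arguments and moduli of the eigenvalues of `T`. -/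
def IsPolarSpectrum {N : ℕ} (T : Matrix (Fin N) (Fin N) ℂ) (θ ρ : Fin N → ℝ) : Prop :=
  (∀ i, 0 ≤ ρ i) ∧ ∀ c : ℂ, (c • (1 : Matrix (Fin N) (Fin N) ℂ) - T).det
    = ∏ i, (c - ρ i * Complex.exp (Complex.I * (θ i : ℂ)))

theorem IsPolarSpectrum.roots {N : ℕ} {T : Matrix (Fin N) (Fin N) ℂ} {θ ρ : Fin N → ℝ}
    (h : IsPolarSpectrum T θ ρ) : T.charpoly.roots
      = Finset.univ.val.map fun i => (ρ i : ℂ) * Complex.exp (Complex.I * (θ i : ℂ)) := by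
  have hcp : T.charpoly = ((Finset.univ.val.map fun i =>
      (ρ i : ℂ) * Complex.exp (Complex.I * (θ i : ℂ))).map
        fun a => Polynomial.X - Polynomial.C a).prod := by
    refine Polynomial.funext fun c => ?_
    rw [Matrix.eval_charpoly, Matrix.scalar_apply, ← Matrix.smul_one_eq_diagonal, h.2,
      Polynomial.eval_multiset_prod, Multiset.map_map, Multiset.map_map, Finset.prod]
    congr 1
    exact Multiset.map_congr rfl fun i _ => by simp
  rw [hcp, Polynomial.roots_multiset_prod_X_sub_C]

theorem IsPolarSpectrum.eigenPhases {N : ℕ} {T : Matrix (Fin N) (Fin N) ℂ} {θ ρ : Fin N → ℝ}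
    (h : IsPolarSpectrum T θ ρ) (hT : T.det ≠ 0) : eigenPhases T = circleTuple θ := by
  rw [BulkEdge.eigenPhases, h.roots, Multiset.map_map, circleTuple]
  refine Multiset.map_congr rfl fun i _ => ?_
  have hρ : ρ i ≠ 0 := fun h0 => hT (by
    have := h.2 0
    rw [zero_smul, zero_sub, Matrix.det_neg, Finset.prod_eq_zero (Finset.mem_univ i)
      (by simp [h0])] at this
    simpa using this)
  have hpos : 0 < ρ i := lt_of_le_of_ne (h.1 i) hρ.symm
  change phase _ = _
  rw [phase_mul, phase_ofReal_pos hpos, one_mul,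
    phase_of_norm_one (Complex.norm_exp_I_mul_ofReal _)]

theorem exists_polarSpectrum {N : ℕ} (T : Matrix (Fin N) (Fin N) ℂ) :
    ∃ θ ρ, IsPolarSpectrum T θ ρ := by
  have hcard : T.charpoly.roots.card = N := by
    have := IsAlgClosed.card_roots_eq_natDegree (p := T.charpoly)
    rw [this, Matrix.charpoly_natDegree_eq_dim, Fintype.card_fin]
  obtain ⟨l, hl⟩ := Quot.exists_rep T.charpoly.roots
  have hl' : (l : Multiset ℂ) = T.charpoly.roots := hl
  have hlen : l.length = N := by rw [← hcard, ← hl']; rfl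
  subst hlen
  refine ⟨fun i => (l.get i).arg, fun i => ‖l.get i‖, fun i => norm_nonneg _, fun c => ?_⟩
  have hp := (IsAlgClosed.splits T.charpoly).eq_prod_roots
  rw [Matrix.charpoly_monic, Polynomial.C_1, one_mul] at hp
  have h2 := congrArg (Polynomial.eval c) hp
  rw [Matrix.eval_charpoly, Matrix.scalar_apply, ← Matrix.smul_one_eq_diagonal, ← hl',
    Polynomial.eval_multiset_prod] at h2
  rw [h2, Multiset.map_map, Multiset.map_coe, Multiset.prod_coe]
  rw [← List.prod_ofFn]
  congr 1
  apply List.ext_get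
  · simp
  · intro n h1 h2
    simp only [List.get_eq_getElem, List.getElem_map, List.getElem_ofFn, Function.comp]
    rw [mul_comm Complex.I, Complex.norm_mul_exp_arg_mul_I]
    simp

theorem IsPolarSpectrum.le {N : ℕ} {T : Matrix (Fin N) (Fin N) ℂ} {θ ρ : Fin N → ℝ}
    (h : IsPolarSpectrum T θ ρ) (i : Fin N) : ρ i ≤ ∑ i, ∑ j, ‖T i j‖ := by
  set a : ℂ := (ρ i : ℂ) * Complex.exp (Complex.I * (θ i : ℂ)) with ha
  have hna : ‖a‖ = ρ i := by
    rw [ha, norm_mul, Complex.norm_exp_I_mul_ofReal, mul_one, Complex.norm_real, Real.norm_eq_abs,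
      abs_of_nonneg (h.1 i)]
  have hdet : (a • (1 : Matrix (Fin N) (Fin N) ℂ) - T).det = 0 := by
    rw [h.2]
    exact Finset.prod_eq_zero (Finset.mem_univ i) (by rw [← ha, sub_self])
  obtain ⟨v, hv0, hv⟩ := Matrix.exists_mulVec_eq_zero_iff.2 hdet
  have : Nonempty (Fin N) := ⟨i⟩
  obtain ⟨k, -, hk⟩ := Finset.exists_max_image Finset.univ (fun j => ‖v j‖) Finset.univ_nonempty
  have hvk : 0 < ‖v k‖ := by
    rw [norm_pos_iff]
    intro h0
    apply hv0
    funext j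
    have := hk j (Finset.mem_univ j)
    rw [h0, norm_zero] at this
    simpa using this
  have h1 : a * v k = ∑ j, T k j * v j := by
    have := congrFun hv k
    rw [Matrix.sub_mulVec, Matrix.smul_mulVec, Matrix.one_mulVec] at this
    simp only [Pi.sub_apply, Pi.smul_apply, smul_eq_mul, Pi.zero_apply] at this
    rw [sub_eq_zero] at this
    rw [this]; rfl
  have h2 : ρ i * ‖v k‖ ≤ (∑ j, ‖T k j‖) * ‖v k‖ := by
    rw [← hna, ← norm_mul, h1, Finset.sum_mul]
    refine (norm_sum_le _ _).trans (Finset.sum_le_sum fun j _ => ?_)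
    rw [norm_mul]
    exact mul_le_mul_of_nonneg_left (hk j (Finset.mem_univ j)) (norm_nonneg _)
  refine (le_of_mul_le_mul_right h2 hvk).trans ?_
  exact Finset.single_le_sum (f := fun i => ∑ j, ‖T i j‖)
    (fun i _ => Finset.sum_nonneg fun j _ => norm_nonneg _) (Finset.mem_univ k)

/-- The eigenvalue phases of a continuous path of invertible matrices have continuous arguments: the
arguments in the window whose sum follows a continuous argument of the determinant are unique, and
hence continuous by compactness. -/
theorem exists_continuous_args {N : ℕ} {a b : ℝ} (hab : a ≤ b)
    {T : ℝ → Matrix (Fin N) (Fin N) ℂ} (hT : ContinuousOn T (Set.Icc a b))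
    (hT0 : ∀ x ∈ Set.Icc a b, (T x).det ≠ 0) :
    ∃ θ : ℝ → Fin N → ℝ, ContinuousOn θ (Set.Icc a b) ∧
      ∀ x ∈ Set.Icc a b, circleTuple (θ x) = eigenPhases (T x) := by
  rcases Nat.eq_zero_or_pos N with rfl | hN
  · refine ⟨fun _ _ => 0, continuousOn_const, fun x hx => ?_⟩
    obtain ⟨θ, ρ, h⟩ := exists_polarSpectrum (T x)
    rw [h.eigenPhases (hT0 x hx)]
    congr 1
    exact Subsingleton.elim _ _
  obtain ⟨s, hs, hsT⟩ := exists_continuousOn_arg hab (g := fun x => phase (T x).det)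
    (ContinuousOn.phase (Continuous.comp_continuousOn continuous_id.matrix_det hT) hT0)
    (fun x hx => norm_phase (hT0 x hx))
  have hex : ∀ x, ∃ θ ρ : Fin N → ℝ, x ∈ Set.Icc a b →
      IsArgWindow θ ∧ IsPolarSpectrum (T x) θ ρ ∧ ∑ i, θ i = s x := by
    intro x
    by_cases hx : x ∈ Set.Icc a b
    swap
    · exact ⟨0, 0, fun h => absurd h hx⟩
    obtain ⟨θ₀, ρ₀, h₀⟩ := exists_polarSpectrum (T x)
    have h1 := h₀.eigenPhases (hT0 x hx)
    have h2 : Complex.exp (Complex.I * (s x : ℂ))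
        = Complex.exp (Complex.I * ((∑ i, θ₀ i : ℝ) : ℂ)) := by
      rw [hsT x hx, ← eigenPhases_prod, h1, circleTuple_prod]
    obtain ⟨m, hm⟩ := Complex.exp_eq_exp_iff_exists_int.1 h2
    have h3 : s x = ∑ i, θ₀ i + 2 * Real.pi * m := by
      have : ((s x : ℝ) : ℂ) = ((∑ i, θ₀ i : ℝ) : ℂ) + 2 * Real.pi * m := by
        apply mul_left_cancel₀ Complex.I_ne_zero
        rw [hm]; ring
      exact_mod_cast this
    obtain ⟨θ, hw, hc, hsum⟩ := exists_window hN θ₀ m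
    obtain ⟨σ, k, hk⟩ := circleTuple_eq_iff hc
    refine ⟨θ, fun i => ρ₀ (σ i), fun _ => ⟨hw, ⟨fun i => h₀.1 _, fun c => ?_⟩, ?_⟩⟩
    · rw [h₀.2 c, ← Equiv.prod_comp σ]
      refine Finset.prod_congr rfl fun i _ => ?_
      congr 2
      rw [hk i, Complex.exp_eq_exp_iff_exists_int]
      exact ⟨-k i, by push_cast; ring⟩
    · rw [hsum, h3]
  choose θ ρ hθ using hex
  refine ⟨θ, ?_, fun x hx => ((hθ x hx).2.1.eigenPhases (hT0 x hx)).symm⟩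
  -- the arguments and the moduli stay in a compact set
  obtain ⟨Bs, hBs⟩ :=
    isCompact_Icc.exists_bound_of_continuousOn (hs.continuousOn (s := Set.Icc a b))
  have hcsum : ContinuousOn (fun x => ∑ i, ∑ j, ‖T x i j‖) (Set.Icc a b) :=
    continuousOn_finsetSum _ fun i _ => continuousOn_finsetSum _ fun j _ =>
      ((continuous_id.matrix_elem i j).comp_continuousOn hT).norm
  obtain ⟨Bρ, hBρ⟩ := isCompact_Icc.exists_bound_of_continuousOn hcsum
  have hpi := Real.pi_pos
  have hbθ : ∀ x ∈ Set.Icc a b, ∀ i, |θ x i| ≤ Bs + 2 * Real.pi * N := by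
    intro x hx i
    have h1 : (N : ℝ) * θ x i = s x + ∑ j, (θ x i - θ x j) := by
      rw [Finset.sum_sub_distrib, (hθ x hx).2.2]; simp
    have h2 : |∑ j, (θ x i - θ x j)| ≤ 2 * Real.pi * N := by
      refine (Finset.abs_sum_le_sum_abs _ _).trans ?_
      refine (Finset.sum_le_sum fun j _ => (?_ : |θ x i - θ x j| ≤ 2 * Real.pi)).trans (by
        simp; linarith)
      rw [abs_le]
      constructor <;> linarith [(hθ x hx).1.2 i j, (hθ x hx).1.2 j i]
    have h3 : |(N : ℝ) * θ x i| ≤ Bs + 2 * Real.pi * N := by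
      rw [h1]
      exact (abs_add_le _ _).trans (add_le_add (hBs x hx) h2)
    rw [abs_mul, Nat.abs_cast] at h3
    have h4 : (1 : ℝ) ≤ N := by exact_mod_cast hN
    nlinarith [abs_nonneg (θ x i)]
  intro x hx
  rw [ContinuousWithinAt]
  refine Filter.tendsto_of_seq_tendsto fun u hu => ?_
  have hu1 : Filter.Tendsto u Filter.atTop (nhds x) :=
    hu.mono_right nhdsWithin_le_nhds
  have hu2 : ∀ᶠ n in Filter.atTop, u n ∈ Set.Icc a b := hu self_mem_nhdsWithin
  refine Filter.tendsto_of_subseq_tendsto fun ns hns => ?_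
  have hK : IsCompact (Set.Icc (fun _ : Fin N => -(Bs + 2 * Real.pi * N))
      (fun _ => Bs + 2 * Real.pi * N) ×ˢ Set.Icc (fun _ : Fin N => (0 : ℝ)) (fun _ => Bρ)) :=
    isCompact_Icc.prod isCompact_Icc
  have hev : ∀ᶠ n in Filter.atTop, ((θ (u (ns n)), ρ (u (ns n))) :
      (Fin N → ℝ) × (Fin N → ℝ)) ∈ (Set.Icc (fun _ : Fin N => -(Bs + 2 * Real.pi * N))
      (fun _ => Bs + 2 * Real.pi * N) ×ˢ Set.Icc (fun _ : Fin N => (0 : ℝ)) (fun _ => Bρ)) := by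
    filter_upwards [hns.eventually hu2] with n hn
    refine ⟨⟨fun i => (abs_le.1 (hbθ _ hn i)).1, fun i => (abs_le.1 (hbθ _ hn i)).2⟩,
      ⟨fun i => (hθ _ hn).2.1.1 i, fun i => ?_⟩⟩
    exact ((hθ _ hn).2.1.le i).trans ((le_abs_self _).trans (hBρ _ hn))
  obtain ⟨⟨θ', ρ'⟩, hmem, φ, hφ, hlim⟩ := hK.tendsto_subseq' hev.frequently
  refine ⟨φ, ?_⟩
  have hsub : Filter.Tendsto (fun n => u (ns (φ n))) Filter.atTop (nhdsWithin x (Set.Icc a b)) :=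
    hu.comp (hns.comp hφ.tendsto_atTop)
  have hsub2 : ∀ᶠ n in Filter.atTop, u (ns (φ n)) ∈ Set.Icc a b := hsub self_mem_nhdsWithin
  have hlimθ : Filter.Tendsto (fun n => θ (u (ns (φ n)))) Filter.atTop (nhds θ') :=
    (continuous_fst.tendsto _).comp hlim
  have hlimρ : Filter.Tendsto (fun n => ρ (u (ns (φ n)))) Filter.atTop (nhds ρ') :=
    (continuous_snd.tendsto _).comp hlim
  have hθi : ∀ i, Filter.Tendsto (fun n => θ (u (ns (φ n))) i) Filter.atTop (nhds (θ' i)) :=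
    fun i => ((continuous_apply i).tendsto _).comp hlimθ
  have hρi : ∀ i, Filter.Tendsto (fun n => ρ (u (ns (φ n))) i) Filter.atTop (nhds (ρ' i)) :=
    fun i => ((continuous_apply i).tendsto _).comp hlimρ
  -- every limit point is a window of arguments for `T x` with sum `s x`, and hence equals `θ x`
  have hpolar : IsPolarSpectrum (T x) θ' ρ' := by
    refine ⟨fun i => hmem.2.1 i, fun c => ?_⟩
    have hl1 : Filter.Tendsto (fun n => (c • (1 : Matrix (Fin N) (Fin N) ℂ)
        - T (u (ns (φ n)))).det) Filter.atTop (nhds (c • 1 - T x).det) := by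
      have hc : Continuous fun M : Matrix (Fin N) (Fin N) ℂ => (c • 1 - M).det :=
        (continuous_const.sub continuous_id).matrix_det
      exact (hc.tendsto _).comp ((hT x hx).tendsto.comp hsub)
    have hl2 : Filter.Tendsto (fun n => ∏ i, (c - ρ (u (ns (φ n))) i
        * Complex.exp (Complex.I * (θ (u (ns (φ n))) i : ℂ)))) Filter.atTop
        (nhds (∏ i, (c - ρ' i * Complex.exp (Complex.I * (θ' i : ℂ))))) := by
      refine tendsto_finsetProd _ fun i _ => ?_
      refine Filter.Tendsto.const_sub c (Filter.Tendsto.mul ?_ (Filter.Tendsto.cexp ?_))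
      · exact (Complex.continuous_ofReal.tendsto _).comp (hρi i)
      · exact ((Complex.continuous_ofReal.tendsto _).comp (hθi i)).const_mul _
    refine tendsto_nhds_unique (hl1.congr' ?_) hl2
    filter_upwards [hsub2] with n hn
    exact (hθ _ hn).2.1.2 c
  have hwin : IsArgWindow θ' := by
    constructor
    · intro i j hij
      refine le_of_tendsto_of_tendsto (hθi i) (hθi j) ?_
      filter_upwards [hsub2] with n hn using (hθ _ hn).1.1 hij
    · intro i j
      refine le_of_tendsto_of_tendsto (hθi i) ((hθi j).add_const _) ?_
      filter_upwards [hsub2] with n hn using (hθ _ hn).1.2 i j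
  have hsum : ∑ i, θ' i = s x := by
    have h1 : Filter.Tendsto (fun n => ∑ i, θ (u (ns (φ n))) i) Filter.atTop
        (nhds (∑ i, θ' i)) := tendsto_finsetSum _ fun i _ => hθi i
    have h2 : Filter.Tendsto (fun n => s (u (ns (φ n)))) Filter.atTop (nhds (s x)) :=
      (hs.tendsto x).comp (hsub.mono_right nhdsWithin_le_nhds)
    refine tendsto_nhds_unique (h1.congr' ?_) h2
    filter_upwards [hsub2] with n hn using (hθ _ hn).2.2
  have heq : θ' = θ x := window_unique hwin (hθ x hx).1
    (by rw [← hpolar.eigenPhases (hT0 x hx), ← (hθ x hx).2.1.eigenPhases (hT0 x hx)])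
    (by rw [hsum, (hθ x hx).2.2])
  rw [heq] at hlimθ
  exact hlimθ

theorem exists_evenDegenerate_args {Z : Multiset ℂ} (h1 : ∀ a ∈ Z, ‖a‖ = 1) {n : ℕ}
    (hn : Z.card = n) : ∃ α : Fin n → ℝ, circleTuple α = Z := by
  obtain ⟨l, rfl⟩ := Quot.exists_rep Z
  have hlen : l.length = n := hn
  subst hlen
  refine ⟨fun i => (l.get i).arg, ?_⟩
  have h2 : ∀ i : Fin l.length, Complex.exp (Complex.I * ((l.get i).arg : ℂ)) = l.get i := by
    intro i
    have h3 := Complex.norm_mul_exp_arg_mul_I (l.get i)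
    rw [h1 _ (Multiset.mem_coe.2 (l.get_mem i))] at h3
    rw [mul_comm]; simpa using h3
  unfold circleTuple
  simp only [h2]
  rw [Fin.univ_val_map]
  simp

/-- Every continuous family that is Kramers at the endpoints has an index. -/
theorem exists_isKramersIndex {N : ℕ} (hN : Even N) {T : ℝ → Matrix (Fin N) (Fin N) ℂ}
    (hT : ContinuousOn T (Set.Icc 0 Real.pi)) (hT0 : ∀ φ ∈ Set.Icc 0 Real.pi, (T φ).det ≠ 0)
    (h0 : T 0 * tau (T 0) = 1) (hpi : T Real.pi * tau (T Real.pi) = 1) :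
    ∃ s, IsKramersIndex T s := by
  obtain ⟨θ, hθ, hθT⟩ := exists_continuous_args Real.pi_pos.le hT hT0
  obtain ⟨Y0, hn0, hY0, -⟩ := kramersRoot_spec hN h0
  obtain ⟨Y1, hn1, hY1, -⟩ := kramersRoot_spec hN hpi
  have hm0 : (0 : ℝ) ∈ Set.Icc 0 Real.pi := ⟨le_rfl, Real.pi_pos.le⟩
  have hm1 : Real.pi ∈ Set.Icc 0 Real.pi := ⟨Real.pi_pos.le, le_rfl⟩
  obtain ⟨n, rfl⟩ := hN
  have hcard : ∀ α : Fin (n + n) → ℝ, (circleTuple α).card = n + n := fun α => by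
    simp [circleTuple]
  have hc0 : Y0.card = n := by
    have := hcard (θ 0)
    rw [hθT 0 hm0, hY0, Multiset.card_add] at this
    omega
  have hc1 : Y1.card = n := by
    have := hcard (θ Real.pi)
    rw [hθT Real.pi hm1, hY1, Multiset.card_add] at this
    omega
  obtain ⟨α0, hα0⟩ := exists_evenDegenerate_args hn0 hc0
  obtain ⟨α1, hα1⟩ := exists_evenDegenerate_args hn1 hc1
  have happ : ∀ α : Fin n → ℝ, circleTuple (Fin.append α α) = circleTuple α + circleTuple α := by
    intro α
    unfold circleTuple
    rw [Fin.univ_val_map, Fin.univ_val_map, Multiset.coe_add, List.ofFn_add]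
    congr 2
    · congr 1; funext i
      exact congrArg (fun t : ℝ => Complex.exp (Complex.I * (t : ℂ))) (Fin.append_left α α i)
    · congr 1; funext i
      rw [Fin.append_right]
  -- the even degenerate continuation moves both members of a pair along the same straight path
  set θ' : ℝ → Fin (n + n) → ℝ := fun x => Fin.append
    (fun i => α1 i + (x - Real.pi) * (α0 i - α1 i))
    (fun i => α1 i + (x - Real.pi) * (α0 i - α1 i)) with hθ'
  have hb : circleTuple (θ' Real.pi) = eigenPhases (T Real.pi) := by
    rw [hθ', happ, hY1, ← hα1]; simp
  have hc : circleTuple (θ' (Real.pi + 1)) = eigenPhases (T 0) := by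
    rw [hθ', happ, hY0, ← hα0]; simp
  have hint : Complex.exp (Complex.I * ((∑ i, (θ Real.pi i - θ 0 i)
      + ∑ i, (θ' (Real.pi + 1) i - θ' Real.pi i) : ℝ) : ℂ)) = 1 := by
    have e1 := circleTuple_prod (θ Real.pi)
    have e2 := circleTuple_prod (θ 0)
    have e3 := circleTuple_prod (θ' (Real.pi + 1))
    have e4 := circleTuple_prod (θ' Real.pi)
    rw [hθT _ hm1] at e1
    rw [hθT _ hm0] at e2
    rw [hc] at e3
    rw [hb] at e4
    rw [Finset.sum_sub_distrib, Finset.sum_sub_distrib]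
    rw [show Complex.I * ((∑ i, θ Real.pi i - ∑ i, θ 0 i
      + (∑ i, θ' (Real.pi + 1) i - ∑ i, θ' Real.pi i) : ℝ) : ℂ)
      = (Complex.I * ((∑ i, θ Real.pi i : ℝ) : ℂ) - Complex.I * ((∑ i, θ 0 i : ℝ) : ℂ))
      + (Complex.I * ((∑ i, θ' (Real.pi + 1) i : ℝ) : ℂ)
        - Complex.I * ((∑ i, θ' Real.pi i : ℝ) : ℂ)) by push_cast; ring]
    rw [Complex.exp_add, Complex.exp_sub, Complex.exp_sub, ← e1, ← e2, ← e3, ← e4]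
    have g1 : (eigenPhases (T 0)).prod ≠ 0 := by rw [e2]; exact Complex.exp_ne_zero _
    have g2 : (eigenPhases (T Real.pi)).prod ≠ 0 := by rw [e1]; exact Complex.exp_ne_zero _
    field_simp
  obtain ⟨w, hw⟩ := Complex.exp_eq_one_iff.1 hint
  have hw' : ∑ i, (θ Real.pi i - θ 0 i) + ∑ i, (θ' (Real.pi + 1) i - θ' Real.pi i)
      = 2 * Real.pi * w := by
    have : ((∑ i, (θ Real.pi i - θ 0 i)
      + ∑ i, (θ' (Real.pi + 1) i - θ' Real.pi i) : ℝ) : ℂ) = ((2 * Real.pi * w : ℝ) : ℂ) := by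
      apply mul_left_cancel₀ Complex.I_ne_zero
      rw [hw]; push_cast; ring
    exact_mod_cast this
  have hK : ∀ {M : Matrix (Fin (n + n)) (Fin (n + n)) ℂ}, M.det ≠ 0 → IsUnit M := fun h =>
    (Matrix.isUnit_iff_isUnit_det _).2 (isUnit_iff_ne_zero.2 h)
  refine ⟨(-1) ^ w, hT, fun φ hφ => hK (hT0 φ hφ), (isKramers_iff ⟨n, rfl⟩ _).2 h0,
    (isKramers_iff ⟨n, rfl⟩ _).2 hpi, ?_, ?_, Real.pi + 1, θ, θ', w, by linarith, hθ, hθT,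
    ?_, ?_, hb, hc, hw', rfl⟩
  · change EvenDegenerate (eigenPhases (T 0))
    rw [hY0]; exact half_evenDegenerate
  · change EvenDegenerate (eigenPhases (T Real.pi))
    rw [hY1]; exact half_evenDegenerate
  · refine continuousOn_pi.2 fun i => ?_
    refine Fin.addCases (fun i => ?_) (fun i => ?_) i
    · simp only [hθ', Fin.append_left]; fun_prop
    · simp only [hθ', Fin.append_right]; fun_prop
  · intro x _
    rw [hθ', happ]; exact half_evenDegenerate

/-! ### Winding numbers and the sign of a transition family -/

theorem IsKramersSign.unique {N : ℕ} {T : ℝ → Matrix (Fin N) (Fin N) ℂ} {s s' : ℂ}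
    (hT : ∀ k ∈ Set.Icc 0 Real.pi, (T k).det ≠ 0) (h : IsKramersSign T s)
    (h' : IsKramersSign T s') : s = s' := by
  obtain ⟨r, hr, hr2, hs⟩ := h
  obtain ⟨r', hr', hr2', hs'⟩ := h'
  have hm0 : (0 : ℝ) ∈ Set.Icc 0 Real.pi := ⟨le_rfl, Real.pi_pos.le⟩
  have hm1 : Real.pi ∈ Set.Icc 0 Real.pi := ⟨Real.pi_pos.le, le_rfl⟩
  have hr0 : ∀ k ∈ Set.Icc 0 Real.pi, r k ≠ 0 := fun k hk h0 =>
    phase_ne_zero (hT k hk) (by rw [← hr2 k hk, h0]; simp)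
  have hr0' : ∀ k ∈ Set.Icc 0 Real.pi, r' k ≠ 0 := fun k hk h0 =>
    phase_ne_zero (hT k hk) (by rw [← hr2' k hk, h0]; simp)
  have key := eq_of_sq_eq_one (f := fun k => r k * (r' k)⁻¹) isPreconnected_Icc
    (hr.mul (hr'.inv₀ hr0')) (fun k hk => by
      have h0 := hr0' k hk
      have := phase_ne_zero (hT k hk)
      rw [mul_pow, inv_pow, hr2 k hk, hr2' k hk, mul_inv_cancel₀ this]) hm1 hm0
  have a0 := hr0 0 hm0
  have b0 := hr0' 0 hm0
  have b1 := hr0' _ hm1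
  have c1 := kramersRoot_ne_zero (T Real.pi)
  field_simp at key
  apply mul_right_cancel₀ (mul_ne_zero (mul_ne_zero a0 b0) c1)
  linear_combination (-r' 0) * hs + r 0 * hs' + kramersRoot (T 0) * key

theorem IsKramersSign.inv {N : ℕ} (hN : Even N) {T : ℝ → Matrix (Fin N) (Fin N) ℂ} {s : ℂ}
    (h0 : T 0 * tau (T 0) = 1) (hpi : T Real.pi * tau (T Real.pi) = 1)
    (hT : ∀ k ∈ Set.Icc 0 Real.pi, (T k).det ≠ 0)
    (h : IsKramersSign T s) : IsKramersSign (fun k => (T k)⁻¹) s⁻¹ := by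
  obtain ⟨r, hr, hr2, hs⟩ := h
  have hr0 : ∀ k ∈ Set.Icc 0 Real.pi, r k ≠ 0 := fun k hk h0 =>
    phase_ne_zero (hT k hk) (by rw [← hr2 k hk, h0]; simp)
  refine ⟨fun k => (r k)⁻¹, hr.inv₀ hr0, fun k hk => ?_, ?_⟩
  · rw [Matrix.det_nonsing_inv, Ring.inverse_eq_inv', phase_inv, ← hr2 k hk, inv_pow]
  · simp only
    rw [Matrix.inv_eq_right_inv h0, Matrix.inv_eq_right_inv hpi, kramersRoot_tau hN h0,
      kramersRoot_tau hN hpi, ← mul_inv, ← mul_inv, ← mul_inv, hs]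

/-- Homotopy invariance of the sign of a Kramers family. -/
theorem IsKramersSign.homotopy {N : ℕ} (hN : Even N) {a b : ℝ} (hab : a ≤ b)
    {T : ℝ → ℝ → Matrix (Fin N) (Fin N) ℂ}
    (hT : ContinuousOn (fun p : ℝ × ℝ => T p.1 p.2) (Set.Icc a b ×ˢ Set.Icc 0 Real.pi))
    (hdet : ∀ x ∈ Set.Icc a b, ∀ k ∈ Set.Icc 0 Real.pi, (T x k).det ≠ 0)
    (h0 : ∀ x ∈ Set.Icc a b, T x 0 * tau (T x 0) = 1)
    (hpi : ∀ x ∈ Set.Icc a b, T x Real.pi * tau (T x Real.pi) = 1) :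
    ∃ s : ℂ, ∀ x ∈ Set.Icc a b, IsKramersSign (T x) s := by
  have hm0 : (0 : ℝ) ∈ Set.Icc 0 Real.pi := ⟨le_rfl, Real.pi_pos.le⟩
  have hm1 : Real.pi ∈ Set.Icc 0 Real.pi := ⟨Real.pi_pos.le, le_rfl⟩
  have hpp := Real.pi_pos.le
  set P : ℝ × ℝ → ℝ × ℝ := fun p =>
    ((Set.projIcc a b hab p.1 : ℝ), (Set.projIcc 0 Real.pi hpp p.2 : ℝ)) with hP
  have hPc : Continuous P := by
    exact (continuous_subtype_val.comp (continuous_projIcc.comp continuous_fst)).prodMk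
      (continuous_subtype_val.comp (continuous_projIcc.comp continuous_snd))
  have hPm : ∀ p, P p ∈ Set.Icc a b ×ˢ Set.Icc 0 Real.pi := fun p =>
    ⟨(Set.projIcc a b hab p.1).2, (Set.projIcc 0 Real.pi hpp p.2).2⟩
  have hPe : ∀ x ∈ Set.Icc a b, ∀ k ∈ Set.Icc 0 Real.pi, P (x, k) = (x, k) := fun x hx k hk => by
    simp only [hP, Set.projIcc_of_mem hab hx, Set.projIcc_of_mem hpp hk]
  obtain ⟨u, hu, hue⟩ := exists_continuous_arg
    (g := fun p : ℝ × ℝ => phase (T (P p).1 (P p).2).det)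
    (by
      rw [← continuousOn_univ]
      refine ContinuousOn.phase ?_ (fun p _ => hdet _ (hPm p).1 _ (hPm p).2)
      exact (Continuous.comp_continuousOn continuous_id.matrix_det
        (hT.comp hPc.continuousOn (fun p _ => hPm p))))
    (fun p => norm_phase (hdet _ (hPm p).1 _ (hPm p).2))
  set r : ℝ → ℝ → ℂ := fun x k => Complex.exp (Complex.I * (u (x, k) : ℂ) / 2) with hr
  have hrc : Continuous fun p : ℝ × ℝ => r p.1 p.2 := by
    simp only [hr]; fun_prop
  have hr2 : ∀ x ∈ Set.Icc a b, ∀ k ∈ Set.Icc 0 Real.pi, r x k ^ 2 = phase (T x k).det := by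
    intro x hx k hk
    have h1 := hue (x, k)
    rw [hPe x hx k hk] at h1
    rw [← h1, hr, ← Complex.exp_nat_mul]
    congr 1; push_cast; ring
  have hrne : ∀ x k, r x k ≠ 0 := fun x k => Complex.exp_ne_zero _
  set f : ℝ → ℂ := fun x => r x Real.pi * kramersRoot (T x 0)
    * (r x 0 * kramersRoot (T x Real.pi))⁻¹ with hf
  have hq : ∀ k ∈ Set.Icc 0 Real.pi, (∀ x ∈ Set.Icc a b, T x k * tau (T x k) = 1) →
      ContinuousOn (fun x => kramersRoot (T x k)) (Set.Icc a b) := fun k hk hK =>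
    (continuousOn_kramersRoot hN).comp (hT.comp (f := fun x => (x, k))
      (Continuous.continuousOn (by fun_prop)) (fun x hx => ⟨hx, hk⟩)) hK
  have hfc : ContinuousOn f (Set.Icc a b) := by
    refine ContinuousOn.mul (ContinuousOn.mul ?_ (hq 0 hm0 h0)) (ContinuousOn.inv₀
      (ContinuousOn.mul ?_ (hq _ hm1 hpi)) ?_)
    · exact (hrc.comp (f := fun x => (x, Real.pi)) (by fun_prop)).continuousOn
    · exact (hrc.comp (f := fun x => (x, (0 : ℝ))) (by fun_prop)).continuousOn
    · exact fun x hx => mul_ne_zero (hrne _ _) (kramersRoot_ne_zero _)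
  have hf2 : ∀ x ∈ Set.Icc a b, f x ^ 2 = 1 := fun x hx => by
    have e0 := phase_ne_zero (hdet x hx 0 hm0)
    have e1 := phase_ne_zero (hdet x hx _ hm1)
    simp only [hf]
    rw [mul_pow, mul_pow, inv_pow, mul_pow, hr2 x hx _ hm1, hr2 x hx _ hm0,
      kramersRoot_sq hN (h0 x hx), kramersRoot_sq hN (hpi x hx)]
    field_simp
  have ha : a ∈ Set.Icc a b := ⟨le_rfl, hab⟩
  refine ⟨f a, fun x hx => ⟨r x, ?_, hr2 x hx, ?_⟩⟩
  · exact (hrc.comp (f := fun k => (x, k)) (by fun_prop)).continuousOn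
  · rw [eq_of_sq_eq_one isPreconnected_Icc hfc hf2 ha hx]
    have := mul_ne_zero (hrne x 0) (kramersRoot_ne_zero (T x Real.pi))
    simp only [hf]
    rw [mul_assoc, inv_mul_cancel₀ this, mul_one]

/-- The sign of the transition family of a frame over the cut torus.  `W` and `W'` are two matrices
of the frame in a fixed space, exchanged by time reversal, of which `W` is invertible for
`0 ≤ φ₁ ≤ π`; they are related by `S` and `S₀` at `φ₁ = π` and `φ₁ = 0`.  The winding number of
`det W` along `φ₂` is the same at both ends, and contributes the sign of `S₀`. -/
theorem transition_sign {N : ℕ} (hN : Even N) {W W' : ℝ → ℝ → Matrix (Fin N) (Fin N) ℂ}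
    {S S₀ T : ℝ → Matrix (Fin N) (Fin N) ℂ} {s t : ℂ}
    (hW : ContinuousOn (fun p : ℝ × ℝ => W p.1 p.2) (Set.Icc 0 Real.pi ×ˢ Set.univ))
    (hper : ∀ x ∈ Set.Icc 0 Real.pi, ∀ k, W x (k + 2 * Real.pi) = W x k)
    (hdet : ∀ x ∈ Set.Icc 0 Real.pi, ∀ k, (W x k).det ≠ 0)
    (hTR : ∀ x ∈ Set.Icc 0 Real.pi, ∀ k, W (-x) (-k) = tau (W' x k))
    (hS : ∀ k, W' Real.pi k = S k * W Real.pi k) (hS₀ : ∀ k, W' 0 k = S₀ k * W 0 k)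
    (hSK : ∀ k, S (-k) * tau (S k) = 1) (hSper : S (-Real.pi) = S Real.pi)
    (hT : ∀ k, W Real.pi k = W (-Real.pi) k * T k)
    (hsS : IsKramersSign S s) (hsS₀ : IsKramersSign S₀ 1)
    (hsT : IsKramersSign T t) : t = s := by
  have hpp := Real.pi_pos.le
  have hm0 : (0 : ℝ) ∈ Set.Icc 0 Real.pi := ⟨le_rfl, hpp⟩
  have hm1 : Real.pi ∈ Set.Icc 0 Real.pi := ⟨hpp, le_rfl⟩
  set P : ℝ → ℝ := fun x => (Set.projIcc 0 Real.pi hpp x : ℝ) with hP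
  have hPc : Continuous P := continuous_subtype_val.comp continuous_projIcc
  have hPm : ∀ x, P x ∈ Set.Icc 0 Real.pi := fun x => (Set.projIcc 0 Real.pi hpp x).2
  have hPe : ∀ x ∈ Set.Icc 0 Real.pi, P x = x := fun x hx => by
    simp only [hP, Set.projIcc_of_mem hpp hx]
  obtain ⟨u, hu, hue'⟩ := exists_continuous_arg
    (g := fun p : ℝ × ℝ => phase (W (P p.1) p.2).det)
    (by
      rw [← continuousOn_univ]
      refine ContinuousOn.phase ?_ (fun p _ => hdet _ (hPm _) _)
      exact (Continuous.comp_continuousOn continuous_id.matrix_det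
        (hW.comp (f := fun p : ℝ × ℝ => (P p.1, p.2)) (by fun_prop)
          (fun p _ => ⟨hPm _, trivial⟩))))
    (fun p => norm_phase (hdet _ (hPm _) _))
  have hue : ∀ x ∈ Set.Icc 0 Real.pi, ∀ k,
      Complex.exp (Complex.I * (u (x, k) : ℂ)) = phase (W x k).det := fun x hx k => by
    rw [hue']; simp only [hPe x hx]
  -- `E x` is `(-1)` to the winding number of `det W` at `φ₁ = x`
  set E : ℝ → ℂ := fun x =>
    Complex.exp (Complex.I * ((u (x, -Real.pi) - u (x, Real.pi) : ℝ) : ℂ) / 2) with hE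
  have hWper : ∀ x ∈ Set.Icc 0 Real.pi, W x (-Real.pi) = W x Real.pi := fun x hx => by
    rw [← hper x hx (-Real.pi)]; congr 1; ring
  have hE2 : ∀ x ∈ Set.Icc 0 Real.pi, E x ^ 2 = 1 := fun x hx => by
    rw [hE, ← Complex.exp_nat_mul, show ((2 : ℕ) : ℂ)
      * (Complex.I * ((u (x, -Real.pi) - u (x, Real.pi) : ℝ) : ℂ) / 2)
      = Complex.I * (u (x, -Real.pi) : ℂ) - Complex.I * (u (x, Real.pi) : ℂ) by push_cast; ring,
      Complex.exp_sub, hue x hx, hue x hx, hWper x hx]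
    exact div_self (phase_ne_zero (hdet x hx _))
  have hEc : ContinuousOn E (Set.Icc 0 Real.pi) := by
    simp only [hE]
    exact Continuous.continuousOn (by fun_prop)
  have hEE : E Real.pi = E 0 := eq_of_sq_eq_one isPreconnected_Icc hEc hE2 hm1 hm0
  have hinvdet : ∀ {M : Matrix (Fin N) (Fin N) ℂ}, M.det ≠ 0 → IsUnit M.det := fun h =>
    isUnit_iff_ne_zero.2 h
  have htaudet : ∀ {M : Matrix (Fin N) (Fin N) ℂ}, M.det ≠ 0 → (tau M).det ≠ 0 := fun h => by
    rw [det_tau hN]; exact (map_ne_zero _).2 h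
  -- the end `φ₁ = 0`
  have hTR0 : ∀ k, W 0 (-k) = tau (S₀ k * W 0 k) := fun k => by
    have := hTR 0 hm0 k
    rwa [neg_zero, hS₀] at this
  have hdS₀ : ∀ k, (S₀ k).det ≠ 0 := fun k h0 => by
    have h1 := hdet 0 hm0 (-k)
    rw [hTR0, det_tau hN, Matrix.det_mul, h0] at h1
    simp at h1
  obtain ⟨r₀, hr₀, hr₀2, hr₀s⟩ := hsS₀
  have hE0 : E 0 = 1 := by
    have hroot : ∀ k, W 0 (-k) = W 0 k → kramersRoot (S₀ k)
        = (Complex.exp (Complex.I * (u (0, k) : ℂ)))⁻¹ := by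
      intro k hk
      have hd := hdet 0 hm0 k
      have h1 : W 0 k = tau (S₀ k) * tau (W 0 k) := by rw [← tau_mul hN, ← hTR0, hk]
      have h2 : S₀ k = (tau (W 0 k)⁻¹)⁻¹ * 1 * (W 0 k)⁻¹ := by
        have h3 : (tau (W 0 k)⁻¹)⁻¹ = tau (W 0 k) := by
          refine Matrix.inv_eq_right_inv ?_
          rw [← tau_mul hN, Matrix.nonsing_inv_mul _ (hinvdet hd), tau_one hN]
        have h4 := congrArg tau h1
        rw [tau_mul hN, tau_tau hN, tau_tau hN] at h4
        rw [h3, mul_one, h4, mul_assoc, Matrix.mul_nonsing_inv _ (hinvdet hd), mul_one]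
      have hd' : (W 0 k)⁻¹.det ≠ 0 := by
        rw [Matrix.det_nonsing_inv, Ring.inverse_eq_inv']; exact inv_ne_zero hd
      rw [h2, kramersRoot_gauge hN (by rw [tau_one hN, one_mul]) hd', kramersRoot_one N hN,
        one_mul, hue 0 hm0, Matrix.det_nonsing_inv, Ring.inverse_eq_inv', phase_inv]
    have hq0 := hroot 0 (by rw [neg_zero])
    have hq1 := hroot Real.pi (hWper 0 hm0)
    have key := eq_of_sq_eq_one (f := fun k =>
        Complex.exp (Complex.I * ((u (0, k) + u (0, -k) : ℝ) : ℂ) / 2) * r₀ k)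
      isPreconnected_Icc (ContinuousOn.mul (Continuous.continuousOn (by fun_prop)) hr₀)
      (fun k hk => by
        rw [mul_pow, hr₀2 k hk, ← Complex.exp_nat_mul, show ((2 : ℕ) : ℂ)
          * (Complex.I * ((u (0, k) + u (0, -k) : ℝ) : ℂ) / 2)
          = Complex.I * (u (0, k) : ℂ) + Complex.I * (u (0, -k) : ℂ) by push_cast; ring,
          Complex.exp_add, hue 0 hm0, hue 0 hm0, hTR0, det_tau hN, Matrix.det_mul, phase_conj,
          phase_mul, map_mul, conj_phase (hdS₀ k), conj_phase (hdet 0 hm0 k)]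
        have e1 := phase_ne_zero (hdS₀ k)
        have e2 := phase_ne_zero (hdet 0 hm0 k)
        field_simp) hm1 hm0
    rw [hq0, hq1, one_mul] at hr₀s
    have hr0 : r₀ 0 ≠ 0 := fun h0 =>
      phase_ne_zero (hdS₀ 0) (by rw [← hr₀2 0 hm0, h0]; simp)
    simp only [neg_zero] at key
    have a1 := Complex.exp_ne_zero (Complex.I * (u (0, 0) : ℂ))
    have a2 := Complex.exp_ne_zero (Complex.I * (u (0, Real.pi) : ℂ))
    have e1 : Complex.exp (Complex.I * ((u (0, 0) + u (0, 0) : ℝ) : ℂ) / 2)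
        = Complex.exp (Complex.I * (u (0, 0) : ℂ)) := by congr 1; push_cast; ring
    have e2 : Complex.exp (Complex.I * ((u (0, Real.pi) + u (0, -Real.pi) : ℝ) : ℂ) / 2)
        = E 0 * Complex.exp (Complex.I * (u (0, Real.pi) : ℂ)) := by
      rw [hE, ← Complex.exp_add]; congr 1; push_cast; ring
    rw [e1, e2] at key
    field_simp at hr₀s
    have h3 : (E 0 - 1) * (Complex.exp (Complex.I * (u (0, 0) : ℂ)) * r₀ 0) = 0 := by
      linear_combination key - E 0 * hr₀s
    exact sub_eq_zero.1 ((mul_eq_zero.1 h3).resolve_right (mul_ne_zero a1 hr0))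
  -- the end `φ₁ = π`
  have hdS : ∀ k, (S k).det ≠ 0 := fun k h0 => by
    have := congrArg Matrix.det (hSK k)
    rw [Matrix.det_mul, det_tau hN, h0] at this
    simp at this
  have hWm : ∀ k, W (-Real.pi) k = tau (S (-k) * W Real.pi (-k)) := fun k => by
    have := hTR Real.pi hm1 (-k)
    rwa [neg_neg, hS] at this
  have hdWm : ∀ k, (W (-Real.pi) k).det ≠ 0 := fun k => by
    rw [hWm]; exact htaudet (by rw [Matrix.det_mul]; exact mul_ne_zero (hdS _) (hdet _ hm1 _))
  have hTe : ∀ k, T k = (W (-Real.pi) k)⁻¹ * W Real.pi k := fun k => by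
    rw [hT, ← mul_assoc, Matrix.nonsing_inv_mul _ (hinvdet (hdWm k)), one_mul]
  have hdT : ∀ k ∈ Set.Icc 0 Real.pi, (T k).det ≠ 0 := fun k _ => by
    rw [hTe, Matrix.det_mul, Matrix.det_nonsing_inv, Ring.inverse_eq_inv']
    exact mul_ne_zero (inv_ne_zero (hdWm k)) (hdet _ hm1 _)
  have hTroot : ∀ k, W Real.pi (-k) = W Real.pi k → S (-k) = S k → kramersRoot (T k)
      = kramersRoot (S k) * phase (W Real.pi k).det := by
    intro k h1 h2
    have hK : S k * tau (S k) = 1 := by rw [← hSK k, h2]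
    have h3 : T k = (tau (W Real.pi k))⁻¹ * S k * W Real.pi k := by
      rw [hTe, hWm, h1, h2, tau_mul hN, Matrix.mul_inv_rev, Matrix.inv_eq_left_inv hK]
    rw [h3, kramersRoot_gauge hN hK (hdet _ hm1 _)]
  have hT0 := hTroot 0 (by rw [neg_zero]) (by rw [neg_zero])
  have hT1 := hTroot Real.pi (hWper _ hm1) hSper
  obtain ⟨r, hr, hr2, hrs⟩ := hsS
  refine IsKramersSign.unique hdT hsT ⟨fun k =>
    Complex.exp (Complex.I * ((u (Real.pi, k) + u (Real.pi, -k) : ℝ) : ℂ) / 2) * r k,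
    ContinuousOn.mul (Continuous.continuousOn (by fun_prop)) hr, fun k hk => ?_, ?_⟩
  · have hSneg : phase (S (-k)).det = phase (S k).det := by
      have h1 := congrArg Matrix.det (hSK k)
      rw [Matrix.det_mul, det_tau hN, Matrix.det_one] at h1
      have h2 : (S (-k)).det = (conj (S k).det)⁻¹ := eq_inv_of_mul_eq_one_left h1
      rw [h2, phase_inv, phase_conj, conj_phase (hdS k), inv_inv]
    rw [mul_pow, hr2 k hk, ← Complex.exp_nat_mul, show ((2 : ℕ) : ℂ)
      * (Complex.I * ((u (Real.pi, k) + u (Real.pi, -k) : ℝ) : ℂ) / 2)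
      = Complex.I * (u (Real.pi, k) : ℂ) + Complex.I * (u (Real.pi, -k) : ℂ) by push_cast; ring,
      Complex.exp_add, hue _ hm1, hue _ hm1, hTe, Matrix.det_mul, Matrix.det_nonsing_inv,
      Ring.inverse_eq_inv', hWm, det_tau hN, Matrix.det_mul, phase_mul, phase_inv, phase_conj,
      phase_mul, map_mul, hSneg, conj_phase (hdS k), conj_phase (hdet _ hm1 _)]
    simp only [mul_inv, inv_inv]
    ring
  · simp only [neg_zero]
    rw [hT0, hT1, ← hue _ hm1, ← hue _ hm1]
    have e1 : Complex.exp (Complex.I * ((u (Real.pi, 0) + u (Real.pi, 0) : ℝ) : ℂ) / 2)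
        = Complex.exp (Complex.I * (u (Real.pi, 0) : ℂ)) := by congr 1; push_cast; ring
    have e2 : Complex.exp (Complex.I * ((u (Real.pi, Real.pi) + u (Real.pi, -Real.pi) : ℝ) : ℂ) / 2)
        = Complex.exp (Complex.I * (u (Real.pi, Real.pi) : ℂ)) := by
      rw [← one_mul (Complex.exp (Complex.I * (u (Real.pi, Real.pi) : ℂ))), ← hE0, ← hEE, hE,
        ← Complex.exp_add]
      congr 1; push_cast; ring
    rw [e1, e2]
    linear_combination Complex.exp (Complex.I * (u (Real.pi, Real.pi) : ℂ))
      * Complex.exp (Complex.I * (u (Real.pi, 0) : ℂ)) * hrs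

/-- A loop `S` with `S(-k) τ(S(k)) = 1` is trivialised by a loop of invertible matrices. -/
theorem exists_trivializing_loop {N : ℕ} (hN : Even N) {S : ℝ → Matrix (Fin N) (Fin N) ℂ}
    (hS : Continuous S) (hper : ∀ k, S (k + 2 * Real.pi) = S k)
    (hSK : ∀ k, S (-k) * tau (S k) = 1) :
    ∃ w : ℝ → Matrix (Fin N) (Fin N) ℂ, Continuous w ∧ (∀ k, w (k + 2 * Real.pi) = w k) ∧
      (∀ k, (w k).det ≠ 0) ∧ ∀ k, w (-k) = tau (S k * w k) := by
  have hpp := Real.pi_pos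
  have hdS : ∀ k, (S k).det ≠ 0 := fun k h0 => by
    have := congrArg Matrix.det (hSK k)
    rw [Matrix.det_mul, det_tau hN, h0] at this
    simp at this
  have htaudet : ∀ {M : Matrix (Fin N) (Fin N) ℂ}, M.det ≠ 0 → (tau M).det ≠ 0 := fun h => by
    rw [det_tau hN]; exact (map_ne_zero _).2 h
  -- at a symmetric point, `z + conj z τ(S)` is a solution
  have hfix : ∀ k, S (-k) = S k → ∃ M : Matrix (Fin N) (Fin N) ℂ, M.det ≠ 0 ∧
      M = tau (S k * M) := fun k hk => by
    obtain ⟨z, hz, hne⟩ := exists_unit_det_ne_zero (tau (S k))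
    refine ⟨_, hne, ?_⟩
    have hK : S k * tau (S k) = 1 := by rw [← hSK k, hk]
    rw [mul_add, Matrix.mul_smul, Matrix.mul_smul, hK, tau_add, tau_smul, tau_smul, mul_one,
      tau_one hN, Complex.conj_conj, add_comm]
  have hSpi : S (-Real.pi) = S Real.pi := by rw [← hper (-Real.pi)]; congr 1; ring
  obtain ⟨M0, hM0, hM0'⟩ := hfix 0 (by rw [neg_zero])
  obtain ⟨M1, hM1, hM1'⟩ := hfix Real.pi hSpi
  have hu0 : IsUnit M0.det := isUnit_iff_ne_zero.2 hM0
  have h0D : (0 : ℂ) ∈ {s : ℂ | (1 + s • (M0⁻¹ * M1 - 1)).det ≠ 0} := by simp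
  have h1D : (1 : ℂ) ∈ {s : ℂ | (1 + s • (M0⁻¹ * M1 - 1)).det ≠ 0} := by
    simp only [Set.mem_ofPred_eq, one_smul, add_sub_cancel, Matrix.det_mul, Matrix.det_nonsing_inv,
      Ring.inverse_eq_inv']
    exact mul_ne_zero (inv_ne_zero hM0) hM1
  obtain ⟨γ, hγ⟩ := (isPathConnected_det_line (M0⁻¹ * M1)).joinedIn 0 h0D 1 h1D
  -- a path of invertible matrices between the solutions at `0` and `π`, continued by reflection to
  -- negative `k` and then periodically
  set p : ℝ → Matrix (Fin N) (Fin N) ℂ := fun k =>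
    M0 * (1 + γ (Set.projIcc 0 1 zero_le_one (k / Real.pi)) • (M0⁻¹ * M1 - 1)) with hp
  have hpc : Continuous p := by
    have : Continuous fun k : ℝ => γ (Set.projIcc 0 1 zero_le_one (k / Real.pi)) :=
      γ.continuous.comp (continuous_projIcc.comp (continuous_id.div_const _))
    exact continuous_const.mul (continuous_const.add (this.smul continuous_const))
  have hpd : ∀ k, (p k).det ≠ 0 := fun k => by
    rw [hp, Matrix.det_mul]; exact mul_ne_zero hM0 (hγ _)
  have hp0 : p 0 = M0 := by simp [hp]
  have hp1 : p Real.pi = M1 := by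
    simp only [hp, div_self hpp.ne', Set.projIcc_right]
    change M0 * (1 + γ 1 • (M0⁻¹ * M1 - 1)) = M1
    rw [γ.target, one_smul, add_sub_cancel, ← mul_assoc, Matrix.mul_nonsing_inv _ hu0, one_mul]
  set q : ℝ → Matrix (Fin N) (Fin N) ℂ := fun k =>
    if 0 ≤ k then p k else tau (S (-k) * p (-k)) with hq
  have hqc : Continuous q := by
    refine Continuous.if_le hpc (continuous_tau.comp ((hS.comp continuous_neg).mul
      (hpc.comp continuous_neg))) continuous_const continuous_id (fun k hk => ?_)
    obtain rfl : k = 0 := hk.symm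
    simp only [neg_zero, hp0]
    exact hM0'
  have hqd : ∀ k, (q k).det ≠ 0 := fun k => by
    simp only [hq]
    split_ifs
    · exact hpd k
    · exact htaudet (by rw [Matrix.det_mul]; exact mul_ne_zero (hdS _) (hpd _))
  have hqneg : ∀ k, q (-k) = tau (S k * q k) := fun k => by
    rcases lt_trichotomy k 0 with h | h | h
    · have h1 : (0 : ℝ) ≤ -k := by linarith
      simp only [hq, if_pos h1, if_neg (not_le.2 h)]
      rw [tau_mul hN, tau_tau hN, ← mul_assoc, mul_eq_one_comm.1 (hSK k), one_mul]
    · subst h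
      simp only [hq, neg_zero, le_refl, if_true, hp0]
      exact hM0'
    · have h1 : ¬ (0 : ℝ) ≤ -k := by linarith
      simp only [hq, if_pos h.le, if_neg h1, neg_neg]
  have : Fact (0 < 2 * Real.pi) := ⟨by positivity⟩
  have hends : q (-Real.pi) = q (-Real.pi + 2 * Real.pi) := by
    rw [hqneg, show -Real.pi + 2 * Real.pi = Real.pi by ring]
    simp only [hq, if_pos hpp.le, hp1]
    exact hM1'.symm
  set w : ℝ → Matrix (Fin N) (Fin N) ℂ := fun k =>
    AddCircle.liftIco (2 * Real.pi) (-Real.pi) q (k : AddCircle (2 * Real.pi)) with hw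
  have hwper : ∀ k, w (k + 2 * Real.pi) = w k := fun k => by
    simp only [hw, AddCircle.coe_add_period]
  have hwq : ∀ k ∈ Set.Icc (-Real.pi) Real.pi, w k = q k := fun k hk => by
    rcases hk.2.eq_or_lt with rfl | h
    · rw [← sub_add_cancel Real.pi (2 * Real.pi), hwper,
        show Real.pi - 2 * Real.pi = -Real.pi by ring, ← hends]
      exact AddCircle.liftIco_coe_apply ⟨le_rfl, by linarith⟩
    · exact AddCircle.liftIco_coe_apply ⟨hk.1, by linarith⟩
  have hred : ∀ k, ∃ k' ∈ Set.Icc (-Real.pi) Real.pi, ∃ m : ℤ, k = k' + m • (2 * Real.pi) := by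
    intro k
    have h1 := toIcoMod_mem_Ico this.out (-Real.pi) k
    refine ⟨_, ⟨h1.1, by linarith [h1.2]⟩, toIcoDiv this.out (-Real.pi) k, ?_⟩
    rw [toIcoMod_add_toIcoDiv_zsmul]
  have hwz : ∀ k (m : ℤ), w (k + m • (2 * Real.pi)) = w k := fun k m =>
    (Function.Periodic.zsmul hwper m) k
  have hSz : ∀ k (m : ℤ), S (k + m • (2 * Real.pi)) = S k := fun k m =>
    (Function.Periodic.zsmul hper m) k
  refine ⟨w, ?_, hwper, fun k => ?_, fun k => ?_⟩
  · exact (AddCircle.liftIco_continuous hends hqc.continuousOn).comp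
      (AddCircle.continuous_mk' _)
  · obtain ⟨k', hk', m, rfl⟩ := hred k
    rw [hwz, hwq k' hk']; exact hqd k'
  · obtain ⟨k', hk', m, rfl⟩ := hred k
    rw [hwz, hSz, neg_add, ← neg_smul, hwz, hwq k' hk',
      hwq (-k') ⟨by linarith [hk'.2], by linarith [hk'.1]⟩, hqneg]

/-! ### Half-line and full-line operators -/

open scoped InnerProductSpace
open ContinuousLinearMap (adjoint)

theorem leftSite_injective (a b m : ℕ) (ha : leftSite a = some m) (hb : leftSite b = some m) :
    a = b := by
  cases a <;> cases b <;> simp_all [leftSite]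

theorem some_succ_injective (a b m : ℕ) (ha : some (a + 1) = some m) (hb : some (b + 1) = some m) :
    a = b := by
  simp only [Option.some.injEq] at ha hb; omega

/-- The half-line operator with hopping matrix `A`, potential `V` and Dirichlet condition. -/
def halfOp {N : ℕ} (A : Mat N) (V : BddSeq ℕ N) : L2 ℕ N →L[ℂ] L2 ℕ N :=
  mulOp (fun _ => A) ‖A‖ (norm_nonneg _) (fun _ => le_rfl) ∘L
      hop N leftSite leftSite_injective
    + mulOp (fun _ => adjoint A) ‖adjoint A‖
        (norm_nonneg _) (fun _ => le_rfl) ∘L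
      hop N (fun j : ℕ => some (j + 1)) some_succ_injective
    + mulOp (fun j => V j) ‖V‖ (norm_nonneg _)
        (fun j => lp.norm_apply_le_norm ENNReal.top_ne_zero V j)

theorem EdgeHamiltonian.op_eq {N : ℕ} {B : BulkHamiltonian N} (S : EdgeHamiltonian B) (k : ℝ) :
    S.op k = halfOp (B.A k) (S.V k) := rfl

theorem halfOp_apply_zero {N : ℕ} (A : Mat N) (V : BddSeq ℕ N) (f : L2 ℕ N) :
    halfOp A V f 0 = adjoint A (f 1) + V 0 (f 0) := by
  have : halfOp A V f 0 = A 0 + adjoint A (f 1) + V 0 (f 0) := rfl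
  simpa using this

theorem halfOp_apply_succ {N : ℕ} (A : Mat N) (V : BddSeq ℕ N) (f : L2 ℕ N) (j : ℕ) :
    halfOp A V f (j + 1) = A (f j) + adjoint A (f (j + 2)) + V (j + 1) (f (j + 1)) := rfl

theorem inner_mulOp {ι : Type} {N : ℕ} (W W' : ι → Mat N) (C C' : ℝ) (hC : 0 ≤ C) (hC' : 0 ≤ C')
    (hW : ∀ n, ‖W n‖ ≤ C) (hW' : ∀ n, ‖W' n‖ ≤ C') (h : ∀ n, adjoint (W n) = W' n)
    (f g : L2 ι N) : ⟪mulOp W C hC hW f, g⟫_ℂ = ⟪f, mulOp W' C' hC' hW' g⟫_ℂ := by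
  rw [lp.inner_eq_tsum, lp.inner_eq_tsum]
  refine tsum_congr fun n => ?_
  change ⟪W n (f n), g n⟫_ℂ = ⟪f n, W' n (g n)⟫_ℂ
  rw [← h n, ContinuousLinearMap.adjoint_inner_right]

theorem inner_hop_leftSite {N : ℕ} (f g : L2 ℕ N) (h1) (h2) :
    ⟪hop N leftSite h1 f, g⟫_ℂ = ⟪f, hop N (fun j : ℕ => some (j + 1)) h2 g⟫_ℂ := by
  have hs := lp.hasSum_inner (𝕜 := ℂ) (hop N leftSite h1 f) g
  rw [lp.inner_eq_tsum, lp.inner_eq_tsum, hs.summable.tsum_eq_zero_add]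
  change ⟪(0 : Internal N), g 0⟫_ℂ + _ = _
  rw [inner_zero_left, zero_add]
  rfl

theorem inner_mulOp_hop {N : ℕ} {ι : Type} (A : Mat N) (s t : ι → Option ι) (hs) (ht)
    (h : ∀ f g : L2 ι N, ⟪hop N s hs f, g⟫_ℂ = ⟪f, hop N t ht g⟫_ℂ) (f g : L2 ι N) :
    ⟪(mulOp (fun _ => A) ‖A‖ (norm_nonneg _) (fun _ => le_rfl) ∘L hop N s hs) f, g⟫_ℂ =
      ⟪f, (mulOp (fun _ => adjoint A) ‖adjoint A‖ (norm_nonneg _)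
        (fun _ => le_rfl) ∘L hop N t ht) g⟫_ℂ := by
  rw [ContinuousLinearMap.comp_apply, ContinuousLinearMap.comp_apply,
    inner_mulOp (fun _ => A) (fun _ => adjoint A) _ _ _ (norm_nonneg _) _ (fun _ => le_rfl)
      (fun _ => rfl), h]
  congr 1
  ext1; funext n
  change (t n).elim (0 : Internal N) (fun m => adjoint A (g m))
    = adjoint A ((t n).elim (0 : Internal N) (fun m => g m))
  cases t n <;> simp

theorem inner_halfOp {N : ℕ} (A : Mat N) (V : BddSeq ℕ N) (hV : ∀ j, IsSelfAdjoint (V j))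
    (f g : L2 ℕ N) : ⟪halfOp A V f, g⟫_ℂ = ⟪f, halfOp A V g⟫_ℂ := by
  simp only [halfOp, add_apply, inner_add_left, inner_add_right]
  have h1 := inner_mulOp_hop A leftSite _ leftSite_injective some_succ_injective
    (fun f g => inner_hop_leftSite f g _ _)
  have h2 := congrArg conj (h1 g f)
  rw [inner_conj_symm, inner_conj_symm] at h2
  rw [h1, h2, inner_mulOp _ _ _ _ (norm_nonneg V) (norm_nonneg V) _
    (fun j => lp.norm_apply_le_norm ENNReal.top_ne_zero V j) (fun j => hV j)]
  ring

/-- The value at the first site. -/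
def firstSite (N : ℕ) : L2 ℕ N →L[ℂ] Internal N := lp.evalCLM ℂ (fun _ : ℕ => Internal N) 2 0

/-- The inclusion of the first site. -/
def inclFirst (N : ℕ) : Internal N →L[ℂ] L2 ℕ N :=
  lp.singleContinuousLinearMap ℂ (fun _ : ℕ => Internal N) 2 0

@[simp] theorem inclFirst_apply_zero {N : ℕ} (u : Internal N) : inclFirst N u 0 = u := by
  simp [inclFirst]

@[simp] theorem inclFirst_apply_succ {N : ℕ} (u : Internal N) (j : ℕ) :
    inclFirst N u (j + 1) = 0 := by
  simp [inclFirst, lp.single_apply]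

theorem inner_inclFirst_left {N : ℕ} (u : Internal N) (f : L2 ℕ N) :
    ⟪inclFirst N u, f⟫_ℂ = ⟪u, f 0⟫_ℂ := lp.inner_single_left 0 u f

theorem inner_inclFirst_right {N : ℕ} (u : Internal N) (f : L2 ℕ N) :
    ⟪f, inclFirst N u⟫_ℂ = ⟪f 0, u⟫_ℂ := lp.inner_single_right 0 u f

/-- The half-line operator with the absorbing boundary condition `ψ₀ + i A* ψ₁ = 0`. -/
def dissOp {N : ℕ} (A : Mat N) (V : BddSeq ℕ N) : L2 ℕ N →L[ℂ] L2 ℕ N :=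
  halfOp A V - Complex.I • (inclFirst N ∘L A ∘L adjoint A ∘L firstSite N)

theorem dissOp_apply {N : ℕ} (A : Mat N) (V : BddSeq ℕ N) (f : L2 ℕ N) :
    dissOp A V f = halfOp A V f - Complex.I • inclFirst N (A (adjoint A (f 0))) := rfl

/-- The absorbing boundary condition contributes with the same sign as `Im z > 0` to the imaginary
part of the quadratic form. -/
theorem im_inner_dissOp {N : ℕ} (A : Mat N) (V : BddSeq ℕ N) (hV : ∀ j, IsSelfAdjoint (V j))
    (z : ℂ) (f : L2 ℕ N) :
    (⟪dissOp A V f - z • f, f⟫_ℂ).im = ‖adjoint A (f 0)‖ ^ 2 + z.im * ‖f‖ ^ 2 := by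
  have h0 : (⟪halfOp A V f, f⟫_ℂ).im = 0 := by
    have := inner_conj_symm (𝕜 := ℂ) (halfOp A V f) f
    rw [← inner_halfOp A V hV] at this
    exact Complex.conj_eq_iff_im.mp this
  rw [dissOp_apply, inner_sub_left, inner_sub_left, inner_smul_left, inner_smul_left,
    inner_inclFirst_left, ← ContinuousLinearMap.adjoint_inner_right A, Complex.sub_im,
    Complex.sub_im, h0, inner_self_eq_norm_sq_to_K, inner_self_eq_norm_sq_to_K]
  simp [← Complex.ofReal_pow]

theorem dissOp_injective {N : ℕ} (A : Mat N) (hA : IsUnit A) (V : BddSeq ℕ N)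
    (hV : ∀ j, IsSelfAdjoint (V j)) {z : ℂ} (hz : 0 ≤ z.im) (f : L2 ℕ N)
    (hf : dissOp A V f = z • f) : f = 0 := by
  have h1 := im_inner_dissOp A V hV z f
  rw [hf, sub_self, inner_zero_left, Complex.zero_im] at h1
  have hA' : ∀ x, adjoint A x = 0 → x = 0 := by
    intro x hx
    have : IsUnit (adjoint A) := by
      rw [← ContinuousLinearMap.star_eq_adjoint]; exact hA.star
    obtain ⟨u, hu⟩ := this
    have h2 : ((u⁻¹ : (Mat N)ˣ) : Mat N) ((u : Mat N) x) = x := by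
      rw [← mul_apply_eq_comp, u.inv_mul]; rfl
    rw [← h2, hu, hx, map_zero]
  have h0 : f 0 = 0 := hA' _ (by
    have : ‖adjoint A (f 0)‖ ^ 2 = 0 := by
      nlinarith [sq_nonneg ‖adjoint A (f 0)‖, mul_nonneg hz (sq_nonneg ‖f‖)]
    simpa using this)
  rw [dissOp_apply, h0, map_zero, map_zero, map_zero, smul_zero, sub_zero] at hf
  have key : ∀ j, f j = 0 ∧ f (j + 1) = 0 := by
    intro j
    induction j with
    | zero =>
      refine ⟨h0, hA' _ ?_⟩
      have := congrArg (fun g : L2 ℕ N => g 0) hf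
      simp only [halfOp_apply_zero, lp.coeFn_smul, Pi.smul_apply, h0, map_zero, smul_zero,
        add_zero] at this
      exact this
    | succ j ih =>
      refine ⟨ih.2, hA' _ ?_⟩
      have := congrArg (fun g : L2 ℕ N => g (j + 1)) hf
      simp only [halfOp_apply_succ, lp.coeFn_smul, Pi.smul_apply, ih.1, ih.2, map_zero, smul_zero,
        add_zero, zero_add] at this
      exact this
  ext1; funext j
  exact (key j).1

theorem isUnit_dissOp_of_im_pos {N : ℕ} (A : Mat N) (V : BddSeq ℕ N)
    (hV : ∀ j, IsSelfAdjoint (V j)) {z : ℂ} (hz : 0 < z.im) :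
    IsUnit (dissOp A V - z • (1 : L2 ℕ N →L[ℂ] L2 ℕ N)) := by
  refine ContinuousLinearMap.isUnit_of_forall_le_norm_inner_map _ (c := ⟨z.im, hz.le⟩) hz
    fun f => ?_
  change ‖f‖ ^ 2 * z.im ≤ ‖⟪dissOp A V f - z • f, f⟫_ℂ‖
  refine le_trans ?_ ((le_abs_self _).trans (Complex.abs_im_le_norm _))
  rw [im_inner_dissOp A V hV]
  nlinarith [sq_nonneg ‖adjoint A (f 0)‖]

/-! ### Invertibility of the absorbing half-line operator outside the bulk spectrum -/

/-- An injective operator with a left inverse up to an operator that factors through a finite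
dimensional space is bounded below. -/
theorem exists_le_norm_of_parametrix {E F : Type*} [NormedAddCommGroup E] [NormedSpace ℂ E]
    [NormedAddCommGroup F] [NormedSpace ℂ F] [ProperSpace F] (T G : E →L[ℂ] E) (c : E →L[ℂ] F)
    (K : F →L[ℂ] E) (hT : ∀ f, T f = 0 → f = 0) (h : ∀ f, f = G (T f) + K (c f)) :
    ∃ δ > 0, ∀ f, δ * ‖f‖ ≤ ‖T f‖ := by
  by_contra! hcon
  have h1 : ∀ n : ℕ, ∃ f, ‖f‖ = 1 ∧ ‖T f‖ < 1 / (n + 1 : ℝ) := by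
    intro n
    obtain ⟨f, hf⟩ := hcon (1 / (n + 1 : ℝ)) (by positivity)
    have hf0 : ‖f‖ ≠ 0 := by
      intro h0
      rw [h0, mul_zero] at hf
      exact absurd hf (not_lt.mpr (norm_nonneg _))
    refine ⟨(‖f‖⁻¹ : ℂ) • f, ?_, ?_⟩
    · rw [norm_smul, norm_inv, Complex.norm_real, norm_norm, inv_mul_cancel₀ hf0]
    · rw [map_smul, norm_smul, norm_inv, Complex.norm_real, norm_norm]
      rw [inv_mul_lt_iff₀ (by positivity), mul_comm]
      exact hf
  choose f hf1 hf2 using h1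
  have hTf : Filter.Tendsto (fun n => T (f n)) Filter.atTop (nhds 0) :=
    squeeze_zero_norm (fun n => (hf2 n).le) tendsto_one_div_add_atTop_nhds_zero_nat
  obtain ⟨y, -, φ, hφ, hy⟩ := tendsto_subseq_of_bounded (x := fun n => c (f n))
    (Metric.isBounded_closedBall (x := 0) (r := ‖c‖)) (fun n => by
      rw [mem_closedBall_zero_iff]
      simpa [hf1 n] using c.le_opNorm (f n))
  have hlim : Filter.Tendsto (fun n => f (φ n)) Filter.atTop (nhds (G 0 + K y)) := by
    have h2 := ((G.continuous.tendsto _).comp (hTf.comp hφ.tendsto_atTop)).add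
      ((K.continuous.tendsto _).comp hy)
    refine h2.congr fun n => ?_
    exact (h (f (φ n))).symm
  have h3 : ‖G 0 + K y‖ = 1 := tendsto_nhds_unique hlim.norm (by simp [hf1])
  have h4 : T (G 0 + K y) = 0 := tendsto_nhds_unique ((T.continuous.tendsto _).comp hlim)
    (hTf.comp hφ.tendsto_atTop)
  rw [hT _ h4, norm_zero] at h3
  exact zero_ne_one h3

/-- If `T` is bounded below and `T - i η` is invertible for all `η > 0`, then `T` is invertible. -/
theorem isUnit_of_le_norm {E : Type*} [NormedAddCommGroup E] [NormedSpace ℂ E] [CompleteSpace E]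
    (T : E →L[ℂ] E) {δ : ℝ} (hδ : 0 < δ) (h : ∀ f, δ * ‖f‖ ≤ ‖T f‖)
    (hu : ∀ η : ℝ, 0 < η → IsUnit (T - (Complex.I * η) • (1 : E →L[ℂ] E))) : IsUnit T := by
  obtain ⟨u, hu⟩ := hu (δ / 4) (by positivity)
  set η : ℂ := Complex.I * ((δ / 4 : ℝ) : ℂ) with hη
  have hηn : ‖η‖ = δ / 4 := by
    rw [hη, norm_mul, Complex.norm_I, one_mul, Complex.norm_real,
      Real.norm_of_nonneg (by positivity)]
  have hinv : ‖((u⁻¹ : (E →L[ℂ] E)ˣ) : E →L[ℂ] E)‖ ≤ 2 / δ := by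
    refine ContinuousLinearMap.opNorm_le_bound _ (by positivity) fun g => ?_
    set f := ((u⁻¹ : (E →L[ℂ] E)ˣ) : E →L[ℂ] E) g with hf
    have hg : g = T f - η • f := by
      have h1 : ((u : E →L[ℂ] E) * ((u⁻¹ : (E →L[ℂ] E)ˣ) : E →L[ℂ] E)) g = g := by
        rw [u.mul_inv]; rfl
      rw [← h1, hu]; rfl
    have h2 : ‖T f‖ ≤ ‖g‖ + δ / 4 * ‖f‖ := by
      have : T f = g + η • f := by rw [hg]; abel
      rw [this, ← hηn, ← norm_smul]
      exact norm_add_le _ _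
    have h3 := h f
    rw [div_mul_eq_mul_div, le_div_iff₀ hδ]
    nlinarith [norm_nonneg f, norm_nonneg g]
  have hsmall : ‖-(η • ((u⁻¹ : (E →L[ℂ] E)ˣ) : E →L[ℂ] E))‖ < 1 := by
    rw [norm_neg, norm_smul, hηn]
    calc δ / 4 * _ ≤ δ / 4 * (2 / δ) := by gcongr
      _ = 1 / 2 := by field_simp; norm_num
      _ < 1 := by norm_num
  have h5 := isUnit_one_sub_of_norm_lt_one hsmall
  have h6 : T = u * (1 - -(η • ((u⁻¹ : (E →L[ℂ] E)ˣ) : E →L[ℂ] E))) := by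
    rw [sub_neg_eq_add, mul_add, mul_one, mul_smul_comm, u.mul_inv, hu]
    abel
  rw [h6]
  exact u.isUnit.mul h5

/-- Extension by zero of sequences from the half-line to the line. -/
def extendZero (N : ℕ) : L2 ℕ N →L[ℂ] L2 ℤ N :=
  hop N (fun n : ℤ => if 1 ≤ n then some (n - 1).toNat else none) (fun a b m ha hb => by
    split_ifs at ha hb
    simp only [Option.some.injEq] at ha hb
    omega)

/-- Restriction of sequences from the line to the half-line. -/
def restrictHalf (N : ℕ) : L2 ℤ N →L[ℂ] L2 ℕ N :=
  hop N (fun j : ℕ => some ((j : ℤ) + 1)) (fun a b m ha hb => by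
    simp only [Option.some.injEq] at ha hb; omega)

theorem extendZero_apply {N : ℕ} (f : L2 ℕ N) (n : ℤ) :
    extendZero N f n = if 1 ≤ n then f (n - 1).toNat else 0 := by
  change (if 1 ≤ n then some (n - 1).toNat else none).elim (0 : Internal N) (fun m => f m) = _
  split_ifs <;> rfl

theorem restrictHalf_extendZero {N : ℕ} (f : L2 ℕ N) : restrictHalf N (extendZero N f) = f := by
  ext1; funext j
  change extendZero N f ((j : ℤ) + 1) = f j
  rw [extendZero_apply, if_pos (by omega)]
  rw [show ((j : ℤ) + 1 - 1).toNat = j by omega]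

/-- Outside the bulk spectrum, the absorbing half-line operator is invertible on the real axis:
cutting the line changes the operator only near the boundary. -/
theorem isUnit_dissOp_of_real {N : ℕ} (B : BulkHamiltonian N) (k : ℝ) (V : BddSeq ℕ N)
    (hV : ∀ j, IsSelfAdjoint (V j)) {n₀ : ℕ} (hn₀ : ∀ j, n₀ ≤ j → V j = B.V k ((j : ℤ) + 1))
    {x : ℝ} (hx : (x : ℂ) ∉ spectrum ℂ (B.op k)) :
    IsUnit (dissOp (B.A k) V - (x : ℂ) • (1 : L2 ℕ N →L[ℂ] L2 ℕ N)) := by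
  set T := dissOp (B.A k) V - (x : ℂ) • (1 : L2 ℕ N →L[ℂ] L2 ℕ N) with hTdef
  have hTf : ∀ f, T f = dissOp (B.A k) V f - (x : ℂ) • f := fun f => rfl
  have hinj : ∀ f, T f = 0 → f = 0 := by
    intro f hf
    rw [hTf, sub_eq_zero] at hf
    exact dissOp_injective _ (B.A_isUnit k) V hV (z := (x : ℂ)) (by simp) f hf
  set U := B.op k - (x : ℂ) • (1 : L2 ℤ N →L[ℂ] L2 ℤ N) with hU
  have hUu : IsUnit U := by
    rw [spectrum.notMem_iff, Algebra.algebraMap_eq_smul_one, ← IsUnit.neg_iff, neg_sub] at hx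
    exact hx
  obtain ⟨R, hR⟩ := hUu.exists_left_inv
  set D : L2 ℕ N →L[ℂ] L2 ℤ N := U ∘L extendZero N - extendZero N ∘L T with hD
  set m := n₀ + 1
  have hD0 : ∀ f : L2 ℕ N, (∀ j, j < m → f j = 0) → D f = 0 := by
    intro f hf
    ext1; funext n
    have e1 : D f n = U (extendZero N f) n - extendZero N (T f) n := rfl
    have e2 : U (extendZero N f) n = B.op k (extendZero N f) n - (x : ℂ) • extendZero N f n := rfl
    have e3 : ∀ j, T f j = halfOp (B.A k) V f j
        - Complex.I • inclFirst N (B.A k (adjoint (B.A k) (f 0))) j - (x : ℂ) • f j := fun j => rfl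
    have hf0 : f 0 = 0 := hf 0 (by omega)
    rw [e1, e2, B.op_apply]
    simp only [extendZero_apply]
    change _ = (0 : Internal N)
    rcases lt_trichotomy n 0 with hn | hn | hn
    · rw [if_neg (by omega), if_neg (by omega), if_neg (by omega), if_neg (by omega)]
      simp
    · subst hn
      simp [hf0]
    · obtain ⟨j, rfl⟩ : ∃ j : ℕ, n = j + 1 := ⟨(n - 1).toNat, by omega⟩
      rw [if_pos (show (1 : ℤ) ≤ j + 1 + 1 by omega), if_pos (show (1 : ℤ) ≤ j + 1 by omega),
        if_pos (show (1 : ℤ) ≤ j + 1 by omega), e3]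
      have t1 : ((j : ℤ) + 1 - 1).toNat = j := by omega
      have t2 : ((j : ℤ) + 1 + 1 - 1).toNat = j + 1 := by omega
      rw [t1, t2, hf0]
      simp only [map_zero]
      have hVj : B.V k ((j : ℤ) + 1) (f j) = V j (f j) := by
        by_cases hj : j < m
        · rw [hf j hj, map_zero, map_zero]
        · rw [hn₀ j (by omega)]
      rw [hVj]
      cases j with
      | zero => simp [halfOp_apply_zero]
      | succ i =>
        rw [if_pos (by push_cast; omega), halfOp_apply_succ]
        have t3 : (((i + 1 : ℕ) : ℤ) + 1 - 1 - 1).toNat = i := by push_cast; omega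
        rw [t3]
        simp
  -- `D` only sees the first `m` sites, so it factors through a finite dimensional space.
  let c : L2 ℕ N →L[ℂ] (Fin m → Internal N) :=
    ContinuousLinearMap.pi fun j => lp.evalCLM ℂ (fun _ : ℕ => Internal N) 2 (j : ℕ)
  let K₀ : (Fin m → Internal N) →L[ℂ] L2 ℕ N :=
    ∑ j : Fin m, (lp.singleContinuousLinearMap ℂ (fun _ : ℕ => Internal N) 2 (j : ℕ)) ∘L
      ContinuousLinearMap.proj (R := ℂ) (φ := fun _ : Fin m => Internal N) j
  have hK₀ : ∀ f : L2 ℕ N, ∀ i, i < m → K₀ (c f) i = f i := by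
    intro f i hi
    have e4 : K₀ (c f) = ∑ j : Fin m, lp.single (E := fun _ : ℕ => Internal N) 2 (j : ℕ) (f j) := by
      simp only [K₀, c, sum_apply]
      rfl
    rw [e4, lp.coeFn_sum, Finset.sum_apply, Finset.sum_eq_single ⟨i, hi⟩]
    · simp
    · intro j _ hj
      rw [lp.single_apply]
      have : i ≠ (j : ℕ) := fun h => hj (Fin.ext h.symm)
      simp [this]
    · simp
  have hDK : ∀ f, D f = D (K₀ (c f)) := by
    intro f
    rw [← sub_eq_zero, ← map_sub]
    refine hD0 _ fun j hj => ?_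
    change f j - K₀ (c f) j = 0
    rw [hK₀ f j hj, sub_self]
  obtain ⟨δ, hδ, hle⟩ := exists_le_norm_of_parametrix T (restrictHalf N ∘L R ∘L extendZero N) c
    (restrictHalf N ∘L R ∘L D ∘L K₀) hinj (fun f => by
      have h1 : extendZero N f = R (extendZero N (T f)) + R (D f) := by
        rw [← map_add]
        have : extendZero N (T f) + D f = U (extendZero N f) := by
          change _ + (U (extendZero N f) - extendZero N (T f)) = _
          abel
        rw [this]
        change _ = (R * U) _
        rw [hR]; rfl
      change f = restrictHalf N (R (extendZero N (T f))) + restrictHalf N (R (D (K₀ (c f))))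
      rw [← hDK f, ← map_add, ← h1, restrictHalf_extendZero])
  refine isUnit_of_le_norm T hδ hle fun η hη => ?_
  have := isUnit_dissOp_of_im_pos (B.A k) V hV (z := (x : ℂ) + Complex.I * η) (by simpa using hη)
  rw [add_smul, ← sub_sub] at this
  exact this

/-! ### The scattering matrix of the half-line -/

/-- The sites `1, 2, …` of the decaying solution of energy `z` with `ψ₀ + i A* ψ₁ = u`; its value at
the site `0` is `u - i A* ψ₁`. -/
def solOp {N : ℕ} (A : Mat N) (V : BddSeq ℕ N) (z : ℂ) : Internal N →L[ℂ] L2 ℕ N :=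
  -(Ring.inverse (dissOp A V - z • (1 : L2 ℕ N →L[ℂ] L2 ℕ N)) ∘L inclFirst N ∘L A)

/-- The scattering matrix, which maps `ψ₀ + i A* ψ₁` to `ψ₀ - i A* ψ₁` for all decaying
solutions `ψ` of energy `z`. -/
def scat {N : ℕ} (A : Mat N) (V : BddSeq ℕ N) (z : ℂ) : Mat N :=
  1 - (2 * Complex.I) • (adjoint A ∘L firstSite N ∘L solOp A V z)

theorem scat_apply {N : ℕ} (A : Mat N) (V : BddSeq ℕ N) (z : ℂ) (u : Internal N) :
    scat A V z u = u - (2 * Complex.I) • adjoint A (solOp A V z u 0) := rfl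

theorem halfOp_solOp {N : ℕ} {A : Mat N} {V : BddSeq ℕ N} {z : ℂ}
    (h : IsUnit (dissOp A V - z • (1 : L2 ℕ N →L[ℂ] L2 ℕ N))) (u : Internal N) :
    halfOp A V (solOp A V z u) =
      z • solOp A V z u - inclFirst N (A (u - Complex.I • adjoint A (solOp A V z u 0))) := by
  have h1 : (dissOp A V - z • (1 : L2 ℕ N →L[ℂ] L2 ℕ N)) (solOp A V z u) = -inclFirst N (A u) := by
    change (dissOp A V - z • (1 : L2 ℕ N →L[ℂ] L2 ℕ N))
      (-(Ring.inverse (dissOp A V - z • (1 : L2 ℕ N →L[ℂ] L2 ℕ N)) (inclFirst N (A u)))) = _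
    rw [map_neg, ← mul_apply_eq_comp, Ring.mul_inverse_cancel _ h]
    rfl
  have h2 : halfOp A V (solOp A V z u) - Complex.I • inclFirst N (A (adjoint A (solOp A V z u 0)))
      - z • solOp A V z u = -inclFirst N (A u) := h1
  rw [map_sub, map_sub, map_smul, map_smul]
  rw [← sub_eq_zero] at h2 ⊢
  rw [← h2]
  abel

/-- Every decaying solution, with value `a` at the site `0` and `f` at the sites `1, 2, …`, is given
by `solOp` in terms of its amplitude. -/
theorem eq_solOp {N : ℕ} {A : Mat N} {V : BddSeq ℕ N} {z : ℂ}
    (h : IsUnit (dissOp A V - z • (1 : L2 ℕ N →L[ℂ] L2 ℕ N))) {a : Internal N} {f : L2 ℕ N}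
    (hf : halfOp A V f = z • f - inclFirst N (A a)) :
    f = solOp A V z (a + Complex.I • adjoint A (f 0)) := by
  have h1 : (dissOp A V - z • (1 : L2 ℕ N →L[ℂ] L2 ℕ N)) f
      = -inclFirst N (A (a + Complex.I • adjoint A (f 0))) := by
    change dissOp A V f - z • f = _
    rw [dissOp_apply, hf, map_add, map_add, map_smul, map_smul]
    abel
  have h2 : solOp A V z (a + Complex.I • adjoint A (f 0)) =
      Ring.inverse (dissOp A V - z • (1 : L2 ℕ N →L[ℂ] L2 ℕ N))
        (-inclFirst N (A (a + Complex.I • adjoint A (f 0)))) := by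
    rw [map_neg]; rfl
  rw [h2, ← h1, ← mul_apply_eq_comp, Ring.inverse_mul_cancel _ h]
  rfl

theorem solOp_injective {N : ℕ} {A : Mat N} (hA : IsUnit A) {V : BddSeq ℕ N} {z : ℂ}
    (h : IsUnit (dissOp A V - z • (1 : L2 ℕ N →L[ℂ] L2 ℕ N))) {u : Internal N}
    (hu : solOp A V z u = 0) : u = 0 := by
  have h1 := halfOp_solOp h u
  rw [hu] at h1
  have h2 := congrArg (fun f : L2 ℕ N => f 0) h1
  simp only [map_zero, smul_zero, zero_sub, lp.coeFn_neg, Pi.neg_apply, lp.coeFn_zero,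
    Pi.zero_apply, sub_zero, inclFirst_apply_zero] at h2
  obtain ⟨w, rfl⟩ := hA
  have h3 : ((w⁻¹ : (Mat N)ˣ) : Mat N) ((w : Mat N) u) = u := by
    rw [← mul_apply_eq_comp, w.inv_mul]; rfl
  rw [← h3, neg_eq_zero.mp h2.symm, map_zero]

/-- The scattering matrices at real energies are related by the Gram matrix of the solutions. -/
theorem adjoint_scat_mul {N : ℕ} {A : Mat N} {V : BddSeq ℕ N} (hV : ∀ j, IsSelfAdjoint (V j))
    {x y : ℝ} (hx : IsUnit (dissOp A V - (x : ℂ) • (1 : L2 ℕ N →L[ℂ] L2 ℕ N)))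
    (hy : IsUnit (dissOp A V - (y : ℂ) • (1 : L2 ℕ N →L[ℂ] L2 ℕ N))) :
    adjoint (scat A V x) * scat A V y =
      1 + (2 * Complex.I * ((y : ℂ) - x)) • (adjoint (solOp A V x) ∘L solOp A V y) := by
  ext1 u
  refine ext_inner_left ℂ fun w => ?_
  change ⟪w, adjoint (scat A V x) (scat A V y u)⟫_ℂ =
    ⟪w, u + (2 * Complex.I * ((y : ℂ) - x)) • adjoint (solOp A V x) (solOp A V y u)⟫_ℂ
  rw [ContinuousLinearMap.adjoint_inner_right, inner_add_right, inner_smul_right,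
    ContinuousLinearMap.adjoint_inner_right, scat_apply, scat_apply]
  have h := inner_halfOp A V hV (solOp A V x w) (solOp A V y u)
  rw [halfOp_solOp hx, halfOp_solOp hy] at h
  set f := solOp A V x w
  set g := solOp A V y u
  rw [inner_sub_left, inner_sub_right, inner_inclFirst_left, inner_inclFirst_right,
    inner_smul_left, inner_smul_right, ← ContinuousLinearMap.adjoint_inner_right A,
    ← ContinuousLinearMap.adjoint_inner_left A] at h
  simp only [inner_sub_left, inner_sub_right, inner_smul_left, inner_smul_right,
    Complex.conj_ofReal, map_mul, Complex.conj_I, map_ofNat] at h ⊢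
  linear_combination (2 * Complex.I) * h

theorem adjoint_scat_mul_self {N : ℕ} {A : Mat N} {V : BddSeq ℕ N}
    (hV : ∀ j, IsSelfAdjoint (V j)) {x : ℝ}
    (hx : IsUnit (dissOp A V - (x : ℂ) • (1 : L2 ℕ N →L[ℂ] L2 ℕ N))) :
    adjoint (scat A V x) * scat A V x = 1 := by
  rw [adjoint_scat_mul hV hx hx]; simp

theorem scat_mul_adjoint_self {N : ℕ} {A : Mat N} {V : BddSeq ℕ N}
    (hV : ∀ j, IsSelfAdjoint (V j)) {x : ℝ}
    (hx : IsUnit (dissOp A V - (x : ℂ) • (1 : L2 ℕ N →L[ℂ] L2 ℕ N))) :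
    scat A V x * adjoint (scat A V x) = 1 := by
  have h := adjoint_scat_mul_self hV hx
  have h1 := congrArg (ContinuousLinearMap.toLinearMap) h
  have h2 : (adjoint (scat A V x)).toLinearMap * (scat A V x).toLinearMap = 1 := h1
  have h3 := mul_eq_one_comm.mp h2
  ext1 u
  exact LinearMap.congr_fun h3 u

theorem scat_eq_mul {N : ℕ} {A : Mat N} {V : BddSeq ℕ N} (hV : ∀ j, IsSelfAdjoint (V j))
    {x y : ℝ} (hx : IsUnit (dissOp A V - (x : ℂ) • (1 : L2 ℕ N →L[ℂ] L2 ℕ N)))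
    (hy : IsUnit (dissOp A V - (y : ℂ) • (1 : L2 ℕ N →L[ℂ] L2 ℕ N))) :
    scat A V y = scat A V x *
      (1 + (2 * Complex.I * ((y : ℂ) - x)) • (adjoint (solOp A V x) ∘L solOp A V y)) := by
  rw [← adjoint_scat_mul hV hx hy, ← mul_assoc, scat_mul_adjoint_self hV hx, one_mul]

/-- The eigenvalue `-1` of the scattering matrix corresponds to the edge states. -/
theorem finrank_eigenspace_halfOp {N : ℕ} {A : Mat N} {V : BddSeq ℕ N} {z : ℂ}
    (h : IsUnit (dissOp A V - z • (1 : L2 ℕ N →L[ℂ] L2 ℕ N))) :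
    Module.finrank ℂ (Module.End.eigenspace (halfOp A V : L2 ℕ N →ₗ[ℂ] L2 ℕ N) z) =
      Module.finrank ℂ
        (LinearMap.ker ((1 + scat A V z : Mat N) : Internal N →ₗ[ℂ] Internal N)) := by
  have hker : ∀ u, u ∈ LinearMap.ker ((1 + scat A V z : Mat N) : Internal N →ₗ[ℂ] Internal N) →
      u = Complex.I • adjoint A (solOp A V z u 0) := by
    intro u hu
    have h1 : u + scat A V z u = 0 := hu
    rw [scat_apply] at h1
    have h2 : (2 : ℂ) • (u - Complex.I • adjoint A (solOp A V z u 0)) = 0 := by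
      rw [← h1]; module
    rw [smul_eq_zero_iff_right two_ne_zero, sub_eq_zero] at h2
    exact h2
  have hmem : ∀ f, f ∈ Module.End.eigenspace (halfOp A V : L2 ℕ N →ₗ[ℂ] L2 ℕ N) z →
      f = solOp A V z (Complex.I • adjoint A (f 0)) := by
    intro f hf
    have h1 : halfOp A V f = z • f := Module.End.mem_eigenspace_iff.mp hf
    have := eq_solOp h (a := 0) (f := f) (by rw [h1]; simp)
    rwa [zero_add] at this
  refine LinearEquiv.finrank_eq (LinearEquiv.ofBijective
    (LinearMap.codRestrict _ ((Complex.I • (adjoint A ∘L firstSite N) :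
      L2 ℕ N →L[ℂ] Internal N).toLinearMap.domRestrict _) ?_) ⟨?_, ?_⟩)
  · rintro ⟨f, hf⟩
    have h1 := hmem f hf
    rw [LinearMap.mem_ker]
    change Complex.I • adjoint A (f 0) + scat A V z (Complex.I • adjoint A (f 0)) = 0
    rw [scat_apply, ← h1]
    module
  · rw [← LinearMap.ker_eq_bot, LinearMap.ker_eq_bot']
    rintro ⟨f, hf⟩ h1
    have h2 : Complex.I • adjoint A (f 0) = 0 := congrArg Subtype.val h1
    have h3 := hmem f hf
    rw [h2, map_zero] at h3
    exact Subtype.ext h3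
  · rintro ⟨u, hu⟩
    have h1 := hker u hu
    refine ⟨⟨solOp A V z u, ?_⟩, Subtype.ext h1.symm⟩
    rw [Module.End.mem_eigenspace_iff]
    change halfOp A V (solOp A V z u) = z • solOp A V z u
    rw [halfOp_solOp h, ← h1]
    simp

/-! ### Dependence on parameters -/

theorem isBoundedLinearMap_mulOp (ι : Type) (N : ℕ) : IsBoundedLinearMap ℝ
    (fun V : BddSeq ι N => mulOp (fun j => V j) ‖V‖ (norm_nonneg _)
      (fun j => lp.norm_apply_le_norm ENNReal.top_ne_zero V j)) where
  map_add _ _ := rfl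
  map_smul _ _ := rfl
  bound := ⟨1, one_pos, fun V => by
    rw [one_mul]; exact LinearMap.mkContinuous_norm_le _ (norm_nonneg _) _⟩

theorem isBoundedLinearMap_mulOp_const (ι : Type) (N : ℕ) : IsBoundedLinearMap ℝ
    (fun A : Mat N => mulOp (fun _ : ι => A) ‖A‖ (norm_nonneg _) (fun _ => le_rfl)) where
  map_add _ _ := rfl
  map_smul _ _ := rfl
  bound := ⟨1, one_pos, fun V => by
    rw [one_mul]; exact LinearMap.mkContinuous_norm_le _ (norm_nonneg _) _⟩

theorem contDiff_comp_right {E F G : Type*} [NormedAddCommGroup E] [NormedSpace ℂ E]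
    [NormedAddCommGroup F] [NormedSpace ℂ F] [NormedAddCommGroup G] [NormedSpace ℂ G]
    (L : E →L[ℂ] F) {n : WithTop ℕ∞} : ContDiff ℝ n (fun X : F →L[ℂ] G => X ∘L L) :=
  (((ContinuousLinearMap.compL ℂ E F G).flip L).contDiff (n := n)).restrict_scalars ℝ

theorem contDiff_comp_left {E F G : Type*} [NormedAddCommGroup E] [NormedSpace ℂ E]
    [NormedAddCommGroup F] [NormedSpace ℂ F] [NormedAddCommGroup G] [NormedSpace ℂ G]
    (L : F →L[ℂ] G) {n : WithTop ℕ∞} : ContDiff ℝ n (fun X : E →L[ℂ] F => L ∘L X) :=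
  ((ContinuousLinearMap.compL ℂ E F G L).contDiff (n := n)).restrict_scalars ℝ

theorem contDiff_comp {E F G : Type*} [NormedAddCommGroup E] [NormedSpace ℂ E]
    [NormedAddCommGroup F] [NormedSpace ℂ F] [NormedAddCommGroup G] [NormedSpace ℂ G]
    {n : WithTop ℕ∞} : ContDiff ℝ n (fun p : (F →L[ℂ] G) × (E →L[ℂ] F) => p.1 ∘L p.2) :=
  (isBoundedBilinearMap_comp (𝕜 := ℂ) (E := E) (F := F) (G := G)).contDiff.restrict_scalars ℝ

theorem contDiff_adjoint (N : ℕ) {n : WithTop ℕ∞} : ContDiff ℝ n (fun A : Mat N => adjoint A) :=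
  (starL' ℝ : Mat N ≃L[ℝ] Mat N).contDiff

theorem contDiff_mulOp_const (ι κ : Type) (N : ℕ) (T : L2 κ N →L[ℂ] L2 ι N) {n : WithTop ℕ∞} :
    ContDiff ℝ n
      (fun A : Mat N => mulOp (fun _ : ι => A) ‖A‖ (norm_nonneg _) (fun _ => le_rfl) ∘L T) :=
  (contDiff_comp_right T).comp (isBoundedLinearMap_mulOp_const ι N).contDiff

theorem contDiff_halfOp (N : ℕ) {n : WithTop ℕ∞} :
    ContDiff ℝ n (fun p : Mat N × BddSeq ℕ N => halfOp p.1 p.2) := by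
  refine ContDiff.add (ContDiff.add ?_ ?_) ?_
  · exact (contDiff_mulOp_const ℕ ℕ N _).comp contDiff_fst
  · exact (contDiff_mulOp_const ℕ ℕ N _).comp ((contDiff_adjoint N).comp contDiff_fst)
  · exact (isBoundedLinearMap_mulOp ℕ N).contDiff.comp contDiff_snd

theorem BulkHamiltonian.contDiff_op {N : ℕ} (B : BulkHamiltonian N) : ContDiff ℝ 1 B.op := by
  refine ContDiff.add (ContDiff.add ?_ ?_) ?_
  · exact (contDiff_mulOp_const ℤ ℤ N _).comp B.A_contDiff
  · exact (contDiff_mulOp_const ℤ ℤ N _).comp ((contDiff_adjoint N).comp B.A_contDiff)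
  · exact (isBoundedLinearMap_mulOp ℤ N).contDiff.comp B.V_contDiff

theorem contDiff_dissOp (N : ℕ) {n : WithTop ℕ∞} :
    ContDiff ℝ n (fun p : Mat N × BddSeq ℕ N => dissOp p.1 p.2) := by
  refine (contDiff_halfOp N).sub (ContDiff.const_smul _ ?_)
  refine (contDiff_comp_left (inclFirst N)).comp (contDiff_comp.comp (contDiff_fst.prodMk ?_))
  exact (contDiff_comp_right (firstSite N)).comp ((contDiff_adjoint N).comp contDiff_fst)

theorem contDiffAt_solOp {N : ℕ} {n : WithTop ℕ∞} {p : Mat N × BddSeq ℕ N × ℂ}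
    (h : IsUnit (dissOp p.1 p.2.1 - p.2.2 • (1 : L2 ℕ N →L[ℂ] L2 ℕ N))) :
    ContDiffAt ℝ n (fun p : Mat N × BddSeq ℕ N × ℂ => solOp p.1 p.2.1 p.2.2) p := by
  have h1 : ContDiff ℝ n (fun p : Mat N × BddSeq ℕ N × ℂ =>
      dissOp p.1 p.2.1 - p.2.2 • (1 : L2 ℕ N →L[ℂ] L2 ℕ N)) :=
    ((contDiff_dissOp N).comp (contDiff_fst.prodMk (contDiff_fst.comp contDiff_snd))).sub
      ((contDiff_snd.comp contDiff_snd).smul contDiff_const)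
  obtain ⟨u, hu⟩ := h
  have h2 : ContDiffAt ℝ n (fun p : Mat N × BddSeq ℕ N × ℂ =>
      Ring.inverse (dissOp p.1 p.2.1 - p.2.2 • (1 : L2 ℕ N →L[ℂ] L2 ℕ N))) p := by
    have h3 := contDiffAt_ringInverse ℝ u (n := n)
    rw [hu] at h3
    exact h3.comp p h1.contDiffAt
  refine ContDiffAt.neg ?_
  exact (contDiff_comp.contDiffAt).comp p (h2.prodMk
    ((contDiff_comp_left (inclFirst N)).comp contDiff_fst).contDiffAt)

theorem contDiffAt_scat {N : ℕ} {n : WithTop ℕ∞} {p : Mat N × BddSeq ℕ N × ℂ}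
    (h : IsUnit (dissOp p.1 p.2.1 - p.2.2 • (1 : L2 ℕ N →L[ℂ] L2 ℕ N))) :
    ContDiffAt ℝ n (fun p : Mat N × BddSeq ℕ N × ℂ => scat p.1 p.2.1 p.2.2) p := by
  refine contDiffAt_const.sub (ContDiffAt.const_smul _ ?_)
  refine (contDiff_comp.contDiffAt).comp p
    (((contDiff_adjoint N).comp contDiff_fst).contDiffAt.prodMk
    ?_)
  exact ((contDiff_comp_left (firstSite N)).contDiffAt).comp p (contDiffAt_solOp h)

/-! ### The jump of the sign of a scattering matrix at an edge eigenvalue -/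

theorem det_mul_mat {N : ℕ} (X Y : Mat N) : (X * Y).det = X.det * Y.det :=
  LinearMap.det_comp (X : Internal N →ₗ[ℂ] Internal N) (Y : Internal N →ₗ[ℂ] Internal N)

theorem det_one_mat {N : ℕ} : (1 : Mat N).det = 1 := LinearMap.det_id

theorem isUnit_iff_det_ne_zero {N : ℕ} (X : Mat N) : IsUnit X ↔ X.det ≠ 0 := by
  constructor
  · rintro ⟨u, rfl⟩ h0
    have h1 : ((u : Mat N) * ((u⁻¹ : (Mat N)ˣ) : Mat N)).det = 1 := by
      rw [u.mul_inv, det_one_mat]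
    rw [det_mul_mat, h0, zero_mul] at h1
    exact zero_ne_one h1
  · intro h0
    have h1 := (LinearMap.isUnit_iff_isUnit_det (X : Internal N →ₗ[ℂ] Internal N)).mpr
      (isUnit_iff_ne_zero.mpr h0)
    obtain ⟨u, hu⟩ := h1
    refine ⟨⟨X, LinearMap.toContinuousLinearMap (u⁻¹ : (Module.End ℂ (Internal N))ˣ).1, ?_, ?_⟩,
      rfl⟩
    · ext1 v
      change (X : Internal N →ₗ[ℂ] Internal N) ((u⁻¹ : (Module.End ℂ (Internal N))ˣ).1 v) = v
      rw [← hu]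
      exact LinearMap.congr_fun u.mul_inv v
    · ext1 v
      change (u⁻¹ : (Module.End ℂ (Internal N))ˣ).1 ((X : Internal N →ₗ[ℂ] Internal N) v) = v
      rw [← hu]
      exact LinearMap.congr_fun u.inv_mul v

theorem det_ne_zero_of_injective {N : ℕ} {X : Mat N} (h : ∀ v, X v = 0 → v = 0) : X.det ≠ 0 := by
  intro h0
  have := LinearMap.bot_lt_ker_of_det_eq_zero (f := (X : Internal N →ₗ[ℂ] Internal N)) h0
  rw [bot_lt_iff_ne_bot] at this
  exact this (LinearMap.ker_eq_bot'.mpr h)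

/-- The matrix of an operator on `ℂ^N`. -/
def toMat (N : ℕ) : Mat N ≃⋆ₐ[ℂ] Matrix (Fin N) (Fin N) ℂ :=
  (Matrix.toEuclideanCLM (𝕜 := ℂ) (n := Fin N)).symm

theorem toMat_mulVec {N : ℕ} (X : Mat N) (v : Internal N) :
    (toMat N X).mulVec v.ofLp = (X v).ofLp := by
  have h := StarAlgEquiv.apply_symm_apply (Matrix.toEuclideanCLM (𝕜 := ℂ) (n := Fin N)) X
  conv_rhs => rw [← h]
  rfl

theorem det_toMat {N : ℕ} (X : Mat N) : (toMat N X).det = X.det := by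
  have h := StarAlgEquiv.apply_symm_apply (Matrix.toEuclideanCLM (𝕜 := ℂ) (n := Fin N)) X
  conv_rhs => rw [← h]
  rw [ContinuousLinearMap.det, Matrix.coe_toEuclideanCLM_eq_toEuclideanLin,
    Matrix.toEuclideanLin, Matrix.toLpLin_eq_toLin, LinearMap.det_toLin]
  rfl

theorem continuous_toMat (N : ℕ) : Continuous (toMat N) :=
  LinearMap.continuous_of_finiteDimensional (toMat N).toAlgEquiv.toLinearMap

theorem det_adjoint_mat {N : ℕ} (X : Mat N) : (adjoint X).det = conj X.det := by
  have h : toMat N (star X) = star (toMat N X) := (toMat N).map_star' X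
  rw [← det_toMat, ← det_toMat, ← ContinuousLinearMap.star_eq_adjoint, h,
    Matrix.star_eq_conjTranspose, Matrix.det_conjTranspose, starRingEnd_apply]

/-- The kernel of `1 + S`. -/
def kerOneAdd {N : ℕ} (S : Mat N) : Submodule ℂ (Internal N) :=
  LinearMap.ker ((1 + S : Mat N) : Internal N →ₗ[ℂ] Internal N)

theorem mem_kerOneAdd {N : ℕ} {S : Mat N} {v : Internal N} : v ∈ kerOneAdd S ↔ v + S v = 0 :=
  Iff.rfl

theorem finrank_kerOneAdd_eq_zero {N : ℕ} {S : Mat N} :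
    Module.finrank ℂ (kerOneAdd S) = 0 ↔ (1 + S).det ≠ 0 := by
  rw [Submodule.finrank_eq_zero]
  constructor
  · intro h
    exact det_ne_zero_of_injective (LinearMap.ker_eq_bot'.mp h)
  · intro h
    by_contra hne
    exact h (LinearMap.det_eq_zero_iff_ker_ne_bot.mpr hne)

theorem det_smul_starProjection_add {N : ℕ} (K : Submodule ℂ (Internal N)) (t : ℂ) :
    (t • K.starProjection + (1 - K.starProjection)).det = t ^ Module.finrank ℂ K := by
  set e : Mat N := t • K.starProjection + (1 - K.starProjection) with he
  have hev : ∀ v, e v = t • K.starProjection v + (v - K.starProjection v) := fun v => rfl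
  have hle : K ≤ K.comap (e : Internal N →ₗ[ℂ] Internal N) := by
    intro v hv
    change e v ∈ K
    rw [hev, Submodule.starProjection_eq_self_iff.mpr hv, sub_self, add_zero]
    exact K.smul_mem _ hv
  have h := LinearMap.det_eq_det_mul_det K (e : Internal N →ₗ[ℂ] Internal N) hle
  change LinearMap.det (e : Internal N →ₗ[ℂ] Internal N) = _
  rw [h]
  have h1 : (e : Internal N →ₗ[ℂ] Internal N).restrict hle = t • LinearMap.id := by
    ext1 ⟨v, hv⟩
    apply Subtype.ext
    change e v = t • v
    rw [hev, Submodule.starProjection_eq_self_iff.mpr hv, sub_self, add_zero]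
  have h2 : K.mapQ K (e : Internal N →ₗ[ℂ] Internal N) hle = LinearMap.id := by
    apply Submodule.linearMap_qext
    ext1 v
    change Submodule.Quotient.mk (e v) = (Submodule.Quotient.mk v : _ ⧸ K)
    rw [Submodule.Quotient.eq, hev]
    have : t • K.starProjection v + (v - K.starProjection v) - v
      = t • K.starProjection v - K.starProjection v := by abel
    rw [this]
    exact K.sub_mem (K.smul_mem _ (K.starProjection_apply_mem v)) (K.starProjection_apply_mem v)
  rw [h1, h2, LinearMap.det_smul, LinearMap.det_id, LinearMap.det_id, mul_one, mul_one]

/-- For a unitary `S`, the phase of `det (1 + S)` is a square root of `det S`. -/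
theorem phase_det_one_add_sq {N : ℕ} {S : Mat N} (hS : S * adjoint S = 1)
    (h : (1 + S).det ≠ 0) : phase (1 + S).det ^ 2 = phase S.det := by
  have h1 : 1 + S = S * adjoint (1 + S) := by
    rw [map_add, mul_add, hS, add_comm]
    have : adjoint (1 : Mat N) = 1 := by
      rw [← ContinuousLinearMap.star_eq_adjoint, star_one]
    rw [this, mul_one]
  have h2 : phase (1 + S).det = phase S.det * (phase (1 + S).det)⁻¹ := by
    conv_lhs => rw [h1]
    rw [det_mul_mat, phase_mul, det_adjoint_mat, phase_conj, conj_phase h]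
  have h3 := phase_ne_zero h
  field_simp at h2
  exact h2

/-- Numbers with square `1` that converge are eventually constant. -/
theorem eventually_eq_of_tendsto_of_sq {X : Type*} {l : Filter X} {f : X → ℂ} {c : ℂ}
    (hf : Filter.Tendsto f l (nhds c)) (hc : c ^ 2 = 1) (h2 : ∀ᶠ x in l, f x ^ 2 = 1) :
    ∀ᶠ x in l, f x = c := by
  have hball := hf.eventually (Metric.ball_mem_nhds c one_pos)
  filter_upwards [hball, h2] with x hx hx2
  have h3 : (f x - c) * (f x + c) = 0 := by linear_combination hx2 - hc
  rcases mul_eq_zero.mp h3 with h | h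
  · exact sub_eq_zero.mp h
  · exfalso
    have hcn : ‖c‖ = 1 := by
      have := congrArg norm hc
      rw [norm_pow, norm_one] at this
      exact (pow_eq_one_iff_of_nonneg (norm_nonneg _) two_ne_zero).mp this
    rw [dist_eq_norm, eq_neg_of_add_eq_zero_left h] at hx
    have : ‖-c - c‖ = 2 := by
      rw [show -c - c = (-2 : ℂ) * c by ring, norm_mul, hcn]; norm_num
    linarith

theorem kerOneAdd_mul_starProjection {N : ℕ} (S : Mat N) :
    S * (kerOneAdd S).starProjection = -(kerOneAdd S).starProjection := by
  ext1 v
  have := (kerOneAdd S).starProjection_apply_mem v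
  rw [mem_kerOneAdd] at this
  exact eq_neg_of_add_eq_zero_right this

theorem starProjection_kerOneAdd_mul {N : ℕ} {S : Mat N} (hS : adjoint S * S = 1) :
    (kerOneAdd S).starProjection * S = -(kerOneAdd S).starProjection := by
  set P := (kerOneAdd S).starProjection with hP
  have hPa : adjoint P = P := by
    rw [← ContinuousLinearMap.star_eq_adjoint]
    exact isSelfAdjoint_starProjection (kerOneAdd S)
  have h1 : adjoint S * (S * P) = P := by rw [← mul_assoc, hS, one_mul]
  rw [kerOneAdd_mul_starProjection] at h1
  have h2 := congrArg adjoint h1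
  have h3 : adjoint (adjoint S * -P) = adjoint (-P) * adjoint (adjoint S) :=
    ContinuousLinearMap.adjoint_comp _ _
  rw [h3, map_neg, hPa, ContinuousLinearMap.adjoint_adjoint] at h2
  rw [← neg_eq_iff_eq_neg, ← neg_mul, h2]

theorem starProjection_kerOneAdd_mul_one_add {N : ℕ} {S : Mat N} (hS : adjoint S * S = 1) :
    (kerOneAdd S).starProjection * (1 + S) = 0 := by
  rw [mul_add, mul_one, starProjection_kerOneAdd_mul hS, add_neg_cancel]

/-- Factorization of `1 + S₁` for `S₁` close to `S₀`: the vanishing of the determinant is collected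
in the factor `t` on the kernel of `1 + S₀`. -/
theorem one_add_eq_mul {N : ℕ} {S₀ S₁ G : Mat N} {t : ℂ} (hS₀ : adjoint S₀ * S₀ = 1)
    (h : S₁ = S₀ * (1 + (2 * Complex.I * t) • G)) :
    1 + S₁ = (t • (kerOneAdd S₀).starProjection + (1 - (kerOneAdd S₀).starProjection)) *
      ((1 + S₀) - (2 * Complex.I) • ((kerOneAdd S₀).starProjection * G)
        + (2 * Complex.I * t) • ((1 - (kerOneAdd S₀).starProjection) * S₀ * G)) := by
  set P := (kerOneAdd S₀).starProjection with hP
  have hPS : P * S₀ = -P := starProjection_kerOneAdd_mul hS₀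
  have hPP : P * P = P := (Submodule.isIdempotentElem_starProjection (kerOneAdd S₀)).eq
  have hP1 : P * (1 + S₀) = 0 := starProjection_kerOneAdd_mul_one_add hS₀
  have hQP : (1 - P) * P = 0 := by rw [sub_mul, one_mul, hPP, sub_self]
  have hPQ : P * (1 - P) = 0 := by rw [mul_sub, mul_one, hPP, sub_self]
  have hQQ : (1 - P) * (1 - P) = 1 - P := by rw [mul_sub, mul_one, hQP, sub_zero]
  have e1 : (t • P + (1 - P)) * (1 + S₀) = 1 + S₀ := by
    rw [add_mul, smul_mul_assoc, hP1, smul_zero, zero_add, sub_mul, one_mul, hP1, sub_zero]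
  have e2 : (t • P + (1 - P)) * (P * G) = t • (P * G) := by
    rw [← mul_assoc, add_mul, smul_mul_assoc, hPP, hQP, add_zero, smul_mul_assoc]
  have e3 : (t • P + (1 - P)) * ((1 - P) * S₀ * G) = S₀ * G + P * G := by
    rw [mul_assoc, ← mul_assoc, add_mul, smul_mul_assoc, hPQ, smul_zero, zero_add, hQQ, sub_mul,
      one_mul, ← mul_assoc, hPS, neg_mul, sub_neg_eq_add]
  rw [mul_add, mul_sub, e1, mul_smul_comm, mul_smul_comm, e2, e3, h, mul_add, mul_one,
    mul_smul_comm]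
  module

/-- The sign `r / phase (det (1 + S))`, where `r` is a continuous square root of `det S`, is
constant on both sides of an energy `x`, and jumps there by the parity of the multiplicity of the
eigenvalue `-1` of `S x`. -/
theorem exists_sign_jump {N : ℕ} {S : ℝ → Mat N} {G : ℝ → Mat N} {r : ℝ → ℂ} {x : ℝ}
    (hS : ∀ᶠ y in nhds x, adjoint (S y) * S y = 1 ∧ S y * adjoint (S y) = 1)
    (hG : ∀ᶠ y in nhds x, S y = S x * (1 + (2 * Complex.I * ((y : ℂ) - x)) • G y))
    (hGc : ContinuousAt G x) (hpos : ∀ u, u ≠ 0 → ⟪u, G x u⟫_ℂ ≠ 0) (hr : ContinuousAt r x)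
    (hr2 : ∀ᶠ y in nhds x, r y ^ 2 = phase (S y).det) :
    ∃ c : ℂ, c ^ 2 = 1 ∧
      (∀ᶠ y in nhdsWithin x (Set.Ioi x), (1 + S y).det ≠ 0 ∧ r y / phase (1 + S y).det = c) ∧
      (∀ᶠ y in nhdsWithin x (Set.Iio x), (1 + S y).det ≠ 0 ∧
        r y / phase (1 + S y).det = (-1) ^ Module.finrank ℂ (kerOneAdd (S x)) * c) := by
  set P := (kerOneAdd (S x)).starProjection with hP
  set m := Module.finrank ℂ (kerOneAdd (S x)) with hm
  have hSx := hS.self_of_nhds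
  -- up to the factor `(y - x) ^ m`, the determinant of `1 + S y` is that of `M y`, which does not
  -- vanish at `y = x`
  set M : ℝ → Mat N := fun y => (1 + S x) - (2 * Complex.I) • (P * G y)
    + (2 * Complex.I * ((y : ℂ) - x)) • ((1 - P) * S x * G y) with hM
  have hP1 : P * (1 + S x) = 0 := starProjection_kerOneAdd_mul_one_add hSx.1
  have hMc : ContinuousAt M x := by
    have h1 : ContinuousAt (fun y => P * G y) x := continuousAt_const.mul hGc
    have h2 : ContinuousAt (fun y => (1 - P) * S x * G y) x := continuousAt_const.mul hGc
    have h3 : ContinuousAt (fun y : ℝ => 2 * Complex.I * ((y : ℂ) - x)) x := by fun_prop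
    have h4 : ContinuousAt (fun y => (2 * Complex.I) • (P * G y)) x :=
      h1.const_smul (2 * Complex.I)
    have h5 : ContinuousAt (fun y : ℝ =>
      (2 * Complex.I * ((y : ℂ) - x)) • ((1 - P) * S x * G y)) x := ContinuousAt.smul h3 h2
    have h6 : ContinuousAt (fun _ : ℝ => (1 + S x : Mat N)) x := continuousAt_const
    exact ContinuousAt.add (ContinuousAt.sub h6 h4) h5
  have hMx : (M x).det ≠ 0 := by
    refine det_ne_zero_of_injective fun v hv => ?_
    have hv' : (v + S x v) - (2 * Complex.I) • P (G x v) = 0 := by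
      have : M x v = (v + S x v) - (2 * Complex.I) • P (G x v)
        + (2 * Complex.I * ((x : ℂ) - x)) • ((1 - P) * S x * G x) v := rfl
      rw [this, sub_self, mul_zero, zero_smul, add_zero] at hv
      exact hv
    have h1 : P (v + S x v) = 0 := by
      change (P * (1 + S x)) v = 0
      rw [hP1]; rfl
    have hPP : ∀ w, P (P w) = P w := fun w =>
      Submodule.starProjection_eq_self_iff.mpr ((kerOneAdd (S x)).starProjection_apply_mem w)
    have h2 : P (G x v) = 0 := by
      have := congrArg P hv'
      rw [map_sub, h1, map_smul, hPP, map_zero, zero_sub, neg_eq_zero,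
        smul_eq_zero_iff_right (by simp)] at this
      exact this
    rw [h2, smul_zero, sub_zero] at hv'
    have hPv : P v = v := Submodule.starProjection_eq_self_iff.mpr (mem_kerOneAdd.mpr hv')
    by_contra hne
    refine hpos v hne ?_
    rw [← hPv, hP, Submodule.inner_starProjection_left_eq_right, ← hP, hPv, h2, inner_zero_right]
  have hMd : ContinuousAt (fun y => (M y).det) x :=
    ContinuousLinearMap.continuous_det.continuousAt.comp hMc
  have hMph : Filter.Tendsto (fun y => phase (M y).det) (nhds x) (nhds (phase (M x).det)) :=
    (continuousAt_phase hMx).tendsto.comp hMd.tendsto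
  have hMne : ∀ᶠ y in nhds x, (M y).det ≠ 0 := hMd.eventually_ne hMx
  have hfac : ∀ᶠ y in nhds x, (1 + S y).det = ((y : ℂ) - x) ^ m * (M y).det := by
    filter_upwards [hG] with y hy
    rw [one_add_eq_mul hSx.1 hy, det_mul_mat, det_smul_starProjection_add]
  set c := r x / phase (M x).det with hc
  have hlim : Filter.Tendsto (fun y => r y / phase (M y).det) (nhds x) (nhds c) :=
    hr.tendsto.div hMph (phase_ne_zero hMx)
  have hright : ∀ᶠ y in nhdsWithin x (Set.Ioi x), (1 + S y).det ≠ 0 ∧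
      phase (1 + S y).det = phase (M y).det := by
    filter_upwards [nhdsWithin_le_nhds hfac, nhdsWithin_le_nhds hMne, self_mem_nhdsWithin]
      with y h1 h2 h3
    have h4 : 0 < y - x := sub_pos.mpr h3
    have h5 : (y : ℂ) - x = ((y - x : ℝ) : ℂ) := by push_cast; ring
    rw [h1, h5, phase_mul, phase_pow, phase_ofReal_pos h4, one_pow, one_mul]
    exact ⟨mul_ne_zero (pow_ne_zero _ (Complex.ofReal_ne_zero.mpr h4.ne')) h2, rfl⟩
  have hleft : ∀ᶠ y in nhdsWithin x (Set.Iio x), (1 + S y).det ≠ 0 ∧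
      phase (1 + S y).det = (-1) ^ m * phase (M y).det := by
    filter_upwards [nhdsWithin_le_nhds hfac, nhdsWithin_le_nhds hMne, self_mem_nhdsWithin]
      with y h1 h2 h3
    have h4 : y - x < 0 := sub_neg.mpr h3
    have h5 : (y : ℂ) - x = ((y - x : ℝ) : ℂ) := by push_cast; ring
    rw [h1, h5, phase_mul, phase_pow, phase_ofReal_neg h4]
    exact ⟨mul_ne_zero (pow_ne_zero _ (Complex.ofReal_ne_zero.mpr h4.ne)) h2, rfl⟩
  have hsq : ∀ᶠ y in nhds x, (1 + S y).det ≠ 0 → (r y / phase (1 + S y).det) ^ 2 = 1 := by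
    filter_upwards [hS, hr2] with y h1 h2 h3
    rw [div_pow, h2, phase_det_one_add_sq h1.2 h3, div_self]
    rw [← phase_det_one_add_sq h1.2 h3]
    exact pow_ne_zero _ (phase_ne_zero h3)
  have hsqr : ∀ᶠ y in nhdsWithin x (Set.Ioi x), (r y / phase (M y).det) ^ 2 = 1 := by
    filter_upwards [hright, nhdsWithin_le_nhds hsq] with y h1 h2
    rw [← h1.2]; exact h2 h1.1
  have hsql : ∀ᶠ y in nhdsWithin x (Set.Iio x), (r y / phase (M y).det) ^ 2 = 1 := by
    filter_upwards [hleft, nhdsWithin_le_nhds hsq] with y h1 h2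
    have := h2 h1.1
    rwa [h1.2, div_pow, mul_pow, ← pow_mul, mul_comm m 2, pow_mul, neg_one_sq, one_pow, one_mul,
      ← div_pow] at this
  have hc2 : c ^ 2 = 1 := by
    refine tendsto_nhds_unique ((hlim.mono_left nhdsWithin_le_nhds).pow 2)
      (tendsto_const_nhds.congr' ?_) (l := nhdsWithin x (Set.Ioi x))
    filter_upwards [hsqr] with y hy using hy.symm
  refine ⟨c, hc2, ?_, ?_⟩
  · filter_upwards [hright, eventually_eq_of_tendsto_of_sq
      (hlim.mono_left nhdsWithin_le_nhds) hc2 hsqr] with y h1 h2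
    exact ⟨h1.1, by rw [h1.2, h2]⟩
  · filter_upwards [hleft, eventually_eq_of_tendsto_of_sq
      (hlim.mono_left nhdsWithin_le_nhds) hc2 hsql] with y h1 h2
    refine ⟨h1.1, ?_⟩
    rw [h1.2, ← h2]
    rcases neg_one_pow_eq_or ℂ m with h | h <;> rw [h] <;> simp [div_neg]

/-! ### Counting edge eigenvalues by signs -/

/-- A family `S x k` of unitary matrices, depending on an energy `x` in the open set `U` and on a
momentum `k`, which rotates monotonically in the energy: `G x y k` governs the increment from the
energy `x` to the energy `y`, and is positive for `x = y`. -/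
structure IsScatteringFamily {N : ℕ} (U : Set ℝ) (S : ℝ → ℝ → Mat N) (G : ℝ → ℝ → ℝ → Mat N) :
    Prop where
  isOpen : IsOpen U
  adjoint_mul : ∀ x ∈ U, ∀ k, adjoint (S x k) * S x k = 1
  mul_adjoint : ∀ x ∈ U, ∀ k, S x k * adjoint (S x k) = 1
  eq_mul : ∀ x ∈ U, ∀ y ∈ U, ∀ k,
    S y k = S x k * (1 + (2 * Complex.I * ((y : ℂ) - x)) • G x y k)
  re_inner_pos : ∀ x ∈ U, ∀ k u, u ≠ 0 → 0 < (⟪u, G x x k u⟫_ℂ).re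
  contDiffAt : ∀ x ∈ U, ∀ k, ContDiffAt ℝ 1 (fun p : ℝ × ℝ => S p.1 p.2) (x, k)
  continuousAt : ∀ x ∈ U, ∀ y ∈ U, ∀ k,
    ContinuousAt (fun p : ℝ × ℝ × ℝ => G p.1 p.2.1 p.2.2) (x, y, k)

/-- The multiplicity of the eigenvalue `-1`. -/
def negOneMult {N : ℕ} (S : Mat N) : ℕ := Module.finrank ℂ (kerOneAdd S)

/-- `c x k` is the limit of the sign `r / phase (det (1 + S))` as the energy decreases to `x`; the
limit from below differs by the parity of the multiplicity of the eigenvalue `-1`. -/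
def IsSignFunction {N : ℕ} (S : ℝ → ℝ → Mat N) (r c : ℝ → ℝ → ℂ) (I : Set ℝ) : Prop :=
  ∀ x ∈ I, ∀ k, c x k ^ 2 = 1 ∧
    (∀ᶠ y in nhdsWithin x (Set.Ioi x),
      (1 + S y k).det ≠ 0 ∧ r y k / phase (1 + S y k).det = c x k) ∧
    (∀ᶠ y in nhdsWithin x (Set.Iio x), (1 + S y k).det ≠ 0 ∧
      r y k / phase (1 + S y k).det = (-1) ^ negOneMult (S x k) * c x k)

section

variable {N : ℕ} {U I : Set ℝ} {S : ℝ → ℝ → Mat N} {G : ℝ → ℝ → ℝ → Mat N} {r c : ℝ → ℝ → ℂ}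

theorem IsScatteringFamily.continuousAt_det (hF : IsScatteringFamily U S G) {x : ℝ} (hx : x ∈ U)
    (k : ℝ) : ContinuousAt (fun p : ℝ × ℝ => (1 + S p.1 p.2).det) (x, k) := by
  have h1 : ContinuousAt (fun p : ℝ × ℝ => (1 + S p.1 p.2 : Mat N)) (x, k) :=
    continuousAt_const.add (hF.contDiffAt x hx k).continuousAt
  exact ContinuousAt.comp (f := fun p : ℝ × ℝ => (1 + S p.1 p.2 : Mat N))
    (g := fun X : Mat N => X.det) ContinuousLinearMap.continuous_det.continuousAt h1

theorem IsScatteringFamily.exists_isSignFunction (hF : IsScatteringFamily U S G) (hI : IsOpen I)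
    (hIU : I ⊆ U) (hr : Continuous (fun p : ℝ × ℝ => r p.1 p.2))
    (hr2 : ∀ x ∈ I, ∀ k, r x k ^ 2 = phase (S x k).det) : ∃ c, IsSignFunction S r c I := by
  have h : ∀ x ∈ I, ∀ k, ∃ c : ℂ, c ^ 2 = 1 ∧
    (∀ᶠ y in nhdsWithin x (Set.Ioi x),
      (1 + S y k).det ≠ 0 ∧ r y k / phase (1 + S y k).det = c) ∧
    (∀ᶠ y in nhdsWithin x (Set.Iio x), (1 + S y k).det ≠ 0 ∧
      r y k / phase (1 + S y k).det = (-1) ^ negOneMult (S x k) * c) := by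
    intro x hx k
    have hUx : ∀ᶠ y in nhds x, y ∈ U := hF.isOpen.mem_nhds (hIU hx)
    refine exists_sign_jump (S := fun y => S y k) (G := fun y => G x y k) (r := fun y => r y k)
      ?_ ?_ ?_ (fun u hu h0 => ?_) ?_ ?_
    · filter_upwards [hUx] with y hy using ⟨hF.adjoint_mul y hy k, hF.mul_adjoint y hy k⟩
    · filter_upwards [hUx] with y hy using hF.eq_mul x (hIU hx) y hy k
    · exact ContinuousAt.comp (f := fun y : ℝ => (x, y, k))
        (g := fun p : ℝ × ℝ × ℝ => G p.1 p.2.1 p.2.2)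
        (hF.continuousAt x (hIU hx) x (hIU hx) k) (by fun_prop)
    · exact absurd (hF.re_inner_pos x (hIU hx) k u hu) (by rw [h0]; simp)
    · exact (hr.comp (f := fun y : ℝ => (y, k)) (by fun_prop)).continuousAt
    · filter_upwards [hI.mem_nhds hx] with y hy using hr2 y hy k
  choose c hc using h
  refine ⟨fun x k => by classical exact if hx : x ∈ I then c x hx k else 0, fun x hx k => ?_⟩
  simpa [hx] using hc x hx k

theorem IsSignFunction.eq_of_regular (hc : IsSignFunction S r c I)
    (hF : IsScatteringFamily U S G) (hIU : I ⊆ U)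
    (hr : Continuous (fun p : ℝ × ℝ => r p.1 p.2)) {x : ℝ} (hx : x ∈ I) {k : ℝ}
    (h0 : (1 + S x k).det ≠ 0) : r x k / phase (1 + S x k).det = c x k := by
  have h1 : ContinuousAt (fun y : ℝ => r y k / phase (1 + S y k).det) x := by
    refine ContinuousAt.div (hr.comp (f := fun y : ℝ => (y, k)) (by fun_prop)).continuousAt ?_
      (phase_ne_zero h0)
    exact ContinuousAt.comp (f := fun y : ℝ => (1 + S y k).det) (continuousAt_phase h0)
      (ContinuousAt.comp (f := fun y : ℝ => (y, k)) (hF.continuousAt_det (hIU hx) k) (by fun_prop))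
  refine tendsto_nhds_unique (h1.tendsto.mono_left nhdsWithin_le_nhds)
    (l := nhdsWithin x (Set.Ioi x))
    (tendsto_const_nhds.congr' ?_)
  filter_upwards [(hc x hx k).2.1] with y hy using hy.2.symm

theorem IsSignFunction.eventually_eq (hc : IsSignFunction S r c I)
    (hF : IsScatteringFamily U S G) (hIU : I ⊆ U)
    (hr : Continuous (fun p : ℝ × ℝ => r p.1 p.2)) {x : ℝ} (hx : x ∈ I) {k : ℝ}
    (h0 : (1 + S x k).det ≠ 0) : ∀ᶠ k' in nhds k, c x k' = c x k := by
  have hd : ContinuousAt (fun k' : ℝ => (1 + S x k').det) k :=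
    ContinuousAt.comp (f := fun y : ℝ => (x, y)) (hF.continuousAt_det (hIU hx) k) (by fun_prop)
  have h1 : ContinuousAt (fun k' : ℝ => r x k' / phase (1 + S x k').det) k := by
    refine ContinuousAt.div (hr.comp (f := fun y : ℝ => (x, y)) (by fun_prop)).continuousAt ?_
      (phase_ne_zero h0)
    exact ContinuousAt.comp (f := fun y : ℝ => (1 + S x y).det) (continuousAt_phase h0) hd
  have h2 := hd.eventually_ne h0
  have h3 : ContinuousAt (fun k' => c x k') k := by
    refine h1.congr ?_
    filter_upwards [h2] with k' hk' using hc.eq_of_regular hF hIU hr hx hk'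
  exact eventually_eq_of_tendsto_of_sq h3.tendsto (hc x hx k).1
    (Filter.Eventually.of_forall fun k' => (hc x hx k').1)

/-- Between two energies, the sign changes by the number of eigenvalues in between. -/
theorem IsSignFunction.eq_mul_of_count (hc : IsSignFunction S r c I)
    (hF : IsScatteringFamily U S G) (hI : IsOpen I) (hIU : I ⊆ U)
    (hr : Continuous (fun p : ℝ × ℝ => r p.1 p.2)) {x y : ℝ} (hxy : x ≤ y)
    (hsub : Set.Icc x y ⊆ I) {k : ℝ} (M : Multiset ℝ)
    (hM : ∀ l ∈ Set.Icc x y, negOneMult (S l k) = M.count l) :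
    c y k = (-1) ^ M.countP (fun l => x < l ∧ l ≤ y) * c x k := by
  have hle : ∀ l, ∀ᶠ l' in nhdsWithin l (Set.Ioi l),
      M.countP (fun e => e ≤ l') = M.countP (fun e => e ≤ l) := by
    intro l
    have h1 : ∀ e ∈ M, ∀ᶠ l' in nhdsWithin l (Set.Ioi l), (e ≤ l' ↔ e ≤ l) := by
      intro e _
      by_cases he : e ≤ l
      · filter_upwards [self_mem_nhdsWithin] with l' hl'
        exact ⟨fun _ => he, fun _ => he.trans (le_of_lt hl')⟩
      · filter_upwards [nhdsWithin_le_nhds (Iio_mem_nhds (not_le.mp he))] with l' hl'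
        exact ⟨fun h => absurd hl' (not_lt.mpr h), fun h => absurd h he⟩
    have h2 : ∀ᶠ l' in nhdsWithin l (Set.Ioi l), ∀ e ∈ M.toFinset, (e ≤ l' ↔ e ≤ l) :=
      (Filter.eventually_all_finset M.toFinset).mpr fun e he => h1 e (Multiset.mem_toFinset.mp he)
    filter_upwards [h2] with l' hl'
    exact Multiset.countP_congr rfl fun e he => propext (hl' e (Multiset.mem_toFinset.mpr he))
  have hlt : ∀ l, ∀ᶠ l' in nhdsWithin l (Set.Iio l),
      M.countP (fun e => e ≤ l') + M.count l = M.countP (fun e => e ≤ l) := by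
    intro l
    have h1 : ∀ e ∈ M, ∀ᶠ l' in nhdsWithin l (Set.Iio l), (e ≤ l' ↔ e < l) := by
      intro e _
      by_cases he : e < l
      · filter_upwards [nhdsWithin_le_nhds (Ioi_mem_nhds he)] with l' hl'
        exact ⟨fun _ => he, fun _ => le_of_lt hl'⟩
      · filter_upwards [self_mem_nhdsWithin] with l' hl'
        exact ⟨fun h => lt_of_le_of_lt h hl', fun h => absurd h he⟩
    have h2 : ∀ᶠ l' in nhdsWithin l (Set.Iio l), ∀ e ∈ M.toFinset, (e ≤ l' ↔ e < l) :=
      (Filter.eventually_all_finset M.toFinset).mpr fun e he => h1 e (Multiset.mem_toFinset.mp he)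
    filter_upwards [h2] with l' hl'
    rw [Multiset.countP_congr rfl fun e he => propext (hl' e (Multiset.mem_toFinset.mpr he))]
    clear hl' h1 h2 hM hle
    induction M using Multiset.induction_on with
    | empty => simp
    | cons e M ih =>
      rw [Multiset.countP_cons, Multiset.countP_cons, Multiset.count_cons, ← ih]
      rcases lt_trichotomy e l with h | h | h
      · rw [if_pos h, if_pos h.le, if_neg h.ne']; ring
      · rw [if_neg (not_lt.mpr h.ge), if_pos h.le, if_pos h.symm]; ring
      · rw [if_neg (not_lt.mpr h.le), if_neg (not_le.mpr h), if_neg h.ne]; ring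
  have hsign : ∀ l ∈ I, (∀ᶠ l' in nhdsWithin l (Set.Ioi l), c l' k = c l k) ∧
      ∀ᶠ l' in nhdsWithin l (Set.Iio l), c l' k = (-1) ^ negOneMult (S l k) * c l k := by
    intro l hl
    have hIl := hI.mem_nhds hl
    constructor
    · filter_upwards [(hc l hl k).2.1, nhdsWithin_le_nhds hIl] with l' h1 h2
      rw [← hc.eq_of_regular hF hIU hr h2 h1.1, h1.2]
    · filter_upwards [(hc l hl k).2.2, nhdsWithin_le_nhds hIl] with l' h1 h2
      rw [← hc.eq_of_regular hF hIU hr h2 h1.1, h1.2]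
  -- the jumps of `c` are compensated by the number of eigenvalues up to `l`
  set g : ℝ → ℂ := fun l => (-1) ^ M.countP (fun e => e ≤ l) * c l k with hg
  have hgc : ContinuousOn g (Set.Icc x y) := by
    intro l hl
    have h1 : ∀ᶠ l' in nhdsWithin l (Set.Icc x y), g l' = g l := by
      have hR : ∀ᶠ l' in nhdsWithin l (Set.Ioi l), g l' = g l := by
        filter_upwards [hle l, (hsign l (hsub hl)).1] with l' h1 h2
        simp only [hg]
        rw [h1, h2]
      have hL : ∀ᶠ l' in nhdsWithin l (Set.Iio l), g l' = g l := by
        filter_upwards [hlt l, (hsign l (hsub hl)).2] with l' h1 h2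
        simp only [hg]
        rw [h2, hM l hl, ← h1, pow_add]
        ring
      have hN : ∀ᶠ l' in nhds l, g l' = g l := by
        rw [← nhdsNE_sup_pure, ← nhdsLT_sup_nhdsGT, Filter.eventually_sup, Filter.eventually_sup]
        exact ⟨⟨hL, hR⟩, by simp⟩
      exact nhdsWithin_le_nhds hN
    exact (continuousWithinAt_const (b := g l)).congr_of_eventuallyEq h1 rfl
  have hg2 : ∀ l ∈ Set.Icc x y, g l ^ 2 = 1 := by
    intro l hl
    simp only [hg]
    rw [mul_pow, (hc l (hsub hl) k).1, ← pow_mul, mul_comm _ 2, pow_mul, neg_one_sq, one_pow,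
      mul_one]
  have key := eq_of_sq_eq_one isPreconnected_Icc hgc hg2
    (show y ∈ Set.Icc x y from ⟨hxy, le_rfl⟩) (show x ∈ Set.Icc x y from ⟨le_rfl, hxy⟩)
  have hcount : M.countP (fun e => e ≤ y) =
      M.countP (fun e => e ≤ x) + M.countP (fun e => x < e ∧ e ≤ y) := by
    clear hM hle hlt hgc hg2 key hg g
    induction M using Multiset.induction_on with
    | empty => simp
    | cons e M ih =>
      rw [Multiset.countP_cons, Multiset.countP_cons, Multiset.countP_cons, ih]
      by_cases h1 : e ≤ x
      · have h2 : e ≤ y := h1.trans hxy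
        have h3 : ¬ (x < e ∧ e ≤ y) := fun h => absurd h.1 (not_lt.mpr h1)
        rw [if_pos h2, if_pos h1, if_neg h3]; ring
      · by_cases h2 : e ≤ y
        · rw [if_pos h2, if_neg h1, if_pos ⟨not_le.mp h1, h2⟩]; ring
        · rw [if_neg h2, if_neg h1, if_neg (fun h => h2 h.2)]; ring
  simp only [hg, hcount, pow_add] at key
  rcases neg_one_pow_eq_or ℂ (M.countP fun e => e ≤ x) with h | h <;>
    rcases neg_one_pow_eq_or ℂ (M.countP fun e => x < e ∧ e ≤ y) with h' | h' <;>
    rw [h, h'] at key <;> rw [h'] <;>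
    first | linear_combination key | linear_combination -key

theorem count_map_univ {m : ℕ} (f : Fin m → ℝ) (l : ℝ) :
    (Multiset.map f Finset.univ.val).count l = Nat.card {i // f i = l} := by
  classical
  rw [Multiset.count_map, Nat.card_eq_fintype_card, Fintype.card_subtype]
  simp only [eq_comm (a := l)]
  rfl

theorem countP_map_univ {m : ℕ} (f : Fin m → ℝ) (p : ℝ → Prop) [DecidablePred p]
    (A : Finset (Fin m)) (h : ∀ i, i ∈ A ↔ p (f i)) :
    (Multiset.map f Finset.univ.val).countP p = A.card := by
  rw [Multiset.countP_map]
  change (Finset.univ.filter fun i => p (f i)).card = _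
  congr 1
  ext i
  simp [h]

/-- If the branches in `A` lie above `ν` along `F` and the others lie below, then the sign at energy
`ν` differs along `F` from the one at `k₀` by the parity of `A`. -/
theorem IsSignFunction.eventually_crossing (hc : IsSignFunction S r c I)
    (hF : IsScatteringFamily U S G) (hI : IsOpen I) (hIU : I ⊆ U)
    (hr : Continuous (fun p : ℝ × ℝ => r p.1 p.2)) {ν k₀ : ℝ} (hν : ν ∈ I) {m : ℕ}
    {ε : Fin m → ℝ → ℝ} (hε : ∀ i, ContinuousAt (ε i) k₀ ∧ ε i k₀ = ν) {δ : ℝ} (hδ : 0 < δ)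
    (hmult : ∀ k l, |k - k₀| < δ → |l - ν| < δ →
      negOneMult (S l k) = Nat.card {i // ε i k = l})
    {F : Filter ℝ} (hFk : F ≤ nhds k₀) (A : Finset (Fin m))
    (hA : ∀ᶠ k in F, ∀ i, (i ∈ A → ν < ε i k) ∧ (i ∉ A → ε i k < ν)) :
    ∀ᶠ k in F, c ν k = (-1) ^ A.card * c ν k₀ ∧ negOneMult (S ν k) = 0 := by
  obtain ⟨ρ, hρ, hball⟩ := Metric.isOpen_iff.mp hI ν hν
  -- slightly above `ν` there is an energy `x₁` at which the sign is locally constant in `k`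
  obtain ⟨x₁, ⟨h1, h2⟩, h3, h4⟩ := ((hc ν hν k₀).2.1.and
    ((Ioo_mem_nhdsGT (show ν < ν + min ρ δ by
      have := lt_min hρ hδ; linarith)))).exists
  have hsub : Set.Icc ν x₁ ⊆ I := fun l hl => hball (by
    rw [Metric.mem_ball, Real.dist_eq, abs_of_nonneg (by linarith [hl.1])]
    linarith [hl.2, min_le_left ρ δ])
  have hx₁ : x₁ ∈ I := hsub ⟨h3.le, le_rfl⟩
  have hcx : c x₁ k₀ = c ν k₀ := by rw [← hc.eq_of_regular hF hIU hr hx₁ h1, h2]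
  have e1 := hFk (hc.eventually_eq hF hIU hr hx₁ h1)
  have e2 : ∀ᶠ k in F, ∀ i, ε i k < x₁ := by
    rw [Filter.eventually_all]
    exact fun i => hFk ((hε i).1.eventually_lt_const (by rw [(hε i).2]; exact h3))
  have e3 : ∀ᶠ k in F, |k - k₀| < δ := hFk (Metric.ball_mem_nhds k₀ hδ)
  filter_upwards [e1, e2, e3, hA] with k h5 h6 h7 h8
  have hcard : ∀ i, i ∈ A ↔ ν < ε i k ∧ ε i k ≤ x₁ := fun i =>
    ⟨fun h => ⟨(h8 i).1 h, (h6 i).le⟩, fun h => by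
      by_contra hi
      exact absurd ((h8 i).2 hi) (not_lt.mpr h.1.le)⟩
  have key := hc.eq_mul_of_count hF hI hIU hr h3.le hsub (k := k)
    (Multiset.map (fun i => ε i k) Finset.univ.val) (fun l hl => by
      rw [count_map_univ]
      refine hmult k l h7 ?_
      rw [abs_of_nonneg (by linarith [hl.1])]
      linarith [hl.2, min_le_right ρ δ])
  rw [countP_map_univ _ _ A hcard, h5.trans hcx] at key
  refine ⟨?_, ?_⟩
  · rw [key, ← mul_assoc, ← pow_add, Even.neg_one_pow ⟨_, rfl⟩, one_mul]
  · rw [hmult k ν h7 (by simpa using hδ), Nat.card_eq_zero]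
    left
    refine ⟨fun i => ?_⟩
    by_cases hi : i.1 ∈ A
    · exact absurd i.2 ((h8 i.1).1 hi).ne'
    · exact absurd i.2 ((h8 i.1).2 hi).ne

/-- At a transversal crossing the sign at energy `ν` changes by the numbers of rising and falling
branches; these agree if the crossing is reflection symmetric. -/
theorem IsSignFunction.exists_crossing_numbers (hc : IsSignFunction S r c I)
    (hF : IsScatteringFamily U S G) (hI : IsOpen I) (hIU : I ⊆ U)
    (hr : Continuous (fun p : ℝ × ℝ => r p.1 p.2)) {ν k₀ : ℝ} (hν : ν ∈ I) {m : ℕ}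
    {ε : Fin m → ℝ → ℝ} (hε : ∀ i, ContinuousAt (ε i) k₀ ∧ ε i k₀ = ν ∧ deriv (ε i) k₀ ≠ 0)
    {δ : ℝ} (hδ : 0 < δ)
    (hmult : ∀ k l, |k - k₀| < δ → |l - ν| < δ →
      negOneMult (S l k) = Nat.card {i // ε i k = l}) :
    ∃ n₁ n₂ : ℕ, negOneMult (S ν k₀) = n₁ + n₂ ∧
      (∀ᶠ k in nhdsWithin k₀ (Set.Ioi k₀),
        c ν k = (-1) ^ n₁ * c ν k₀ ∧ negOneMult (S ν k) = 0) ∧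
      (∀ᶠ k in nhdsWithin k₀ (Set.Iio k₀),
        c ν k = (-1) ^ n₂ * c ν k₀ ∧ negOneMult (S ν k) = 0) ∧
      ((∀ x ∈ U, ∀ k, negOneMult (S x (2 * k₀ - k)) = negOneMult (S x k)) → n₁ = n₂) := by
  classical
  set A : Finset (Fin m) := Finset.univ.filter fun i => 0 < deriv (ε i) k₀ with hAdef
  have hsg : ∀ i, ∀ᶠ k in nhds k₀, (i ∈ A → SignType.sign (ε i k - ν) = SignType.sign (k - k₀)) ∧
      (i ∉ A → SignType.sign (ε i k - ν) = -SignType.sign (k - k₀)) := by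
    intro i
    rcases lt_or_gt_of_ne (hε i).2.2 with h | h
    · have hi : i ∉ A := by simp [hAdef, h.le]
      have := eventually_nhdsWithin_sign_eq_of_deriv_neg (f := fun k => ε i k - ν) (x₀ := k₀)
        (by rw [deriv_sub_const]; exact h) (by rw [(hε i).2.1, sub_self])
      filter_upwards [this] with k hk
      refine ⟨fun h' => absurd h' hi, fun _ => ?_⟩
      rw [hk, ← Left.sign_neg, neg_sub]
    · have hi : i ∈ A := by simp [hAdef, h]
      have := eventually_nhdsWithin_sign_eq_of_deriv_pos (f := fun k => ε i k - ν) (x₀ := k₀)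
        (by rw [deriv_sub_const]; exact h) (by rw [(hε i).2.1, sub_self])
      filter_upwards [this] with k hk
      exact ⟨fun _ => hk, fun h' => absurd hi h'⟩
  have hR : ∀ᶠ k in nhdsWithin k₀ (Set.Ioi k₀),
      ∀ i, (i ∈ A → ν < ε i k) ∧ (i ∉ A → ε i k < ν) := by
    filter_upwards [nhdsWithin_le_nhds (Filter.eventually_all.mpr hsg), self_mem_nhdsWithin]
      with k hk hk0 i
    rw [sign_pos (sub_pos.mpr hk0)] at hk
    refine ⟨fun hi => ?_, fun hi => ?_⟩
    · exact sub_pos.mp (sign_eq_one_iff.mp ((hk i).1 hi))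
    · exact sub_neg.mp (sign_eq_neg_one_iff.mp ((hk i).2 hi))
  have hL : ∀ᶠ k in nhdsWithin k₀ (Set.Iio k₀),
      ∀ i, (i ∈ Aᶜ → ν < ε i k) ∧ (i ∉ Aᶜ → ε i k < ν) := by
    filter_upwards [nhdsWithin_le_nhds (Filter.eventually_all.mpr hsg), self_mem_nhdsWithin]
      with k hk hk0 i
    rw [sign_neg (sub_neg.mpr hk0), neg_neg] at hk
    refine ⟨fun hi => ?_, fun hi => ?_⟩
    · exact sub_pos.mp (sign_eq_one_iff.mp ((hk i).2 (Finset.mem_compl.mp hi)))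
    · exact sub_neg.mp (sign_eq_neg_one_iff.mp ((hk i).1 (by simpa using hi)))
  have hε' : ∀ i, ContinuousAt (ε i) k₀ ∧ ε i k₀ = ν := fun i => ⟨(hε i).1, (hε i).2.1⟩
  refine ⟨A.card, Aᶜ.card, ?_,
    hc.eventually_crossing hF hI hIU hr hν hε' hδ hmult nhdsWithin_le_nhds A hR,
    hc.eventually_crossing hF hI hIU hr hν hε' hδ hmult nhdsWithin_le_nhds Aᶜ hL, fun hsym => ?_⟩
  · rw [hmult k₀ ν (by simpa using hδ) (by simpa using hδ), Finset.card_add_card_compl,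
      Nat.card_eq_fintype_card, Fintype.card_subtype]
    simp [(hε' _).2]
  · obtain ⟨ρ, hρ, hball⟩ := Metric.isOpen_iff.mp hF.isOpen ν (hIU hν)
    have hδρ : 0 < min δ ρ := lt_min hδ hρ
    have hclose : ∀ᶠ k in nhds k₀, ∀ i, |ε i k - ν| < min δ ρ := by
      rw [Filter.eventually_all]
      intro i
      have : Filter.Tendsto (fun k => |ε i k - ν|) (nhds k₀) (nhds |ν - ν|) := by
        have := ((hε i).1.tendsto.sub_const ν).abs
        rwa [(hε i).2.1] at this
      rw [sub_self, abs_zero] at this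
      exact this.eventually_lt_const hδρ
    have htend : Filter.Tendsto (fun k => 2 * k₀ - k) (nhdsWithin k₀ (Set.Ioi k₀))
        (nhdsWithin k₀ (Set.Iio k₀)) := by
      refine tendsto_nhdsWithin_iff.mpr ⟨?_, ?_⟩
      · have : Filter.Tendsto (fun k : ℝ => 2 * k₀ - k) (nhds k₀) (nhds (2 * k₀ - k₀)) :=
          (continuous_const.sub continuous_id).tendsto k₀
        rw [show 2 * k₀ - k₀ = k₀ by ring] at this
        exact this.mono_left nhdsWithin_le_nhds
      · filter_upwards [self_mem_nhdsWithin] with k hk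
        have : k₀ < k := hk
        change 2 * k₀ - k < k₀
        linarith
    have hδe : ∀ᶠ k in nhds k₀, |k - k₀| < δ := Metric.ball_mem_nhds k₀ hδ
    obtain ⟨k, h1, h2, h3, h4, h5⟩ := (hR.and ((hclose.filter_mono nhdsWithin_le_nhds).and
      ((htend.eventually hL).and ((htend.eventually (hclose.filter_mono nhdsWithin_le_nhds)).and
        (hδe.filter_mono nhdsWithin_le_nhds))))).exists
    have h6 : |2 * k₀ - k - k₀| < δ := by
      rw [show 2 * k₀ - k - k₀ = -(k - k₀) by ring, abs_neg]; exact h5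
    -- the eigenvalues near `ν` at two reflected momenta are the same; those above `ν` are counted
    -- by `A` on the right and by its complement on the left
    have hMeq : Multiset.map (fun i => ε i k) Finset.univ.val =
        Multiset.map (fun i => ε i (2 * k₀ - k)) Finset.univ.val := by
      ext l
      by_cases hl : |l - ν| < min δ ρ
      · rw [count_map_univ, count_map_univ, ← hmult k l h5 (hl.trans_le (min_le_left _ _)),
          ← hmult _ l h6 (hl.trans_le (min_le_left _ _)), hsym l (hball ?_) k]
        rw [Metric.mem_ball, Real.dist_eq]
        exact hl.trans_le (min_le_right _ _)
      · rw [Multiset.count_eq_zero_of_notMem, Multiset.count_eq_zero_of_notMem]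
        · intro hmem
          obtain ⟨i, -, hi⟩ := Multiset.mem_map.mp hmem
          exact hl (hi ▸ h4 i)
        · intro hmem
          obtain ⟨i, -, hi⟩ := Multiset.mem_map.mp hmem
          exact hl (hi ▸ h2 i)
    rw [← countP_map_univ (fun i => ε i k) (fun l => ν < l) A (fun i => ⟨(h1 i).1, fun h => by
        by_contra hi; exact absurd ((h1 i).2 hi) (not_lt.mpr h.le)⟩), hMeq,
      countP_map_univ (fun i => ε i (2 * k₀ - k)) (fun l => ν < l) Aᶜ (fun i =>
        ⟨(h3 i).1, fun h => by
          by_contra hi; exact absurd ((h3 i).2 hi) (not_lt.mpr h.le)⟩)]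

end

theorem eventually_sum_filter_lt (K : Finset ℝ) (m : ℝ → ℕ) (k₀ : ℝ) :
    (∀ᶠ k in nhdsWithin k₀ (Set.Ioi k₀), ∑ l ∈ K with l < k, m l =
      ∑ l ∈ K with l < k₀, m l + if k₀ ∈ K then m k₀ else 0) ∧
    (∀ᶠ k in nhdsWithin k₀ (Set.Iio k₀), ∑ l ∈ K with l < k, m l = ∑ l ∈ K with l < k₀, m l) := by
  constructor
  · have h : ∀ᶠ k in nhdsWithin k₀ (Set.Ioi k₀), ∀ l ∈ K, (l < k ↔ l ≤ k₀) := by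
      refine (Filter.eventually_all_finset K).mpr fun l _ => ?_
      by_cases hl : l ≤ k₀
      · filter_upwards [self_mem_nhdsWithin] with k hk
        exact ⟨fun _ => hl, fun _ => lt_of_le_of_lt hl hk⟩
      · filter_upwards [nhdsWithin_le_nhds (Iio_mem_nhds (not_le.mp hl))] with k hk
        exact ⟨fun h => absurd hk (not_lt.mpr h.le), fun h => absurd h hl⟩
    filter_upwards [h] with k hk
    rw [Finset.filter_congr hk]
    split_ifs with h0
    · have : K.filter (fun l => l ≤ k₀) = insert k₀ (K.filter fun l => l < k₀) := by
        ext l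
        simp only [Finset.mem_filter, Finset.mem_insert]
        constructor
        · rintro ⟨h1, h2⟩
          rcases h2.lt_or_eq with h | h
          · exact Or.inr ⟨h1, h⟩
          · exact Or.inl h
        · rintro (rfl | h)
          · exact ⟨h0, le_rfl⟩
          · exact ⟨h.1, h.2.le⟩
      rw [this, Finset.sum_insert (by simp), add_comm]
    · rw [add_zero]
      congr 1
      refine Finset.filter_congr fun l hl => ⟨fun h => lt_of_le_of_ne h ?_, le_of_lt⟩
      rintro rfl
      exact h0 hl
  · have h : ∀ᶠ k in nhdsWithin k₀ (Set.Iio k₀), ∀ l ∈ K, (l < k ↔ l < k₀) := by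
      refine (Filter.eventually_all_finset K).mpr fun l _ => ?_
      by_cases hl : l < k₀
      · filter_upwards [nhdsWithin_le_nhds (Ioi_mem_nhds hl)] with k hk
        exact ⟨fun _ => hl, fun _ => hk⟩
      · filter_upwards [self_mem_nhdsWithin] with k hk
        exact ⟨fun h => h.trans hk, fun h => absurd h hl⟩
    filter_upwards [h] with k hk
    rw [Finset.filter_congr hk]

theorem norm_det_of_unitary {N : ℕ} {X : Mat N} (h : X * adjoint X = 1) : ‖X.det‖ = 1 := by
  have h1 := congrArg (fun Y : Mat N => ‖Y.det‖) h
  simp only [det_mul_mat, det_adjoint_mat, det_one_mat, norm_mul, RCLike.norm_conj, norm_one] at h1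
  nlinarith [norm_nonneg X.det]

/-- The number of transversal crossings of the energy `ν` over half a period, those at the end
points counted half, is given modulo `2` by the sign of the scattering matrix at energy `ν`. -/
theorem exists_isKramersSign_of_crossings {N : ℕ} (hN : Even N) {U : Set ℝ} {S : ℝ → ℝ → Mat N}
    {G : ℝ → ℝ → ℝ → Mat N} (hF : IsScatteringFamily U S G)
    {T : ℝ → ℝ → Matrix (Fin N) (Fin N) ℂ} (hTdet : ∀ x k, (T x k).det = (S x k).det)
    (hTdet1 : ∀ x k, (1 + T x k).det = (1 + S x k).det)
    (hTc : ∀ x ∈ U, ∀ k, ContinuousAt (fun y => T y k) x)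
    (hT0 : ∀ x ∈ U, T x 0 * tau (T x 0) = 1)
    (hTpi : ∀ x ∈ U, T x Real.pi * tau (T x Real.pi) = 1)
    (hsym : ∀ x ∈ U, ∀ k, negOneMult (S x (-k)) = negOneMult (S x k))
    (hper : ∀ x k, S x (k + 2 * Real.pi) = S x k) {ν : ℝ} (hν : ν ∈ U)
    (hbr : ∀ k₀, ∃ (m : ℕ) (ε : Fin m → ℝ → ℝ),
      (∀ i, ContinuousAt (ε i) k₀ ∧ ε i k₀ = ν ∧ deriv (ε i) k₀ ≠ 0) ∧
      ∃ δ > 0, ∀ k l, |k - k₀| < δ → |l - ν| < δ →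
        negOneMult (S l k) = Nat.card {i // ε i k = l})
    {K : Finset ℝ} (hK : ∀ k, k ∈ K ↔ k ∈ Set.Icc 0 Real.pi ∧ negOneMult (S ν k) ≠ 0) :
    ∃ n : ℕ, 2 * n = ∑ k ∈ K, (if k = 0 ∨ k = Real.pi then negOneMult (S ν k)
      else 2 * negOneMult (S ν k)) ∧ IsKramersSign (T ν) ((-1) ^ n) := by
  have hpi := Real.pi_pos
  obtain ⟨ρ, hρ, hball⟩ := Metric.isOpen_iff.mp hF.isOpen ν hν
  set ρ' := ρ / 2 with hρ'
  have hρ'0 : 0 < ρ' := by positivity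
  have hcl : Set.Icc (ν - ρ') (ν + ρ') ⊆ U := fun l hl => hball (by
    rw [Metric.mem_ball, Real.dist_eq, abs_lt]
    constructor <;> linarith [hl.1, hl.2])
  have hle : ν - ρ' ≤ ν + ρ' := by linarith
  set I := Set.Ioo (ν - ρ') (ν + ρ') with hIdef
  have hI : IsOpen I := isOpen_Ioo
  have hIcc : I ⊆ Set.Icc (ν - ρ') (ν + ρ') := Set.Ioo_subset_Icc_self
  have hIU : I ⊆ U := hIcc.trans hcl
  have hνI : ν ∈ I := ⟨by linarith, by linarith⟩
  -- the projection `p` extends the family near `ν` to all energies, over which `det S` has a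
  -- continuous argument
  set p : ℝ → ℝ := fun x => (Set.projIcc _ _ hle x : ℝ) with hp
  have hpc : Continuous p := continuous_subtype_val.comp continuous_projIcc
  have hpU : ∀ x, p x ∈ U := fun x => hcl (Set.projIcc _ _ hle x).2
  have hpe : ∀ x ∈ I, p x = x := fun x hx => by
    simp only [hp, Set.projIcc_of_mem hle (hIcc hx)]
  obtain ⟨f, hf, hfe⟩ := exists_continuous_arg (g := fun q : ℝ × ℝ => (S (p q.1) q.2).det)
    (by
      rw [continuous_iff_continuousAt]
      rintro ⟨x, k⟩
      have h1 := (hF.contDiffAt (p x) (hpU x) k).continuousAt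
      have h2 : ContinuousAt (fun q : ℝ × ℝ => S (p q.1) q.2) (x, k) :=
        ContinuousAt.comp (f := fun q : ℝ × ℝ => (p q.1, q.2))
          (g := fun q : ℝ × ℝ => S q.1 q.2) h1 (by fun_prop)
      exact ContinuousAt.comp (f := fun q : ℝ × ℝ => S (p q.1) q.2)
        (g := fun X : Mat N => X.det) ContinuousLinearMap.continuous_det.continuousAt h2)
    (fun q => norm_det_of_unitary (hF.mul_adjoint _ (hpU q.1) q.2))
  set r : ℝ → ℝ → ℂ := fun x k => Complex.exp (Complex.I * ((f (x, k) / 2 : ℝ) : ℂ)) with hrdef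
  have hr : Continuous (fun q : ℝ × ℝ => r q.1 q.2) := by
    simp only [hrdef]
    fun_prop
  have hr2 : ∀ x ∈ I, ∀ k, r x k ^ 2 = phase (S x k).det := by
    intro x hx k
    have h1 := hfe (x, k)
    simp only [hpe x hx] at h1
    rw [phase_of_norm_one (norm_det_of_unitary (hF.mul_adjoint _ (hIU hx) k)), ← h1, hrdef]
    simp only
    rw [← Complex.exp_nat_mul]
    congr 1
    push_cast
    ring
  obtain ⟨c, hc⟩ := hF.exists_isSignFunction hI hIU hr hr2
  -- at the symmetric momenta the sign is computed from `kramersRoot`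
  have hend : ∀ k, (∀ x ∈ U, T x k * tau (T x k) = 1) →
      c ν k * kramersRoot (T ν k) = r ν k := by
    intro k hTk
    have h1 : ContinuousAt (fun y => kramersRoot (T y k)) ν := by
      have h2 := (continuousOn_kramersRoot hN) (T ν k) (hTk ν hν)
      refine h2.tendsto.comp (tendsto_nhdsWithin_iff.mpr ⟨(hTc ν hν k).tendsto, ?_⟩)
      filter_upwards [hF.isOpen.mem_nhds hν] with y hy using hTk y hy
    have h3 : Filter.Tendsto (fun y => r y k / kramersRoot (T y k)) (nhdsWithin ν (Set.Ioi ν))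
        (nhds (r ν k / kramersRoot (T ν k))) := by
      refine Filter.Tendsto.mono_left ?_ nhdsWithin_le_nhds
      exact ((hr.comp (f := fun y : ℝ => (y, k)) (by fun_prop)).tendsto ν).div h1.tendsto
        (kramersRoot_ne_zero _)
    have h4 := tendsto_nhds_unique h3 (tendsto_const_nhds.congr' (f₁ := fun _ => c ν k) (by
      filter_upwards [(hc ν hνI k).2.1, nhdsWithin_le_nhds (hF.isOpen.mem_nhds hν)] with y hy hyU
      rw [← hy.2, kramersRoot_eq hN (hTk y hyU) (z := 1) norm_one
        (by rw [one_smul, map_one, one_smul, hTdet1]; exact hy.1), one_smul, map_one, one_smul,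
        hTdet1]))
    rw [← h4, div_mul_cancel₀ _ (kramersRoot_ne_zero _)]
  have hcross : ∀ k₀, ∃ n₁ n₂ : ℕ, negOneMult (S ν k₀) = n₁ + n₂ ∧
      (∀ᶠ k in nhdsWithin k₀ (Set.Ioi k₀),
        c ν k = (-1) ^ n₁ * c ν k₀ ∧ negOneMult (S ν k) = 0) ∧
      (∀ᶠ k in nhdsWithin k₀ (Set.Iio k₀),
        c ν k = (-1) ^ n₂ * c ν k₀ ∧ negOneMult (S ν k) = 0) ∧
      ((∀ x ∈ U, ∀ k, negOneMult (S x (2 * k₀ - k)) = negOneMult (S x k)) → n₁ = n₂) := by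
    intro k₀
    obtain ⟨m, ε, hε, δ, hδ, hm⟩ := hbr k₀
    exact hc.exists_crossing_numbers hF hI hIU hr hνI hε hδ hm
  choose n₁ n₂ hsum hright hleft hnn using hcross
  set m : ℝ → ℕ := fun k => negOneMult (S ν k) with hm
  have hsym0 : n₁ 0 = n₂ 0 := hnn 0 fun x hx k => by rw [mul_zero, zero_sub, hsym x hx]
  have hsymp : n₁ Real.pi = n₂ Real.pi := hnn _ fun x hx k => by
    rw [← hsym x hx, ← hper x (-_)]
    congr 2
    ring
  -- `c ν` changes by the parity of `E`: arriving at `k` from the left adds the `n₂ k` falling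
  -- branches, and leaving to the right adds the `n₁ k` rising ones
  set E : ℝ → ℕ := fun k => ∑ l ∈ K with l < k, m l + n₂ k with hE
  set g : ℝ → ℂ := fun k => (-1) ^ E k * c ν k with hg
  have hgc : ContinuousOn g (Set.Icc 0 Real.pi) := by
    intro k₀ hk₀
    obtain ⟨hs1, hs2⟩ := eventually_sum_filter_lt K m k₀
    have hK0 : (if k₀ ∈ K then m k₀ else 0) = m k₀ := by
      split_ifs with h
      · rfl
      · by_contra h0
        exact h ((hK k₀).mpr ⟨hk₀, fun h' => h0 h'.symm⟩)
    rw [hK0] at hs1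
    have hz : ∀ k, m k = 0 → n₂ k = 0 := fun k hk => by
      have := hsum k
      simp only [hm] at hk
      omega
    have hR : ∀ᶠ k in nhdsWithin k₀ (Set.Ioi k₀), g k = g k₀ := by
      filter_upwards [hs1, hright k₀] with k h1 h2
      simp only [hg, hE]
      rw [h1, hz k h2.2, h2.1, add_zero, hm]
      simp only
      rw [hsum k₀, ← mul_assoc, ← pow_add]
      congr 1
      rw [show ∑ l ∈ K with l < k₀, negOneMult (S ν l) + (n₁ k₀ + n₂ k₀) + n₁ k₀
        = 2 * n₁ k₀ + (∑ l ∈ K with l < k₀, negOneMult (S ν l) + n₂ k₀) by ring, pow_add, pow_mul,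
        neg_one_sq, one_pow, one_mul]
    have hL : ∀ᶠ k in nhdsWithin k₀ (Set.Iio k₀), g k = g k₀ := by
      filter_upwards [hs2, hleft k₀] with k h1 h2
      simp only [hg, hE]
      rw [h1, hz k h2.2, h2.1, add_zero, ← mul_assoc, ← pow_add]
    have hNh : ∀ᶠ k in nhds k₀, g k = g k₀ := by
      rw [← nhdsNE_sup_pure, ← nhdsLT_sup_nhdsGT, Filter.eventually_sup, Filter.eventually_sup]
      exact ⟨⟨hL, hR⟩, by simp⟩
    exact (continuousWithinAt_const (b := g k₀)).congr_of_eventuallyEq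
      (nhdsWithin_le_nhds hNh) rfl
  have hg2 : ∀ k ∈ Set.Icc 0 Real.pi, g k ^ 2 = 1 := by
    intro k _
    simp only [hg]
    rw [mul_pow, (hc ν hνI k).1, ← pow_mul, mul_comm _ 2, pow_mul, neg_one_sq, one_pow, mul_one]
  have key := eq_of_sq_eq_one isPreconnected_Icc hgc hg2
    (show Real.pi ∈ Set.Icc 0 Real.pi from ⟨hpi.le, le_rfl⟩)
    (show (0 : ℝ) ∈ Set.Icc 0 Real.pi from ⟨le_rfl, hpi.le⟩)
  set K' := K.filter (fun k => 0 < k ∧ k < Real.pi) with hK'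
  have hE0 : E 0 = n₂ 0 := by
    simp only [hE]
    rw [Finset.sum_eq_zero, zero_add]
    intro l hl
    rw [Finset.mem_filter] at hl
    exact absurd hl.2 (not_lt.mpr ((hK l).mp hl.1).1.1)
  have hmK : ∀ k ∈ Set.Icc 0 Real.pi, k ∉ K → m k = 0 := fun k hk hkK => by
    by_contra h0
    exact hkK ((hK k).mpr ⟨hk, h0⟩)
  have hEpi : E Real.pi = m 0 + ∑ l ∈ K', m l + n₂ Real.pi := by
    simp only [hE]
    congr 1
    rw [← Finset.sum_insert (s := K') (a := (0 : ℝ)) (by simp [hK'])]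
    refine Finset.sum_subset (fun l hl => ?_) (fun l hl hl' => ?_)
    · rw [Finset.mem_filter] at hl
      rcases ((hK l).mp hl.1).1.1.lt_or_eq with h | h
      · exact Finset.mem_insert_of_mem (Finset.mem_filter.mpr ⟨hl.1, h, hl.2⟩)
      · rw [← h]; exact Finset.mem_insert_self _ _
    · rcases Finset.mem_insert.mp hl with rfl | h
      · exact hmK 0 ⟨le_rfl, hpi.le⟩ fun h0 => hl' (Finset.mem_filter.mpr ⟨h0, hpi⟩)
      · rw [Finset.mem_filter] at h
        exact absurd (Finset.mem_filter.mpr ⟨h.1, h.2.2⟩) hl'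
  refine ⟨n₂ 0 + ∑ l ∈ K', m l + n₂ Real.pi, ?_, r ν, ?_,
    fun k _ => by rw [hTdet]; exact hr2 ν hνI k, ?_⟩
  · have h1 : ∑ k ∈ K, (if k = 0 ∨ k = Real.pi then m k else 2 * m k) =
        ∑ k ∈ insert 0 (insert Real.pi K'), (if k = 0 ∨ k = Real.pi then m k else 2 * m k) := by
      refine Finset.sum_subset (fun l hl => ?_) (fun l hl hl' => ?_)
      · rcases ((hK l).mp hl).1.1.lt_or_eq with h | h
        · rcases ((hK l).mp hl).1.2.lt_or_eq with h' | h'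
          · exact Finset.mem_insert_of_mem (Finset.mem_insert_of_mem
              (Finset.mem_filter.mpr ⟨hl, h, h'⟩))
          · rw [h']; exact Finset.mem_insert_of_mem (Finset.mem_insert_self _ _)
        · rw [← h]; exact Finset.mem_insert_self _ _
      · rcases Finset.mem_insert.mp hl with rfl | h
        · rw [hmK 0 ⟨le_rfl, hpi.le⟩ hl']; simp
        · rcases Finset.mem_insert.mp h with rfl | h
          · rw [hmK _ ⟨hpi.le, le_rfl⟩ hl']; simp
          · exact absurd (Finset.mem_filter.mp h).1 hl'
    rw [h1, Finset.sum_insert (by simp [hK', hpi.ne]), Finset.sum_insert (by simp [hK'])]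
    have h2 : ∑ k ∈ K', (if k = 0 ∨ k = Real.pi then m k else 2 * m k) = 2 * ∑ l ∈ K', m l := by
      rw [Finset.mul_sum]
      refine Finset.sum_congr rfl fun k hk => ?_
      rw [Finset.mem_filter] at hk
      rw [if_neg]
      rintro (h | h)
      · exact hk.2.1.ne' h
      · exact hk.2.2.ne h
    rw [h2, if_pos (Or.inl rfl), if_pos (Or.inr rfl)]
    have h3 : m 0 = n₁ 0 + n₂ 0 := hsum 0
    have h4 : m Real.pi = n₁ Real.pi + n₂ Real.pi := hsum Real.pi
    omega
  · exact (hr.comp (f := fun k : ℝ => (ν, k)) (by fun_prop)).continuousOn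
  · have e0 := hend 0 hT0
    have e1 := hend Real.pi hTpi
    simp only [hg] at key
    have h3 : m 0 = n₁ 0 + n₂ 0 := hsum 0
    rw [hE0, hEpi, show m 0 + ∑ l ∈ K', m l + n₂ Real.pi
      = n₂ 0 + (n₂ 0 + ∑ l ∈ K', m l + n₂ Real.pi) by omega, pow_add, mul_assoc] at key
    have key2 := mul_left_cancel₀ (pow_ne_zero _ (neg_ne_zero.mpr one_ne_zero)) key
    rw [← e0, ← e1, ← key2]
    have hs : ((-1 : ℂ) ^ (n₂ 0 + ∑ l ∈ K', m l + n₂ Real.pi)) ^ 2 = 1 := by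
      rw [← pow_mul, mul_comm _ 2, pow_mul, neg_one_sq, one_pow]
    linear_combination (-c ν Real.pi * kramersRoot (T ν 0) * kramersRoot (T ν Real.pi)) * hs

/-! ### Time reversal -/

/-- Time-reversal symmetry of the edge Hamiltonian in terms of its coefficients. -/
structure IsEdgeReversal {N : ℕ} {B : BulkHamiltonian N} (S : EdgeHamiltonian B)
    (Θ : Internal N →ₛₗ[starRingEnd ℂ] Internal N) : Prop where
  sq : ∀ x, Θ (Θ x) = -x
  antiunitary : ∀ x y, ⟪Θ x, Θ y⟫_ℂ = ⟪y, x⟫_ℂ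
  hopping : ∀ k u, B.A (-k) (Θ u) = Θ (B.A k u)
  hopping_adjoint : ∀ k u, adjoint (B.A (-k)) (Θ u) = Θ (adjoint (B.A k) u)
  potential : ∀ k j u, S.V (-k) j (Θ u) = Θ (S.V k j u)

theorem norm_antiunitary {N : ℕ} {Θ : Internal N →ₛₗ[starRingEnd ℂ] Internal N}
    (h : ∀ x y, ⟪Θ x, Θ y⟫_ℂ = ⟪y, x⟫_ℂ) (x : Internal N) : ‖Θ x‖ = ‖x‖ := by
  rw [@norm_eq_sqrt_re_inner ℂ, @norm_eq_sqrt_re_inner ℂ, h]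

theorem continuous_antiunitary {N : ℕ} {Θ : Internal N →ₛₗ[starRingEnd ℂ] Internal N}
    (h : ∀ x y, ⟪Θ x, Θ y⟫_ℂ = ⟪y, x⟫_ℂ) : Continuous Θ :=
  AddMonoidHomClass.continuous_of_bound Θ 1 fun x => by rw [one_mul, norm_antiunitary h]

theorem IsTimeReversal.isEdgeReversal {N : ℕ} {B : BulkHamiltonian N} {S : EdgeHamiltonian B}
    {Θ : Internal N →ₛₗ[starRingEnd ℂ] Internal N} (h : IsTimeReversal B S Θ) :
    IsEdgeReversal S Θ := by
  have hcoe : ∀ (j : ℕ) (u : Internal N) (i : ℕ),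
      (lp.single (E := fun _ : ℕ => Internal N) 2 j u) i = if i = j then u else 0 := by
    intro j u i
    rw [lp.single_apply]
    split_ifs with h
    · subst h; simp
    · simp [h]
  have hs : ∀ (j : ℕ) (u : Internal N) (n : ℕ),
      (lp.single (E := fun _ : ℕ => Internal N) 2 j (Θ u)) n
        = Θ ((lp.single (E := fun _ : ℕ => Internal N) 2 j u) n) := by
    intro j u n
    rw [hcoe, hcoe]
    split_ifs <;> simp
  have key := fun (k : ℝ) (j : ℕ) (u : Internal N) => h.edge k _ _ (hs j u)
  refine ⟨h.sq, h.antiunitary, fun k u => ?_, fun k u => ?_, fun k j u => ?_⟩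
  · have := key k 0 u 1
    rw [S.op_apply_succ, S.op_apply_succ] at this
    simpa [hcoe] using this
  · have := key k 1 u 0
    rw [S.op_apply_zero, S.op_apply_zero] at this
    simpa [hcoe] using this
  · have := key k j u j
    cases j with
    | zero =>
      rw [S.op_apply_zero, S.op_apply_zero] at this
      simpa [hcoe] using this
    | succ j =>
      rw [S.op_apply_succ, S.op_apply_succ] at this
      simpa [hcoe] using this

theorem IsTimeReversal.bulk_potential {N : ℕ} {B : BulkHamiltonian N} {S : EdgeHamiltonian B}
    {Θ : Internal N →ₛₗ[starRingEnd ℂ] Internal N} (h : IsTimeReversal B S Θ) (k : ℝ) (n : ℤ)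
    (u : Internal N) : B.V (-k) n (Θ u) = Θ (B.V k n u) := by
  have hcoe : ∀ (j : ℤ) (u : Internal N) (i : ℤ),
      (lp.single (E := fun _ : ℤ => Internal N) 2 j u) i = if i = j then u else 0 := by
    intro j u i
    rw [lp.single_apply]
    split_ifs with h
    · subst h; simp
    · simp [h]
  have hs : ∀ m : ℤ, (lp.single (E := fun _ : ℤ => Internal N) 2 n (Θ u)) m
        = Θ ((lp.single (E := fun _ : ℤ => Internal N) 2 n u) m) := by
    intro m
    rw [hcoe, hcoe]
    split_ifs <;> simp
  have := h.bulk k _ _ hs n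
  rw [B.op_apply, B.op_apply] at this
  simpa [hcoe] using this

/-- `Θ` acting on square-summable sequences. -/
theorem exists_reversed {N : ℕ} {Θ : Internal N →ₛₗ[starRingEnd ℂ] Internal N}
    (h : ∀ x y, ⟪Θ x, Θ y⟫_ℂ = ⟪y, x⟫_ℂ) (f : L2 ℕ N) : ∃ g : L2 ℕ N, ∀ j, g j = Θ (f j) :=
  ⟨⟨fun j => Θ (f j), (lp.memℓp f).mono' fun j => (norm_antiunitary h (f j)).le⟩, fun _ => rfl⟩

/-- Time reversal exchanges incoming and outgoing amplitudes. -/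
theorem scat_reversal {N : ℕ} {Θ : Internal N →ₛₗ[starRingEnd ℂ] Internal N}
    (hanti : ∀ x y, ⟪Θ x, Θ y⟫_ℂ = ⟪y, x⟫_ℂ) {A A' : Mat N} {V V' : BddSeq ℕ N}
    (hA : ∀ u, A' (Θ u) = Θ (A u)) (hA' : ∀ u, adjoint A' (Θ u) = Θ (adjoint A u))
    (hV : ∀ j u, V' j (Θ u) = Θ (V j u)) {x : ℝ}
    (h : IsUnit (dissOp A V - (x : ℂ) • (1 : L2 ℕ N →L[ℂ] L2 ℕ N)))
    (h' : IsUnit (dissOp A' V' - (x : ℂ) • (1 : L2 ℕ N →L[ℂ] L2 ℕ N))) (u : Internal N) :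
    scat A' V' x (Θ (scat A V x u)) = Θ u := by
  set f := solOp A V x u with hf
  obtain ⟨g, hg⟩ := exists_reversed hanti f
  have h1 := halfOp_solOp h u
  rw [← hf] at h1
  have h2 : halfOp A' V' g = (x : ℂ) • g -
      inclFirst N (A' (Θ (u - Complex.I • adjoint A (f 0)))) := by
    ext1; funext j
    have h3 := congrArg (fun F : L2 ℕ N => Θ (F j)) h1
    change halfOp A' V' g j = (x : ℂ) • g j -
      inclFirst N (A' (Θ (u - Complex.I • adjoint A (f 0)))) j
    change Θ (halfOp A V f j) = Θ ((x : ℂ) • f j -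
      inclFirst N (A (u - Complex.I • adjoint A (f 0))) j) at h3
    rw [map_sub, LinearMap.map_smulₛₗ, Complex.conj_ofReal] at h3
    cases j with
    | zero =>
      rw [halfOp_apply_zero, map_add, inclFirst_apply_zero] at h3
      rw [halfOp_apply_zero, inclFirst_apply_zero, hg, hg, hA', hV, hA, h3]
    | succ j =>
      rw [halfOp_apply_succ, map_add, map_add, inclFirst_apply_succ, map_zero] at h3
      rw [halfOp_apply_succ, inclFirst_apply_succ, hg, hg, hg, hA', hV, hA, h3]
  have h4 := eq_solOp h' h2
  have h5 : Θ (u - Complex.I • adjoint A (f 0)) + Complex.I • adjoint A' (g 0)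
      = Θ (scat A V x u) := by
    rw [hg, hA', scat_apply, ← hf, map_sub, map_sub, LinearMap.map_smulₛₗ, LinearMap.map_smulₛₗ,
      map_mul, Complex.conj_I, map_ofNat]
    module
  rw [h5] at h4
  rw [scat_apply, ← h4, hg, hA', scat_apply, ← hf, map_sub, LinearMap.map_smulₛₗ, map_mul,
    Complex.conj_I, map_ofNat]
  module

theorem finrank_le_of_antilinear {N : ℕ} {Θ : Internal N →ₛₗ[starRingEnd ℂ] Internal N}
    (hsq : ∀ x, Θ (Θ x) = -x) {K K' : Submodule ℂ (Internal N)} (h : ∀ x ∈ K, Θ x ∈ K') :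
    Module.finrank ℂ K ≤ Module.finrank ℂ K' := by
  set b := Module.finBasis ℂ K
  have hli : LinearIndependent ℂ fun i => (⟨Θ (b i), h _ (b i).2⟩ : K') := by
    rw [Fintype.linearIndependent_iff]
    intro g hg i
    have h1 : Θ (∑ i, conj (g i) • (b i : Internal N)) = 0 := by
      have := congrArg (Subtype.val : K' → Internal N) hg
      simpa using this
    have h2 : ∑ i, conj (g i) • (b i : Internal N) = 0 := by
      have := hsq (∑ i, conj (g i) • (b i : Internal N))
      rw [h1, map_zero] at this
      exact neg_eq_zero.mp this.symm
    have h3 : ∑ i, conj (g i) • b i = 0 := Subtype.ext (by simpa using h2)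
    have := Fintype.linearIndependent_iff.mp b.linearIndependent _ h3 i
    simpa using this
  simpa using hli.fintype_card_le_finrank

/-- The matrix of an antilinear map. -/
theorem exists_matrix_antilinear {N : ℕ} {Θ : Internal N →ₛₗ[starRingEnd ℂ] Internal N}
    (hsq : ∀ x, Θ (Θ x) = -x) :
    ∃ M : Matrix (Fin N) (Fin N) ℂ, (∀ x : Fin N → ℂ,
      (Θ (WithLp.toLp 2 x)).ofLp = M.mulVec fun i => conj (x i)) ∧
      M * M.map (starRingEnd ℂ) = -1 := by
  set M : Matrix (Fin N) (Fin N) ℂ := Matrix.of fun i j => Θ (EuclideanSpace.single j 1) i with hMd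
  have hM : ∀ x : Fin N → ℂ,
      (Θ (WithLp.toLp 2 x)).ofLp = M.mulVec fun i => conj (x i) := by
    intro x
    have h1 : WithLp.toLp 2 x = ∑ j, x j • (EuclideanSpace.single j (1 : ℂ) : Internal N) := by
      ext i
      simp [Finset.sum_apply, Pi.single_apply]
    rw [h1, map_sum]
    ext i
    simp [hMd, Matrix.mulVec, dotProduct, mul_comm]
  refine ⟨M, hM, ?_⟩
  apply Matrix.toLin'.injective
  refine LinearMap.ext fun x => ?_
  have h3 := congrArg WithLp.ofLp (hsq (WithLp.toLp 2 x))
  have h4 : Θ (WithLp.toLp 2 x) = WithLp.toLp 2 (M.mulVec fun i => conj (x i)) := by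
    rw [← hM x]
  rw [h4, hM, conj_mulVec, Matrix.mulVec_mulVec] at h3
  simp only [Complex.conj_conj] at h3
  rw [Matrix.toLin'_apply, Matrix.toLin'_apply, h3, Matrix.neg_mulVec, Matrix.one_mulVec]
  rfl

theorem even_of_antilinear {N : ℕ} {Θ : Internal N →ₛₗ[starRingEnd ℂ] Internal N}
    (hsq : ∀ x, Θ (Θ x) = -x) : Even N := by
  obtain ⟨M, -, h1⟩ := exists_matrix_antilinear hsq
  have h5 := congrArg Matrix.det h1
  have h6 : (M.map (starRingEnd ℂ)).det = conj M.det := by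
    rw [RingHom.map_det]; rfl
  rw [Matrix.det_mul, h6, Complex.mul_conj, Matrix.det_neg, Matrix.det_one, mul_one,
    Fintype.card_fin] at h5
  by_contra hodd
  rw [Nat.not_even_iff_odd] at hodd
  rw [hodd.neg_one_pow] at h5
  have h7 : Complex.normSq M.det = -1 := by exact_mod_cast h5
  linarith [Complex.normSq_nonneg M.det]

/-- The columns of `M` form a basis in which `Θ` is given by `-ε C`. -/
def IsAdapted {N : ℕ} (Θ : Internal N →ₛₗ[starRingEnd ℂ] Internal N)
    (M : Matrix (Fin N) (Fin N) ℂ) : Prop :=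
  M.det ≠ 0 ∧ ∀ x : Fin N → ℂ,
    Θ (WithLp.toLp 2 (M.mulVec x)) = -WithLp.toLp 2 (M.mulVec (thetaZero N x))

theorem exists_isAdapted {N : ℕ} {Θ : Internal N →ₛₗ[starRingEnd ℂ] Internal N}
    (hsq : ∀ x, Θ (Θ x) = -x) : ∃ M, IsAdapted Θ M := by
  have hN := even_of_antilinear hsq
  obtain ⟨R, hR, hRR⟩ := exists_matrix_antilinear hsq
  -- `X ↦ R conj(X) ε` is an involution; its fixed points are obtained by averaging
  obtain ⟨z, -, hz⟩ := exists_unit_det_ne_zero (R * epsMatrix N)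
  refine ⟨_, hz, fun x => ?_⟩
  have hfix : R * (z • (1 : Matrix (Fin N) (Fin N) ℂ) + conj z • (R * epsMatrix N)).map
      (starRingEnd ℂ) = -((z • (1 : Matrix (Fin N) (Fin N) ℂ) + conj z • (R * epsMatrix N))
        * epsMatrix N) := by
    have h1 : (z • (1 : Matrix (Fin N) (Fin N) ℂ) + conj z • (R * epsMatrix N)).map
        (starRingEnd ℂ) = conj z • (1 : Matrix (Fin N) (Fin N) ℂ)
          + z • (R.map (starRingEnd ℂ) * epsMatrix N) := by
      have h0 : (R * epsMatrix N).map (starRingEnd ℂ) = R.map (starRingEnd ℂ) * epsMatrix N := by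
        rw [Matrix.map_mul, epsMatrix_map_conj]
      have h00 : ∀ Y : Matrix (Fin N) (Fin N) ℂ,
          (z • (1 : Matrix (Fin N) (Fin N) ℂ) + conj z • Y).map (starRingEnd ℂ) =
          conj z • (1 : Matrix (Fin N) (Fin N) ℂ) + z • Y.map (starRingEnd ℂ) := by
        intro Y
        ext i j
        by_cases hij : i = j
        · subst hij; simp
        · simp [hij]
      rw [h00, h0]
    rw [h1, mul_add, mul_smul_comm, mul_smul_comm, ← mul_assoc, hRR, add_mul, smul_mul_assoc,
      smul_mul_assoc, mul_assoc, epsMatrix_mul_self hN]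
    simp only [mul_one, one_mul, neg_mul, mul_neg, smul_neg]
    abel
  apply (WithLp.ofLp_injective 2)
  rw [hR, conj_mulVec, Matrix.mulVec_mulVec, hfix, thetaZero_apply, Matrix.neg_mulVec,
    WithLp.ofLp_neg, Matrix.mulVec_mulVec]

/-! ### The scattering family of an edge Hamiltonian -/

theorem BulkHamiltonian.op_periodic {N : ℕ} (B : BulkHamiltonian N) (k : ℝ) :
    B.op (k + 2 * Real.pi) = B.op k := by
  rw [BulkHamiltonian.op, BulkHamiltonian.op]
  simp only [B.A_periodic, B.V_periodic]

/-- The energies outside the spectra of all bulk Hamiltonians. -/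
def BulkHamiltonian.gap {N : ℕ} (B : BulkHamiltonian N) : Set ℝ :=
  {x | ∀ k, (x : ℂ) ∉ spectrum ℂ (B.op k)}

theorem BulkHamiltonian.isOpen_gap {N : ℕ} (B : BulkHamiltonian N) : IsOpen B.gap := by
  rw [isOpen_iff_mem_nhds]
  intro x hx
  have hc : Continuous fun q : ℝ × ℝ =>
      algebraMap ℂ (L2 ℤ N →L[ℂ] L2 ℤ N) (q.1 : ℂ) - B.op q.2 := by
    refine Continuous.sub ?_ (B.contDiff_op.continuous.comp continuous_snd)
    exact (continuous_algebraMap ℂ _).comp (Complex.continuous_ofReal.comp continuous_fst)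
  have h := (isCompact_Icc (a := (0 : ℝ)) (b := 2 * Real.pi)).eventually_forall_of_forall_eventually
    (x₀ := x) (P := fun y k => IsUnit (algebraMap ℂ (L2 ℤ N →L[ℂ] L2 ℤ N) (y : ℂ) - B.op k))
    (fun k _ => by
      have h1 := spectrum.notMem_iff.mp (hx k)
      exact hc.continuousAt.eventually (Units.isOpen.mem_nhds h1))
  filter_upwards [h] with y hy k
  have hper : Function.Periodic B.op (2 * Real.pi) := B.op_periodic
  obtain ⟨k', hk', he⟩ := hper.exists_mem_Ico₀ Real.two_pi_pos k
  rw [he, spectrum.notMem_iff]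
  exact hy k' ⟨hk'.1, hk'.2.le⟩

section

variable {N : ℕ} {B : BulkHamiltonian N}

theorem EdgeHamiltonian.isUnit_dissOp (S : EdgeHamiltonian B) {x : ℝ} (hx : x ∈ B.gap) (k : ℝ) :
    IsUnit (dissOp (B.A k) (S.V k) - (x : ℂ) • (1 : L2 ℕ N →L[ℂ] L2 ℕ N)) := by
  obtain ⟨n₀, hn₀⟩ := S.eq_bulk
  exact isUnit_dissOp_of_real B k (S.V k) (S.V_selfAdjoint k) (n₀ := n₀)
    (fun j hj => hn₀ k j (by omega)) (hx k)

/-- The scattering matrix of the edge Hamiltonian at energy `x` and momentum `k`. -/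
def EdgeHamiltonian.scat (S : EdgeHamiltonian B) (x k : ℝ) : Mat N :=
  BulkEdge.scat (B.A k) (S.V k) x

theorem EdgeHamiltonian.contDiffAt_param (S : EdgeHamiltonian B) (p : ℝ × ℝ) :
    ContDiffAt ℝ 1 (fun p : ℝ × ℝ => (B.A p.2, S.V p.2, (p.1 : ℂ))) p := by
  refine ContDiff.contDiffAt ?_
  exact (B.A_contDiff.comp contDiff_snd).prodMk ((S.V_contDiff.comp contDiff_snd).prodMk
    (Complex.ofRealCLM.contDiff.comp contDiff_fst))

theorem EdgeHamiltonian.contDiffAt_scat (S : EdgeHamiltonian B) {x : ℝ} (hx : x ∈ B.gap) (k : ℝ) :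
    ContDiffAt ℝ 1 (fun p : ℝ × ℝ => S.scat p.1 p.2) (x, k) :=
  ContDiffAt.comp (f := fun p : ℝ × ℝ => (B.A p.2, S.V p.2, (p.1 : ℂ)))
    (g := fun p : Mat N × BddSeq ℕ N × ℂ => BulkEdge.scat p.1 p.2.1 p.2.2) (x, k)
    (BulkEdge.contDiffAt_scat (S.isUnit_dissOp hx k)) (S.contDiffAt_param (x, k))

theorem EdgeHamiltonian.continuousAt_solOp (S : EdgeHamiltonian B) {x : ℝ} (hx : x ∈ B.gap)
    (k : ℝ) : ContinuousAt (fun p : ℝ × ℝ => solOp (B.A p.2) (S.V p.2) (p.1 : ℂ)) (x, k) :=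
  (ContDiffAt.comp (f := fun p : ℝ × ℝ => (B.A p.2, S.V p.2, (p.1 : ℂ))) (n := 1)
    (g := fun p : Mat N × BddSeq ℕ N × ℂ => solOp p.1 p.2.1 p.2.2) (x, k)
    (contDiffAt_solOp (S.isUnit_dissOp hx k)) (S.contDiffAt_param (x, k))).continuousAt

theorem EdgeHamiltonian.isScatteringFamily (S : EdgeHamiltonian B) :
    IsScatteringFamily B.gap S.scat (fun x y k =>
      adjoint (solOp (B.A k) (S.V k) (x : ℂ)) ∘L solOp (B.A k) (S.V k) (y : ℂ)) where
  isOpen := B.isOpen_gap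
  adjoint_mul x hx k := adjoint_scat_mul_self (S.V_selfAdjoint k) (S.isUnit_dissOp hx k)
  mul_adjoint x hx k := scat_mul_adjoint_self (S.V_selfAdjoint k) (S.isUnit_dissOp hx k)
  eq_mul x hx y hy k := scat_eq_mul (S.V_selfAdjoint k) (S.isUnit_dissOp hx k)
    (S.isUnit_dissOp hy k)
  re_inner_pos x hx k u hu := by
    change 0 < (⟪u, adjoint (solOp (B.A k) (S.V k) (x : ℂ)) (solOp (B.A k) (S.V k) (x : ℂ) u)⟫_ℂ).re
    rw [ContinuousLinearMap.adjoint_inner_right]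
    have h1 : solOp (B.A k) (S.V k) (x : ℂ) u ≠ 0 := fun h0 =>
      hu (solOp_injective (B.A_isUnit k) (S.isUnit_dissOp hx k) h0)
    have h2 : 0 < RCLike.re
        (⟪solOp (B.A k) (S.V k) (x : ℂ) u, solOp (B.A k) (S.V k) (x : ℂ) u⟫_ℂ) := by
      rw [inner_self_eq_norm_sq]
      positivity
    exact h2
  contDiffAt x hx k := S.contDiffAt_scat hx k
  continuousAt x hx y hy k := by
    have h1 : ContinuousAt (fun p : ℝ × ℝ × ℝ =>
        solOp (B.A p.2.2) (S.V p.2.2) (p.1 : ℂ)) (x, y, k) :=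
      ContinuousAt.comp (f := fun p : ℝ × ℝ × ℝ => (p.1, p.2.2))
        (g := fun p : ℝ × ℝ => solOp (B.A p.2) (S.V p.2) (p.1 : ℂ))
        (S.continuousAt_solOp hx k) (by fun_prop)
    have h2 : ContinuousAt (fun p : ℝ × ℝ × ℝ =>
        solOp (B.A p.2.2) (S.V p.2.2) (p.2.1 : ℂ)) (x, y, k) :=
      ContinuousAt.comp (f := fun p : ℝ × ℝ × ℝ => (p.2.1, p.2.2))
        (g := fun p : ℝ × ℝ => solOp (B.A p.2) (S.V p.2) (p.1 : ℂ))
        (S.continuousAt_solOp hy k) (by fun_prop)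
    have h3 : ContinuousAt (fun p : ℝ × ℝ × ℝ =>
        adjoint (solOp (B.A p.2.2) (S.V p.2.2) (p.1 : ℂ))) (x, y, k) :=
      ContinuousAt.comp (g := fun X : Internal N →L[ℂ] L2 ℕ N => adjoint X)
        (ContinuousLinearMap.adjoint (𝕜 := ℂ)).continuous.continuousAt h1
    have h4 := (contDiff_comp (E := Internal N) (F := L2 ℕ N) (G := Internal N)
      (n := 0)).continuous
    exact ContinuousAt.comp (f := fun p : ℝ × ℝ × ℝ =>
        (adjoint (solOp (B.A p.2.2) (S.V p.2.2) (p.1 : ℂ)),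
          solOp (B.A p.2.2) (S.V p.2.2) (p.2.1 : ℂ))) h4.continuousAt (h3.prodMk h2)

theorem EdgeHamiltonian.mult_eq (S : EdgeHamiltonian B) {x : ℝ} (hx : x ∈ B.gap) (k : ℝ) :
    S.mult k x = negOneMult (S.scat x k) :=
  finrank_eigenspace_halfOp (S.isUnit_dissOp hx k)

theorem EdgeHamiltonian.scat_periodic (S : EdgeHamiltonian B) (x k : ℝ) :
    S.scat x (k + 2 * Real.pi) = S.scat x k := by
  rw [EdgeHamiltonian.scat, EdgeHamiltonian.scat, B.A_periodic, S.V_periodic]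

variable {S : EdgeHamiltonian B} {Θ : Internal N →ₛₗ[starRingEnd ℂ] Internal N}

theorem IsEdgeReversal.scat_neg (h : IsEdgeReversal S Θ) {x : ℝ} (hx : x ∈ B.gap) (k : ℝ)
    (u : Internal N) : S.scat x (-k) (Θ (S.scat x k u)) = Θ u :=
  scat_reversal h.antiunitary (h.hopping k) (h.hopping_adjoint k) (h.potential k)
    (S.isUnit_dissOp hx k) (S.isUnit_dissOp hx (-k)) u

theorem IsEdgeReversal.negOneMult_neg (h : IsEdgeReversal S Θ) {x : ℝ} (hx : x ∈ B.gap) (k : ℝ) :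
    negOneMult (S.scat x (-k)) = negOneMult (S.scat x k) := by
  have key : ∀ k, negOneMult (S.scat x k) ≤ negOneMult (S.scat x (-k)) := by
    intro k
    refine finrank_le_of_antilinear h.sq fun u hu => ?_
    rw [mem_kerOneAdd] at hu ⊢
    have h1 := h.scat_neg hx k u
    rw [eq_neg_of_add_eq_zero_right hu, map_neg, map_neg] at h1
    nth_rewrite 1 [← h1]
    exact neg_add_cancel _
  refine le_antisymm ?_ (key k)
  have := key (-k)
  rwa [neg_neg] at this

/-- The scattering matrix in the basis given by the columns of `M`. -/
def EdgeHamiltonian.scatMatrix (S : EdgeHamiltonian B) (M : Matrix (Fin N) (Fin N) ℂ) (x k : ℝ) :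
    Matrix (Fin N) (Fin N) ℂ := M⁻¹ * toMat N (S.scat x k) * M

theorem IsAdapted.isUnit {M : Matrix (Fin N) (Fin N) ℂ} (hM : IsAdapted Θ M) : IsUnit M.det :=
  isUnit_iff_ne_zero.mpr hM.1

theorem IsAdapted.det_conj {M : Matrix (Fin N) (Fin N) ℂ} (hM : IsAdapted Θ M)
    (X : Matrix (Fin N) (Fin N) ℂ) : (M⁻¹ * X * M).det = X.det := by
  rw [Matrix.det_mul, Matrix.det_mul, Matrix.det_nonsing_inv, Ring.inverse_eq_inv']
  have := hM.1
  field_simp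

theorem IsAdapted.det_scatMatrix {M : Matrix (Fin N) (Fin N) ℂ} (hM : IsAdapted Θ M) (x k : ℝ) :
    (S.scatMatrix M x k).det = (S.scat x k).det := by
  rw [EdgeHamiltonian.scatMatrix, hM.det_conj, det_toMat]

theorem IsAdapted.det_one_add_scatMatrix {M : Matrix (Fin N) (Fin N) ℂ} (hM : IsAdapted Θ M)
    (x k : ℝ) : (1 + S.scatMatrix M x k).det = (1 + S.scat x k).det := by
  rw [← det_toMat, map_add, map_one, ← hM.det_conj (1 + toMat N (S.scat x k)), mul_add, add_mul,
    mul_one, Matrix.nonsing_inv_mul _ hM.isUnit]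
  rfl

/-- In an adapted basis, time reversal is expressed by `tau`; at `k = 0, π` the scattering matrix is
a Kramers matrix. -/
theorem IsEdgeReversal.scatMatrix_mul_tau (h : IsEdgeReversal S Θ)
    {M : Matrix (Fin N) (Fin N) ℂ} (hM : IsAdapted Θ M) {x : ℝ} (hx : x ∈ B.gap) (k : ℝ) :
    S.scatMatrix M x (-k) * tau (S.scatMatrix M x k) = 1 := by
  have hN := even_of_antilinear h.sq
  have hMT : ∀ k v, M.mulVec ((S.scatMatrix M x k).mulVec v) =
      (S.scat x k (WithLp.toLp 2 (M.mulVec v))).ofLp := by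
    intro k v
    rw [EdgeHamiltonian.scatMatrix, ← toMat_mulVec, Matrix.mulVec_mulVec, Matrix.mulVec_mulVec,
      ← mul_assoc, ← mul_assoc, Matrix.mul_nonsing_inv _ hM.isUnit, one_mul]
  have key : ∀ v, (S.scatMatrix M x (-k) * tau (S.scatMatrix M x k)).mulVec (thetaZero N v)
      = thetaZero N v := by
    intro v
    rw [← Matrix.mulVec_mulVec, ← thetaZero_mulVec hN]
    apply Matrix.mulVec_injective_iff_isUnit.mpr ((Matrix.isUnit_iff_isUnit_det _).mpr hM.isUnit)
    change M.mulVec _ = M.mulVec _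
    rw [hMT]
    have h1 := hM.2 ((S.scatMatrix M x k).mulVec v)
    rw [hMT, WithLp.toLp_ofLp] at h1
    rw [← neg_neg (WithLp.toLp 2 (M.mulVec (thetaZero N ((S.scatMatrix M x k).mulVec v)))), ← h1,
      map_neg, h.scat_neg hx, hM.2, neg_neg]
  apply Matrix.toLin'.injective
  refine LinearMap.ext fun v => ?_
  have h2 := key (-thetaZero N v)
  rw [map_neg, thetaZero_thetaZero hN, neg_neg] at h2
  rw [Matrix.toLin'_apply, Matrix.toLin'_apply, h2, Matrix.one_mulVec]

theorem EdgeHamiltonian.continuousAt_scatMatrix (S : EdgeHamiltonian B)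
    (M : Matrix (Fin N) (Fin N) ℂ) {x : ℝ} (hx : x ∈ B.gap) (k : ℝ) :
    ContinuousAt (fun p : ℝ × ℝ => S.scatMatrix M p.1 p.2) (x, k) := by
  have h1 : ContinuousAt (fun p : ℝ × ℝ => toMat N (S.scat p.1 p.2)) (x, k) :=
    ContinuousAt.comp (continuous_toMat N).continuousAt (S.contDiffAt_scat hx k).continuousAt
  exact (continuousAt_const.mul h1).mul continuousAt_const

theorem IsEdgeReversal.scatMatrix_zero (h : IsEdgeReversal S Θ)
    {M : Matrix (Fin N) (Fin N) ℂ} (hM : IsAdapted Θ M) {x : ℝ} (hx : x ∈ B.gap) :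
    S.scatMatrix M x 0 * tau (S.scatMatrix M x 0) = 1 := by
  have := h.scatMatrix_mul_tau hM hx 0
  rwa [neg_zero] at this

theorem IsEdgeReversal.scatMatrix_pi (h : IsEdgeReversal S Θ)
    {M : Matrix (Fin N) (Fin N) ℂ} (hM : IsAdapted Θ M) {x : ℝ} (hx : x ∈ B.gap) :
    S.scatMatrix M x Real.pi * tau (S.scatMatrix M x Real.pi) = 1 := by
  have h1 := h.scatMatrix_mul_tau hM hx Real.pi
  have h2 : S.scatMatrix M x (-Real.pi) = S.scatMatrix M x Real.pi := by
    rw [EdgeHamiltonian.scatMatrix, EdgeHamiltonian.scatMatrix, ← S.scat_periodic x (-Real.pi)]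
    congr 4
    ring
  rwa [h2] at h1

theorem IsAdapted.scatMatrix_det_ne_zero {M : Matrix (Fin N) (Fin N) ℂ} (hM : IsAdapted Θ M)
    {x : ℝ} (hx : x ∈ B.gap) (k : ℝ) : (S.scatMatrix M x k).det ≠ 0 := by
  rw [hM.det_scatMatrix, ← norm_ne_zero_iff,
    norm_det_of_unitary (S.isScatteringFamily.mul_adjoint x hx k)]
  exact one_ne_zero

/-- The sign of the scattering matrix is the same at all energies of an interval in the gap. -/
theorem IsEdgeReversal.exists_isKramersSign_scatMatrix (h : IsEdgeReversal S Θ)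
    {M : Matrix (Fin N) (Fin N) ℂ} (hM : IsAdapted Θ M) {a b : ℝ} (hab : a ≤ b)
    (hsub : Set.Icc a b ⊆ B.gap) :
    ∃ s : ℂ, ∀ x ∈ Set.Icc a b, IsKramersSign (S.scatMatrix M x) s :=
  IsKramersSign.homotopy (even_of_antilinear h.sq) hab
    (fun p hp => (S.continuousAt_scatMatrix M (hsub hp.1) p.2).continuousWithinAt)
    (fun _ hx k _ => hM.scatMatrix_det_ne_zero (hsub hx) k)
    (fun _ hx => h.scatMatrix_zero hM (hsub hx)) (fun _ hx => h.scatMatrix_pi hM (hsub hx))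

theorem IsEdgeReversal.exists_crossing_number (h : IsEdgeReversal S Θ)
    {M : Matrix (Fin N) (Fin N) ℂ} (hM : IsAdapted Θ M) {ν : ℝ} (hν : ν ∈ B.gap)
    (hbr : ∀ k₀, HasTransversalBranches S ν k₀) {K : Finset ℝ}
    (hK : ∀ k, k ∈ K ↔ k ∈ Set.Icc 0 Real.pi ∧ S.mult k ν ≠ 0) :
    ∃ n : ℕ, 2 * n = ∑ k ∈ K, (if k = 0 ∨ k = Real.pi then S.mult k ν else 2 * S.mult k ν) ∧
      IsKramersSign (S.scatMatrix M ν) ((-1) ^ n) := by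
  have hF := S.isScatteringFamily
  have := exists_isKramersSign_of_crossings (even_of_antilinear h.sq) hF
    (T := S.scatMatrix M) (fun x k => hM.det_scatMatrix x k)
    (fun x k => hM.det_one_add_scatMatrix x k)
    (fun x hx k => ContinuousAt.comp (f := fun y : ℝ => (y, k))
      (g := fun p : ℝ × ℝ => S.scatMatrix M p.1 p.2)
      (S.continuousAt_scatMatrix M hx k) (by fun_prop))
    (fun _ hx => h.scatMatrix_zero hM hx) (fun _ hx => h.scatMatrix_pi hM hx)
    (fun _ hx k => h.negOneMult_neg hx k) S.scat_periodic hν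
    (fun k₀ => by
      obtain ⟨m, ε, hε, δ, hδ, hm⟩ := hbr k₀
      obtain ⟨ρ, hρ, hball⟩ := Metric.isOpen_iff.mp B.isOpen_gap ν hν
      refine ⟨m, ε, fun i => ⟨(hε i).1.continuousAt, (hε i).2⟩, min δ ρ, lt_min hδ hρ,
        fun k l hk hl => ?_⟩
      rw [← S.mult_eq (hball (by
          rw [Metric.mem_ball, Real.dist_eq]; exact hl.trans_le (min_le_right _ _)))]
      exact hm k l (hk.trans_le (min_le_left _ _)) (hl.trans_le (min_le_left _ _)))
    (K := K) (fun k => by rw [hK, S.mult_eq hν])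
  simpa only [S.mult_eq hν] using this

/-- The edge index is the sign of the scattering matrix at the energy `μ`. -/
theorem IsEdgeIndex.isKramersSign (h : IsEdgeReversal S Θ) {M : Matrix (Fin N) (Fin N) ℂ}
    (hM : IsAdapted Θ M) {μ : ℝ} {s : ℤˣ} (hs : IsEdgeIndex S μ s) :
    IsKramersSign (S.scatMatrix M μ) ((s : ℤ) : ℂ) := by
  obtain ⟨a, b, ν, K, n, haμ, hμb, hgap, hν, hbr, hK, hn, rfl⟩ := hs
  obtain ⟨n', hn', hsign⟩ := h.exists_crossing_number hM (hgap ν hν) hbr hK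
  have hnn : n' = n := by omega
  obtain ⟨t, ht⟩ := h.exists_isKramersSign_scatMatrix hM (haμ.le.trans hμb.le) hgap
  have h1 := (ht ν hν).unique (fun k _ => hM.scatMatrix_det_ne_zero (hgap ν hν) k) hsign
  have h2 := ht μ ⟨haμ.le, hμb.le⟩
  rw [h1, hnn] at h2
  simpa using h2

end

/-! ### Local eigenvalue branches -/

section

variable {N : ℕ}

/-- The Schur complement of `1 + S` on the subspace `K`. -/
def schurCompl (K : Submodule ℂ (Internal N)) (S : Mat N) : Mat N :=
  K.starProjection - K.starProjection * Ring.inverse (1 + S + K.starProjection) * K.starProjection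

theorem starProjection_kerOneAdd_facts {S : Mat N} (hS : adjoint S * S = 1) :
    IsUnit (1 + S + (kerOneAdd S).starProjection) ∧
    Ring.inverse (1 + S + (kerOneAdd S).starProjection) * (kerOneAdd S).starProjection
      = (kerOneAdd S).starProjection ∧
    (kerOneAdd S).starProjection * Ring.inverse (1 + S + (kerOneAdd S).starProjection)
      = (kerOneAdd S).starProjection := by
  set P := (kerOneAdd S).starProjection with hP
  have hPP : P * P = P := (Submodule.isIdempotentElem_starProjection (kerOneAdd S)).eq
  have hP1 : P * (1 + S) = 0 := starProjection_kerOneAdd_mul_one_add hS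
  have h1P : (1 + S) * P = 0 := by
    rw [add_mul, one_mul, kerOneAdd_mul_starProjection, add_neg_cancel]
  have hu : IsUnit (1 + S + P) := by
    rw [isUnit_iff_det_ne_zero]
    refine det_ne_zero_of_injective fun v hv => ?_
    have h1 : P v = 0 := by
      have h2 : (P * (1 + S + P)) v = 0 := by
        rw [mul_apply_eq_comp, hv, map_zero]
      rwa [mul_add, hP1, zero_add, hPP] at h2
    have h3 : v + S v + P v = 0 := hv
    rw [h1, add_zero] at h3
    rw [← h1, hP]
    exact (Submodule.starProjection_eq_self_iff.mpr (mem_kerOneAdd.mpr h3)).symm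
  have e1 : (1 + S + P) * P = P := by rw [add_mul, h1P, hPP, zero_add]
  have e2 : P * (1 + S + P) = P := by rw [mul_add, hP1, hPP, zero_add]
  refine ⟨hu, ?_, ?_⟩
  · have h1 := congrArg (Ring.inverse (1 + S + P) * ·) e1
    simp only [← mul_assoc, Ring.inverse_mul_cancel _ hu, one_mul] at h1
    exact h1.symm
  · have h1 := congrArg (· * Ring.inverse (1 + S + P)) e2
    simp only [mul_assoc, Ring.mul_inverse_cancel _ hu, mul_one] at h1
    exact h1.symm

theorem apply_of_mem_kerOneAdd {K : Submodule ℂ (Internal N)} {S : Mat N}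
    (hu : IsUnit (1 + S + K.starProjection)) {v : Internal N} (hv : v ∈ kerOneAdd S) :
    v = Ring.inverse (1 + S + K.starProjection) (K.starProjection v) := by
  have h1 : (1 + S + K.starProjection) v = K.starProjection v := by
    have : v + S v + K.starProjection v = K.starProjection v := by
      rw [mem_kerOneAdd.mp hv, zero_add]
    exact this
  have h2 : (Ring.inverse (1 + S + K.starProjection) * (1 + S + K.starProjection)) v = v := by
    rw [Ring.inverse_mul_cancel _ hu]; rfl
  rw [← h1]
  exact h2.symm

theorem schurCompl_apply_eq_zero_of_mem {K : Submodule ℂ (Internal N)} {S : Mat N}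
    (hu : IsUnit (1 + S + K.starProjection)) {v : Internal N} (hv : v ∈ kerOneAdd S) :
    schurCompl K S v = 0 := by
  have h1 := apply_of_mem_kerOneAdd hu hv
  change K.starProjection v - K.starProjection
    (Ring.inverse (1 + S + K.starProjection) (K.starProjection v)) = 0
  rw [← h1, sub_self]

/-- The eigenvalue `-1` keeps its full multiplicity exactly where the Schur complement vanishes. -/
theorem negOneMult_eq_iff {K : Submodule ℂ (Internal N)} {S : Mat N}
    (hu : IsUnit (1 + S + K.starProjection)) :
    negOneMult S = Module.finrank ℂ K ↔ schurCompl K S = 0 := by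
  set P := K.starProjection with hP
  set R := Ring.inverse (1 + S + P) with hR
  have hPmem : ∀ w ∈ K, P w = w := fun w hw => Submodule.starProjection_eq_self_iff.mpr hw
  -- `P` maps the kernel of `1 + S` injectively into `K`
  let f : kerOneAdd S →ₗ[ℂ] K := LinearMap.codRestrict K
    ((P : Internal N →ₗ[ℂ] Internal N).domRestrict _) fun v => K.starProjection_apply_mem v
  have hf : ∀ v, ((f v : K) : Internal N) = P v := fun v => rfl
  have hfinj : Function.Injective f := by
    rw [← LinearMap.ker_eq_bot, LinearMap.ker_eq_bot']
    rintro ⟨v, hv⟩ h0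
    have h1 := congrArg (Subtype.val) h0
    rw [hf] at h1
    have h2 := apply_of_mem_kerOneAdd hu hv
    rw [← hP] at h2
    change P v = 0 at h1
    rw [h1, map_zero] at h2
    exact Subtype.ext h2
  constructor
  · intro h
    have hsurj : Function.Surjective f :=
      (LinearMap.injective_iff_surjective_of_finrank_eq_finrank h).mp hfinj
    ext1 u
    obtain ⟨⟨v, hv⟩, hvu⟩ := hsurj ⟨P u, K.starProjection_apply_mem u⟩
    have h1 : P v = P u := by
      have := congrArg Subtype.val hvu
      rwa [hf] at this
    have h2 := schurCompl_apply_eq_zero_of_mem hu hv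
    change P u - P (R (P u)) = 0
    rw [← h1]
    exact h2
  · intro h
    refine le_antisymm (LinearMap.finrank_le_finrank_of_injective hfinj) ?_
    have hker : ∀ w ∈ K, R w ∈ kerOneAdd S := by
      intro w hw
      rw [mem_kerOneAdd]
      have h1 : ((1 + S + P) * R) w = w := by rw [Ring.mul_inverse_cancel _ hu]; rfl
      have h2 : R w + S (R w) + P (R w) = w := h1
      have h3 : P w - P (R (P w)) = 0 := by
        have := congrArg (fun X : Mat N => X w) h
        exact this
      rw [hPmem w hw, sub_eq_zero] at h3
      rw [← h3] at h2
      exact add_eq_right.mp h2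
    let g : K →ₗ[ℂ] kerOneAdd S := LinearMap.codRestrict _
      ((R : Internal N →ₗ[ℂ] Internal N).domRestrict K) fun w => hker w w.2
    refine LinearMap.finrank_le_finrank_of_injective (f := g) ?_
    rw [← LinearMap.ker_eq_bot, LinearMap.ker_eq_bot']
    rintro ⟨w, hw⟩ h0
    have h1 : R w = 0 := congrArg Subtype.val h0
    have h2 : ((1 + S + P) * R) w = w := by rw [Ring.mul_inverse_cancel _ hu]; rfl
    rw [mul_apply_eq_comp, h1, map_zero] at h2
    exact Subtype.ext h2.symm

theorem schurCompl_sub {K : Submodule ℂ (Internal N)} {S₁ S₂ G : Mat N} {t : ℂ}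
    (h : S₂ = S₁ * (1 + (2 * Complex.I * t) • G)) (hu₁ : IsUnit (1 + S₁ + K.starProjection))
    (hu₂ : IsUnit (1 + S₂ + K.starProjection)) :
    schurCompl K S₂ - schurCompl K S₁ = (2 * Complex.I * t) •
      (K.starProjection * Ring.inverse (1 + S₂ + K.starProjection) * S₁ * G *
        Ring.inverse (1 + S₁ + K.starProjection) * K.starProjection) := by
  set P := K.starProjection with hP
  set R₁ := Ring.inverse (1 + S₁ + P) with hR₁
  set R₂ := Ring.inverse (1 + S₂ + P) with hR₂
  have h1 : R₁ - R₂ = R₂ * (S₂ - S₁) * R₁ := by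
    have e : S₂ - S₁ = (1 + S₂ + P) - (1 + S₁ + P) := by abel
    rw [e, mul_sub, Ring.inverse_mul_cancel _ hu₂, sub_mul, one_mul, mul_assoc,
      Ring.mul_inverse_cancel _ hu₁, mul_one]
  have h2 : S₂ - S₁ = (2 * Complex.I * t) • (S₁ * G) := by
    rw [h, mul_add, mul_one, add_sub_cancel_left, mul_smul_comm]
  have h3 : schurCompl K S₂ - schurCompl K S₁ = P * (R₁ - R₂) * P := by
    simp only [schurCompl, ← hP, ← hR₁, ← hR₂, mul_sub, sub_mul]
    abel
  rw [h3, h1, h2]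
  simp only [mul_smul_comm, smul_mul_assoc, mul_assoc]

/-- Where the eigenvalue `-1` has its full multiplicity, there are no other eigenvalues close by. -/
theorem negOneMult_eq_zero_of_schurCompl {K : Submodule ℂ (Internal N)} {S₁ S₂ G : Mat N} {t : ℂ}
    (h : S₂ = S₁ * (1 + (2 * Complex.I * t) • G)) (ht : t ≠ 0)
    (hu₁ : IsUnit (1 + S₁ + K.starProjection)) (hu₂ : IsUnit (1 + S₂ + K.starProjection))
    (hY : IsUnit (K.starProjection * Ring.inverse (1 + S₂ + K.starProjection) * S₁ * G *
        Ring.inverse (1 + S₁ + K.starProjection) * K.starProjection + (1 - K.starProjection)))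
    (h0 : schurCompl K S₁ = 0) : negOneMult S₂ = 0 := by
  rw [negOneMult, Submodule.finrank_eq_zero, Submodule.eq_bot_iff]
  intro v hv
  have h1 := schurCompl_sub h hu₁ hu₂
  rw [h0, sub_zero] at h1
  set Y := K.starProjection * Ring.inverse (1 + S₂ + K.starProjection) * S₁ * G *
        Ring.inverse (1 + S₁ + K.starProjection) * K.starProjection with hYd
  have h2 := schurCompl_apply_eq_zero_of_mem hu₂ hv
  rw [h1] at h2
  have h3 : (2 * Complex.I * t) • Y v = 0 := h2
  rw [smul_eq_zero_iff_right (by simpa using ht)] at h3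
  have h4 : Y (K.starProjection v) = 0 := by
    have : Y * K.starProjection = Y := by
      rw [hYd, mul_assoc, (Submodule.isIdempotentElem_starProjection K).eq]
    rw [← h3]
    exact congrArg (fun X : Mat N => X v) this
  have h5 : (Y + (1 - K.starProjection)) (K.starProjection v) = 0 := by
    change Y (K.starProjection v) + (K.starProjection v -
      K.starProjection (K.starProjection v)) = 0
    rw [h4, Submodule.starProjection_eq_self_iff.mpr (K.starProjection_apply_mem v), sub_self,
      add_zero]
  have h6 : K.starProjection v = 0 := by
    have : (Ring.inverse (Y + (1 - K.starProjection)) * (Y + (1 - K.starProjection)))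
        (K.starProjection v) = K.starProjection v := by
      rw [Ring.inverse_mul_cancel _ hY]; rfl
    rw [← this, mul_apply_eq_comp, h5, map_zero]
  rw [apply_of_mem_kerOneAdd hu₂ hv, h6, map_zero]

end

section

variable {N : ℕ} {U : Set ℝ} {S : ℝ → ℝ → Mat N} {G : ℝ → ℝ → ℝ → Mat N}

/-- An implicit function of class `C¹` on the line. -/
theorem exists_implicit_curve {f : ℝ × ℝ → ℝ} {k₀ l₀ d : ℝ} (hf : ContDiffAt ℝ 1 f (k₀, l₀))
    (hd : HasDerivAt (fun l => f (k₀, l)) d l₀) (hd0 : d ≠ 0) :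
    ∃ c : ℝ → ℝ, c k₀ = l₀ ∧ ContDiffAt ℝ 1 c k₀ ∧
      ∀ᶠ p in nhds (k₀, l₀), f p = f (k₀, l₀) ↔ c p.1 = p.2 := by
  have h1 : fderiv ℝ f (k₀, l₀) (0, 1) = d := by
    have h2 : HasDerivAt (fun l : ℝ => (k₀, l)) ((0 : ℝ), (1 : ℝ)) l₀ :=
      (hasDerivAt_const l₀ k₀).prodMk (hasDerivAt_id l₀)
    have h3 : HasFDerivAt f (fderiv ℝ f (k₀, l₀)) (k₀, l₀) :=
      (hf.differentiableAt one_ne_zero).hasFDerivAt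
    exact (h3.comp_hasDerivAt l₀ h2).unique hd
  have hinv : (fderiv ℝ f (k₀, l₀) ∘L ContinuousLinearMap.inr ℝ ℝ ℝ).IsInvertible := by
    refine ⟨ContinuousLinearEquiv.unitsEquivAut ℝ (Units.mk0 d hd0), ?_⟩
    ext
    simp [h1]
  exact ⟨hf.implicitFunction one_ne_zero hinv, hf.implicitFunction_apply_self one_ne_zero hinv,
    hf.contDiffAt_implicitFunction one_ne_zero hinv,
    hf.eventually_apply_eq_iff_implicitFunction one_ne_zero hinv⟩

theorem contDiffAt_inverse_add {E : Type*} [NormedAddCommGroup E] [NormedSpace ℝ E]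
    {X : E → Mat N} {Q : Mat N} {p : E} (hX : ContDiffAt ℝ 1 X p) (hu : IsUnit (1 + X p + Q)) :
    ContDiffAt ℝ 1 (fun q => Ring.inverse (1 + X q + Q)) p := by
  obtain ⟨u, hu⟩ := hu
  have h1 : ContDiffAt ℝ 1 (fun q => 1 + X q + Q) p :=
    (contDiffAt_const.add hX).add contDiffAt_const
  have h2 : ContDiffAt ℝ 1 (Ring.inverse : Mat N → Mat N) (1 + X p + Q) := by
    rw [← hu]; exact contDiffAt_ringInverse ℝ u
  exact ContDiffAt.comp (f := fun q => 1 + X q + Q) (g := (Ring.inverse : Mat N → Mat N)) p h2 h1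

theorem contDiffAt_schurCompl {E : Type*} [NormedAddCommGroup E] [NormedSpace ℝ E]
    (K : Submodule ℂ (Internal N)) {X : E → Mat N} {p : E} (hX : ContDiffAt ℝ 1 X p)
    (hu : IsUnit (1 + X p + K.starProjection)) :
    ContDiffAt ℝ 1 (fun q => schurCompl K (X q)) p := by
  have h3 := contDiffAt_inverse_add hX hu
  have h4 : ContDiffAt ℝ 1 (fun q => K.starProjection *
      Ring.inverse (1 + X q + K.starProjection)) p := contDiffAt_const.mul h3
  exact contDiffAt_const.sub (h4.mul contDiffAt_const)

/-- At a point where `-1` is an eigenvalue of the unitary `S`, the energy derivative of the Schur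
complement is a negative definite multiple of `i` on the eigenspace. -/
theorem IsScatteringFamily.hasDerivAt_schurCompl (hF : IsScatteringFamily U S G) {l₀ k₀ : ℝ}
    (hl : l₀ ∈ U) {e : Internal N} (he : e ∈ kerOneAdd (S l₀ k₀)) :
    HasDerivAt (fun l => (⟪e, schurCompl (kerOneAdd (S l₀ k₀)) (S l k₀) e⟫_ℂ).im)
      (-2 * (⟪e, G l₀ l₀ k₀ e⟫_ℂ).re) l₀ := by
  obtain ⟨hu, hRP, hPR⟩ := starProjection_kerOneAdd_facts (hF.adjoint_mul l₀ hl k₀)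
  set K := kerOneAdd (S l₀ k₀) with hK
  set P := K.starProjection with hP
  have hS : ContDiffAt ℝ 1 (fun l => S l k₀) l₀ :=
    ContDiffAt.comp (f := fun l : ℝ => (l, k₀)) (g := fun p : ℝ × ℝ => S p.1 p.2) l₀
      (hF.contDiffAt l₀ hl k₀) (by fun_prop)
  have hR := (contDiffAt_inverse_add hS hu).continuousAt
  have hG : ContinuousAt (fun l => G l₀ l k₀) l₀ :=
    ContinuousAt.comp (f := fun l : ℝ => (l₀, l, k₀))
      (g := fun p : ℝ × ℝ × ℝ => G p.1 p.2.1 p.2.2) (hF.continuousAt l₀ hl l₀ hl k₀) (by fun_prop)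
  let Y : ℝ → Mat N := fun l => P * Ring.inverse (1 + S l k₀ + P) * S l₀ k₀ * G l₀ l k₀ *
        Ring.inverse (1 + S l₀ k₀ + P) * P
  have hY : ContinuousAt Y l₀ :=
    ((((continuousAt_const.mul hR).mul continuousAt_const).mul hG).mul continuousAt_const).mul
      continuousAt_const
  have hYe : Y l₀ = -(P * G l₀ l₀ k₀ * P) := by
    have h1 : P * S l₀ k₀ = -P := by
      have := starProjection_kerOneAdd_mul_one_add (hF.adjoint_mul l₀ hl k₀)
      rw [mul_add, mul_one] at this
      exact eq_neg_of_add_eq_zero_right this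
    change P * Ring.inverse (1 + S l₀ k₀ + P) * S l₀ k₀ * G l₀ l₀ k₀ *
        Ring.inverse (1 + S l₀ k₀ + P) * P = _
    rw [hPR, mul_assoc _ _ P, hRP, h1]
    simp only [neg_mul]
  have hPe : P e = e := Submodule.starProjection_eq_self_iff.mpr he
  have hval : (⟪e, Y l₀ e⟫_ℂ).re = -(⟪e, G l₀ l₀ k₀ e⟫_ℂ).re := by
    rw [hYe]
    change (⟪e, -(P (G l₀ l₀ k₀ (P e)))⟫_ℂ).re = _
    rw [hPe, inner_neg_right, hP, ← Submodule.inner_starProjection_left_eq_right, ← hP, hPe,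
      Complex.neg_re]
  have hinner : ContinuousAt (fun l => 2 * (⟪e, Y l e⟫_ℂ).re) l₀ := by
    have h1 : ContinuousAt (fun l => Y l e) l₀ :=
      ContinuousAt.comp (f := Y) (g := fun X : Mat N => X e)
        (ContinuousLinearMap.apply ℂ (Internal N) e).continuous.continuousAt hY
    have h2 : ContinuousAt (fun l => ⟪e, Y l e⟫_ℂ) l₀ := 
      (innerSL ℂ e).continuous.continuousAt.comp h1
    exact continuousAt_const.mul (Complex.continuous_re.continuousAt.comp h2)
  rw [hasDerivAt_iff_tendsto_slope]
  have h0 : -2 * (⟪e, G l₀ l₀ k₀ e⟫_ℂ).re = 2 * (⟪e, Y l₀ e⟫_ℂ).re := by rw [hval]; ring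
  rw [h0]
  refine (hinner.tendsto.mono_left nhdsWithin_le_nhds).congr' ?_
  have hunits : ∀ᶠ l in nhds l₀, IsUnit (1 + S l k₀ + P) := by
    have h1 : ContinuousAt (fun l => 1 + S l k₀ + P) l₀ :=
      (continuousAt_const.add hS.continuousAt).add continuousAt_const
    exact h1.eventually_mem (Units.isOpen.mem_nhds hu)
  filter_upwards [nhdsWithin_le_nhds hunits, nhdsWithin_le_nhds (hF.isOpen.mem_nhds hl),
    self_mem_nhdsWithin] with l hul hlU hne
  have h1 := schurCompl_sub (hF.eq_mul l₀ hl l hlU k₀) hu hul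
  have h2 : schurCompl K (S l k₀) e - schurCompl K (S l₀ k₀) e
      = (2 * Complex.I * ((l : ℂ) - l₀)) • Y l e := congrArg (fun X : Mat N => X e) h1
  have h3 : (⟪e, schurCompl K (S l k₀) e⟫_ℂ).im - (⟪e, schurCompl K (S l₀ k₀) e⟫_ℂ).im
      = 2 * (l - l₀) * (⟪e, Y l e⟫_ℂ).re := by
    rw [← Complex.sub_im, ← inner_sub_right, h2, inner_smul_right]
    have : 2 * Complex.I * ((l : ℂ) - l₀) = ((2 * (l - l₀) : ℝ) : ℂ) * Complex.I := by
      push_cast; ring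
    rw [this, mul_assoc, Complex.im_ofReal_mul]
    simp
  rw [slope_def_field, h3]
  have : l - l₀ ≠ 0 := sub_ne_zero.mpr hne
  field_simp

/-- The positive operator of the energy derivative, compressed to the eigenspace of `-1`, is
invertible there. -/
theorem IsScatteringFamily.isUnit_gramCompl (hF : IsScatteringFamily U S G) {l₀ k₀ : ℝ}
    (hl : l₀ ∈ U) :
    IsUnit ((kerOneAdd (S l₀ k₀)).starProjection *
      Ring.inverse (1 + S l₀ k₀ + (kerOneAdd (S l₀ k₀)).starProjection) * S l₀ k₀ * G l₀ l₀ k₀ *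
      Ring.inverse (1 + S l₀ k₀ + (kerOneAdd (S l₀ k₀)).starProjection) *
      (kerOneAdd (S l₀ k₀)).starProjection + (1 - (kerOneAdd (S l₀ k₀)).starProjection)) := by
  obtain ⟨hu, hRP, hPR⟩ := starProjection_kerOneAdd_facts (hF.adjoint_mul l₀ hl k₀)
  set K := kerOneAdd (S l₀ k₀) with hK
  set P := K.starProjection with hP
  have h6 : P * S l₀ k₀ = -P := by
    have := starProjection_kerOneAdd_mul_one_add (hF.adjoint_mul l₀ hl k₀)
    rw [mul_add, mul_one] at this
    exact eq_neg_of_add_eq_zero_right this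
  rw [hPR, mul_assoc _ _ P, hRP, h6, isUnit_iff_det_ne_zero]
  refine det_ne_zero_of_injective fun v hv => ?_
  have hv1 : -(P (G l₀ l₀ k₀ (P v))) + (v - P v) = 0 := by
    rw [neg_mul, neg_mul] at hv
    exact hv
  have hPP : ∀ w, P (P w) = P w := fun w =>
    Submodule.starProjection_eq_self_iff.mpr (K.starProjection_apply_mem w)
  have hv2 : P (G l₀ l₀ k₀ (P v)) = 0 := by
    have := congrArg P hv1
    rw [map_add, map_neg, map_sub, hPP, hPP, sub_self, add_zero, map_zero, neg_eq_zero] at this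
    exact this
  have hv3 : P v = 0 := by
    by_contra hne
    have h8 := hF.re_inner_pos l₀ hl k₀ (P v) hne
    have h9 : ⟪P v, G l₀ l₀ k₀ (P v)⟫_ℂ = 0 := by
      conv_lhs => rw [← hPP v]
      rw [hP, Submodule.inner_starProjection_left_eq_right, ← hP, hPP, hv2, inner_zero_right]
    rw [h9] at h8
    simp at h8
  rw [hv2, hv3, neg_zero, zero_add, sub_zero] at hv1
  exact hv1

theorem IsScatteringFamily.continuousAt_gramCompl (hF : IsScatteringFamily U S G) {l₀ k₀ : ℝ}
    (hl : l₀ ∈ U) {c : ℝ → ℝ} (hc0 : c k₀ = l₀) (hc : ContinuousAt c k₀) :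
    ContinuousAt (fun p : ℝ × ℝ => (kerOneAdd (S l₀ k₀)).starProjection *
      Ring.inverse (1 + S p.2 p.1 + (kerOneAdd (S l₀ k₀)).starProjection) * S (c p.1) p.1 *
      G (c p.1) p.2 p.1 *
      Ring.inverse (1 + S (c p.1) p.1 + (kerOneAdd (S l₀ k₀)).starProjection) *
      (kerOneAdd (S l₀ k₀)).starProjection + (1 - (kerOneAdd (S l₀ k₀)).starProjection))
      (k₀, l₀) := by
  have hu := (starProjection_kerOneAdd_facts (hF.adjoint_mul l₀ hl k₀)).1
  set K := kerOneAdd (S l₀ k₀) with hK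
  set P := K.starProjection with hP
  have hR : ContinuousAt (fun X : Mat N => Ring.inverse (1 + X + P)) (S l₀ k₀) :=
    (contDiffAt_inverse_add (X := fun X : Mat N => X) contDiffAt_id hu).continuousAt
  have hS : ContinuousAt (fun p : ℝ × ℝ => S p.1 p.2) (l₀, k₀) :=
    (hF.contDiffAt l₀ hl k₀).continuousAt
  have hc1 : ContinuousAt (fun p : ℝ × ℝ => c p.1) (k₀, l₀) :=
    ContinuousAt.comp (f := fun p : ℝ × ℝ => p.1) hc continuous_fst.continuousAt
  have h1 : ContinuousAt (fun p : ℝ × ℝ => S p.2 p.1) (k₀, l₀) :=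
    ContinuousAt.comp (f := fun p : ℝ × ℝ => (p.2, p.1)) (g := fun p : ℝ × ℝ => S p.1 p.2)
      hS continuous_swap.continuousAt
  have h2 : ContinuousAt (fun p : ℝ × ℝ => S (c p.1) p.1) (k₀, l₀) :=
    ContinuousAt.comp_of_eq (f := fun p : ℝ × ℝ => (c p.1, p.1)) (g := fun p : ℝ × ℝ => S p.1 p.2)
      (y := (l₀, k₀)) hS (hc1.prodMk continuous_fst.continuousAt) (by rw [hc0])
  have h1' : ContinuousAt (fun p : ℝ × ℝ => Ring.inverse (1 + S p.2 p.1 + P)) (k₀, l₀) :=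
    ContinuousAt.comp (f := fun p : ℝ × ℝ => S p.2 p.1)
      (g := fun X : Mat N => Ring.inverse (1 + X + P)) hR h1
  have h2' : ContinuousAt (fun p : ℝ × ℝ => Ring.inverse (1 + S (c p.1) p.1 + P)) (k₀, l₀) :=
    ContinuousAt.comp_of_eq (f := fun p : ℝ × ℝ => S (c p.1) p.1)
      (g := fun X : Mat N => Ring.inverse (1 + X + P)) (y := S l₀ k₀) hR h2 (by rw [hc0])
  have h4 : ContinuousAt (fun p : ℝ × ℝ => G (c p.1) p.2 p.1) (k₀, l₀) :=
    ContinuousAt.comp_of_eq (f := fun p : ℝ × ℝ => (c p.1, p.2, p.1))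
      (g := fun p : ℝ × ℝ × ℝ => G p.1 p.2.1 p.2.2) (y := (l₀, l₀, k₀))
      (hF.continuousAt l₀ hl l₀ hl k₀)
      (hc1.prodMk (continuous_snd.continuousAt.prodMk continuous_fst.continuousAt)) (by rw [hc0])
  have h5 : ContinuousAt (fun p : ℝ × ℝ => P * Ring.inverse (1 + S p.2 p.1 + P)) (k₀, l₀) :=
    continuousAt_const.mul h1'
  have h6 := ((((h5.mul h2).mul h4).mul h2').mul (continuousAt_const (y := P)))
  exact h6.add continuousAt_const

/-- Near a point `(l₀, k₀)` with an eigenvalue `-1` of multiplicity `m`, the points with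
multiplicity `m` lie on the graph of a function `c` of class `C¹`.  They are the points of the graph
above the zeros of `σ`, and above these momenta there are no other eigenvalues `-1`. -/
theorem IsScatteringFamily.exists_curve (hF : IsScatteringFamily U S G) {l₀ k₀ : ℝ}
    (hl : l₀ ∈ U) (hm : negOneMult (S l₀ k₀) ≠ 0) :
    ∃ (c : ℝ → ℝ) (σ : ℝ → Mat N), c k₀ = l₀ ∧
      (∀ᶠ k in nhds k₀, ContDiffAt ℝ 1 c k ∧ ContinuousAt σ k ∧
        (negOneMult (S (c k) k) = negOneMult (S l₀ k₀) ↔ σ k = 0)) ∧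
      ∀ᶠ p : ℝ × ℝ in nhds (k₀, l₀),
        (negOneMult (S p.2 p.1) = negOneMult (S l₀ k₀) → p.2 = c p.1) ∧
        (negOneMult (S (c p.1) p.1) = negOneMult (S l₀ k₀) → p.2 ≠ c p.1 →
          negOneMult (S p.2 p.1) = 0) := by
  obtain ⟨hu, hRP, hPR⟩ := starProjection_kerOneAdd_facts (hF.adjoint_mul l₀ hl k₀)
  obtain ⟨e, he, he0⟩ : ∃ e ∈ kerOneAdd (S l₀ k₀), e ≠ 0 := by
    by_contra! h
    exact hm (Submodule.finrank_eq_zero.mpr ((Submodule.eq_bot_iff _).mpr h))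
  have hderiv := hF.hasDerivAt_schurCompl hl he
  set K := kerOneAdd (S l₀ k₀) with hK
  set P := K.starProjection with hP
  have hfin : negOneMult (S l₀ k₀) = Module.finrank ℂ K := rfl
  have hS : ∀ l ∈ U, ∀ k, ContDiffAt ℝ 1 (fun p : ℝ × ℝ => S p.2 p.1) (k, l) := fun l hl k =>
    ContDiffAt.comp (f := fun p : ℝ × ℝ => (p.2, p.1)) (g := fun p : ℝ × ℝ => S p.1 p.2) (k, l)
      (hF.contDiffAt l hl k) (by fun_prop)
  -- the curve is the zero set of a single matrix element of the Schur complement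
  let f : ℝ × ℝ → ℝ := fun p => (⟪e, schurCompl K (S p.2 p.1) e⟫_ℂ).im
  have hSchur := contDiffAt_schurCompl K (hS l₀ hl k₀) hu
  have hf : ContDiffAt ℝ 1 f (k₀, l₀) := by
    have h1 : ContDiffAt ℝ 1 (fun p : ℝ × ℝ => schurCompl K (S p.2 p.1) e) (k₀, l₀) :=
      ContDiffAt.comp (f := fun p : ℝ × ℝ => schurCompl K (S p.2 p.1)) (g := fun X : Mat N => X e)
        (k₀, l₀)
        (((ContinuousLinearMap.apply ℂ (Internal N) e).restrictScalars ℝ).contDiff.contDiffAt)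
        hSchur
    have h2 : ContDiffAt ℝ 1 (fun p : ℝ × ℝ => ⟪e, schurCompl K (S p.2 p.1) e⟫_ℂ) (k₀, l₀) :=
      contDiffAt_const.inner ℂ h1
    exact Complex.imCLM.contDiff.contDiffAt.comp _ h2
  have hpos := hF.re_inner_pos l₀ hl k₀ e he0
  obtain ⟨c, hc0, hc, hceq⟩ := exists_implicit_curve hf hderiv (by nlinarith)
  have hf0 : f (k₀, l₀) = 0 := by
    change (⟪e, schurCompl K (S l₀ k₀) e⟫_ℂ).im = 0
    rw [schurCompl_apply_eq_zero_of_mem hu he, inner_zero_right, Complex.zero_im]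
  rw [hf0] at hceq
  -- everything stays regular near the base point
  have hU : ∀ᶠ p : ℝ × ℝ in nhds (k₀, l₀), p.2 ∈ U ∧ IsUnit (1 + S p.2 p.1 + P) := by
    have h1 : ContinuousAt (fun p : ℝ × ℝ => 1 + S p.2 p.1 + P) (k₀, l₀) :=
      (continuousAt_const.add (hS l₀ hl k₀).continuousAt).add continuousAt_const
    exact (continuous_snd.continuousAt.eventually_mem (hF.isOpen.mem_nhds hl)).and
      (h1.eventually_mem (Units.isOpen.mem_nhds hu))
  have hgraph : Filter.Tendsto (fun k => (k, c k)) (nhds k₀) (nhds (k₀, l₀)) := by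
    have := (continuousAt_id (x := k₀)).prodMk hc.continuousAt
    rw [ContinuousAt, hc0] at this
    exact this
  have hYunit := (hF.continuousAt_gramCompl hl hc0 hc.continuousAt).eventually_mem
    (Units.isOpen.mem_nhds (by
      change IsUnit _
      rw [hc0]
      exact hF.isUnit_gramCompl hl))
  refine ⟨c, fun k => schurCompl K (S (c k) k), hc0, ?_, ?_⟩
  · filter_upwards [hc.eventually (by simp), hgraph.eventually hU] with k hck hk
    refine ⟨hck, ?_, ?_⟩
    · have h1 := (contDiffAt_schurCompl K (hS (c k) hk.1 k) hk.2).continuousAt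
      exact ContinuousAt.comp (f := fun k => (k, c k))
        (g := fun p : ℝ × ℝ => schurCompl K (S p.2 p.1)) h1
        (continuousAt_id.prodMk hck.continuousAt)
    · rw [hfin]
      exact negOneMult_eq_iff hk.2
  · have hfst : Filter.Tendsto (fun p : ℝ × ℝ => (p.1, c p.1)) (nhds (k₀, l₀)) (nhds (k₀, l₀)) :=
      hgraph.comp (continuous_fst.tendsto (k₀, l₀))
    filter_upwards [hceq, hU, hfst.eventually hU, hYunit] with p h1 h2 h3 h4
    refine ⟨fun h => ?_, fun h hne => ?_⟩
    · rw [hfin, negOneMult_eq_iff h2.2] at h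
      refine (h1.mp ?_).symm
      change (⟪e, schurCompl K (S p.2 p.1) e⟫_ℂ).im = 0
      rw [h, zero_apply, inner_zero_right, Complex.zero_im]
    · rw [hfin, negOneMult_eq_iff h3.2] at h
      exact negOneMult_eq_zero_of_schurCompl (hF.eq_mul (c p.1) h3.1 p.2 h2.1 p.1)
        (sub_ne_zero.mpr (by exact_mod_cast hne)) h3.2 h2.2 h4 h

end

/-! ### Generic energies -/

/-- The image of a set is meagre if this holds locally, by the Lindelöf property. -/
theorem isMeagre_image_of_local {X Y : Type*} [TopologicalSpace X] [SecondCountableTopology X]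
    [TopologicalSpace Y] {f : X → Y} {s : Set X}
    (h : ∀ x ∈ s, ∃ W ∈ nhds x, IsMeagre (f '' (s ∩ W))) : IsMeagre (f '' s) := by
  choose! W hW hWm using h
  obtain ⟨t, hts, htc, hst⟩ := TopologicalSpace.countable_cover_nhdsWithin (s := s) (f := W)
    fun x hx => mem_nhdsWithin_of_mem_nhds (hW x hx)
  have := htc.to_subtype
  refine (isMeagre_iUnion fun x : t => hWm x (hts x.2)).mono ?_
  rintro _ ⟨y, hy, rfl⟩
  obtain ⟨x, hx, hyx⟩ := Set.mem_iUnion₂.mp (hst hy)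
  exact Set.mem_iUnion.mpr ⟨⟨x, hx⟩, y, ⟨hy, hyx⟩, rfl⟩

/-- The critical values of a `C¹` function on a compact set are a meagre set. -/
theorem isMeagre_image_critical {c : ℝ → ℝ} {J : Set ℝ} (hJ : IsCompact J)
    (hc : ∀ k ∈ J, ContDiffAt ℝ 1 c k) : IsMeagre (c '' {k | k ∈ J ∧ deriv c k = 0}) := by
  have hder : ContinuousOn (deriv c) J := fun k hk => by
    have h1 : ContinuousAt (fun x => fderiv ℝ c x 1) k :=
      ((hc k hk).fderiv_right (m := 0) (by norm_num)).continuousAt.clm_apply continuousAt_const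
    exact ContinuousAt.continuousWithinAt (h1.congr (Filter.Eventually.of_forall
      fun x => by simp))
  have hcl : IsCompact {k | k ∈ J ∧ deriv c k = 0} :=
    hJ.of_isClosed_subset (hder.preimage_isClosed_of_isClosed hJ.isClosed isClosed_singleton)
      fun k hk => hk.1
  have hcomp : IsCompact (c '' {k | k ∈ J ∧ deriv c k = 0}) :=
    hcl.image_of_continuousOn fun k hk => (hc k hk.1).continuousAt.continuousWithinAt
  refine IsNowhereDense.isMeagre (hcomp.isClosed.isNowhereDense_iff.mpr ?_)
  refine MeasureTheory.Measure.interior_eq_empty_of_null (μ := MeasureTheory.volume) ?_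
  refine MeasureTheory.addHaar_image_eq_zero_of_det_fderivWithin_eq_zero (f' := fderiv ℝ c) _
    (fun k hk => ((hc k hk.1).differentiableAt one_ne_zero).hasFDerivAt.hasFDerivWithinAt)
    fun k hk => ?_
  have : fderiv ℝ c k = 0 := by
    ext
    simpa using hk.2
  rw [this]
  simp

/-- The values of a `C¹` function at those points of the boundary of a closed set where it is
regular are a meagre set. -/
theorem isMeagre_image_regular_boundary {c : ℝ → ℝ} {D : Set ℝ} (hD : IsClosed D)
    (hc : ∀ k ∈ D, ContDiffAt ℝ 1 c k) :
    IsMeagre (c '' {k | k ∈ D ∧ k ∉ interior D ∧ deriv c k ≠ 0}) := by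
  refine isMeagre_image_of_local fun k hk => ?_
  obtain ⟨hkD, hki, hk0⟩ := hk
  have hstrict := ((hc k hkD).hasStrictDerivAt one_ne_zero).hasStrictFDerivAt_equiv hk0
  set e := hstrict.toOpenPartialHomeomorph c with he
  have hek : k ∈ e.source := hstrict.mem_toOpenPartialHomeomorph_source
  have hec : ∀ x, e x = c x := fun x => by rw [he, hstrict.toOpenPartialHomeomorph_coe]
  refine ⟨e.source, e.open_source.mem_nhds hek, ?_⟩
  -- the values lie on the boundary of an open set
  set t := e.target ∩ e.symm ⁻¹' Dᶜ with ht
  have hto : IsOpen t := e.isOpen_inter_preimage_symm hD.isOpen_compl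
  have hnd : IsMeagre (frontier t) := by
    refine IsNowhereDense.isMeagre (isClosed_frontier.isNowhereDense_iff.mpr ?_)
    rw [← frontier_compl]
    exact interior_frontier hto.isClosed_compl
  refine hnd.mono ?_
  rintro _ ⟨x, ⟨⟨hxD, hxi, -⟩, hxs⟩, rfl⟩
  rw [← hec, hto.frontier_eq]
  refine ⟨?_, fun hmem => ?_⟩
  · have h1 : x ∈ closure (Dᶜ ∩ e.source) := by
      have h2 : x ∈ closure Dᶜ := by rwa [closure_compl]
      rw [Set.inter_comm]
      exact e.open_source.inter_closure ⟨hxs, h2⟩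
    have h3 : e x ∈ closure (e '' (Dᶜ ∩ e.source)) :=
      mem_closure_image (e.continuousAt hxs) h1
    refine closure_mono ?_ h3
    rintro _ ⟨y, ⟨hyD, hys⟩, rfl⟩
    refine ⟨e.map_source hys, ?_⟩
    change e.symm (e y) ∈ Dᶜ
    rwa [e.left_inv hys]
  · have h1 : e.symm (e x) ∈ Dᶜ := hmem.2
    rw [e.left_inv hxs] at h1
    exact h1 hxD

section

variable {N : ℕ} {U : Set ℝ} {S : ℝ → ℝ → Mat N} {G : ℝ → ℝ → ℝ → Mat N}

/-- Near `(l, k)` the points where `-1` is an eigenvalue of `S` form the graph of a function of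
class `C¹` with non-zero slope at `k`, and the multiplicity is constant along this graph. -/
def HasTransversalCurve (S : ℝ → ℝ → Mat N) (l k : ℝ) : Prop :=
  ∃ c : ℝ → ℝ, c k = l ∧ ContDiffAt ℝ 1 c k ∧ deriv c k ≠ 0 ∧
    ∀ᶠ p : ℝ × ℝ in nhds (k, l),
      (p.2 = c p.1 → negOneMult (S p.2 p.1) = negOneMult (S l k)) ∧
      (p.2 ≠ c p.1 → negOneMult (S p.2 p.1) = 0)

/-- For generic energies all eigenvalue curves cross transversally: locally, the exceptional
energies are critical values of the curve, or its values at the boundary points of the set of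
momenta where the multiplicity persists. -/
theorem IsScatteringFamily.isMeagre_not_transversal (hF : IsScatteringFamily U S G) :
    IsMeagre {l | l ∈ U ∧ ∃ k, negOneMult (S l k) ≠ 0 ∧ ¬ HasTransversalCurve S l k} := by
  let bad : ℕ → Set (ℝ × ℝ) := fun m =>
    {p | p.2 ∈ U ∧ negOneMult (S p.2 p.1) = m + 1 ∧ ¬ HasTransversalCurve S p.2 p.1}
  suffices h : ∀ m, IsMeagre (Prod.snd '' bad m) by
    refine (isMeagre_iUnion h).mono ?_
    rintro l ⟨hl, k, hk, hk'⟩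
    obtain ⟨m, hm⟩ := Nat.exists_eq_succ_of_ne_zero hk
    exact Set.mem_iUnion.mpr ⟨m, (k, l), ⟨hl, hm, hk'⟩, rfl⟩
  intro m
  refine isMeagre_image_of_local ?_
  rintro ⟨k₀, l₀⟩ ⟨hl, hm, -⟩
  obtain ⟨c, σ, hc0, hev, hbox⟩ := hF.exists_curve hl (by rw [hm]; exact Nat.succ_ne_zero m)
  rw [hm] at hev hbox
  obtain ⟨r, hr, hrJ⟩ := Metric.nhds_basis_closedBall.mem_iff.mp hev
  set J := Metric.closedBall k₀ r with hJ
  set D := {k | k ∈ J ∧ σ k = 0} with hD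
  have hJc : IsCompact J := isCompact_closedBall k₀ r
  have hDc : IsClosed D := ContinuousOn.preimage_isClosed_of_isClosed
    (fun k hk => (hrJ hk).2.1.continuousWithinAt) hJc.isClosed isClosed_singleton
  have hmeagre := (isMeagre_image_critical hJc fun k hk => (hrJ hk).1).union
    (isMeagre_image_regular_boundary hDc fun k hk => (hrJ hk.1).1)
  refine ⟨_, Filter.inter_mem (eventually_eventually_nhds.mpr hbox)
    (continuous_fst.continuousAt.preimage_mem_nhds (Metric.closedBall_mem_nhds k₀ hr)),
    hmeagre.mono ?_⟩
  rintro _ ⟨⟨k, l⟩, ⟨⟨hlU, hlm, hnt⟩, hnear, hkJ⟩, rfl⟩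
  change l ∈ U at hlU
  change negOneMult (S l k) = m + 1 at hlm
  change k ∈ J at hkJ
  have hlc : l = c k := hnear.self_of_nhds.1 hlm
  have hσ : σ k = 0 := (hrJ hkJ).2.2.mp (by rw [← hlc]; exact hlm)
  change l ∈ _
  by_cases hd : deriv c k = 0
  · exact Or.inl ⟨k, ⟨hkJ, hd⟩, hlc.symm⟩
  · refine Or.inr ⟨k, ⟨⟨hkJ, hσ⟩, fun hint => hnt ?_, hd⟩, hlc.symm⟩
    refine ⟨c, hlc.symm, (hrJ hkJ).1, hd, ?_⟩
    have hDn : ∀ᶠ p : ℝ × ℝ in nhds (k, l), p.1 ∈ D :=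
      continuous_fst.continuousAt.eventually_mem (mem_interior_iff_mem_nhds.mp hint)
    filter_upwards [hnear, hDn] with p hp hpD
    have h1 : negOneMult (S (c p.1) p.1) = m + 1 := (hrJ hpD.1).2.2.mpr hpD.2
    change _ ∧ (_ → negOneMult (S p.2 p.1) = 0)
    refine ⟨fun h => ?_, hp.2 h1⟩
    rw [hlm, h, h1]

variable {B : BulkHamiltonian N} (E : EdgeHamiltonian B)

theorem EdgeHamiltonian.hasTransversalBranches {ν : ℝ} (hν : ν ∈ B.gap) (k : ℝ)
    (h : negOneMult (E.scat ν k) ≠ 0 → HasTransversalCurve E.scat ν k) :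
    HasTransversalBranches E ν k := by
  have hgap : ∀ᶠ p : ℝ × ℝ in nhds (k, ν), p.2 ∈ B.gap :=
    continuous_snd.continuousAt.eventually_mem (B.isOpen_gap.mem_nhds hν)
  suffices hs : ∃ (m : ℕ) (ε : Fin m → ℝ → ℝ),
      (∀ i, ContDiffAt ℝ 1 (ε i) k ∧ ε i k = ν ∧ deriv (ε i) k ≠ 0) ∧
      ∀ᶠ p : ℝ × ℝ in nhds (k, ν), E.mult p.1 p.2 = Nat.card {i : Fin m // ε i p.1 = p.2} by
    obtain ⟨m, ε, h1, h2⟩ := hs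
    obtain ⟨δ, hδ, hball⟩ := Metric.eventually_nhds_iff.mp h2
    refine ⟨m, ε, h1, δ, hδ, fun k' l hk' hl => hball (y := (k', l)) ?_⟩
    rw [Prod.dist_eq, Real.dist_eq, Real.dist_eq]
    exact max_lt hk' hl
  by_cases h0 : negOneMult (E.scat ν k) = 0
  · refine ⟨0, fun _ => id, fun i => i.elim0, ?_⟩
    have h1 : ContinuousAt (fun p : ℝ × ℝ => (1 + E.scat p.2 p.1).det) (k, ν) :=
      ContinuousAt.comp (f := fun p : ℝ × ℝ => (p.2, p.1))
        (g := fun p : ℝ × ℝ => (1 + E.scat p.1 p.2).det)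
        (E.isScatteringFamily.continuousAt_det hν k) continuous_swap.continuousAt
    filter_upwards [hgap, h1.eventually_ne (finrank_kerOneAdd_eq_zero.mp h0)] with p hp hdet
    rw [E.mult_eq hp]
    rw [Nat.card_of_isEmpty]
    exact finrank_kerOneAdd_eq_zero.mpr hdet
  · obtain ⟨c, hck, hc, hc', hev⟩ := h h0
    refine ⟨negOneMult (E.scat ν k), fun _ => c, fun _ => ⟨hc, hck, hc'⟩, ?_⟩
    filter_upwards [hgap, hev] with p hp hpc
    rw [E.mult_eq hp]
    by_cases hpe : p.2 = c p.1
    · rw [hpc.1 hpe, Nat.card_congr (Equiv.subtypeUnivEquiv fun _ => hpe.symm), Nat.card_fin]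
    · have : IsEmpty {i : Fin (negOneMult (E.scat ν k)) // c p.1 = p.2} :=
        ⟨fun i => hpe i.2.symm⟩
      rw [hpc.2 hpe, Nat.card_of_isEmpty]

/-- Transversal crossings are isolated. -/
theorem HasTransversalBranches.eventually_mult_eq_zero {ν k₀ : ℝ}
    (h : HasTransversalBranches E ν k₀) : ∀ᶠ k in nhds k₀, k ≠ k₀ → E.mult k ν = 0 := by
  obtain ⟨m, ε, h1, δ, hδ, h2⟩ := h
  have h3 : ∀ᶠ k in nhds k₀, k ≠ k₀ → ∀ i, ε i k ≠ ν := by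
    refine eventually_nhdsWithin_iff (s := {k₀}ᶜ).mp (Filter.eventually_all.mpr ?_)
    intro i
    have := ((h1 i).1.differentiableAt one_ne_zero).hasDerivAt.eventually_ne
      (c := ε i k₀) (h1 i).2.2
    filter_upwards [this] with k hk
    rwa [(h1 i).2.1] at hk
  filter_upwards [h3, Metric.ball_mem_nhds k₀ hδ] with k hk hkδ hne
  rw [h2 k ν hkδ (by simpa using hδ)]
  have : IsEmpty {i : Fin m // ε i k = ν} := ⟨fun i => hk hne i.1 i.2⟩
  exact Nat.card_of_isEmpty

theorem exists_finset_crossings {ν : ℝ} (h : ∀ k, HasTransversalBranches E ν k) :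
    ∃ K : Finset ℝ, ∀ k, k ∈ K ↔ k ∈ Set.Icc 0 Real.pi ∧ E.mult k ν ≠ 0 := by
  obtain ⟨t, -, ht⟩ := (isCompact_Icc (a := (0 : ℝ)) (b := Real.pi)).elim_nhds_subcover
    (fun k₀ => {k | k ≠ k₀ → E.mult k ν = 0}) fun k₀ _ => (h k₀).eventually_mult_eq_zero E
  have hfin : {k | k ∈ Set.Icc 0 Real.pi ∧ E.mult k ν ≠ 0}.Finite := by
    refine t.finite_toSet.subset fun k hk => ?_
    obtain ⟨k₀, hk₀, hkk⟩ := Set.mem_iUnion₂.mp (ht hk.1)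
    by_contra hkt
    exact hk.2 (hkk fun he => hkt (by rw [he]; exact hk₀))
  exact ⟨hfin.toFinset, fun k => by rw [Set.Finite.mem_toFinset]; rfl⟩

/-- The edge index exists. -/
theorem exists_isEdgeIndex {Θ : Internal N →ₛₗ[starRingEnd ℂ] Internal N}
    {M : Matrix (Fin N) (Fin N) ℂ} (hE : IsEdgeReversal E Θ) (hM : IsAdapted Θ M) {μ : ℝ}
    (hμ : μ ∈ B.gap) : ∃ s, IsEdgeIndex E μ s := by
  obtain ⟨r, hr, hrU⟩ := Metric.nhds_basis_closedBall.mem_iff.mp (B.isOpen_gap.mem_nhds hμ)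
  rw [Real.closedBall_eq_Icc] at hrU
  have hne : ¬ IsMeagre (Set.Ioo (μ - r) (μ + r)) :=
    not_isMeagre_of_isOpen isOpen_Ioo ⟨μ, by constructor <;> linarith⟩
  obtain ⟨ν, hν, hνt⟩ : ∃ ν ∈ Set.Ioo (μ - r) (μ + r),
      ∀ k, negOneMult (E.scat ν k) ≠ 0 → HasTransversalCurve E.scat ν k := by
    by_contra! hcon
    refine hne (E.isScatteringFamily.isMeagre_not_transversal.mono fun ν hν => ?_)
    exact ⟨hrU (Set.Ioo_subset_Icc_self hν), hcon ν hν⟩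
  have hνg : ν ∈ B.gap := hrU (Set.Ioo_subset_Icc_self hν)
  have hbr : ∀ k, HasTransversalBranches E ν k := fun k => E.hasTransversalBranches hνg k (hνt k)
  obtain ⟨K, hK⟩ := exists_finset_crossings E hbr
  obtain ⟨n, hn, -⟩ := hE.exists_crossing_number hM hνg hbr hK
  exact ⟨(-1) ^ n, μ - r, μ + r, ν, K, n, by linarith, by linarith, fun l hl k => hrU hl k,
    Set.Ioo_subset_Icc_self hν, hbr, hK, hn, rfl⟩

end

/-! ### Independence of the boundary and of the energy -/

/-- The restriction of a sequence on `ℤ` to the sites `1, 2, …`. -/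
def restrictSites (N : ℕ) : BddSeq ℤ N →L[ℝ] BddSeq ℕ N :=
  LinearMap.mkContinuous
    { toFun := fun V => ⟨fun j => V ((j : ℤ) + 1), memℓp_infty ⟨‖V‖, by
        rintro _ ⟨j, rfl⟩
        exact lp.norm_apply_le_norm ENNReal.top_ne_zero V _⟩⟩
      map_add' := fun _ _ => rfl
      map_smul' := fun _ _ => rfl } 1
    (fun V => by
      rw [one_mul]
      exact lp.norm_le_of_forall_le (norm_nonneg _) fun j =>
        lp.norm_apply_le_norm ENNReal.top_ne_zero V _)

section

variable {N : ℕ} {B : BulkHamiltonian N} {Θ : Internal N →ₛₗ[starRingEnd ℂ] Internal N}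

/-- The edge Hamiltonian obtained by restricting the bulk Hamiltonian to the half-line. -/
def BulkHamiltonian.truncation (B : BulkHamiltonian N) : EdgeHamiltonian B where
  V k := restrictSites N (B.V k)
  V_contDiff := (restrictSites N).contDiff.comp B.V_contDiff
  V_periodic k := by rw [B.V_periodic]
  V_selfAdjoint k _ := B.V_selfAdjoint k _
  eq_bulk := ⟨0, fun _ _ _ => rfl⟩

theorem BulkHamiltonian.truncation_V (B : BulkHamiltonian N) (k : ℝ) (j : ℕ) :
    B.truncation.V k j = B.V k ((j : ℤ) + 1) := rfl

theorem IsTimeReversal.isEdgeReversal_truncation {S : EdgeHamiltonian B}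
    (h : IsTimeReversal B S Θ) : IsEdgeReversal B.truncation Θ where
  sq := h.sq
  antiunitary := h.antiunitary
  hopping := h.isEdgeReversal.hopping
  hopping_adjoint := h.isEdgeReversal.hopping_adjoint
  potential k _ u := h.bulk_potential k _ u

theorem isSelfAdjoint_lineCombination {N : ℕ} {X Y : Mat N} (hX : IsSelfAdjoint X)
    (hY : IsSelfAdjoint Y) (r s : ℝ) : IsSelfAdjoint ((r : ℂ) • X + (s : ℂ) • Y) := by
  have h1 : star ((r : ℂ) • X + (s : ℂ) • Y) = (r : ℂ) • X + (s : ℂ) • Y := by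
    have hX' : adjoint X = X := hX
    have hY' : adjoint Y = Y := hY
    rw [ContinuousLinearMap.star_eq_adjoint, map_add, map_smulₛₗ, map_smulₛₗ, hX', hY',
      Complex.conj_ofReal, Complex.conj_ofReal]
  exact h1

theorem lineCombination_self {N : ℕ} (X : Mat N) (t : ℝ) :
    ((1 - t : ℝ) : ℂ) • X + (t : ℂ) • X = X := by
  ext1 u
  change ((1 - t : ℝ) : ℂ) • X u + (t : ℂ) • X u = X u
  rw [← add_smul]
  push_cast
  rw [sub_add_cancel, one_smul]

/-- The straight path between two edge Hamiltonians with the same bulk. -/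
def EdgeHamiltonian.interpolate (S S' : EdgeHamiltonian B) (t : ℝ) : EdgeHamiltonian B where
  V k := ((1 - t : ℝ) : ℂ) • S.V k + (t : ℂ) • S'.V k
  V_contDiff :=
    ContDiff.add (ContDiff.const_smul _ S.V_contDiff) (ContDiff.const_smul _ S'.V_contDiff)
  V_periodic k := by rw [S.V_periodic, S'.V_periodic]
  V_selfAdjoint k j :=
    isSelfAdjoint_lineCombination (S.V_selfAdjoint k j) (S'.V_selfAdjoint k j) _ _
  eq_bulk := by
    obtain ⟨n, hn⟩ := S.eq_bulk
    obtain ⟨n', hn'⟩ := S'.eq_bulk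
    refine ⟨max n n', fun k j hj => ?_⟩
    have h1 : ∀ X Y Z : Mat N, X = Z → Y = Z → ((1 - t : ℝ) : ℂ) • X + (t : ℂ) • Y = Z := by
      rintro X Y Z rfl rfl
      exact lineCombination_self _ t
    exact h1 _ _ _ (hn k j (by omega)) (hn' k j (by omega))

theorem EdgeHamiltonian.interpolate_V (S S' : EdgeHamiltonian B) (t k : ℝ) :
    (S.interpolate S' t).V k = ((1 - t : ℝ) : ℂ) • S.V k + (t : ℂ) • S'.V k := rfl

theorem IsEdgeReversal.interpolate {S S' : EdgeHamiltonian B} (h : IsEdgeReversal S Θ)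
    (h' : IsEdgeReversal S' Θ) (t : ℝ) : IsEdgeReversal (S.interpolate S' t) Θ where
  sq := h.sq
  antiunitary := h.antiunitary
  hopping := h.hopping
  hopping_adjoint := h.hopping_adjoint
  potential k j u := by
    change ((1 - t : ℝ) : ℂ) • S.V (-k) j (Θ u) + (t : ℂ) • S'.V (-k) j (Θ u)
      = Θ (((1 - t : ℝ) : ℂ) • S.V k j u + (t : ℂ) • S'.V k j u)
    rw [h.potential, h'.potential, map_add, LinearMap.map_smulₛₗ, LinearMap.map_smulₛₗ,
      Complex.conj_ofReal, Complex.conj_ofReal]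

/-- The sign of the scattering matrix depends on the bulk only. -/
theorem IsEdgeReversal.exists_common_sign {S S' : EdgeHamiltonian B} (h : IsEdgeReversal S Θ)
    (h' : IsEdgeReversal S' Θ) {M : Matrix (Fin N) (Fin N) ℂ} (hM : IsAdapted Θ M) {x : ℝ}
    (hx : x ∈ B.gap) :
    ∃ s : ℂ, IsKramersSign (S.scatMatrix M x) s ∧ IsKramersSign (S'.scatMatrix M x) s := by
  have hcont : ∀ p : ℝ × ℝ, ContinuousAt (fun p : ℝ × ℝ =>
      (S.interpolate S' p.1).scatMatrix M x p.2) p := by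
    intro p
    have h1 : Continuous fun p : ℝ × ℝ => (B.A p.2, (S.interpolate S' p.1).V p.2, (x : ℂ)) := by
      have h2 : Continuous fun p : ℝ × ℝ => S.V p.2 := S.V_contDiff.continuous.comp continuous_snd
      have h3 : Continuous fun p : ℝ × ℝ => S'.V p.2 := S'.V_contDiff.continuous.comp continuous_snd
      have h4 : Continuous fun p : ℝ × ℝ => B.A p.2 := B.A_contDiff.continuous.comp continuous_snd
      have h5 : Continuous fun p : ℝ × ℝ => ((1 - p.1 : ℝ) : ℂ) := by fun_prop
      have h6 : Continuous fun p : ℝ × ℝ => (p.1 : ℂ) := by fun_prop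
      exact h4.prodMk (((h5.smul h2).add (h6.smul h3)).prodMk continuous_const)
    have h2 : ContinuousAt (fun p : ℝ × ℝ => (S.interpolate S' p.1).scat x p.2) p :=
      ContinuousAt.comp (f := fun p : ℝ × ℝ => (B.A p.2, (S.interpolate S' p.1).V p.2, (x : ℂ)))
        (g := fun p : Mat N × BddSeq ℕ N × ℂ => BulkEdge.scat p.1 p.2.1 p.2.2)
        (BulkEdge.contDiffAt_scat (n := 0) (p := (B.A p.2, (S.interpolate S' p.1).V p.2, (x : ℂ)))
          ((S.interpolate S' p.1).isUnit_dissOp hx p.2)).continuousAt h1.continuousAt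
    have h3 : ContinuousAt (fun p : ℝ × ℝ => toMat N ((S.interpolate S' p.1).scat x p.2)) p :=
      ContinuousAt.comp (continuous_toMat N).continuousAt h2
    exact (continuousAt_const.mul h3).mul continuousAt_const
  obtain ⟨s, hs⟩ := IsKramersSign.homotopy (even_of_antilinear h.sq) zero_le_one
    (T := fun t k => (S.interpolate S' t).scatMatrix M x k)
    (fun p _ => (hcont p).continuousWithinAt)
    (fun _ _ k _ => hM.scatMatrix_det_ne_zero hx k)
    (fun t _ => (h.interpolate h' t).scatMatrix_zero hM hx)
    (fun t _ => (h.interpolate h' t).scatMatrix_pi hM hx)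
  have e0 : (S.interpolate S' 0).scatMatrix M x = S.scatMatrix M x := by
    funext k
    simp only [EdgeHamiltonian.scatMatrix, EdgeHamiltonian.scat, EdgeHamiltonian.interpolate_V]
    simp
  have e1 : (S.interpolate S' 1).scatMatrix M x = S'.scatMatrix M x := by
    funext k
    simp only [EdgeHamiltonian.scatMatrix, EdgeHamiltonian.scat, EdgeHamiltonian.interpolate_V]
    simp
  refine ⟨s, ?_, ?_⟩
  · rw [← e0]; exact hs 0 (by simp)
  · rw [← e1]; exact hs 1 (by simp)

theorem EdgeHamiltonian.mult_eq_zero_of_norm_lt (S : EdgeHamiltonian B) {k x : ℝ}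
    (h : ‖S.op k‖ < |x|) : S.mult k x = 0 := by
  suffices h0 : Module.End.eigenspace (S.op k : L2 ℕ N →ₗ[ℂ] L2 ℕ N) (x : ℂ) = ⊥ by
    rw [EdgeHamiltonian.mult, h0, finrank_bot]
  rw [Submodule.eq_bot_iff]
  intro f hf
  rw [Module.End.mem_eigenspace_iff] at hf
  have h1 : S.op k f = (x : ℂ) • f := hf
  have h2 := (S.op k).le_opNorm f
  rw [h1, norm_smul, Complex.norm_real, Real.norm_eq_abs] at h2
  by_contra hne
  have h3 : 0 < ‖f‖ := norm_pos_iff.mpr hne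
  nlinarith

/-- Below the bulk spectrum the sign of the scattering matrix is trivial, because there are no edge
states at very low energies. -/
theorem IsEdgeReversal.isKramersSign_one {S : EdgeHamiltonian B} (h : IsEdgeReversal S Θ)
    {M : Matrix (Fin N) (Fin N) ℂ} (hM : IsAdapted Θ M) {x : ℝ} (hx : Set.Iic x ⊆ B.gap) :
    IsKramersSign (S.scatMatrix M x) 1 := by
  have hN := even_of_antilinear h.sq
  have hop : Continuous S.op := by
    have h1 : Continuous fun k => (B.A k, S.V k) :=
      B.A_contDiff.continuous.prodMk S.V_contDiff.continuous
    have h2 : Continuous fun p : Mat N × BddSeq ℕ N => halfOp p.1 p.2 :=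
      (contDiff_halfOp N (n := 0)).continuous
    have h3 : Continuous fun k => halfOp (B.A k) (S.V k) :=
      Continuous.comp (f := fun k => (B.A k, S.V k))
        (g := fun p : Mat N × BddSeq ℕ N => halfOp p.1 p.2) h2 h1
    have h4 : S.op = fun k => halfOp (B.A k) (S.V k) := funext S.op_eq
    rw [h4]
    exact h3
  obtain ⟨C, hC⟩ := (isCompact_Icc (a := (0 : ℝ)) (b := Real.pi)).exists_bound_of_continuousOn
    hop.continuousOn
  -- at the energy `y` below all edge spectra, `phase (det (1 + S))` is a continuous square root
  set y := min x (-(|C| + 1)) with hy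
  have hyx : y ≤ x := min_le_left _ _
  have hyg : y ∈ B.gap := hx hyx
  have hdet : ∀ k ∈ Set.Icc 0 Real.pi, (1 + S.scatMatrix M y k).det ≠ 0 := by
    intro k hk
    rw [hM.det_one_add_scatMatrix]
    refine finrank_kerOneAdd_eq_zero.mp ?_
    have h1 : S.mult k y = 0 := by
      refine S.mult_eq_zero_of_norm_lt ((hC k hk).trans_lt ?_)
      have h2 : y ≤ -(|C| + 1) := min_le_right _ _
      have h3 := neg_abs_le y
      have h4 := le_abs_self C
      linarith
    rwa [S.mult_eq hyg] at h1
  have hsign : IsKramersSign (S.scatMatrix M y) 1 := by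
    refine ⟨fun k => phase (1 + S.scatMatrix M y k).det, ?_, fun k hk => ?_, ?_⟩
    · refine ContinuousOn.phase (fun k _ => ?_) hdet
      have h1 : ContinuousAt (fun k => S.scatMatrix M y k) k :=
        ContinuousAt.comp (f := fun k : ℝ => (y, k)) (g := fun p : ℝ × ℝ => S.scatMatrix M p.1 p.2)
          (S.continuousAt_scatMatrix M hyg k) (by fun_prop)
      have h2 : ContinuousAt (fun k => 1 + S.scatMatrix M y k) k := continuousAt_const.add h1
      exact (ContinuousAt.comp (continuous_id.matrix_det).continuousAt h2).continuousWithinAt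
    · have h1 := hdet k hk
      rw [hM.det_one_add_scatMatrix] at h1
      change phase (1 + S.scatMatrix M y k).det ^ 2 = _
      rw [hM.det_one_add_scatMatrix, hM.det_scatMatrix,
        phase_det_one_add_sq (S.isScatteringFamily.mul_adjoint y hyg k) h1]
    · have key : ∀ k ∈ Set.Icc 0 Real.pi, S.scatMatrix M y k * tau (S.scatMatrix M y k) = 1 →
          kramersRoot (S.scatMatrix M y k) = phase (1 + S.scatMatrix M y k).det := by
        intro k hk hk'
        rw [kramersRoot_eq hN hk' (z := 1) (by simp) (by simpa using hdet k hk)]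
        simp
      rw [key 0 ⟨le_rfl, Real.pi_pos.le⟩ (h.scatMatrix_zero hM hyg),
        key Real.pi ⟨Real.pi_pos.le, le_rfl⟩ (h.scatMatrix_pi hM hyg), one_mul, mul_comm]
  obtain ⟨s, hs⟩ := h.exists_isKramersSign_scatMatrix hM hyx
    (fun z hz => hx hz.2)
  have h1 := (hs y ⟨le_rfl, hyx⟩).unique (fun k _ => hM.scatMatrix_det_ne_zero hyg k) hsign
  rw [← h1]
  exact hs x ⟨hyx, le_rfl⟩

end

/-! ### Decaying solutions and their amplitudes -/

section

variable {N : ℕ} {B : BulkHamiltonian N} {Θ : Internal N →ₛₗ[starRingEnd ℂ] Internal N}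

/-- The amplitude `ψ₀ + c A* ψ₁` of a sequence. -/
def BulkHamiltonian.amp (B : BulkHamiltonian N) (k : ℝ) (c : ℂ) :
    (ℤ → Internal N) →ₗ[ℂ] Internal N :=
  LinearMap.proj 0 + c • ((adjoint (B.A k) : Internal N →ₗ[ℂ] Internal N) ∘ₗ LinearMap.proj 1)

theorem BulkHamiltonian.amp_apply (B : BulkHamiltonian N) (k : ℝ) (c : ℂ) (ψ : ℤ → Internal N) :
    B.amp k c ψ = ψ 0 + c • adjoint (B.A k) (ψ 1) := rfl

theorem BulkHamiltonian.isUnit_dissOp_truncation (B : BulkHamiltonian N) {z : ℂ} {k : ℝ}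
    (hz : 0 ≤ z.im) (hzk : z ∉ spectrum ℂ (B.op k)) :
    IsUnit (dissOp (B.A k) (B.truncation.V k) - z • (1 : L2 ℕ N →L[ℂ] L2 ℕ N)) := by
  rcases hz.lt_or_eq with h | h
  · exact isUnit_dissOp_of_im_pos _ _ (B.truncation.V_selfAdjoint k) h
  · have hre : z = (z.re : ℂ) := Complex.ext rfl (by simp [← h])
    rw [hre] at hzk ⊢
    exact isUnit_dissOp_of_real B k _ (B.truncation.V_selfAdjoint k) (n₀ := 0)
      (fun j _ => B.truncation_V k j) hzk

theorem BulkHamiltonian.A_injective (B : BulkHamiltonian N) {k : ℝ} {u : Internal N}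
    (h : B.A k u = 0) : u = 0 := by
  have h1 : (Ring.inverse (B.A k) * B.A k) u = u := by
    rw [Ring.inverse_mul_cancel _ (B.A_isUnit k)]; rfl
  rw [← h1]
  change Ring.inverse (B.A k) (B.A k u) = 0
  rw [h, map_zero]

/-- A decaying solution is determined by its amplitude `ψ₀ + i A* ψ₁`. -/
theorem eq_solOp_of_mem_decayingSolutions {z : ℂ} {k : ℝ} {ψ : ℤ → Internal N}
    (hψ : ψ ∈ decayingSolutions B z k)
    (h : IsUnit (dissOp (B.A k) (B.truncation.V k) - z • (1 : L2 ℕ N →L[ℂ] L2 ℕ N))) (j : ℕ) :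
    ψ ((j : ℤ) + 1) = solOp (B.A k) (B.truncation.V k) z (B.amp k Complex.I ψ) j := by
  obtain ⟨h1, h2⟩ := hψ
  have hmem : Memℓp (fun j : ℕ => ψ ((j : ℤ) + 1)) 2 := by
    rw [memℓp_gen_iff (by norm_num)] at h2 ⊢
    exact_mod_cast (summable_nat_add_iff 1).mpr h2
  set f : L2 ℕ N := ⟨fun j : ℕ => ψ ((j : ℤ) + 1), hmem⟩ with hf
  have hfj : ∀ j : ℕ, f j = ψ ((j : ℤ) + 1) := fun _ => rfl
  have hop : halfOp (B.A k) (B.truncation.V k) f = z • f - inclFirst N (B.A k (ψ 0)) := by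
    ext1; funext j
    change halfOp (B.A k) (B.truncation.V k) f j = z • f j - inclFirst N (B.A k (ψ 0)) j
    cases j with
    | zero =>
      have h3 := h1 1
      rw [halfOp_apply_zero, inclFirst_apply_zero, hfj, hfj, B.truncation_V]
      norm_num at h3 ⊢
      rw [← h3]
      abel
    | succ j =>
      have h3 := h1 ((j : ℤ) + 1 + 1)
      rw [halfOp_apply_succ, inclFirst_apply_succ, hfj, hfj, hfj, B.truncation_V, sub_zero]
      push_cast
      rw [← h3]
      congr 4
      ring
  have h4 := eq_solOp h hop
  have h5 : ψ 0 + Complex.I • adjoint (B.A k) (f 0) = B.amp k Complex.I ψ := by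
    rw [B.amp_apply, hfj, Nat.cast_zero, zero_add]
  rw [h5] at h4
  exact congrArg (fun F : L2 ℕ N => F j) h4

theorem eq_zero_of_amp_eq_zero {z : ℂ} {k : ℝ} {ψ : ℤ → Internal N}
    (hψ : ψ ∈ decayingSolutions B z k)
    (h : IsUnit (dissOp (B.A k) (B.truncation.V k) - z • (1 : L2 ℕ N →L[ℂ] L2 ℕ N)))
    (h0 : B.amp k Complex.I ψ = 0) : ψ = 0 := by
  have hpos : ∀ j : ℕ, ψ ((j : ℤ) + 1) = 0 := fun j => by
    rw [eq_solOp_of_mem_decayingSolutions hψ h, h0, map_zero]; rfl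
  have hone : ψ 1 = 0 := by simpa using hpos 0
  have hzero : ψ 0 = 0 := by
    rw [B.amp_apply, hone, map_zero, smul_zero, add_zero] at h0
    exact h0
  have hneg : ∀ n : ℕ, ψ (-(n : ℤ)) = 0 ∧ ψ (-(n : ℤ) + 1) = 0 := by
    intro n
    induction n with
    | zero => simpa using ⟨hzero, hone⟩
    | succ n ih =>
      have h3 := hψ.1 (-(n : ℤ))
      rw [ih.1, ih.2, map_zero, map_zero, smul_zero, add_zero, add_zero] at h3
      have h4 := B.A_injective h3
      refine ⟨?_, ?_⟩
      · rw [← h4]; congr 1; push_cast; ring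
      · rw [← ih.1]; congr 1; push_cast; ring
  funext n
  obtain ⟨m, rfl | rfl⟩ := n.eq_nat_or_neg
  · cases m with
    | zero => exact hzero
    | succ m => exact_mod_cast hpos m
  · exact (hneg m).1

theorem amp_neg_eq_scat {x k : ℝ} (hx : x ∈ B.gap) {ψ : ℤ → Internal N}
    (hψ : ψ ∈ decayingSolutions B x k) :
    B.amp k (-Complex.I) ψ = B.truncation.scat x k (B.amp k Complex.I ψ) := by
  have h1 := eq_solOp_of_mem_decayingSolutions hψ (B.truncation.isUnit_dissOp hx k) 0
  rw [EdgeHamiltonian.scat, scat_apply, ← h1, B.amp_apply, B.amp_apply]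
  norm_num
  module

theorem IsTimeReversal.mem_decayingSolutions {S : EdgeHamiltonian B} (h : IsTimeReversal B S Θ)
    {z : ℂ} {k : ℝ} {ψ : ℤ → Internal N} (hψ : ψ ∈ decayingSolutions B z k) :
    (fun n => Θ (ψ n)) ∈ decayingSolutions B (conj z) (-k) := by
  refine ⟨fun n => ?_, ?_⟩
  · rw [h.isEdgeReversal.hopping, h.isEdgeReversal.hopping_adjoint, h.bulk_potential, ← map_add,
      ← map_add, hψ.1 n, LinearMap.map_smulₛₗ]
  · exact hψ.2.mono' fun j => (norm_antiunitary h.antiunitary (ψ j)).le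

theorem IsTimeReversal.amp_reversed {S : EdgeHamiltonian B} (h : IsTimeReversal B S Θ) (k : ℝ)
    (c : ℂ) (ψ : ℤ → Internal N) :
    B.amp (-k) c (fun n => Θ (ψ n)) = Θ (B.amp k (conj c) ψ) := by
  rw [B.amp_apply, B.amp_apply, map_add, LinearMap.map_smulₛₗ, Complex.conj_conj,
    h.isEdgeReversal.hopping_adjoint]

/-- The values at the sites `-n` and `-n + 1` of the solution with prescribed values at `0`, `1`. -/
def BulkHamiltonian.backward (B : BulkHamiltonian N) (z : ℂ) (k : ℝ) (a b : Internal N) :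
    ℕ → Internal N × Internal N
  | 0 => (a, b)
  | n + 1 =>
    (Ring.inverse (B.A k) (z • (B.backward z k a b n).1
        - adjoint (B.A k) (B.backward z k a b n).2 - B.V k (-(n : ℤ)) (B.backward z k a b n).1),
      (B.backward z k a b n).1)

/-- The decaying solution of energy `z` with amplitude `ψ₀ + i A* ψ₁ = u`. -/
def BulkHamiltonian.solution (B : BulkHamiltonian N) (z : ℂ) (k : ℝ) (u : Internal N) :
    ℤ → Internal N := fun n =>
  if 1 ≤ n then solOp (B.A k) (B.truncation.V k) z u (n - 1).toNat
  else (B.backward z k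
    (u - Complex.I • adjoint (B.A k) (solOp (B.A k) (B.truncation.V k) z u 0))
    (solOp (B.A k) (B.truncation.V k) z u 0) (-n).toNat).1

theorem BulkHamiltonian.solution_succ (B : BulkHamiltonian N) (z : ℂ) (k : ℝ) (u : Internal N)
    (j : ℕ) : B.solution z k u ((j : ℤ) + 1) = solOp (B.A k) (B.truncation.V k) z u j := by
  have h1 : ((j : ℤ) + 1 - 1).toNat = j := by omega
  rw [BulkHamiltonian.solution, if_pos (by omega), h1]

theorem BulkHamiltonian.solution_neg (B : BulkHamiltonian N) (z : ℂ) (k : ℝ) (u : Internal N)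
    (n : ℕ) : B.solution z k u (-(n : ℤ)) = (B.backward z k
      (u - Complex.I • adjoint (B.A k) (solOp (B.A k) (B.truncation.V k) z u 0))
      (solOp (B.A k) (B.truncation.V k) z u 0) n).1 := by
  have h1 : (-(-(n : ℤ))).toNat = n := by omega
  rw [BulkHamiltonian.solution, if_neg (by omega), h1]

theorem BulkHamiltonian.solution_zero (B : BulkHamiltonian N) (z : ℂ) (k : ℝ) (u : Internal N) :
    B.solution z k u 0 =
      u - Complex.I • adjoint (B.A k) (solOp (B.A k) (B.truncation.V k) z u 0) :=
  B.solution_neg z k u 0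

theorem BulkHamiltonian.solution_one (B : BulkHamiltonian N) (z : ℂ) (k : ℝ) (u : Internal N) :
    B.solution z k u 1 = solOp (B.A k) (B.truncation.V k) z u 0 := by
  have := B.solution_succ z k u 0
  rwa [Nat.cast_zero, zero_add] at this

theorem BulkHamiltonian.solution_neg_add_one (B : BulkHamiltonian N) (z : ℂ) (k : ℝ)
    (u : Internal N) (n : ℕ) : B.solution z k u (-(n : ℤ) + 1) = (B.backward z k
      (u - Complex.I • adjoint (B.A k) (solOp (B.A k) (B.truncation.V k) z u 0))
      (solOp (B.A k) (B.truncation.V k) z u 0) n).2 := by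
  cases n with
  | zero => rw [Nat.cast_zero, neg_zero, zero_add, B.solution_one]; rfl
  | succ n =>
    rw [show -((n + 1 : ℕ) : ℤ) + 1 = -(n : ℤ) by push_cast; ring, B.solution_neg]
    rfl

theorem BulkHamiltonian.amp_solution (B : BulkHamiltonian N) (z : ℂ) (k : ℝ) (u : Internal N) :
    B.amp k Complex.I (B.solution z k u) = u := by
  rw [B.amp_apply, B.solution_zero, B.solution_one, sub_add_cancel]

theorem BulkHamiltonian.solution_mem (B : BulkHamiltonian N) {z : ℂ} {k : ℝ}
    (h : IsUnit (dissOp (B.A k) (B.truncation.V k) - z • (1 : L2 ℕ N →L[ℂ] L2 ℕ N)))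
    (u : Internal N) : B.solution z k u ∈ decayingSolutions B z k := by
  have hop := halfOp_solOp h u
  set f := solOp (B.A k) (B.truncation.V k) z u with hf
  refine ⟨fun n => ?_, ?_⟩
  · rcases le_or_gt n 0 with hn | hn
    · obtain ⟨m, rfl⟩ : ∃ m : ℕ, n = -(m : ℤ) := ⟨(-n).toNat, by omega⟩
      have h1 : B.solution z k u (-(m : ℤ) - 1) = Ring.inverse (B.A k)
          (z • B.solution z k u (-(m : ℤ)) - adjoint (B.A k) (B.solution z k u (-(m : ℤ) + 1))
            - B.V k (-(m : ℤ)) (B.solution z k u (-(m : ℤ)))) := by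
        rw [show -(m : ℤ) - 1 = -((m + 1 : ℕ) : ℤ) by push_cast; ring, B.solution_neg,
          B.solution_neg, B.solution_neg_add_one]
        rfl
      have h2 : ∀ v, B.A k (Ring.inverse (B.A k) v) = v := fun v => by
        have : (B.A k * Ring.inverse (B.A k)) v = v := by
          rw [Ring.mul_inverse_cancel _ (B.A_isUnit k)]; rfl
        exact this
      rw [h1, h2]
      abel
    · obtain ⟨m, rfl⟩ : ∃ m : ℕ, n = (m : ℤ) + 1 := ⟨(n - 1).toNat, by omega⟩
      have h1 := congrArg (fun F : L2 ℕ N => F m) hop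
      change halfOp (B.A k) (B.truncation.V k) f m = z • f m - inclFirst N _ m at h1
      cases m with
      | zero =>
        rw [halfOp_apply_zero, inclFirst_apply_zero] at h1
        have h2 : B.solution z k u (1 + 1) = f 1 := B.solution_succ z k u 1
        simp only [Nat.cast_zero, zero_add, sub_self]
        rw [h2, B.solution_zero, B.solution_one, ← hf, add_assoc]
        have h3 : B.V k 1 = B.truncation.V k 0 := by rw [B.truncation_V]; simp
        rw [h3, h1]
        abel
      | succ m =>
        rw [halfOp_apply_succ, inclFirst_apply_succ, sub_zero] at h1
        have h2 : B.solution z k u (((m + 1 : ℕ) : ℤ) + 1 - 1) = f m := by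
          rw [← B.solution_succ]; congr 1; push_cast; ring
        have h3 : B.solution z k u (((m + 1 : ℕ) : ℤ) + 1 + 1) = f (m + 2) := by
          rw [← B.solution_succ]; congr 1
        rw [h2, h3, B.solution_succ, ← hf, ← B.truncation_V]
        exact h1
  · rw [memℓp_gen_iff (by norm_num)]
    have h1 := (memℓp_gen_iff (p := 2) (by norm_num)).mp (lp.memℓp f)
    refine (summable_nat_add_iff 1).mp ?_
    refine h1.congr fun j => ?_
    rw [Nat.cast_add, Nat.cast_one, B.solution_succ]

theorem BulkHamiltonian.solution_periodic (B : BulkHamiltonian N) (z : ℂ) (k : ℝ)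
    (u : Internal N) : B.solution z (k + 2 * Real.pi) u = B.solution z k u := by
  have hb : ∀ a b n, B.backward z (k + 2 * Real.pi) a b n = B.backward z k a b n := by
    intro a b n
    induction n with
    | zero => rfl
    | succ n ih => simp only [BulkHamiltonian.backward, ih, B.A_periodic, B.V_periodic]
  funext n
  simp only [BulkHamiltonian.solution, hb, B.A_periodic, B.truncation.V_periodic]

theorem BulkHamiltonian.continuousOn_solOp (B : BulkHamiltonian N) {X : Type*}
    [TopologicalSpace X] {s : Set X} {z : X → ℂ} {κ : X → ℝ} {u : X → Internal N}
    (hz : ContinuousOn z s) (hκ : ContinuousOn κ s) (hu : ContinuousOn u s)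
    (h : ∀ x ∈ s, IsUnit (dissOp (B.A (κ x)) (B.truncation.V (κ x)) -
      z x • (1 : L2 ℕ N →L[ℂ] L2 ℕ N))) (j : ℕ) :
    ContinuousOn (fun x => solOp (B.A (κ x)) (B.truncation.V (κ x)) (z x) (u x) j) s := by
  have hA : ContinuousOn (fun x => B.A (κ x)) s := B.A_contDiff.continuous.comp_continuousOn hκ
  have hVt : ContinuousOn (fun x => B.truncation.V (κ x)) s :=
    B.truncation.V_contDiff.continuous.comp_continuousOn hκ
  have hsol : ContinuousOn (fun x => solOp (B.A (κ x)) (B.truncation.V (κ x)) (z x)) s := by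
    intro x hx
    have h1 : ContinuousAt (fun p : Mat N × BddSeq ℕ N × ℂ => solOp p.1 p.2.1 p.2.2)
        (B.A (κ x), B.truncation.V (κ x), z x) :=
      (contDiffAt_solOp (n := 0) (p := (B.A (κ x), B.truncation.V (κ x), z x))
        (h x hx)).continuousAt
    exact ContinuousAt.comp_continuousWithinAt
      (f := fun x => (B.A (κ x), B.truncation.V (κ x), z x))
      (g := fun p : Mat N × BddSeq ℕ N × ℂ => solOp p.1 p.2.1 p.2.2) h1
      ((hA x hx).prodMk ((hVt x hx).prodMk (hz x hx)))
  have h1 : Continuous fun f : L2 ℕ N => f j :=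
    (lp.evalCLM ℂ (fun _ : ℕ => Internal N) 2 j).continuous
  have h2 : ContinuousOn (fun x => solOp (B.A (κ x)) (B.truncation.V (κ x)) (z x) (u x)) s :=
    hsol.clm_apply hu
  exact Continuous.comp_continuousOn (g := fun f : L2 ℕ N => f j) h1 h2

theorem BulkHamiltonian.continuousOn_backward (B : BulkHamiltonian N) {X : Type*}
    [TopologicalSpace X] {s : Set X} {z : X → ℂ} {κ : X → ℝ} {a b : X → Internal N}
    (hz : ContinuousOn z s) (hκ : ContinuousOn κ s) (ha : ContinuousOn a s)
    (hb : ContinuousOn b s) (n : ℕ) :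
    ContinuousOn (fun x => (B.backward (z x) (κ x) (a x) (b x) n).1) s ∧
    ContinuousOn (fun x => (B.backward (z x) (κ x) (a x) (b x) n).2) s := by
  have hA : ContinuousOn (fun x => B.A (κ x)) s := B.A_contDiff.continuous.comp_continuousOn hκ
  have hAa : ContinuousOn (fun x => adjoint (B.A (κ x))) s :=
    Continuous.comp_continuousOn (g := fun X : Mat N => adjoint X)
      (contDiff_adjoint N (n := 0)).continuous hA
  have hAi : ContinuousOn (fun x => Ring.inverse (B.A (κ x))) s := by
    intro x hx
    have h1 : ContinuousAt (Ring.inverse : Mat N → Mat N) (B.A (κ x)) := by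
      obtain ⟨a, ha⟩ := B.A_isUnit (κ x)
      rw [← ha]
      exact (contDiffAt_ringInverse (n := 1) ℝ a).continuousAt
    exact ContinuousAt.comp_continuousWithinAt (f := fun x => B.A (κ x)) h1 (hA x hx)
  have hV : ∀ n : ℤ, ContinuousOn (fun x => B.V (κ x) n) s := fun n => by
    have h1 : Continuous fun V : BddSeq ℤ N => V n :=
      (lp.evalCLM ℂ (fun _ : ℤ => Mat N) ∞ n).continuous
    have h2 : ContinuousOn (fun x => B.V (κ x)) s :=
      B.V_contDiff.continuous.comp_continuousOn hκ
    exact Continuous.comp_continuousOn (g := fun V : BddSeq ℤ N => V n) h1 h2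
  induction n with
  | zero => exact ⟨ha, hb⟩
  | succ n ih =>
    refine ⟨?_, ih.1⟩
    have h1 : ContinuousOn (fun x => z x • (B.backward (z x) (κ x) (a x) (b x) n).1) s :=
      hz.smul ih.1
    have h2 : ContinuousOn (fun x => adjoint (B.A (κ x))
        (B.backward (z x) (κ x) (a x) (b x) n).2) s := hAa.clm_apply ih.2
    have h3 : ContinuousOn (fun x => B.V (κ x) (-(n : ℤ))
        (B.backward (z x) (κ x) (a x) (b x) n).1) s := (hV _).clm_apply ih.1
    have h4 := (h1.sub h2).sub h3
    exact hAi.clm_apply h4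

theorem BulkHamiltonian.continuousOn_solution (B : BulkHamiltonian N) {X : Type*}
    [TopologicalSpace X] {s : Set X} {z : X → ℂ} {κ : X → ℝ} {u : X → Internal N}
    (hz : ContinuousOn z s) (hκ : ContinuousOn κ s) (hu : ContinuousOn u s)
    (h : ∀ x ∈ s, IsUnit (dissOp (B.A (κ x)) (B.truncation.V (κ x)) -
      z x • (1 : L2 ℕ N →L[ℂ] L2 ℕ N))) :
    ContinuousOn (fun x => B.solution (z x) (κ x) (u x)) s := by
  have hsolj := B.continuousOn_solOp hz hκ hu h
  have hAa : ContinuousOn (fun x => adjoint (B.A (κ x))) s :=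
    Continuous.comp_continuousOn (g := fun X : Mat N => adjoint X)
      (contDiff_adjoint N (n := 0)).continuous (B.A_contDiff.continuous.comp_continuousOn hκ)
  have ha : ContinuousOn (fun x => u x - Complex.I • adjoint (B.A (κ x))
      (solOp (B.A (κ x)) (B.truncation.V (κ x)) (z x) (u x) 0)) s := by
    have h1 : ContinuousOn (fun x => adjoint (B.A (κ x))
        (solOp (B.A (κ x)) (B.truncation.V (κ x)) (z x) (u x) 0)) s := hAa.clm_apply (hsolj 0)
    have h2 : ContinuousOn (fun _ : X => Complex.I) s := continuousOn_const
    exact hu.sub (h2.smul h1)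
  have hback := B.continuousOn_backward hz hκ ha (hsolj 0)
  rw [continuousOn_pi]
  intro n
  rcases le_or_gt n 0 with hn | hn
  · obtain ⟨m, rfl⟩ : ∃ m : ℕ, n = -(m : ℤ) := ⟨(-n).toNat, by omega⟩
    simp only [B.solution_neg]
    exact (hback m).1
  · obtain ⟨m, rfl⟩ : ∃ m : ℕ, n = (m : ℤ) + 1 := ⟨(n - 1).toNat, by omega⟩
    simp only [B.solution_succ]
    exact hsolj m

end

/-! ### Amplitudes of frames of decaying solutions -/

section

variable {N : ℕ} {B : BulkHamiltonian N} {S : EdgeHamiltonian B}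
  {Θ : Internal N →ₛₗ[starRingEnd ℂ] Internal N} {M : Matrix (Fin N) (Fin N) ℂ} {μ : ℝ} {γ : ℝ → ℂ}

/-- The amplitudes of the members of a frame, as columns in the basis given by `M`. -/
def BulkHamiltonian.ampMatrix (B : BulkHamiltonian N) (M : Matrix (Fin N) (Fin N) ℂ) (k : ℝ) (c : ℂ)
    (v : Fin N → ℤ → Internal N) : Matrix (Fin N) (Fin N) ℂ :=
  Matrix.of fun i j => M⁻¹.mulVec (B.amp k c (v j)).ofLp i

theorem BulkHamiltonian.ampMatrix_mulVec (B : BulkHamiltonian N) (M : Matrix (Fin N) (Fin N) ℂ)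
    (k : ℝ) (c : ℂ) (v : Fin N → ℤ → Internal N) (x : Fin N → ℂ) :
    (B.ampMatrix M k c v).mulVec x = M⁻¹.mulVec (B.amp k c (∑ j, x j • v j)).ofLp := by
  have h1 : (B.amp k c (∑ j, x j • v j)).ofLp = ∑ j, x j • (B.amp k c (v j)).ofLp := by
    rw [map_sum, WithLp.ofLp_sum]
    exact Finset.sum_congr rfl fun j _ => by rw [map_smul, WithLp.ofLp_smul]
  rw [h1, Matrix.mulVec_sum]
  ext i
  rw [Finset.sum_apply]
  change ∑ j, M⁻¹.mulVec (B.amp k c (v j)).ofLp i * x j = _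
  refine Finset.sum_congr rfl fun j _ => ?_
  rw [Matrix.mulVec_smul, Pi.smul_apply, smul_eq_mul, mul_comm]

theorem BulkHamiltonian.ampMatrix_sum (B : BulkHamiltonian N) (M : Matrix (Fin N) (Fin N) ℂ)
    (k : ℝ) (c : ℂ) (v : Fin N → ℤ → Internal N) (T : Matrix (Fin N) (Fin N) ℂ) :
    B.ampMatrix M k c (fun j => ∑ i, T i j • v i) = B.ampMatrix M k c v * T := by
  ext i j
  exact (congrFun (B.ampMatrix_mulVec M k c v fun i => T i j) i).symm

theorem IsAdapted.inv_mulVec (hM : IsAdapted Θ M) (y : Internal N) :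
    M⁻¹.mulVec (Θ y).ofLp = -thetaZero N (M⁻¹.mulVec y.ofLp) := by
  have h1 := hM.2 (M⁻¹.mulVec y.ofLp)
  rw [Matrix.mulVec_mulVec, Matrix.mul_nonsing_inv _ hM.isUnit, Matrix.one_mulVec,
    WithLp.toLp_ofLp] at h1
  rw [h1, WithLp.ofLp_neg, Matrix.mulVec_neg, Matrix.mulVec_mulVec,
    Matrix.nonsing_inv_mul _ hM.isUnit, Matrix.one_mulVec]

theorem IsTimeReversal.ampMatrix_reversed (h : IsTimeReversal B S Θ) (hM : IsAdapted Θ M) (k : ℝ)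
    (c : ℂ) (v : Fin N → ℤ → Internal N) :
    B.ampMatrix M (-k) c (fun j => ∑ i, epsMatrix N i j • fun n => Θ (v i n)) =
      tau (B.ampMatrix M k (conj c) v) := by
  rw [B.ampMatrix_sum, tau, ← neg_mul]
  congr 1
  ext i j
  change M⁻¹.mulVec (B.amp (-k) c fun n => Θ (v j n)).ofLp i = _
  rw [h.amp_reversed, hM.inv_mulVec, thetaZero_apply]
  rfl

theorem ampMatrix_neg_eq (hM : IsAdapted Θ M) {x k : ℝ} (hx : x ∈ B.gap)
    {v : Fin N → ℤ → Internal N} (hv : ∀ j, v j ∈ decayingSolutions B x k) :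
    B.ampMatrix M k (-Complex.I) v =
      B.truncation.scatMatrix M x k * B.ampMatrix M k Complex.I v := by
  ext i j
  change M⁻¹.mulVec (B.amp k (-Complex.I) (v j)).ofLp i =
    (B.truncation.scatMatrix M x k).mulVec (M⁻¹.mulVec (B.amp k Complex.I (v j)).ofLp) i
  rw [amp_neg_eq_scat hx (hv j), EdgeHamiltonian.scatMatrix, Matrix.mulVec_mulVec, mul_assoc,
    Matrix.mul_nonsing_inv _ hM.isUnit, mul_one, ← Matrix.mulVec_mulVec, toMat_mulVec]

theorem IsAdapted.inv_mulVec_eq_zero (hM : IsAdapted Θ M) {y : Internal N}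
    (h : M⁻¹.mulVec y.ofLp = 0) : y = 0 := by
  have h1 := congrArg M.mulVec h
  rw [Matrix.mulVec_mulVec, Matrix.mul_nonsing_inv _ hM.isUnit, Matrix.one_mulVec,
    Matrix.mulVec_zero] at h1
  exact (WithLp.ofLp_eq_zero 2).mp h1

theorem det_ampMatrix_ne_zero (hM : IsAdapted Θ M) {E : Submodule ℂ (ℤ → Internal N)} {k : ℝ}
    {c : ℂ} (hinj : ∀ ψ ∈ E, B.amp k c ψ = 0 → ψ = 0) {v : Fin N → ℤ → Internal N}
    (hv : ∀ j, v j ∈ E) (hli : LinearIndependent ℂ v) : (B.ampMatrix M k c v).det ≠ 0 := by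
  intro h0
  obtain ⟨x, hx, hx0⟩ := Matrix.exists_mulVec_eq_zero_iff.mpr h0
  rw [B.ampMatrix_mulVec] at hx0
  have h1 := hinj _ (E.sum_mem fun j _ => E.smul_mem _ (hv j)) (hM.inv_mulVec_eq_zero hx0)
  exact hx (funext (Fintype.linearIndependent_iff.mp hli x h1))

/-- Solutions with linearly independent amplitudes form a basis of the space of solutions. -/
theorem basis_of_det_ampMatrix_ne_zero (hM : IsAdapted Θ M) {E : Submodule ℂ (ℤ → Internal N)}
    {k : ℝ} {c : ℂ} (hinj : ∀ ψ ∈ E, B.amp k c ψ = 0 → ψ = 0) {v : Fin N → ℤ → Internal N}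
    (hv : ∀ j, v j ∈ E) (hdet : (B.ampMatrix M k c v).det ≠ 0) :
    LinearIndependent ℂ v ∧ Submodule.span ℂ (Set.range v) = E := by
  have hu : IsUnit (B.ampMatrix M k c v).det := isUnit_iff_ne_zero.mpr hdet
  refine ⟨Fintype.linearIndependent_iff.mpr fun x hx => ?_, le_antisymm ?_ fun ψ hψ => ?_⟩
  · have h1 := B.ampMatrix_mulVec M k c v x
    rw [hx, map_zero, WithLp.ofLp_zero, Matrix.mulVec_zero] at h1
    exact congrFun (Matrix.eq_zero_of_mulVec_eq_zero hdet h1)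
  · rw [Submodule.span_le]
    rintro _ ⟨j, rfl⟩
    exact hv j
  · set x := (B.ampMatrix M k c v)⁻¹.mulVec (M⁻¹.mulVec (B.amp k c ψ).ofLp) with hx
    have hmem : ∑ j, x j • v j ∈ E := E.sum_mem fun j _ => E.smul_mem _ (hv j)
    have h1 := B.ampMatrix_mulVec M k c v x
    rw [hx, Matrix.mulVec_mulVec, Matrix.mul_nonsing_inv _ hu, Matrix.one_mulVec, ← hx] at h1
    have h2 : B.amp k c (ψ - ∑ j, x j • v j) = 0 := by
      refine hM.inv_mulVec_eq_zero ?_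
      rw [map_sub, WithLp.ofLp_sub, Matrix.mulVec_sub, h1, sub_self]
    have h3 := hinj _ (E.sub_mem hψ hmem) h2
    rw [sub_eq_zero.mp h3]
    exact Submodule.sum_mem _ fun j _ =>
      Submodule.smul_mem _ _ (Submodule.subset_span ⟨j, rfl⟩)

theorem eq_zero_of_amp_I_eq_zero {z : ℂ} {k : ℝ} (hz : 0 ≤ z.im) (hzk : z ∉ spectrum ℂ (B.op k))
    (ψ : ℤ → Internal N) (hψ : ψ ∈ decayingSolutions B z k) (h0 : B.amp k Complex.I ψ = 0) :
    ψ = 0 :=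
  eq_zero_of_amp_eq_zero hψ (B.isUnit_dissOp_truncation hz hzk) h0

theorem IsTimeReversal.eq_zero_of_amp_neg_I_eq_zero (h : IsTimeReversal B S Θ) {z : ℂ} {k : ℝ}
    (hz : z.im ≤ 0) (hzk : conj z ∉ spectrum ℂ (B.op (-k))) (ψ : ℤ → Internal N)
    (hψ : ψ ∈ decayingSolutions B z k) (h0 : B.amp k (-Complex.I) ψ = 0) : ψ = 0 := by
  have h1 := eq_zero_of_amp_I_eq_zero (by rw [Complex.conj_im]; linarith) hzk _
    (h.mem_decayingSolutions hψ) (by rw [h.amp_reversed, Complex.conj_I, h0, map_zero])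
  funext n
  have h2 : Θ (Θ (ψ n)) = 0 := by
    have := congrFun h1 n
    change Θ (ψ n) = 0 at this
    rw [this, map_zero]
  rw [h.sq, neg_eq_zero] at h2
  exact h2

theorem BulkHamiltonian.continuousOn_ampMatrix (B : BulkHamiltonian N)
    (M : Matrix (Fin N) (Fin N) ℂ) {X : Type*} [TopologicalSpace X] {s : Set X} {κ : X → ℝ}
    {v : X → Fin N → ℤ → Internal N} (hκ : ContinuousOn κ s) (hv : ContinuousOn v s) (c : ℂ) :
    ContinuousOn (fun x => B.ampMatrix M (κ x) c (v x)) s := by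
  have hA : ContinuousOn (fun x => adjoint (B.A (κ x))) s :=
    Continuous.comp_continuousOn (g := fun X : Mat N => adjoint X)
      (contDiff_adjoint N (n := 0)).continuous (B.A_contDiff.continuous.comp_continuousOn hκ)
  have hvj : ∀ j n, ContinuousOn (fun x => v x j n) s := fun j n =>
    (continuousOn_pi.mp (continuousOn_pi.mp hv j)) n
  have hc : ContinuousOn (fun _ : X => c) s := continuousOn_const
  have hamp : ∀ j, ContinuousOn (fun x => B.amp (κ x) c (v x j)) s := fun j =>
    (hvj j 0).add (hc.smul (hA.clm_apply (hvj j 1)))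
  refine continuousOn_pi.mpr fun i => continuousOn_pi.mpr fun j => ?_
  have h1 : Continuous fun y : Internal N => M⁻¹.mulVec y.ofLp i := by
    have h2 : Continuous fun y : Internal N => y.ofLp := PiLp.continuous_ofLp 2 _
    exact (continuous_apply i).comp (Continuous.matrix_mulVec continuous_const h2)
  exact Continuous.comp_continuousOn (g := fun y : Internal N => M⁻¹.mulVec y.ofLp i) h1 (hamp j)

/-! ### The transition matrix of a bundle of decaying solutions -/

/-- A reflection symmetric curve in the resolvent sets, parametrized such that it runs through the
closed upper half-plane for parameters in `[0, π]`, from a real energy below the bulk spectrum to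
`μ`. -/
structure IsUpperContour (B : BulkHamiltonian N) (μ : ℝ) (γ : ℝ → ℂ) : Prop where
  continuous : Continuous γ
  symm : ∀ t, γ (-t) = conj (γ t)
  at_pi : γ Real.pi = μ
  resolvent : ∀ t k, γ t ∉ spectrum ℂ (B.op k)
  im_nonneg : ∀ t ∈ Set.Icc 0 Real.pi, 0 ≤ (γ t).im
  below : Set.Iic (γ 0).re ⊆ B.gap

theorem IsUpperContour.at_neg_pi (hγ : IsUpperContour B μ γ) : γ (-Real.pi) = μ := by
  rw [hγ.symm, hγ.at_pi, Complex.conj_ofReal]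

theorem IsUpperContour.at_zero (hγ : IsUpperContour B μ γ) : γ 0 = ((γ 0).re : ℝ) := by
  have h1 := hγ.symm 0
  rw [neg_zero] at h1
  exact (Complex.conj_eq_iff_re.mp h1.symm).symm

theorem IsUpperContour.mem_gap (hγ : IsUpperContour B μ γ) : μ ∈ B.gap := fun k => by
  rw [← hγ.at_pi]; exact hγ.resolvent _ k

theorem IsUpperContour.amp_injective (hγ : IsUpperContour B μ γ) {t : ℝ}
    (ht : t ∈ Set.Icc 0 Real.pi) (k : ℝ) (ψ : ℤ → Internal N)
    (hψ : ψ ∈ decayingSolutions B (γ t) k) (h0 : B.amp k Complex.I ψ = 0) : ψ = 0 :=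
  eq_zero_of_amp_I_eq_zero (hγ.im_nonneg t ht) (hγ.resolvent t k) ψ hψ h0

theorem IsUpperContour.amp_injective_neg_pi (hγ : IsUpperContour B μ γ) (k : ℝ)
    (ψ : ℤ → Internal N) (hψ : ψ ∈ decayingSolutions B (γ (-Real.pi)) k)
    (h0 : B.amp k Complex.I ψ = 0) : ψ = 0 :=
  eq_zero_of_amp_I_eq_zero (by rw [hγ.at_neg_pi]; simp) (hγ.resolvent _ k) ψ hψ h0

variable {v : ℝ → ℝ → Fin N → ℤ → Internal N}

theorem section_mem {fib : ℝ → ℝ → Submodule ℂ (ℤ → Internal N)}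
    {R : (ℤ → Internal N) → ℤ → Internal N} (hv : IsCutTorusSection fib R v) {t : ℝ}
    (ht : t ∈ Set.Icc (-Real.pi) Real.pi) (k : ℝ) (j : Fin N) : v t k j ∈ fib t k := by
  rw [← hv.span_eq t ht k]
  exact Submodule.subset_span ⟨j, rfl⟩

theorem section_ampMatrix_neg (h : IsTimeReversal B S Θ) (hM : IsAdapted Θ M)
    {fib : ℝ → ℝ → Submodule ℂ (ℤ → Internal N)}
    (hv : IsCutTorusSection fib (fun ψ n => Θ (ψ n)) v) {t : ℝ}
    (ht : t ∈ Set.Icc (-Real.pi) Real.pi) (k : ℝ) (c : ℂ) :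
    B.ampMatrix M (-k) c (v (-t) (-k)) = tau (B.ampMatrix M k (conj c) (v t k)) := by
  rw [← h.ampMatrix_reversed hM]
  congr 1
  funext j
  exact hv.timeReversal t ht k j

/-- The sign of the transition matrices of any section is the sign of the scattering matrix at the
energy `μ`. -/
theorem IsUpperContour.isKramersSign_scatMatrix (hγ : IsUpperContour B μ γ)
    (h : IsTimeReversal B S Θ) (hM : IsAdapted Θ M)
    (hv : IsCutTorusSection (fun φ₁ φ₂ => decayingSolutions B (γ φ₁) φ₂) (fun ψ n => Θ (ψ n)) v)
    {T : ℝ → Matrix (Fin N) (Fin N) ℂ}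
    (hT : ∀ φ₂ j, v Real.pi φ₂ j = ∑ i, T φ₂ i j • v (-Real.pi) φ₂ i) {t : ℂ}
    (ht : IsKramersSign T t) : IsKramersSign (B.truncation.scatMatrix M μ) t := by
  have hN := even_of_antilinear h.sq
  have hE := h.isEdgeReversal_truncation
  have hpp := Real.pi_pos.le
  have hsub : ∀ x ∈ Set.Icc 0 Real.pi, x ∈ Set.Icc (-Real.pi) Real.pi := fun x hx =>
    ⟨by linarith [hx.1], hx.2⟩
  have hm0 : (0 : ℝ) ∈ Set.Icc 0 Real.pi := ⟨le_rfl, hpp⟩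
  have hm1 : Real.pi ∈ Set.Icc 0 Real.pi := ⟨hpp, le_rfl⟩
  obtain ⟨s, hs⟩ := hE.exists_isKramersSign_scatMatrix hM (le_refl μ) (fun x hx => by
    rw [le_antisymm hx.2 hx.1]; exact hγ.mem_gap)
  have hs' := hs μ ⟨le_rfl, le_rfl⟩
  have key : t = s := by
    -- the amplitudes `ψ₀ ± i A* ψ₁` of the frame; at the real energies `μ` and `γ 0` they are
    -- related by the scattering matrix
    refine transition_sign hN (W := fun x k => B.ampMatrix M k Complex.I (v x k))
      (W' := fun x k => B.ampMatrix M k (-Complex.I) (v x k))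
      (S := B.truncation.scatMatrix M μ) (S₀ := B.truncation.scatMatrix M (γ 0).re)
      ?_ ?_ ?_ ?_ ?_ ?_ (fun k => hE.scatMatrix_mul_tau hM hγ.mem_gap k) ?_ ?_ hs'
      (hE.isKramersSign_one hM hγ.below) ht
    · exact B.continuousOn_ampMatrix M continuousOn_snd (hv.continuousOn.mono
        (Set.prod_mono hsub subset_rfl)) _
    · intro x hx k
      simp only [hv.periodic x (hsub x hx), BulkHamiltonian.ampMatrix, B.amp_apply, B.A_periodic]
    · intro x hx k
      exact det_ampMatrix_ne_zero hM (hγ.amp_injective hx k)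
        (fun j => section_mem hv (hsub x hx) k j) (hv.linearIndependent x (hsub x hx) k)
    · intro x hx k
      have := section_ampMatrix_neg h hM hv (hsub x hx) k Complex.I
      rwa [Complex.conj_I] at this
    · intro k
      refine ampMatrix_neg_eq hM hγ.mem_gap fun j => ?_
      rw [← hγ.at_pi]
      exact section_mem hv (hsub _ hm1) k j
    · intro k
      refine ampMatrix_neg_eq hM (hγ.below (Set.mem_Iic.mpr le_rfl)) fun j => ?_
      rw [← hγ.at_zero]
      exact section_mem hv (hsub _ hm0) k j
    · rw [EdgeHamiltonian.scatMatrix, EdgeHamiltonian.scatMatrix,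
        ← B.truncation.scat_periodic μ (-Real.pi)]
      congr 4
      ring
    · intro k
      rw [← B.ampMatrix_sum]
      congr 1
      funext j
      exact hT k j
  rw [key]
  exact hs'

/-- The transition matrices of a section are continuous and invertible, and they are Kramers
matrices at `k = 0, π`. -/
theorem IsUpperContour.exists_transition (hγ : IsUpperContour B μ γ)
    (h : IsTimeReversal B S Θ) (hM : IsAdapted Θ M)
    (hv : IsCutTorusSection (fun φ₁ φ₂ => decayingSolutions B (γ φ₁) φ₂) (fun ψ n => Θ (ψ n)) v) :
    ∃ T : ℝ → Matrix (Fin N) (Fin N) ℂ,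
      (∀ φ₂ j, v Real.pi φ₂ j = ∑ i, T φ₂ i j • v (-Real.pi) φ₂ i) ∧ Continuous T ∧
      (∀ k, (T k).det ≠ 0) ∧ T 0 * tau (T 0) = 1 ∧ T Real.pi * tau (T Real.pi) = 1 := by
  have hpp := Real.pi_pos.le
  have hm1 : Real.pi ∈ Set.Icc (-Real.pi) Real.pi := ⟨by linarith, le_rfl⟩
  have hm2 : -Real.pi ∈ Set.Icc (-Real.pi) Real.pi := ⟨le_rfl, by linarith⟩
  set P : ℝ → Matrix (Fin N) (Fin N) ℂ := fun k => B.ampMatrix M k Complex.I (v Real.pi k) with hP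
  set Q : ℝ → Matrix (Fin N) (Fin N) ℂ := fun k => B.ampMatrix M k Complex.I (v (-Real.pi) k)
    with hQ
  have hPd : ∀ k, (P k).det ≠ 0 := fun k =>
    det_ampMatrix_ne_zero hM (hγ.amp_injective ⟨hpp, le_rfl⟩ k)
      (fun j => section_mem hv hm1 k j) (hv.linearIndependent _ hm1 k)
  have hQd : ∀ k, (Q k).det ≠ 0 := fun k =>
    det_ampMatrix_ne_zero hM (hγ.amp_injective_neg_pi k)
      (fun j => section_mem hv hm2 k j) (hv.linearIndependent _ hm2 k)
  have hcont : ∀ t ∈ Set.Icc (-Real.pi) Real.pi,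
      Continuous fun k => B.ampMatrix M k Complex.I (v t k) := fun t ht => by
    rw [← continuousOn_univ]
    refine B.continuousOn_ampMatrix M continuousOn_id ?_ _
    exact hv.continuousOn.comp (f := fun k : ℝ => (t, k)) (by fun_prop) fun k _ => ⟨ht, trivial⟩
  have hQu : ∀ k, IsUnit (Q k).det := fun k => isUnit_iff_ne_zero.mpr (hQd k)
  have hQT : ∀ k, Q k * ((Q k)⁻¹ * P k) = P k := fun k => by
    rw [← mul_assoc, Matrix.mul_nonsing_inv _ (hQu k), one_mul]
  have hTK : ∀ k, ((Q (-k))⁻¹ * P (-k)) * tau ((Q k)⁻¹ * P k) = 1 := by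
    intro k
    have hP' : P (-k) = tau (B.truncation.scatMatrix M μ k * Q k) := by
      have h1 := section_ampMatrix_neg h hM hv hm2 k Complex.I
      rw [Complex.conj_I, neg_neg, ampMatrix_neg_eq hM hγ.mem_gap (fun j => by
        rw [← hγ.at_neg_pi]; exact section_mem hv hm2 k j)] at h1
      exact h1
    have hQ' : Q (-k) = tau (B.truncation.scatMatrix M μ k * P k) := by
      have h1 := section_ampMatrix_neg h hM hv hm1 k Complex.I
      rw [Complex.conj_I, ampMatrix_neg_eq hM hγ.mem_gap (fun j => by
        rw [← hγ.at_pi]; exact section_mem hv hm1 k j)] at h1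
      exact h1
    rw [mul_assoc, hP', ← tau_mul (even_of_antilinear h.sq), mul_assoc, hQT, ← hQ',
      Matrix.nonsing_inv_mul _ (hQu _)]
  refine ⟨fun k => (Q k)⁻¹ * P k, fun k j => ?_, ?_, fun k => ?_, ?_, ?_⟩
  · have hmem : ∀ j, v Real.pi k j ∈ decayingSolutions B μ k := fun j => by
      rw [← hγ.at_pi]; exact section_mem hv hm1 k j
    have hmem' : ∀ j, v (-Real.pi) k j ∈ decayingSolutions B μ k := fun j => by
      rw [← hγ.at_neg_pi]; exact section_mem hv hm2 k j
    have h1 := B.ampMatrix_sum M k Complex.I (v (-Real.pi) k) ((Q k)⁻¹ * P k)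
    have h2 : B.ampMatrix M k Complex.I (v (-Real.pi) k) * ((Q k)⁻¹ * P k) = P k := hQT k
    rw [h2] at h1
    have h3 : B.amp k Complex.I (v Real.pi k j -
        ∑ i, ((Q k)⁻¹ * P k) i j • v (-Real.pi) k i) = 0 := by
      refine hM.inv_mulVec_eq_zero ?_
      rw [map_sub, WithLp.ofLp_sub, Matrix.mulVec_sub, sub_eq_zero]
      funext i
      exact (congrFun (congrFun h1 i) j).symm
    exact sub_eq_zero.mp (eq_zero_of_amp_I_eq_zero (by simp) (hγ.mem_gap k) _
      (Submodule.sub_mem _ (hmem j) (Submodule.sum_mem _ fun i _ =>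
        Submodule.smul_mem _ _ (hmem' i))) h3)
  · have h1 : Continuous fun k => (Q k)⁻¹ := by
      simp only [Matrix.inv_def, Ring.inverse_eq_inv']
      exact ((hcont _ hm2).matrix_det.inv₀ hQd).smul (hcont _ hm2).matrix_adjugate
    exact h1.mul (hcont _ hm1)
  · rw [Matrix.det_mul, Matrix.det_nonsing_inv, Ring.inverse_eq_inv']
    exact mul_ne_zero (inv_ne_zero (hQd k)) (hPd k)
  · have := hTK 0
    rwa [neg_zero] at this
  · have h1 := hTK Real.pi
    have h2 : ∀ t ∈ Set.Icc (-Real.pi) Real.pi, B.ampMatrix M (-Real.pi) Complex.I (v t (-Real.pi))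
        = B.ampMatrix M Real.pi Complex.I (v t Real.pi) := fun t ht => by
      have e : Real.pi = -Real.pi + 2 * Real.pi := by ring
      have h3 := hv.periodic t ht (-Real.pi)
      rw [← e] at h3
      have h4 := B.A_periodic (-Real.pi)
      rw [← e] at h4
      simp only [BulkHamiltonian.ampMatrix, B.amp_apply, h3, h4]
    have h5 : Q (-Real.pi) = Q Real.pi := h2 _ hm2
    have h6 : P (-Real.pi) = P Real.pi := h2 _ hm1
    rwa [h5, h6] at h1

end

/-! ### Existence of a section -/

section

variable {N : ℕ} {B : BulkHamiltonian N} {S : EdgeHamiltonian B}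
  {Θ : Internal N →ₛₗ[starRingEnd ℂ] Internal N} {M : Matrix (Fin N) (Fin N) ℂ} {μ : ℝ} {γ : ℝ → ℂ}

/-- The time-reversed frame `(Θ x) ε`. -/
def reflectFrame (Θ : Internal N →ₛₗ[starRingEnd ℂ] Internal N) (x : Fin N → ℤ → Internal N) :
    Fin N → ℤ → Internal N :=
  fun j => ∑ i, epsMatrix N i j • fun n => Θ (x i n)

theorem reflectFrame_apply (x : Fin N → ℤ → Internal N) (j : Fin N) (n : ℤ) :
    reflectFrame Θ x j n = ∑ i, epsMatrix N i j • Θ (x i n) := by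
  rw [reflectFrame, Finset.sum_apply]
  rfl

theorem reflectFrame_reflectFrame (hsq : ∀ x, Θ (Θ x) = -x) (x : Fin N → ℤ → Internal N) :
    reflectFrame Θ (reflectFrame Θ x) = x := by
  have hconj : ∀ i j, conj (epsMatrix N i j) = epsMatrix N i j := fun i j =>
    congrFun (congrFun (epsMatrix_map_conj N) i) j
  funext j n
  rw [reflectFrame_apply]
  have h1 : ∀ i, epsMatrix N i j • Θ (reflectFrame Θ x i n) =
      ∑ l, -((epsMatrix N l i * epsMatrix N i j) • x l n) := fun i => by
    rw [reflectFrame_apply, map_sum, Finset.smul_sum]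
    refine Finset.sum_congr rfl fun l _ => ?_
    rw [LinearMap.map_smulₛₗ, hsq, hconj, smul_neg, smul_neg, smul_smul, mul_comm]
  rw [Finset.sum_congr rfl fun i _ => h1 i, Finset.sum_comm]
  have h2 : ∀ l, ∑ i, -((epsMatrix N l i * epsMatrix N i j) • x l n)
      = (1 : Matrix (Fin N) (Fin N) ℂ) l j • x l n := fun l => by
    rw [Finset.sum_neg_distrib, ← Finset.sum_smul, ← Matrix.mul_apply,
      epsMatrix_mul_self (even_of_antilinear hsq), Matrix.neg_apply, neg_smul, neg_neg]
  rw [Finset.sum_congr rfl fun l _ => h2 l]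
  simp [Matrix.one_apply]

theorem reflectFrame_mem (h : IsTimeReversal B S Θ) {z : ℂ} {k : ℝ} {x : Fin N → ℤ → Internal N}
    (hx : ∀ j, x j ∈ decayingSolutions B z k) (j : Fin N) :
    reflectFrame Θ x j ∈ decayingSolutions B (conj z) (-k) :=
  Submodule.sum_mem _ fun i _ => Submodule.smul_mem _ _ (h.mem_decayingSolutions (hx i))

theorem eq_of_ampMatrix_eq (hM : IsAdapted Θ M) {E : Submodule ℂ (ℤ → Internal N)} {k : ℝ} {c : ℂ}
    (hinj : ∀ ψ ∈ E, B.amp k c ψ = 0 → ψ = 0) {x y : Fin N → ℤ → Internal N} (hx : ∀ j, x j ∈ E)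
    (hy : ∀ j, y j ∈ E) (hxy : B.ampMatrix M k c x = B.ampMatrix M k c y) : x = y := by
  funext j
  refine sub_eq_zero.mp (hinj _ (E.sub_mem (hx j) (hy j)) (hM.inv_mulVec_eq_zero ?_))
  rw [map_sub, WithLp.ofLp_sub, Matrix.mulVec_sub, sub_eq_zero]
  funext i
  exact congrFun (congrFun hxy i) j

/-- The frame of solutions whose amplitudes are the columns of `M w`. -/
def BulkHamiltonian.solutionFrame (B : BulkHamiltonian N) (M w : Matrix (Fin N) (Fin N) ℂ) (z : ℂ)
    (k : ℝ) : Fin N → ℤ → Internal N :=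
  fun j => B.solution z k (WithLp.toLp 2 (M.mulVec fun i => w i j))

theorem IsAdapted.ampMatrix_solutionFrame (hM : IsAdapted Θ M) (w : Matrix (Fin N) (Fin N) ℂ)
    (z : ℂ) (k : ℝ) : B.ampMatrix M k Complex.I (B.solutionFrame M w z k) = w := by
  ext i j
  change M⁻¹.mulVec (B.amp k Complex.I (B.solution z k _)).ofLp i = _
  rw [B.amp_solution, Matrix.mulVec_mulVec, Matrix.nonsing_inv_mul _ hM.isUnit, Matrix.one_mulVec]

/-- Every upper contour admits a time-reversal invariant section on the cut torus: the amplitudes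
are kept constant in the upper half-plane, and the lower half-plane is filled by reflection. -/
theorem IsUpperContour.exists_section (hγ : IsUpperContour B μ γ)
    (h : IsTimeReversal B S Θ) (hM : IsAdapted Θ M) :
    ∃ v : ℝ → ℝ → Fin N → ℤ → Internal N,
      IsCutTorusSection (fun φ₁ φ₂ => decayingSolutions B (γ φ₁) φ₂) (fun ψ n => Θ (ψ n)) v := by
  have hN := even_of_antilinear h.sq
  have hE := h.isEdgeReversal_truncation
  have hpp := Real.pi_pos.le
  have hx₀ : (γ 0).re ∈ B.gap := hγ.below (Set.mem_Iic.mpr le_rfl)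
  obtain ⟨w, hwc, hwper, hwdet, hwrev⟩ := exists_trivializing_loop hN
    (S := B.truncation.scatMatrix M (γ 0).re)
    (continuous_iff_continuousAt.mpr fun k =>
      ContinuousAt.comp (f := fun k : ℝ => ((γ 0).re, k))
        (g := fun p : ℝ × ℝ => B.truncation.scatMatrix M p.1 p.2)
        (B.truncation.continuousAt_scatMatrix M hx₀ k) (by fun_prop))
    (fun k => by rw [EdgeHamiltonian.scatMatrix, B.truncation.scat_periodic]; rfl)
    (fun k => hE.scatMatrix_mul_tau hM hx₀ k)
  let up : ℝ → ℝ → Fin N → ℤ → Internal N := fun t k => B.solutionFrame M (w k) (γ t) k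
  let down : ℝ → ℝ → Fin N → ℤ → Internal N := fun t k => reflectFrame Θ (up (-t) (-k))
  have hup_mem : ∀ t ∈ Set.Icc 0 Real.pi, ∀ k j, up t k j ∈ decayingSolutions B (γ t) k :=
    fun t ht k j =>
      B.solution_mem (B.isUnit_dissOp_truncation (hγ.im_nonneg t ht) (hγ.resolvent t k)) _
  have hneg : ∀ t ∈ Set.Icc (-Real.pi) 0, -t ∈ Set.Icc 0 Real.pi := fun t ht =>
    ⟨by linarith [ht.2], by linarith [ht.1]⟩
  have hdown_mem : ∀ t ∈ Set.Icc (-Real.pi) 0, ∀ k j, down t k j ∈ decayingSolutions B (γ t) k :=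
    fun t ht k j => by
      have h1 := reflectFrame_mem h (hup_mem (-t) (hneg t ht) (-k)) j
      rwa [← hγ.symm, neg_neg, neg_neg] at h1
  have hup_amp : ∀ t k, B.ampMatrix M k Complex.I (up t k) = w k := fun t k =>
    hM.ampMatrix_solutionFrame (w k) (γ t) k
  have hdown_amp : ∀ t k c, B.ampMatrix M k c (down t k) =
      tau (B.ampMatrix M (-k) (conj c) (up (-t) (-k))) := fun t k c => by
    have h1 := h.ampMatrix_reversed hM (-k) c (up (-t) (-k))
    rwa [neg_neg] at h1
  -- at `t = 0` both definitions agree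
  have hzero : ∀ k, up 0 k = down 0 k := fun k => by
    have hm0 : (0 : ℝ) ∈ Set.Icc 0 Real.pi := ⟨le_rfl, hpp⟩
    refine eq_of_ampMatrix_eq hM (hγ.amp_injective hm0 k) (hup_mem 0 hm0 k)
      (hdown_mem 0 ⟨by linarith, le_rfl⟩ k) ?_
    rw [hup_amp, hdown_amp, Complex.conj_I, neg_zero, ampMatrix_neg_eq hM hx₀ (fun j => by
      rw [← hγ.at_zero]; exact hup_mem 0 hm0 (-k) j), hup_amp, ← hwrev, neg_neg]
  have hup_per : ∀ t k, up t (k + 2 * Real.pi) = up t k := fun t k => by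
    funext j
    change B.solution _ _ _ = B.solution _ _ _
    rw [B.solution_periodic, hwper]
  have hdown_per : ∀ t k, down t (k + 2 * Real.pi) = down t k := fun t k => by
    have h1 := hup_per (-t) (-(k + 2 * Real.pi))
    rw [show -(k + 2 * Real.pi) + 2 * Real.pi = -k by ring] at h1
    change reflectFrame Θ (up (-t) (-(k + 2 * Real.pi))) = _
    rw [← h1]
  have hup_cont : ContinuousOn (fun p : ℝ × ℝ => up p.1 p.2) (Set.Icc 0 Real.pi ×ˢ Set.univ) := by
    refine continuousOn_pi.mpr fun j => ?_
    refine B.continuousOn_solution (z := fun p : ℝ × ℝ => γ p.1) (κ := fun p : ℝ × ℝ => p.2)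
      (hγ.continuous.comp continuous_fst).continuousOn continuousOn_snd ?_
      fun p hp => B.isUnit_dissOp_truncation (hγ.im_nonneg _ hp.1) (hγ.resolvent _ _)
    have h1 : Continuous fun p : ℝ × ℝ => M.mulVec fun i => w p.2 i j := by
      refine Continuous.matrix_mulVec continuous_const ?_
      exact continuous_pi fun i => (hwc.comp continuous_snd).matrix_elem i j
    exact ((PiLp.continuous_toLp 2 _).comp h1).continuousOn
  have hdown_cont : ContinuousOn (fun p : ℝ × ℝ => down p.1 p.2)
      (Set.Icc (-Real.pi) 0 ×ˢ Set.univ) := by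
    have h1 : ContinuousOn (fun p : ℝ × ℝ => up (-p.1) (-p.2))
        (Set.Icc (-Real.pi) 0 ×ˢ Set.univ) :=
      hup_cont.comp (f := fun p : ℝ × ℝ => (-p.1, -p.2)) (by fun_prop)
        fun p hp => ⟨hneg _ hp.1, trivial⟩
    refine continuousOn_pi.mpr fun j => continuousOn_pi.mpr fun n => ?_
    simp only [down, reflectFrame_apply]
    refine continuousOn_finsetSum _ fun i _ => ?_
    have h2 : ContinuousOn (fun p : ℝ × ℝ => up (-p.1) (-p.2) i n)
        (Set.Icc (-Real.pi) 0 ×ˢ Set.univ) :=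
      continuousOn_pi.mp (continuousOn_pi.mp h1 i) n
    have h3 : ContinuousOn (fun p : ℝ × ℝ => Θ (up (-p.1) (-p.2) i n))
        (Set.Icc (-Real.pi) 0 ×ˢ Set.univ) :=
      (continuous_antiunitary h.antiunitary).comp_continuousOn h2
    have h4 : ContinuousOn (fun _ : ℝ × ℝ => epsMatrix N i j)
        (Set.Icc (-Real.pi) 0 ×ˢ Set.univ) := continuousOn_const
    exact h4.smul h3
  let v : ℝ → ℝ → Fin N → ℤ → Internal N := fun t k => if 0 ≤ t then up t k else down t k
  have hv_up : ∀ t, 0 ≤ t → ∀ k, v t k = up t k := fun t ht k => if_pos ht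
  have hv_down : ∀ t, t ≤ 0 → ∀ k, v t k = down t k := fun t ht k => by
    rcases ht.lt_or_eq with h1 | h1
    · exact if_neg (not_le.mpr h1)
    · rw [h1, hv_up 0 le_rfl, hzero]
  have hbasis : ∀ t ∈ Set.Icc (-Real.pi) Real.pi, ∀ k, LinearIndependent ℂ (v t k) ∧
      Submodule.span ℂ (Set.range (v t k)) = decayingSolutions B (γ t) k := by
    intro t ht k
    rcases le_total 0 t with h0 | h0
    · rw [hv_up t h0]
      exact basis_of_det_ampMatrix_ne_zero hM (hγ.amp_injective ⟨h0, ht.2⟩ k)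
        (hup_mem t ⟨h0, ht.2⟩ k) (by rw [hup_amp]; exact hwdet k)
    · rw [hv_down t h0]
      have h1 : (γ t).im ≤ 0 := by
        have h2 := hγ.im_nonneg (-t) (hneg t ⟨ht.1, h0⟩)
        rw [hγ.symm, Complex.conj_im] at h2
        linarith
      refine basis_of_det_ampMatrix_ne_zero hM (c := -Complex.I)
        (h.eq_zero_of_amp_neg_I_eq_zero h1 (by rw [← hγ.symm]; exact hγ.resolvent _ _))
        (hdown_mem t ⟨ht.1, h0⟩ k) ?_
      rw [hdown_amp, map_neg, Complex.conj_I, neg_neg, hup_amp, det_tau hN]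
      exact (map_ne_zero _).mpr (hwdet _)
  refine ⟨v, ⟨?_, ?_, fun t ht k => (hbasis t ht k).1, fun t ht k => (hbasis t ht k).2, ?_⟩⟩
  · have h1 : Set.Icc (-Real.pi) Real.pi ×ˢ (Set.univ : Set ℝ) =
        (Set.Icc (-Real.pi) 0 ×ˢ Set.univ) ∪ (Set.Icc 0 Real.pi ×ˢ Set.univ) := by
      rw [← Set.union_prod, Set.Icc_union_Icc_eq_Icc (by linarith) hpp]
    rw [h1]
    exact (hdown_cont.congr fun p hp => hv_down _ hp.1.2 _).union_of_isClosed
      (hup_cont.congr fun p hp => hv_up _ hp.1.1 _) (isClosed_Icc.prod isClosed_univ)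
      (isClosed_Icc.prod isClosed_univ)
  · intro t _ k
    rcases le_total 0 t with h0 | h0
    · rw [hv_up t h0, hv_up t h0, hup_per]
    · rw [hv_down t h0, hv_down t h0, hdown_per]
  · intro t _ k j
    change v (-t) (-k) j = reflectFrame Θ (v t k) j
    rcases le_total 0 t with h0 | h0
    · rw [hv_up t h0, hv_down (-t) (by linarith)]
      simp only [down, neg_neg]
    · rw [hv_down t h0, hv_up (-t) (by linarith)]
      simp only [down, reflectFrame_reflectFrame h.sq]

end

/-! ### Reflection symmetric contours -/

theorem eqOn_const_of_exp_eq {a b : ℝ} (hab : a ≤ b) {d : ℝ → ℝ} (hd : ContinuousOn d (Set.Icc a b))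
    {ζ : ℂ} (h : ∀ t ∈ Set.Icc a b, Complex.exp (Complex.I * (d t : ℂ)) = ζ) : d b = d a := by
  have ha : a ∈ Set.Icc a b := ⟨le_rfl, hab⟩
  have hb : b ∈ Set.Icc a b := ⟨hab, le_rfl⟩
  have hmaps : Set.MapsTo (fun t => d t - d a) (Set.Icc a b)
      (AddSubgroup.zmultiples (2 * Real.pi) : Set ℝ) := by
    intro t ht
    obtain ⟨n, hn⟩ := Complex.exp_eq_exp_iff_exists_int.mp ((h t ht).trans (h a ha).symm)
    refine ⟨n, ?_⟩
    have h1 : ((d t : ℂ)) = d a + n * (2 * Real.pi) := by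
      have h2 : Complex.I * (d t : ℂ) = Complex.I * (d a + n * (2 * Real.pi)) := by
        rw [hn]; ring
      exact mul_left_cancel₀ Complex.I_ne_zero h2
    have h3 : d t = d a + n * (2 * Real.pi) := by exact_mod_cast h1
    simp only [zsmul_eq_mul, h3]
    ring
  have h1 := isPreconnected_Icc.constant_of_mapsTo (f := fun t => d t - d a)
    (IsDiscrete.mk (inferInstanceAs (DiscreteTopology (AddSubgroup.zmultiples (2 * Real.pi)))))
    (hd.sub continuousOn_const) hmaps hb ha
  simpa [sub_eq_zero] using h1

/-- Along an arc on which `ζ (γ - w)` avoids the negative real axis, the principal argument of this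
quantity measures the change of the argument of `γ - w`. -/
theorem angle_change {γ : ℝ → ℂ} (hγ : Continuous γ) {w ζ : ℂ} {θ : ℝ → ℝ} {a b : ℝ} (hab : a ≤ b)
    (hζ : ‖ζ‖ = 1) (hθ : ContinuousOn θ (Set.Icc a b))
    (h : ∀ t ∈ Set.Icc a b, γ t - w = ‖γ t - w‖ * Complex.exp (Complex.I * (θ t : ℂ)))
    (hs : ∀ t ∈ Set.Icc a b, ζ * (γ t - w) ∈ Complex.slitPlane) :
    θ b - θ a = Complex.arg (ζ * (γ b - w)) - Complex.arg (ζ * (γ a - w)) := by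
  have harg : ContinuousOn (fun t => Complex.arg (ζ * (γ t - w))) (Set.Icc a b) := fun t ht =>
    (ContinuousAt.comp (f := fun t => ζ * (γ t - w)) (Complex.continuousAt_arg (hs t ht))
      (by fun_prop)).continuousWithinAt
  have key := eqOn_const_of_exp_eq hab (d := fun t => θ t - Complex.arg (ζ * (γ t - w)))
    (hθ.sub harg) (ζ := ζ⁻¹) fun t ht => by
      have hne : ζ * (γ t - w) ≠ 0 := Complex.slitPlane_ne_zero (hs t ht)
      have hζ0 : ζ ≠ 0 := left_ne_zero_of_mul hne
      have hn0 : ((‖γ t - w‖ : ℝ) : ℂ) ≠ 0 := by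
        exact_mod_cast norm_ne_zero_iff.mpr (right_ne_zero_of_mul hne)
      have h1 := Complex.norm_mul_exp_arg_mul_I (ζ * (γ t - w))
      rw [norm_mul, hζ, one_mul] at h1
      nth_rewrite 3 [h t ht] at h1
      have h2 : Complex.exp ((Complex.arg (ζ * (γ t - w)) : ℂ) * Complex.I)
          = ζ * Complex.exp (Complex.I * (θ t : ℂ)) := by
        refine mul_left_cancel₀ hn0 (h1.trans ?_)
        ring
      push_cast
      rw [mul_sub, Complex.exp_sub, mul_comm Complex.I (Complex.arg (ζ * (γ t - w)) : ℂ), h2]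
      field_simp [Complex.exp_ne_zero]
  linarith

theorem HasWindingNumber.neg {γ : ℝ → ℂ} {w : ℂ} {m : ℤ} (h : HasWindingNumber γ w m) :
    HasWindingNumber (fun t => γ (-t)) w (-m) := by
  obtain ⟨θ, hθ, h1, h2⟩ := h
  have hm : ∀ t ∈ Set.Icc (-Real.pi) Real.pi, -t ∈ Set.Icc (-Real.pi) Real.pi := fun t ht =>
    ⟨by linarith [ht.2], by linarith [ht.1]⟩
  refine ⟨fun t => θ (-t), hθ.comp (by fun_prop) hm, fun t ht => h1 (-t) (hm t ht), ?_⟩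
  change θ (-Real.pi) - θ (-(-Real.pi)) = _
  rw [neg_neg]
  push_cast
  linarith

section

variable {N : ℕ} {B : BulkHamiltonian N} {μ : ℝ} {γ : ℝ → ℂ}

theorem IsContour.at_neg_pi (h : IsContour B μ γ) : γ (-Real.pi) = μ := by
  rw [h.symm, h.at_pi, Complex.conj_ofReal]

theorem IsContour.at_zero (h : IsContour B μ γ) : γ 0 = ((γ 0).re : ℝ) := by
  have h1 := h.symm 0
  rw [neg_zero] at h1
  exact (Complex.conj_eq_iff_re.mp h1.symm).symm

/-- By injectivity, the contour meets the real axis only at the parameters `0` and `±π`. -/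
theorem IsContour.im_ne_zero (h : IsContour B μ γ) {t : ℝ} (ht : t ∈ Set.Ioo (-Real.pi) Real.pi)
    (ht0 : t ≠ 0) : (γ t).im ≠ 0 := fun h0 => by
  have h1 : γ (-t) = γ t := by
    rw [h.symm]
    exact Complex.conj_eq_iff_im.mpr h0
  have h2 := h.injOn ⟨by linarith [ht.2], by linarith [ht.1]⟩ ⟨ht.1.le, ht.2⟩ h1
  exact ht0 (by linarith)

theorem IsContour.reverse (h : IsContour B μ γ) : IsContour B μ (fun t => γ (-t)) where
  continuous := h.continuous.comp continuous_neg
  periodic t := by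
    have h1 := h.periodic (-(t + 2 * Real.pi))
    rw [show -(t + 2 * Real.pi) + 2 * Real.pi = -t by ring] at h1
    exact h1.symm
  injOn s hs t ht hst := by
    -- the endpoint `-π` is mapped to `π`, which has to be identified with `-π`
    have hend : γ Real.pi = γ (-Real.pi) := by rw [h.at_pi, h.at_neg_pi]
    have key : ∀ s ∈ Set.Ico (-Real.pi) Real.pi, ∃ s' ∈ Set.Ico (-Real.pi) Real.pi,
        γ s' = γ (-s) ∧ (s' = -s ∨ (s' = -Real.pi ∧ s = -Real.pi)) := fun s hs => by
      rcases hs.1.lt_or_eq with h1 | h1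
      · exact ⟨-s, ⟨by linarith [hs.2], by linarith⟩, rfl, Or.inl rfl⟩
      · exact ⟨-Real.pi, ⟨le_rfl, by linarith [Real.pi_pos]⟩, by rw [← h1, neg_neg, hend],
          Or.inr ⟨rfl, h1.symm⟩⟩
    obtain ⟨s', hs', e1, c1⟩ := key s hs
    obtain ⟨t', ht', e2, c2⟩ := key t ht
    have h1 := h.injOn hs' ht' (by rw [e1, e2]; exact hst)
    rcases c1 with c1 | c1 <;> rcases c2 with c2 | c2
    · linarith
    · linarith [hs.2]
    · linarith [ht.2]
    · linarith
  symm t := h.symm (-t)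
  at_pi := h.at_neg_pi
  resolvent t k := h.resolvent (-t) k
  below k w hw hwμ := by
    rcases h.below k w hw hwμ with h1 | h1
    · exact Or.inr h1.neg
    · refine Or.inl ?_
      have h2 := h1.neg
      rwa [neg_neg] at h2
  above k w hw hwμ := by
    have h1 := (h.above k w hw hwμ).neg
    rwa [neg_zero] at h1

/-- The winding number vanishes around real points to the left of the contour. -/
theorem IsContour.winding_left (h : IsContour B μ γ) {w : ℝ} (h0 : w < (γ 0).re) (hμ : w < μ)
    {m : ℤ}     (hm : HasWindingNumber γ w m) : m = 0 := by
  obtain ⟨θ, hθ, h1, h2⟩ := hm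
  have hpp := Real.pi_pos
  have h3 := angle_change h.continuous (ζ := 1) (by linarith) (by simp) hθ
    (fun t ht => (h1 t ht).2) fun t ht => by
      rw [one_mul]
      have hreal : ∀ r : ℝ, w < r → ((r : ℂ) - w) ∈ Complex.slitPlane := fun r hr =>
        Or.inl (by simpa using hr)
      rcases ht.1.lt_or_eq with hl | hl
      · rcases ht.2.lt_or_eq with hr | hr
        · by_cases ht0 : t = 0
          · rw [ht0, h.at_zero]; exact hreal _ h0
          · exact Or.inr (by simpa using h.im_ne_zero ⟨hl, hr⟩ ht0)
        · rw [hr, h.at_pi]; exact hreal _ hμ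
      · rw [← hl, h.at_neg_pi]; exact hreal _ hμ
  rw [h2, h.at_pi, h.at_neg_pi, sub_self] at h3
  have h4 : (m : ℝ) = 0 := by nlinarith
  exact_mod_cast h4

/-- The winding number is `1` around real points between `μ` and a point `γ(0)` to the right. -/
theorem IsContour.winding_between (h : IsContour B μ γ)
    (him : ∀ t ∈ Set.Ioo 0 Real.pi, 0 < (γ t).im) {w : ℝ} (h0 : w < (γ 0).re) (hμ : μ < w) {m : ℤ}
    (hm : HasWindingNumber γ w m) : m = 1 := by
  obtain ⟨θ, hθ, h1, h2⟩ := hm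
  have hpp := Real.pi_pos
  have hI : ∀ r : ℝ, 0 < r → Complex.arg (r * Complex.I) = Real.pi / 2 := fun r hr => by
    rw [Complex.arg_real_mul _ hr, Complex.arg_I]
  have hnI : ∀ r : ℝ, 0 < r → Complex.arg (r * -Complex.I) = -(Real.pi / 2) := fun r hr => by
    rw [Complex.arg_real_mul _ hr, Complex.arg_neg_I]
  have hz0 : γ 0 - w = (((γ 0).re - w : ℝ) : ℂ) := by
    conv_lhs => rw [h.at_zero]
    push_cast; ring
  have hend : ∀ t, γ t = μ → γ t - w = -((w - μ : ℝ) : ℂ) := fun t ht => by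
    rw [ht]; push_cast; ring
  have hslit : ∀ r : ℝ, r ≠ 0 → ∀ ζ : ℂ, ζ.im ≠ 0 → ζ * (r : ℂ) ∈ Complex.slitPlane :=
    fun r hr ζ hζ => Or.inr (by simpa using ⟨hζ, hr⟩)
  -- the upper half of the contour turns the argument by `π`, and so does the lower half
  have hup := angle_change h.continuous (ζ := -Complex.I) hpp.le (by simp)
    (hθ.mono (Set.Icc_subset_Icc_left (by linarith)))
    (fun t ht => (h1 t ⟨by linarith [ht.1], ht.2⟩).2) fun t ht => by
      rcases ht.1.lt_or_eq with hl | hl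
      · rcases ht.2.lt_or_eq with hr | hr
        · exact Or.inl (by simpa using him t ⟨hl, hr⟩)
        · rw [hr, hend _ h.at_pi, mul_neg, ← neg_mul]
          exact hslit _ (by linarith) _ (by simp)
      · rw [← hl, hz0]
        exact hslit _ (by linarith) _ (by simp)
  have hdown := angle_change h.continuous (ζ := Complex.I) (a := -Real.pi) (b := 0) (by linarith)
    (by simp) (hθ.mono (Set.Icc_subset_Icc_right hpp.le))
    (fun t ht => (h1 t ⟨ht.1, by linarith [ht.2]⟩).2) fun t ht => by
      rcases ht.1.lt_or_eq with hl | hl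
      · rcases ht.2.lt_or_eq with hr | hr
        · have h3 := him (-t) ⟨by linarith, by linarith⟩
          rw [h.symm, Complex.conj_im] at h3
          exact Or.inl (by simpa using h3)
        · rw [hr, hz0]
          exact hslit _ (by linarith) _ (by simp)
      · rw [← hl, hend _ h.at_neg_pi, mul_neg, ← neg_mul]
        exact hslit _ (by linarith) _ (by simp)
  rw [hend _ h.at_pi, hz0, mul_comm _ (((γ 0).re - w : ℝ) : ℂ), hnI _ (by linarith),
    neg_mul_neg, mul_comm, hI _ (by linarith)] at hup
  rw [hend _ h.at_neg_pi, hz0, mul_comm _ (((γ 0).re - w : ℝ) : ℂ), hI _ (by linarith),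
    mul_neg, ← neg_mul, mul_comm, hnI _ (by linarith)] at hdown
  have h4 : (m : ℝ) = 1 := by nlinarith
  exact_mod_cast h4

/-- The winding numbers force `γ 0` to lie below the bulk spectrum: real points to the left of the
contour are not encircled, while those between `μ` and a point `γ 0 > μ` would be. -/
theorem IsContour.isUpperContour_of_im_pos (h : IsContour B μ γ)
    (him : ∀ t ∈ Set.Ioo 0 Real.pi, 0 < (γ t).im) : IsUpperContour B μ γ where
  continuous := h.continuous
  symm := h.symm
  at_pi := h.at_pi
  resolvent := h.resolvent
  im_nonneg t ht := by
    rcases ht.1.lt_or_eq with hl | hl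
    · rcases ht.2.lt_or_eq with hr | hr
      · exact (him t ⟨hl, hr⟩).le
      · rw [hr, h.at_pi]; simp
    · rw [← hl, h.at_zero]; simp
  below := by
    intro w hw k hspec
    have hw0 : w < (γ 0).re := by
      refine lt_of_le_of_ne hw fun he => h.resolvent 0 k ?_
      rw [h.at_zero, ← he]; exact hspec
    rcases lt_trichotomy w μ with h1 | h1 | h1
    · rcases h.below k w hspec (by simpa using h1) with h2 | h2
      · exact absurd (h.winding_left hw0 h1 h2) (by norm_num)
      · exact absurd (h.winding_left hw0 h1 h2) (by norm_num)
    · refine h.resolvent Real.pi k ?_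
      rw [h.at_pi, ← h1]; exact hspec
    · exact absurd (h.winding_between him hw0 h1 (h.above k w hspec (by simpa using h1)))
        (by norm_num)

/-- Up to reversal of the direction, the contour runs through the upper half-plane first. -/
theorem IsContour.isUpperContour (h : IsContour B μ γ) :
    IsUpperContour B μ γ ∨ IsUpperContour B μ (fun t => γ (-t)) := by
  by_cases hpos : ∀ t ∈ Set.Ioo 0 Real.pi, 0 < (γ t).im
  · exact Or.inl (h.isUpperContour_of_im_pos hpos)
  · refine Or.inr (h.reverse.isUpperContour_of_im_pos fun t ht => ?_)
    have hne : ∀ t ∈ Set.Ioo 0 Real.pi, (γ t).im ≠ 0 := fun t ht =>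
      h.im_ne_zero ⟨by linarith [ht.1, Real.pi_pos], ht.2⟩ ht.1.ne'
    push Not at hpos
    obtain ⟨s, hs, hs0⟩ := hpos
    change 0 < (γ (-t)).im
    rw [h.symm, Complex.conj_im]
    by_contra hcon
    obtain ⟨r, hr, hr0⟩ := isPreconnected_Ioo.intermediate_value hs ht
      (Complex.continuous_im.comp h.continuous).continuousOn
      (show (0 : ℝ) ∈ Set.Icc (γ s).im (γ t).im from ⟨hs0, by linarith⟩)
    exact hne r hr hr0

end

/-! ### Bulk index and edge index -/

section

variable {N : ℕ} {B : BulkHamiltonian N} {S : EdgeHamiltonian B}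
  {Θ : Internal N →ₛₗ[starRingEnd ℂ] Internal N} {M : Matrix (Fin N) (Fin N) ℂ} {μ : ℝ} {γ : ℝ → ℂ}

theorem IsCutTorusSection.reverse {W : Type} [AddCommGroup W] [Module ℂ W] [TopologicalSpace W]
    {fib : ℝ → ℝ → Submodule ℂ W} {R : W → W} {v : ℝ → ℝ → Fin N → W}
    (h : IsCutTorusSection fib R v) :
    IsCutTorusSection (fun φ₁ φ₂ => fib (-φ₁) φ₂) R (fun φ₁ φ₂ => v (-φ₁) φ₂) := by
  have hm : ∀ t ∈ Set.Icc (-Real.pi) Real.pi, -t ∈ Set.Icc (-Real.pi) Real.pi := fun t ht =>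
    ⟨by linarith [ht.2], by linarith [ht.1]⟩
  exact
  { continuousOn := h.continuousOn.comp (f := fun p : ℝ × ℝ => (-p.1, p.2)) (by fun_prop)
      fun p hp => ⟨hm _ hp.1, trivial⟩
    periodic := fun t ht => h.periodic (-t) (hm t ht)
    linearIndependent := fun t ht => h.linearIndependent (-t) (hm t ht)
    span_eq := fun t ht => h.span_eq (-t) (hm t ht)
    timeReversal := fun t ht => h.timeReversal (-t) (hm t ht) }

theorem transition_reverse {W : Type} [AddCommGroup W] [Module ℂ W] {x y : Fin N → W}
    {T : Matrix (Fin N) (Fin N) ℂ} (hT : T.det ≠ 0) (h : ∀ j, x j = ∑ i, T i j • y i) (j : Fin N) :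
    y j = ∑ i, T⁻¹ i j • x i := by
  have h1 : ∀ i, T⁻¹ i j • x i = ∑ l, (T l i * T⁻¹ i j) • y l := fun i => by
    rw [h i, Finset.smul_sum]
    exact Finset.sum_congr rfl fun l _ => by rw [smul_smul, mul_comm]
  rw [Finset.sum_congr rfl fun i _ => h1 i, Finset.sum_comm]
  have h2 : ∀ l, ∑ i, (T l i * T⁻¹ i j) • y l = (1 : Matrix (Fin N) (Fin N) ℂ) l j • y l :=
    fun l => by
      rw [← Finset.sum_smul, ← Matrix.mul_apply,
        Matrix.mul_nonsing_inv _ (isUnit_iff_ne_zero.mpr hT)]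
  rw [Finset.sum_congr rfl fun l _ => h2 l]
  simp [Matrix.one_apply]

theorem inv_mul_tau_inv (hN : Even N) {T : Matrix (Fin N) (Fin N) ℂ} (h : T * tau T = 1) :
    T⁻¹ * tau T⁻¹ = 1 := by
  rw [Matrix.inv_eq_right_inv h, tau_tau hN]
  exact mul_eq_one_comm.mp h

/-- The bulk index exists. -/
theorem IsContour.exists_isBulkIndex (hγ : IsContour B μ γ) (h : IsTimeReversal B S Θ)
    (hM : IsAdapted Θ M) : ∃ s, IsBulkIndex B Θ γ s := by
  have hN := even_of_antilinear h.sq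
  rcases hγ.isUpperContour with hu | hu
  · obtain ⟨v, hv⟩ := hu.exists_section h hM
    obtain ⟨T, hT, hTc, hTd, hT0, hTπ⟩ := hu.exists_transition h hM hv
    obtain ⟨s, hs⟩ := exists_isKramersIndex hN hTc.continuousOn (fun k _ => hTd k) hT0 hTπ
    exact ⟨s, v, T, hv, hT, hs⟩
  · obtain ⟨v, hv⟩ := hu.exists_section h hM
    obtain ⟨T, hT, hTc, hTd, hT0, hTπ⟩ := hu.exists_transition h hM hv
    have hTi : Continuous fun k => (T k)⁻¹ := by
      simp only [Matrix.inv_def, Ring.inverse_eq_inv']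
      exact (hTc.matrix_det.inv₀ hTd).smul hTc.matrix_adjugate
    obtain ⟨s, hs⟩ := exists_isKramersIndex hN (T := fun k => (T k)⁻¹) hTi.continuousOn
      (fun k _ => by
        rw [Matrix.det_nonsing_inv, Ring.inverse_eq_inv']; exact inv_ne_zero (hTd k))
      (inv_mul_tau_inv hN hT0) (inv_mul_tau_inv hN hTπ)
    have hv' := hv.reverse
    simp only [neg_neg] at hv'
    refine ⟨s, _, _, hv', fun k j => ?_, hs⟩
    simp only [neg_neg]
    exact transition_reverse (hTd k) (hT k) j

/-- The bulk index is the sign of the scattering matrix at the energy `μ`. -/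
theorem IsBulkIndex.isKramersSign (hγ : IsContour B μ γ) (h : IsTimeReversal B S Θ)
    (hM : IsAdapted Θ M) {s : ℤˣ} (hs : IsBulkIndex B Θ γ s) :
    IsKramersSign (B.truncation.scatMatrix M μ) ((s : ℤ) : ℂ) := by
  have hN := even_of_antilinear h.sq
  obtain ⟨v, T, hv, hT, hK⟩ := hs
  have hsign := hK.isKramersSign hN
  rcases hγ.isUpperContour with hu | hu
  · exact hu.isKramersSign_scatMatrix h hM hv hT hsign
  · obtain ⟨-, hTu, h0, hπ, -⟩ := hK
    have hTd : ∀ k, (T k).det ≠ 0 := by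
      intro k hk
      obtain ⟨x, hx, hTx⟩ := Matrix.exists_mulVec_eq_zero_iff.mpr hk
      have hli := hv.linearIndependent Real.pi ⟨by linarith [Real.pi_pos], le_rfl⟩ k
      refine hx (funext (Fintype.linearIndependent_iff.mp hli x ?_))
      simp only [hT, Finset.smul_sum]
      rw [Finset.sum_comm]
      refine Finset.sum_eq_zero fun i _ => ?_
      have hi : ∑ j, T k i j * x j = 0 := congrFun hTx i
      simp only [smul_smul, ← Finset.sum_smul, mul_comm (x _), hi, zero_smul]
    have h1 := hsign.inv hN ((isKramers_iff hN _).mp h0) ((isKramers_iff hN _).mp hπ)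
      fun k _ => hTd k
    have h2 := hu.isKramersSign_scatMatrix h hM hv.reverse (T := fun k => (T k)⁻¹)
      (fun k j => by
        simp only [neg_neg]
        exact transition_reverse (hTd k) (hT k) j) h1
    have h3 : (((s : ℤ) : ℂ))⁻¹ = ((s : ℤ) : ℂ) := by
      rcases Int.units_eq_one_or s with rfl | rfl <;> norm_num
    rwa [h3] at h2

end

end BulkEdge

end

theorem theorem1 {N : ℕ} (B : BulkEdge.BulkHamiltonian N) (S : BulkEdge.EdgeHamiltonian B)
    (Θ : BulkEdge.Internal N →ₛₗ[starRingEnd ℂ] BulkEdge.Internal N)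
    (hΘ : BulkEdge.IsTimeReversal B S Θ)
    (μ : ℝ) (hgap : ∀ k, (μ : ℂ) ∉ spectrum ℂ (B.op k))
    (γ : ℝ → ℂ) (hγ : BulkEdge.IsContour B μ γ) :
    ∃ s : ℤˣ, (∀ s', BulkEdge.IsBulkIndex B Θ γ s' ↔ s' = s) ∧
      (∀ s', BulkEdge.IsEdgeIndex S μ s' ↔ s' = s) := by
  obtain ⟨M, hM⟩ := BulkEdge.exists_isAdapted hΘ.sq
  have hE := hΘ.isEdgeReversal
  have hμ : μ ∈ B.gap := hgap
  obtain ⟨t, ht, ht'⟩ := hE.exists_common_sign hΘ.isEdgeReversal_truncation hM hμ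
  -- both indices are the sign `t`
  have hbulk : ∀ s, BulkEdge.IsBulkIndex B Θ γ s → ((s : ℤ) : ℂ) = t := fun s hs =>
    (hs.isKramersSign hγ hΘ hM).unique (fun k _ => hM.scatMatrix_det_ne_zero hμ k) ht'
  have hedge : ∀ s, BulkEdge.IsEdgeIndex S μ s → ((s : ℤ) : ℂ) = t := fun s hs =>
    (BulkEdge.IsEdgeIndex.isKramersSign hE hM hs).unique
      (fun k _ => hM.scatMatrix_det_ne_zero hμ k) ht
  have hinj : ∀ s s' : ℤˣ, ((s : ℤ) : ℂ) = ((s' : ℤ) : ℂ) → s = s' := fun s s' h =>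
    Units.ext (by exact_mod_cast h)
  obtain ⟨s, hs⟩ := hγ.exists_isBulkIndex hΘ hM
  obtain ⟨s₁, hs₁⟩ := BulkEdge.exists_isEdgeIndex S hE hM hμ
  have hss : s₁ = s := hinj _ _ ((hedge s₁ hs₁).trans (hbulk s hs).symm)
  subst hss
  refine ⟨s₁, fun s' => ⟨fun h => hinj _ _ ((hbulk s' h).trans (hbulk s₁ hs).symm), ?_⟩,
    fun s' => ⟨fun h => hinj _ _ ((hedge s' h).trans (hedge s₁ hs₁).symm), ?_⟩⟩
  · rintro rfl; exact hs
  · rintro rfl; exact hs₁
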